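/- All diagrams are piecewise linear and lie in the square $I\times I$, $I=[0,1]$, of the $xt$-plane, with the $t$-axis directed downward. A strand is a descending arc (no local maxima or minima); strands meet in finitely many transversal double points (crossings), never at an extremity of a strand. A crossing carries over/under data (classical crossing) or is virtual. A *virtual braid diagram* on $n\ge 1$ strands is such a system of $n$ strands, each joining the top line to the bottom line, with bottom ends vertically aligned with the top ends. A *virtual braidoid diagram* is such a system with exactly two endpoints of strands, the *leg* (where a strand starts) and the *head* (where a strand terminates), at heights $0<t<1$; the leg and the head may belong to the same strand. All other extremities of strands are ends on the top and bottom lines; they lie equidistantly, are vertically aligned in pairs, and none is vertically aligned with the leg or the head. A braid or braidoid diagram is *classical* if it has no virtual crossing. *Braidoid isotopy* is generated by: descending $\Delta$-moves (a segment of a strand is replaced by two descending segments forming with it a triangle that contains no endpoint, the strand passing through the triangle entirely over, entirely under or entirely virtually with respect to the other arcs, where an over or under move must not pass across a virtual crossing of other strands); and swing and vertical moves of the leg or the head (the segment of strand adjacent to the endpoint sweeps a triangle disjoint from all other strands, staying descending). *Braid isotopy* is generated by descending $\Delta$-moves and level-preserving planar isotopy. A *(virtual) braidoid* is an isotopy class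 of classical (virtual) braidoid diagrams; for classical objects all intermediate diagrams are classical. *$L$-equivalence* of classical braids is generated by braid isotopy and the $L$-moves: a strand is cut at an interior point and the two ends are pulled to the bottom and to the top along the vertical line of the cut point, both entirely over or both entirely under the rest of the diagram, giving a new pair of corresponding strands. *Virtual $L$-equivalence* of virtual braids is generated by virtual braid isotopy, real conjugation, and the virtual $L$-moves, in which a strand is cut and the two ends are pulled entirely virtually: basic; real (the up-arc that is cut belongs to a small kink with a real crossing); and threaded (the up-arc that is cut belongs to a small kink with a virtual crossing and has first been pulled over or under one neighbouring strand, with two real crossings). An *underpass closure* of a braidoid diagram $B$ is a braid diagram obtained as follows. If the head is higher than the leg, the head is joined to the leg by a descending arc. Otherwise, a descending arc from the top line to the leg and a descending arc from the head to the bottom line are added, whose new ends are vertically aligned with each other and with a point of the straight segment between the two endpoints. All crossings on the added arcs are under-crossings of the added arcs. A *virtual closure* of a virtual braidoid diagram is defined in the same way, all crossings on the added arcs being virtual. **Proposition.** Every braidoid diagram has an underpass closure, and sending the isotopy class of a braidoid diagram to the $L$-equivalence class of any of its underpass closures is a well-defined surjective map from the set of braidoids to the set of $L$-equivalence classes of classical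 braids. Likewise, every virtual braidoid diagram has a virtual closure, and sending the class of a virtual braidoid diagram to the virtual $L$-equivalence class of any of its virtual closures is a well-defined surjective map from the set of virtual braidoids to the set of virtual $L$-equivalence classes of virtual braids. -/

import Mathlib

namespace Braidoids

/-- `f` is affine on the closed interval `[s, u]`. -/
def AffineOn (f : ℝ → ℝ) (s u : ℝ) : Prop :=
  ∃ p q : ℝ, ∀ t ∈ Set.Icc s u, f t = p * t + q

/-- `f` is (continuous and) piecewise linear on `[a, b]`: outside a finite set of break points it
is affine, each affine piece being taken on a closed interval. -/
def PiecewiseLinear (f : ℝ → ℝ) (a b : ℝ) : Prop :=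
  ∃ S : Finset ℝ, ∀ s u : ℝ, a ≤ s → s < u → u ≤ b →
    (∀ r ∈ S, r ∉ Set.Ioo s u) → AffineOn f s u

/-- A system of `n` descending piecewise linear strands in the square `I × I` of the `xt`-plane
(`t` directed downward), in general position, with crossing data.
A strand without local maxima and minima is the graph of a function of `t`: strand `i` is
`{(x i t, t) | a i ≤ t ≤ b i}`. The values of `x i` outside `[a i, b i]` have no meaning.
At a crossing of the strands `i` and `j` at height `t`, `sign i j t` is `1` if `i` passes over `j`,
`-1` if `i` passes under `j`, and `0` if the crossing is virtual; elsewhere it has no meaning. -/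
structure StrandDiagram (n : ℕ) where
  a : Fin n → ℝ
  b : Fin n → ℝ
  x : Fin n → ℝ → ℝ
  sign : Fin n → Fin n → ℝ → SignType
  a_nonneg : ∀ i, 0 ≤ a i
  a_lt_b : ∀ i, a i < b i
  b_le_one : ∀ i, b i ≤ 1
  x_mem : ∀ i, ∀ t ∈ Set.Icc (a i) (b i), x i t ∈ Set.Icc (0 : ℝ) 1
  pl : ∀ i, PiecewiseLinear (x i) (a i) (b i)
  sign_symm : ∀ i j t, sign j i t = -sign i j t
  /-- finitely many intersection points -/
  finite : ∀ i j, i ≠ j →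
    {t | t ∈ Set.Icc (a i) (b i) ∧ t ∈ Set.Icc (a j) (b j) ∧ x i t = x j t}.Finite
  /-- no strand meets another one at one of its two extremities -/
  interior : ∀ i j t, i ≠ j → t ∈ Set.Icc (a i) (b i) → t ∈ Set.Icc (a j) (b j) →
    x i t = x j t → t ∈ Set.Ioo (a i) (b i)
  /-- intersections are transversal -/
  transversal : ∀ i j t, i ≠ j → t ∈ Set.Icc (a i) (b i) → t ∈ Set.Icc (a j) (b j) →
    x i t = x j t → ∃ ε > 0, ∀ s ∈ Set.Ioo 0 ε,
      (x i (t - s) - x j (t - s)) * (x i (t + s) - x j (t + s)) < 0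
  /-- intersections are double points -/
  double : ∀ i j k t, i ≠ j → i ≠ k → t ∈ Set.Icc (a i) (b i) → t ∈ Set.Icc (a j) (b j) →
    t ∈ Set.Icc (a k) (b k) → x i t = x j t → x i t = x k t → j = k

namespace StrandDiagram

variable {n : ℕ}

/-- The strands `i` and `j` cross at height `t`. -/
def Crosses (D : StrandDiagram n) (i j : Fin n) (t : ℝ) : Prop :=
  i ≠ j ∧ t ∈ Set.Icc (D.a i) (D.b i) ∧ t ∈ Set.Icc (D.a j) (D.b j) ∧ D.x i t = D.x j t

/-- The point of strand `i` at height `t`. -/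
def pt (D : StrandDiagram n) (i : Fin n) (t : ℝ) : ℝ × ℝ := (D.x i t, t)

/-- No crossing is virtual. -/
def IsClassical (D : StrandDiagram n) : Prop :=
  ∀ i j t, D.Crosses i j t → D.sign i j t ≠ 0

/-- A descending `Δ`-move: the segment `AB` of strand `i`, between the heights `tA` and `tB`, is
replaced by the two segments `AC` and `CB`, where `C` has height `tC`. The triangle `ABC` contains
no point of `E` (the endpoints of the diagram), and the moving strand passes through the triangle
entirely over (`s = 1`), entirely under (`s = -1`) or entirely virtually (`s = 0`) with respect to
the arcs in it. A move over or under does not pass across a virtual crossing. -/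
def DeltaMove (E : Set (ℝ × ℝ)) (D D' : StrandDiagram n) : Prop :=
  ∃ (i : Fin n) (s : SignType) (tA tC tB : ℝ),
    D'.a = D.a ∧ D'.b = D.b ∧
    D.a i ≤ tA ∧ tA < tC ∧ tC < tB ∧ tB ≤ D.b i ∧
    AffineOn (D.x i) tA tB ∧ AffineOn (D'.x i) tA tC ∧ AffineOn (D'.x i) tC tB ∧
    (∀ j, ∀ t ∈ Set.Icc (D.a j) (D.b j), j ≠ i ∨ t ∉ Set.Ioo tA tB → D'.x j t = D.x j t) ∧
    (∀ j k t, D.Crosses j k t → (j ≠ i ∧ k ≠ i) ∨ t ∉ Set.Icc tA tB →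
      D'.sign j k t = D.sign j k t) ∧
    (∀ j, ∀ t ∈ Set.Icc tA tB, D.Crosses i j t → D.sign i j t = s) ∧
    (∀ j, ∀ t ∈ Set.Icc tA tB, D'.Crosses i j t → D'.sign i j t = s) ∧
    (∀ P ∈ E, P ∉ convexHull ℝ {D.pt i tA, D'.pt i tC, D.pt i tB}) ∧
    (s ≠ 0 → ∀ j k t, j ≠ i → k ≠ i → D.Crosses j k t →
      D.pt j t ∈ convexHull ℝ {D.pt i tA, D'.pt i tC, D.pt i tB} → D.sign j k t ≠ 0)

end StrandDiagram

/-! ### Braidoid diagrams and their isotopy -/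

/-- A (virtual) braidoid diagram with `m` strands. The strand `leg` starts at the endpoint called
the leg and the strand `head` terminates at the endpoint called the head; these two strands may
coincide. All other extremities are braidoid ends: there are `m - 1` of them on the top line and
`m - 1` on the bottom line, and they lie equidistantly, at the positions `k / m` with `0 < k < m`.
(Different strands have different ends, so every position is taken, at the top and at the bottom.)
No end is vertically aligned with an endpoint. -/
structure BraidoidDiagram (m : ℕ) extends StrandDiagram m where
  leg : Fin m
  head : Fin m
  a_eq : ∀ i, i ≠ leg → a i = 0
  b_eq : ∀ i, i ≠ head → b i = 1
  leg_pos : 0 < a leg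
  head_lt : b head < 1
  top_ends : ∀ i, i ≠ leg → ∃ k : ℕ, 0 < k ∧ k < m ∧ x i 0 = (k : ℝ) / m
  bottom_ends : ∀ i, i ≠ head → ∃ k : ℕ, 0 < k ∧ k < m ∧ x i 1 = (k : ℝ) / m
  leg_not_aligned : ∀ k : ℕ, 0 < k → k < m → x leg (a leg) ≠ (k : ℝ) / m
  head_not_aligned : ∀ k : ℕ, 0 < k → k < m → x head (b head) ≠ (k : ℝ) / m

namespace BraidoidDiagram

variable {m : ℕ}

/-- The height of the leg. -/
def legHeight (B : BraidoidDiagram m) : ℝ := B.a B.leg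

/-- The height of the head. -/
def headHeight (B : BraidoidDiagram m) : ℝ := B.b B.head

/-- The leg, as a point. -/
def legPt (B : BraidoidDiagram m) : ℝ × ℝ := B.pt B.leg B.legHeight

/-- The head, as a point. -/
def headPt (B : BraidoidDiagram m) : ℝ × ℝ := B.pt B.head B.headHeight

/-- `B` and `B'` are the same diagram, up to the numbering of the strands (and up to the values
without meaning of the functions that describe them). -/
def Same (B B' : BraidoidDiagram m) : Prop :=
  ∃ e : Equiv.Perm (Fin m), e B.leg = B'.leg ∧ e B.head = B'.head ∧
    (∀ i, B'.a (e i) = B.a i ∧ B'.b (e i) = B.b i) ∧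
    (∀ i, ∀ t ∈ Set.Icc (B.a i) (B.b i), B'.x (e i) t = B.x i t) ∧
    (∀ i j t, B.Crosses i j t → B'.sign (e i) (e j) t = B.sign i j t)

/-- A swing move or a vertical move of the head: the last segment `AP` of the strand that ends at
the head `P` is replaced by a segment `AP'`, also descending, and the triangle `APP'` is disjoint
from the other strands. (When `P` and `P'` are on the same vertical line, this is a vertical move;
otherwise the head swings.) -/
def HeadMove (B B' : BraidoidDiagram m) : Prop :=
  ∃ tA : ℝ, B'.leg = B.leg ∧ B'.head = B.head ∧ B'.a = B.a ∧
    (∀ j, j ≠ B.head → B'.b j = B.b j) ∧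
    B.a B.head ≤ tA ∧ tA < B.headHeight ∧ tA < B'.headHeight ∧
    AffineOn (B.x B.head) tA B.headHeight ∧ AffineOn (B'.x B.head) tA B'.headHeight ∧
    (∀ t ∈ Set.Icc (B.a B.head) tA, B'.x B.head t = B.x B.head t) ∧
    (∀ j, j ≠ B.head → ∀ t ∈ Set.Icc (B.a j) (B.b j), B'.x j t = B.x j t) ∧
    (∀ j k t, B.Crosses j k t → B'.sign j k t = B.sign j k t) ∧
    (∀ j, j ≠ B.head → ∀ t ∈ Set.Icc (B.a j) (B.b j),
      B.pt j t ∉ convexHull ℝ {B.pt B.head tA, B.headPt, B'.headPt})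

/-- A swing move or a vertical move of the leg: the mirror image of `HeadMove`. -/
def LegMove (B B' : BraidoidDiagram m) : Prop :=
  ∃ tA : ℝ, B'.leg = B.leg ∧ B'.head = B.head ∧ B'.b = B.b ∧
    (∀ j, j ≠ B.leg → B'.a j = B.a j) ∧
    tA ≤ B.b B.leg ∧ B.legHeight < tA ∧ B'.legHeight < tA ∧
    AffineOn (B.x B.leg) B.legHeight tA ∧ AffineOn (B'.x B.leg) B'.legHeight tA ∧
    (∀ t ∈ Set.Icc tA (B.b B.leg), B'.x B.leg t = B.x B.leg t) ∧
    (∀ j, j ≠ B.leg → ∀ t ∈ Set.Icc (B.a j) (B.b j), B'.x j t = B.x j t) ∧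
    (∀ j k t, B.Crosses j k t → B'.sign j k t = B.sign j k t) ∧
    (∀ j, j ≠ B.leg → ∀ t ∈ Set.Icc (B.a j) (B.b j),
      B.pt j t ∉ convexHull ℝ {B.pt B.leg tA, B.legPt, B'.legPt})

end BraidoidDiagram

/-- The moves that generate the isotopy of (virtual) braidoid diagrams. -/
inductive BraidoidMove : (Σ m, BraidoidDiagram m) → (Σ m, BraidoidDiagram m) → Prop
  | same {m : ℕ} {B B' : BraidoidDiagram m} : B.Same B' → BraidoidMove ⟨m, B⟩ ⟨m, B'⟩
  | delta {m : ℕ} {B B' : BraidoidDiagram m} : B'.leg = B.leg → B'.head = B.head →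
      StrandDiagram.DeltaMove {B.legPt, B.headPt} B.toStrandDiagram B'.toStrandDiagram →
      BraidoidMove ⟨m, B⟩ ⟨m, B'⟩
  | head {m : ℕ} {B B' : BraidoidDiagram m} : B.HeadMove B' → BraidoidMove ⟨m, B⟩ ⟨m, B'⟩
  | leg {m : ℕ} {B B' : BraidoidDiagram m} : B.LegMove B' → BraidoidMove ⟨m, B⟩ ⟨m, B'⟩

/-- Braidoid diagrams (all crossings are classical). -/
abbrev ClassicalBraidoidDiagram : Type := {B : Σ m, BraidoidDiagram m // B.2.IsClassical}

/-- Virtual braidoid diagrams. -/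
abbrev VirtualBraidoidDiagram : Type := Σ m, BraidoidDiagram m

/-- Braidoids: isotopy classes of braidoid diagrams, the classes of the equivalence relation that
is generated by the moves between classical diagrams. -/
def Braidoid : Type := Quot (fun B B' : ClassicalBraidoidDiagram => BraidoidMove B.1 B'.1)

/-- Virtual braidoids. -/
def VirtualBraidoid : Type := Quot (fun B B' : VirtualBraidoidDiagram => BraidoidMove B B')

/-! ### Braid diagrams and `L`-equivalence -/

/-- A (virtual) braid diagram with `n ≥ 1` strands: all strands descend from the top line to the
bottom line, and the ends at the bottom are vertically aligned with the ends at the top. -/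
structure BraidDiagram (n : ℕ) extends StrandDiagram n where
  n_pos : 0 < n
  a_eq : ∀ i, a i = 0
  b_eq : ∀ i, b i = 1
  ends : ∀ i, ∃ j, x i 1 = x j 0

namespace BraidDiagram

variable {n : ℕ}

/-- `D` and `D'` differ by a level preserving planar isotopy (and by the numbering of the strands):
on every horizontal line the strands appear in the same order from left to right, and the crossings
are the same. The ends may move along the top and the bottom line, in aligned pairs. -/
def PlanarIsotopic (D D' : BraidDiagram n) : Prop :=
  ∃ e : Equiv.Perm (Fin n),
    (∀ i j, ∀ t ∈ Set.Icc (0 : ℝ) 1, D.x i t < D.x j t ↔ D'.x (e i) t < D'.x (e j) t) ∧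
    (∀ i j t, D.Crosses i j t → D'.sign (e i) (e j) t = D.sign i j t)

/-- The strand `i` of `D` is cut and opened along the vertical line at `x₀`; `D'` is the result.
The arc of strand `i` between the heights `t₁` and `t₂` has no crossing and is removed.
The upper part of strand `i` (in `D'` it is the strand `i.castSucc`) is joined to the vertical line
at `x₀` by a segment that descends from `t₁` to `t₂`, and continues on that line to the bottom.
The lower part (in `D'` it is the strand `Fin.last n`) is preceded by the part of the vertical line
from the top to the height `t₁` and a segment that descends from `t₁` to `t₂`.
Nothing else changes. The crossings on the new arcs are not specified here. -/
structure Opening (D : BraidDiagram n) (D' : BraidDiagram (n + 1)) (i : Fin n)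
    (t₁ t₂ x₀ : ℝ) : Prop where
  pos : 0 < t₁
  lt : t₁ < t₂
  lt_one : t₂ < 1
  arc_free : ∀ j t, t ∈ Set.Icc t₁ t₂ → ¬ D.Crosses i j t
  other : ∀ j, j ≠ i → ∀ t ∈ Set.Icc (0 : ℝ) 1, D'.x j.castSucc t = D.x j t
  upper_old : ∀ t ∈ Set.Icc 0 t₁, D'.x i.castSucc t = D.x i t
  upper_mid : AffineOn (D'.x i.castSucc) t₁ t₂
  upper_new : ∀ t ∈ Set.Icc t₂ 1, D'.x i.castSucc t = x₀
  lower_new : ∀ t ∈ Set.Icc 0 t₁, D'.x (Fin.last n) t = x₀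
  lower_mid : AffineOn (D'.x (Fin.last n)) t₁ t₂
  lower_old : ∀ t ∈ Set.Icc t₂ 1, D'.x (Fin.last n) t = D.x i t
  sign_other : ∀ j k t, j ≠ i → k ≠ i → D.Crosses j k t →
    D'.sign j.castSucc k.castSucc t = D.sign j k t
  sign_upper : ∀ k t, t ≤ t₁ → D.Crosses i k t →
    D'.sign i.castSucc k.castSucc t = D.sign i k t
  sign_lower : ∀ k t, t₂ ≤ t → D.Crosses i k t →
    D'.sign (Fin.last n) k.castSucc t = D.sign i k t

/-- An `L`-move: a strand is cut at a point of a sloping arc, and the two resulting ends are pulled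
to the bottom and to the top, along the vertical line of the cut point, entirely over (`s = 1`),
entirely under (`s = -1`) or entirely virtually (`s = 0`) with respect to the rest of the
diagram. Since the line at `x₀` passes between the two ends of the removed arc, the new arcs do not
meet each other. -/
def LMove (s : SignType) (D : BraidDiagram n) (D' : BraidDiagram (n + 1)) : Prop :=
  ∃ (i : Fin n) (t₁ t₂ x₀ : ℝ), D.Opening D' i t₁ t₂ x₀ ∧
    ((D.x i t₁ < x₀ ∧ x₀ < D.x i t₂) ∨ (D.x i t₂ < x₀ ∧ x₀ < D.x i t₁)) ∧
    (∀ k t, t₁ ≤ t → D'.Crosses i.castSucc k t → D'.sign i.castSucc k t = s) ∧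
    (∀ k t, t ≤ t₂ → D'.Crosses (Fin.last n) k t → D'.sign (Fin.last n) k t = s)

/-- A real virtual `L`-move, to the right or to the left: a kink with a real crossing is made on an
arc, beside it and away from the other strands; the up-arc of the kink is cut and the two ends are
pulled to the bottom and to the top entirely virtually. -/
def RealVirtualLMove (D : BraidDiagram n) (D' : BraidDiagram (n + 1)) : Prop :=
  ∃ (i : Fin n) (t₁ t₂ x₀ : ℝ) (c : SignType), c ≠ 0 ∧ D.Opening D' i t₁ t₂ x₀ ∧
    ((D.x i t₁ < x₀ ∧ D.x i t₂ < x₀) ∨ (x₀ < D.x i t₁ ∧ x₀ < D.x i t₂)) ∧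
    (∀ j, j ≠ i → ∀ t ∈ Set.Icc t₁ t₂,
      D.x j t ∉ Set.uIcc (D.x i t₁) x₀ ∧ D.x j t ∉ Set.uIcc (D.x i t₂) x₀) ∧
    (∀ t ∈ Set.Icc t₁ t₂, D'.Crosses i.castSucc (Fin.last n) t →
      D'.sign i.castSucc (Fin.last n) t = c) ∧
    (∀ k t, t₁ ≤ t → ¬ (k = Fin.last n ∧ t ≤ t₂) → D'.Crosses i.castSucc k t →
      D'.sign i.castSucc k t = 0) ∧
    (∀ k t, t ≤ t₂ → ¬ (k = i.castSucc ∧ t₁ ≤ t) → D'.Crosses (Fin.last n) k t →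
      D'.sign (Fin.last n) k t = 0)

/-- A threaded virtual `L`-move, to the right or to the left: a kink with a virtual crossing is made
on an arc of strand `i`; its up-arc is pulled over (`s = 1`) or under (`s = -1`) a neighbouring
strand `k`, the thread, with two real crossings, beyond the crossing of the kink; then the up-arc
is cut and the two ends are pulled to the bottom and to the top entirely virtually. -/
def ThreadedVirtualLMove (D : BraidDiagram n) (D' : BraidDiagram (n + 1)) : Prop :=
  ∃ (i k : Fin n) (t₁ t₂ x₀ : ℝ) (s : SignType), s ≠ 0 ∧ k ≠ i ∧ D.Opening D' i t₁ t₂ x₀ ∧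
    ((D.x i t₁ < D.x k t₁ ∧ D.x k t₁ < x₀ ∧ D.x i t₂ < D.x k t₂ ∧ D.x k t₂ < x₀) ∨
      (x₀ < D.x k t₁ ∧ D.x k t₁ < D.x i t₁ ∧ x₀ < D.x k t₂ ∧ D.x k t₂ < D.x i t₂)) ∧
    (∀ j, ∀ t ∈ Set.Icc t₁ t₂, ¬ D.Crosses k j t) ∧
    (∀ j, j ≠ i → j ≠ k → ∀ t ∈ Set.Icc t₁ t₂,
      D.x j t ∉ Set.uIcc (D.x i t₁) x₀ ∧ D.x j t ∉ Set.uIcc (D.x i t₂) x₀) ∧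
    (∀ r ∈ Set.Icc t₁ t₂, ∀ t ∈ Set.Icc t₁ t₂, D'.Crosses i.castSucc (Fin.last n) r →
      (D'.Crosses i.castSucc k.castSucc t → r < t) ∧
      (D'.Crosses (Fin.last n) k.castSucc t → t < r)) ∧
    (∀ t ∈ Set.Icc t₁ t₂, D'.Crosses i.castSucc k.castSucc t →
      D'.sign i.castSucc k.castSucc t = s) ∧
    (∀ t ∈ Set.Icc t₁ t₂, D'.Crosses (Fin.last n) k.castSucc t →
      D'.sign (Fin.last n) k.castSucc t = s) ∧
    (∀ j t, t₁ ≤ t → ¬ (j = k.castSucc ∧ t ≤ t₂) → D'.Crosses i.castSucc j t →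
      D'.sign i.castSucc j t = 0) ∧
    (∀ j t, t ≤ t₂ → ¬ (j = k.castSucc ∧ t₁ ≤ t) → D'.Crosses (Fin.last n) j t →
      D'.sign (Fin.last n) j t = 0)

/-- Real conjugation: `D` is a product `α β` (`α` above the height `c`, `β` below it) in which `α`
has no virtual crossing, and `D'` is the product `β α`. -/
def RealConjugation (D D' : BraidDiagram n) : Prop :=
  ∃ (c : ℝ) (e : Equiv.Perm (Fin n)), 0 < c ∧ c < 1 ∧ (∀ i, D.x (e i) 0 = D.x i 1) ∧
    (∀ i j t, t < c → D.Crosses i j t → D.sign i j t ≠ 0) ∧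
    (∀ i, ∀ t ∈ Set.Icc 0 (1 - c), D'.x i t = D.x i (t + c)) ∧
    (∀ i, ∀ t ∈ Set.Icc (1 - c) 1, D'.x i t = D.x (e i) (t + c - 1)) ∧
    (∀ i j t, c < t → D.Crosses i j t → D'.sign i j (t - c) = D.sign i j t) ∧
    (∀ i j t, t < c → D.Crosses (e i) (e j) t →
      D'.sign i j (t + 1 - c) = D.sign (e i) (e j) t)

end BraidDiagram

/-- The moves that generate the isotopy of (virtual) braid diagrams: level preserving planar
isotopy and descending `Δ`-moves. -/
inductive BraidIsotopyMove : (Σ n, BraidDiagram n) → (Σ n, BraidDiagram n) → Prop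
  | planar {n : ℕ} {D D' : BraidDiagram n} : D.PlanarIsotopic D' →
      BraidIsotopyMove ⟨n, D⟩ ⟨n, D'⟩
  | delta {n : ℕ} {D D' : BraidDiagram n} :
      StrandDiagram.DeltaMove ∅ D.toStrandDiagram D'.toStrandDiagram →
      BraidIsotopyMove ⟨n, D⟩ ⟨n, D'⟩

/-- The moves that generate the `L`-equivalence of classical braids: isotopy, and the `L`-moves
over and under. -/
inductive LEquivMove : (Σ n, BraidDiagram n) → (Σ n, BraidDiagram n) → Prop
  | isotopy {D D' : Σ n, BraidDiagram n} : BraidIsotopyMove D D' → LEquivMove D D'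
  | lmove {n : ℕ} {D : BraidDiagram n} {D' : BraidDiagram (n + 1)} (s : SignType) : s ≠ 0 →
      D.LMove s D' → LEquivMove ⟨n, D⟩ ⟨n + 1, D'⟩

/-- The moves that generate the virtual `L`-equivalence of virtual braids: virtual isotopy, the
virtual `L`-moves (basic, real and threaded) and real conjugation. -/
inductive VirtualLEquivMove : (Σ n, BraidDiagram n) → (Σ n, BraidDiagram n) → Prop
  | isotopy {D D' : Σ n, BraidDiagram n} : BraidIsotopyMove D D' → VirtualLEquivMove D D'
  | basic {n : ℕ} {D : BraidDiagram n} {D' : BraidDiagram (n + 1)} :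
      D.LMove 0 D' → VirtualLEquivMove ⟨n, D⟩ ⟨n + 1, D'⟩
  | real {n : ℕ} {D : BraidDiagram n} {D' : BraidDiagram (n + 1)} :
      D.RealVirtualLMove D' → VirtualLEquivMove ⟨n, D⟩ ⟨n + 1, D'⟩
  | threaded {n : ℕ} {D : BraidDiagram n} {D' : BraidDiagram (n + 1)} :
      D.ThreadedVirtualLMove D' → VirtualLEquivMove ⟨n, D⟩ ⟨n + 1, D'⟩
  | conjugation {n : ℕ} {D D' : BraidDiagram n} :
      D.RealConjugation D' → VirtualLEquivMove ⟨n, D⟩ ⟨n, D'⟩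

/-- Classical braid diagrams. -/
abbrev ClassicalBraidDiagram : Type := {D : Σ n, BraidDiagram n // D.2.IsClassical}

/-- Virtual braid diagrams. -/
abbrev VirtualBraidDiagram : Type := Σ n, BraidDiagram n

/-- `L`-equivalence classes of classical braids. -/
def LClass : Type := Quot (fun D D' : ClassicalBraidDiagram => LEquivMove D.1 D'.1)

/-- Virtual `L`-equivalence classes of virtual braids. -/
def VirtualLClass : Type := Quot (fun D D' : VirtualBraidDiagram => VirtualLEquivMove D D')

/-! ### The closures -/

/-- The braid diagram `D` is obtained from the braidoid diagram `B` by adding new arcs at its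
endpoints; strand `i` of `B` becomes a part of strand `f i` of `D`.
If the head is higher than the leg, the new arc is a descending arc from the head to the leg.
Otherwise the new arcs are a descending arc from the top line to the leg and a descending arc from
the head to the bottom line; the two new ends are corresponding ends (vertically aligned), on the
vertical line of a point of the straight segment between the endpoints.
All crossings on the new arcs are of type `s`: the new arcs pass under the rest if `s = -1`,
and their crossings are virtual if `s = 0`. -/
structure IsClosureVia {m n : ℕ} (s : SignType) (B : BraidoidDiagram m) (D : BraidDiagram n)
    (f : Fin m → Fin n) : Prop where
  surj : Function.Surjective f
  inj : ∀ i j, f i = f j →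
    i = j ∨ (i = B.leg ∧ j = B.head) ∨ (i = B.head ∧ j = B.leg)
  joined : B.headHeight < B.legHeight → f B.leg = f B.head
  opened : B.legHeight ≤ B.headHeight → Function.Injective f ∧
    D.x (f B.leg) 0 = D.x (f B.head) 1 ∧
    D.x (f B.leg) 0 ∈ Set.uIcc (B.x B.leg B.legHeight) (B.x B.head B.headHeight)
  x_eq : ∀ i, ∀ t ∈ Set.Icc (B.a i) (B.b i), D.x (f i) t = B.x i t
  sign_eq : ∀ i j t, B.Crosses i j t → D.sign (f i) (f j) t = B.sign i j t
  sign_new : ∀ c j t, D.Crosses c j t →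
    (∀ i, f i = c → t ∉ Set.Icc (B.a i) (B.b i)) → D.sign c j t = s

/-- `D` is an underpass closure of the braidoid diagram `B`. -/
def IsUnderpassClosure (B : ClassicalBraidoidDiagram) (D : ClassicalBraidDiagram) : Prop :=
  ∃ f, IsClosureVia (-1) B.1.2 D.1.2 f

/-- `D` is a virtual closure of the virtual braidoid diagram `B`. -/
def IsVirtualClosure (B : VirtualBraidoidDiagram) (D : VirtualBraidDiagram) : Prop :=
  ∃ f, IsClosureVia 0 B.2 D.2 f

end Braidoids

/-!
Let `s` be the type of the crossings on the added arcs: `-1` for the underpass closure, `0` for the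
virtual closure. Both cases are treated together, by means of the equivalence relation `R s` that is
generated by isotopy and the `L`-moves of type `s` (among classical diagrams, if `s ≠ 0`); it is
contained in the equivalences of the theorem.

All isotopies are produced by `arc_move`: if the crossings of a part of a strand are all of the same
type, this part can be replaced by any other arc with the same ends whose crossings are all of this
type, as long as no virtual crossing is swept by a classical arc. The vertices of the arc are moved
one by one along horizontal lines, which is a sequence of `Δ`-moves (`Repl.vertex_move`).

*Any two closures of a diagram are equivalent* (`Clos.equiv`). If the head is above the leg, two
closures differ in one arc, and `arc_move` applies. Otherwise, closures with the same new ends differ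
in two arcs (`Clos.move`), and the new ends are brought to a common position on the left of the
diagram by two `L`-moves: the closure with ends at the old position, opened at the new one, is
isotopic to the closure with ends at the new position, opened at the old one (`Clos.exists_left`).
So it is enough to compare one closure of each of two diagrams (`Eqv`).

*Moves of the diagram do not change the class of the closure* (`BraidoidMove.closure`). In a `Δ`-move
(`WindowChange.eqv`) one takes closures whose arcs are not swept, after the move has been split into
two, if necessary. When the leg or the head moves (`EndMove`) and the order of their heights remains
the same, the closures differ in the added arcs. When this order changes, the endpoint is first moved
along its strand past the height of the other one (`OpenBraid.Roomy.restrict_head`,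
`OpenBraid.Roomy.restrict_leg`); here the one arc of one closure and the two arcs of the other are
related by an `L`-move.

*Surjectivity* (`BraidDiagram.exists_closure_of`): the ends of a braid diagram are made equidistant by
an isotopy, and a small arc of a strand without crossings is removed. The two ends of this gap are the
head, above, and the leg, below, and the closure fills the gap.

The arguments need some space beside the diagrams; therefore everything is first contracted
horizontally into the interior of the square (`BraidDiagram.scale_R`). They take place in the wider
class of diagrams whose ends need not be equidistant (`OpenBraid`), with closures whose new ends
may lie anywhere (`Clos`).
-/

namespace Braidoids
open Set

/-! ### Piecewise linear functions on a grid -/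

theorem AffineOn.interp {f : ℝ → ℝ} {s u t : ℝ} (h : AffineOn f s u) (ht : t ∈ Icc s u) :
    (u - s) * f t = (u - t) * f s + (t - s) * f u := by
  obtain ⟨p, q, h⟩ := h
  have hsu : s ≤ u := ht.1.trans ht.2
  rw [h t ht, h s ⟨le_rfl, hsu⟩, h u ⟨hsu, le_rfl⟩]; ring

theorem AffineOn.congr {f g : ℝ → ℝ} {s u : ℝ} (h : AffineOn f s u)
    (e : ∀ t ∈ Icc s u, g t = f t) : AffineOn g s u := by
  obtain ⟨p, q, h⟩ := h
  exact ⟨p, q, fun t ht => (e t ht).trans (h t ht)⟩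

theorem AffineOn.mono {f : ℝ → ℝ} {s u s' u' : ℝ} (h : AffineOn f s u) (hs : s ≤ s')
    (hu : u' ≤ u) : AffineOn f s' u' := by
  obtain ⟨p, q, h⟩ := h
  exact ⟨p, q, fun t ht => h t ⟨hs.trans ht.1, ht.2.trans hu⟩⟩

theorem AffineOn.sub {f g : ℝ → ℝ} {s u : ℝ} (hf : AffineOn f s u) (hg : AffineOn g s u) :
    AffineOn (fun t => f t - g t) s u := by
  obtain ⟨p, q, h⟩ := hf
  obtain ⟨p', q', h'⟩ := hg
  exact ⟨p - p', q - q', fun t ht => by simp only [h t ht, h' t ht]; ring⟩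

theorem AffineOn.const (c s u : ℝ) : AffineOn (fun _ => c) s u := ⟨0, c, fun _ _ => by ring⟩

theorem AffineOn.comp_affine {f : ℝ → ℝ} {s u : ℝ} (h : AffineOn f s u) (c d : ℝ) :
    AffineOn (fun t => c * f t + d) s u := by
  obtain ⟨p, q, h⟩ := h
  exact ⟨c * p, c * q + d, fun t ht => by simp only [h t ht]; ring⟩

theorem AffineOn.pos {f : ℝ → ℝ} {s u t : ℝ} (h : AffineOn f s u) (ht : t ∈ Icc s u)
    (hs : 0 < f s) (hu : 0 < f u) : 0 < f t := by
  rcases eq_or_lt_of_le ht.1 with rfl | h1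
  · exact hs
  have := h.interp ht
  have h2 : 0 < (u - t) * f s + (t - s) * f u := by
    have := mul_nonneg (sub_nonneg.2 ht.2) hs.le
    have := mul_pos (sub_pos.2 h1) hu
    linarith
  rw [← this] at h2
  exact pos_of_mul_pos_right h2 (by linarith [ht.2])

theorem AffineOn.nonneg {f : ℝ → ℝ} {s u t : ℝ} (h : AffineOn f s u) (ht : t ∈ Icc s u)
    (hs : 0 ≤ f s) (hu : 0 ≤ f u) : 0 ≤ f t := by
  rcases eq_or_lt_of_le ht.1 with rfl | h1
  · exact hs
  have := h.interp ht
  have h2 : 0 ≤ (u - t) * f s + (t - s) * f u := by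
    have := mul_nonneg (sub_nonneg.2 ht.2) hs
    have := mul_nonneg (sub_pos.2 h1).le hu
    linarith
  rw [← this] at h2
  exact nonneg_of_mul_nonneg_right h2 (by linarith [ht.2])

theorem AffineOn.lt {f g : ℝ → ℝ} {s u t : ℝ} (hf : AffineOn f s u) (hg : AffineOn g s u)
    (ht : t ∈ Icc s u) (hs : f s < g s) (hu : f u < g u) : f t < g t :=
  sub_pos.1 ((hg.sub hf).pos ht (sub_pos.2 hs) (sub_pos.2 hu))

theorem AffineOn.le {f g : ℝ → ℝ} {s u t : ℝ} (hf : AffineOn f s u) (hg : AffineOn g s u)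
    (ht : t ∈ Icc s u) (hs : f s ≤ g s) (hu : f u ≤ g u) : f t ≤ g t :=
  sub_nonneg.1 ((hg.sub hf).nonneg ht (sub_nonneg.2 hs) (sub_nonneg.2 hu))

theorem AffineOn.eq {f g : ℝ → ℝ} {s u t : ℝ} (hf : AffineOn f s u) (hg : AffineOn g s u)
    (ht : t ∈ Icc s u) (hs : f s = g s) (hu : f u = g u) : f t = g t :=
  le_antisymm (hf.le hg ht hs.le hu.le) (hg.le hf ht hs.ge hu.ge)

/-- The affine function whose graph joins `(t₁, y₁)` to `(t₂, y₂)`. -/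
noncomputable def line (t₁ y₁ t₂ y₂ t : ℝ) : ℝ := y₁ + (t - t₁) / (t₂ - t₁) * (y₂ - y₁)

theorem line_left (t₁ y₁ t₂ y₂ : ℝ) : line t₁ y₁ t₂ y₂ t₁ = y₁ := by simp [line]

theorem line_right {t₁ y₁ t₂ y₂ : ℝ} (h : t₁ < t₂) : line t₁ y₁ t₂ y₂ t₂ = y₂ := by
  have : t₂ - t₁ ≠ 0 := by linarith
  simp [line, this]

theorem line_affine (t₁ y₁ t₂ y₂ s u : ℝ) : AffineOn (line t₁ y₁ t₂ y₂) s u :=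
  ⟨(y₂ - y₁) / (t₂ - t₁), y₁ - t₁ * ((y₂ - y₁) / (t₂ - t₁)), fun t _ => by unfold line; ring⟩

/-- The sign of `φ` changes at `t`: it has opposite signs at symmetric points near `t`. -/
def TransAt (φ : ℝ → ℝ) (t : ℝ) : Prop := ∃ ε > 0, ∀ r ∈ Ioo 0 ε, φ (t - r) * φ (t + r) < 0

theorem TransAt.congr {φ ψ : ℝ → ℝ} {t : ℝ} (h : TransAt φ t) (e : ∀ᶠ r in nhds t, ψ r = φ r) :
    TransAt ψ t := by
  obtain ⟨ε, hε, h⟩ := h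
  obtain ⟨η, hη, e⟩ := Metric.eventually_nhds_iff.1 e
  refine ⟨min ε η, lt_min hε hη, fun r hr => ?_⟩
  have h1 := hr.2.trans_le (min_le_left _ _)
  have h2 := hr.2.trans_le (min_le_right _ _)
  rw [e, e]
  · exact h r ⟨hr.1, h1⟩
  · simp [abs_of_pos hr.1, h2]
  · simp [abs_of_pos hr.1, h2]

theorem TransAt.neg {φ : ℝ → ℝ} {t : ℝ} (h : TransAt φ t) : TransAt (fun r => -φ r) t := by
  obtain ⟨ε, hε, h⟩ := h
  exact ⟨ε, hε, fun r hr => by simpa using h r hr⟩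

theorem TransAt.swap {f g : ℝ → ℝ} {t : ℝ} (h : TransAt (fun r => f r - g r) t) :
    TransAt (fun r => g r - f r) t := by
  simpa using h.neg

theorem AffineOn.transAt {φ : ℝ → ℝ} {s u t : ℝ} (h : AffineOn φ s u) (ht : t ∈ Ioo s u)
    (h0 : φ t = 0) (hne : φ s ≠ 0 ∨ φ u ≠ 0) : TransAt φ t := by
  obtain ⟨p, q, h⟩ := h
  have hsu : s < u := ht.1.trans ht.2
  have hq : q = - (p * t) := by
    have := h t ⟨ht.1.le, ht.2.le⟩
    linarith
  have hp : p ≠ 0 := by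
    rintro rfl
    rcases hne with h' | h'
    · exact h' (by rw [h s ⟨le_rfl, hsu.le⟩, hq]; ring)
    · exact h' (by rw [h u ⟨hsu.le, le_rfl⟩, hq]; ring)
  refine ⟨min (t - s) (u - t), lt_min (by linarith [ht.1]) (by linarith [ht.2]), fun r hr => ?_⟩
  have h1 := hr.2.trans_le (min_le_left _ _)
  have h2 := hr.2.trans_le (min_le_right _ _)
  have h3 := hr.1
  rw [h _ ⟨by linarith, by linarith [ht.2]⟩, h _ ⟨by linarith [ht.1], by linarith⟩, hq]
  have : 0 < p ^ 2 * r ^ 2 := by positivity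
  nlinarith

/-- A sign change at `t` of a function that is affine on both sides of its zero `t`, in terms of
the values at the ends of the affine pieces. -/
theorem transAt_of_affine {φ : ℝ → ℝ} {s t u : ℝ} (h1 : AffineOn φ s t) (h2 : AffineOn φ t u)
    (hs : s < t) (hu : t < u) (h0 : φ t = 0) (h : φ s * φ u < 0) : TransAt φ t := by
  refine ⟨min (t - s) (u - t), lt_min (by linarith) (by linarith), fun r hr => ?_⟩
  have h3 := hr.2.trans_le (min_le_left _ _)
  have h4 := hr.2.trans_le (min_le_right _ _)
  have e1 := h1.interp (t := t - r) ⟨by linarith, by linarith [hr.1]⟩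
  have e2 := h2.interp (t := t + r) ⟨by linarith [hr.1], by linarith⟩
  rw [h0] at e1 e2
  have e3 : (t - s) * (u - t) * (φ (t - r) * φ (t + r)) = r * r * (φ s * φ u) := by
    have : (t - s) * (u - t) * (φ (t - r) * φ (t + r))
      = ((t - s) * φ (t - r)) * ((u - t) * φ (t + r)) := by ring
    rw [this, e1, e2]; ring
  have e4 : r * r * (φ s * φ u) < 0 := mul_neg_of_pos_of_neg (mul_pos hr.1 hr.1) h
  rw [← e3] at e4
  by_contra h5
  exact absurd e4 (not_lt.2 (mul_nonneg (mul_nonneg (by linarith) (by linarith)) (not_lt.1 h5)))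

/-- Conversely, at a sign change the end values of the two affine pieces have opposite signs. -/
theorem TransAt.mul_neg {φ : ℝ → ℝ} {s t u : ℝ} (h : TransAt φ t) (h1 : AffineOn φ s t)
    (h2 : AffineOn φ t u) (hs : s < t) (hu : t < u) (h0 : φ t = 0) : φ s * φ u < 0 := by
  obtain ⟨ε, hε, h⟩ := h
  set r := min (ε / 2) (min (t - s) (u - t)) with hr
  have r0 : 0 < r := lt_min (by linarith) (lt_min (by linarith) (by linarith))
  have r1 : r ≤ ε / 2 := min_le_left _ _
  have r2 : r ≤ t - s := (min_le_right _ _).trans (min_le_left _ _)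
  have r3 : r ≤ u - t := (min_le_right _ _).trans (min_le_right _ _)
  have hh := h r ⟨r0, by linarith⟩
  have e1 := h1.interp (t := t - r) ⟨by linarith, by linarith⟩
  have e2 := h2.interp (t := t + r) ⟨by linarith, by linarith⟩
  rw [h0] at e1 e2
  have e3 : (t - s) * (u - t) * (φ (t - r) * φ (t + r)) = r * r * (φ s * φ u) := by
    have : (t - s) * (u - t) * (φ (t - r) * φ (t + r))
      = ((t - s) * φ (t - r)) * ((u - t) * φ (t + r)) := by ring
    rw [this, e1, e2]; ring
  have e4 : (t - s) * (u - t) * (φ (t - r) * φ (t + r)) < 0 :=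
    mul_neg_of_pos_of_neg (mul_pos (by linarith) (by linarith)) hh
  rw [e3] at e4
  by_contra h5
  exact absurd e4 (not_lt.2 (mul_nonneg (mul_nonneg r0.le r0.le) (not_lt.1 h5)))

/-- `f` is affine on every closed subinterval of `[a, b]` without points of `T` in its interior. -/
def PolyOn (T : Finset ℝ) (f : ℝ → ℝ) (a b : ℝ) : Prop :=
  ∀ s u : ℝ, a ≤ s → s < u → u ≤ b → (∀ r ∈ T, r ∉ Ioo s u) → AffineOn f s u

theorem PolyOn.pl {T : Finset ℝ} {f : ℝ → ℝ} {a b : ℝ} (h : PolyOn T f a b) :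
    PiecewiseLinear f a b := ⟨T, h⟩

section PolyOn

variable {T T' : Finset ℝ} {f g φ : ℝ → ℝ} {a b : ℝ}

theorem PolyOn.mono (h : PolyOn T f a b) (hT : T ⊆ T') : PolyOn T' f a b :=
  fun s u hs hsu hu hr => h s u hs hsu hu fun r h' => hr r (hT h')

theorem PolyOn.sub_interval (h : PolyOn T f a b) {a' b' : ℝ} (ha : a ≤ a') (hb : b' ≤ b) :
    PolyOn T f a' b' := fun s u hs hsu hu hr => h s u (ha.trans hs) hsu (hu.trans hb) hr

theorem PolyOn.congr (h : PolyOn T f a b) (e : ∀ t ∈ Icc a b, g t = f t) : PolyOn T g a b :=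
  fun s u hs hsu hu hr => (h s u hs hsu hu hr).congr
    fun t ht => e t ⟨hs.trans ht.1, ht.2.trans hu⟩

theorem PolyOn.sub (hf : PolyOn T f a b) (hg : PolyOn T g a b) :
    PolyOn T (fun t => f t - g t) a b :=
  fun s u hs hsu hu hr => (hf s u hs hsu hu hr).sub (hg s u hs hsu hu hr)

theorem PolyOn.const (T : Finset ℝ) (c a b : ℝ) : PolyOn T (fun _ => c) a b :=
  fun s u _ _ _ _ => AffineOn.const c s u

/-- Two pieces that meet at a grid point. -/
theorem PolyOn.append {c : ℝ} (h1 : PolyOn T f a c) (h2 : PolyOn T f c b) (hc : c ∈ T) :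
    PolyOn T f a b := by
  intro s u hs hsu hu hr
  rcases le_or_gt u c with h | h
  · exact h1 s u hs hsu h hr
  rcases le_or_gt c s with h' | h'
  · exact h2 s u h' hsu hu hr
  · exact absurd ⟨h', h⟩ (hr c hc)

theorem exists_next {t : ℝ} (hb : b ∈ T) (ht : t < b) :
    ∃ τ ∈ T, t < τ ∧ τ ≤ b ∧ ∀ r ∈ T, r ∉ Ioo t τ := by
  have hne : (T.filter (t < ·)).Nonempty := ⟨b, by simp [hb, ht]⟩
  have hm := Finset.min'_mem _ hne
  simp only [Finset.mem_filter] at hm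
  refine ⟨_, hm.1, hm.2, Finset.min'_le _ _ (by simp [hb, ht]), fun r hr h => ?_⟩
  exact absurd (Finset.min'_le (T.filter (t < ·)) r (by simp [hr, h.1])) (not_le.2 h.2)

theorem exists_prev {t : ℝ} (ha : a ∈ T) (ht : a < t) :
    ∃ τ ∈ T, τ < t ∧ a ≤ τ ∧ ∀ r ∈ T, r ∉ Ioo τ t := by
  have hne : (T.filter (· < t)).Nonempty := ⟨a, by simp [ha, ht]⟩
  have hm := Finset.max'_mem _ hne
  simp only [Finset.mem_filter] at hm
  refine ⟨_, hm.1, hm.2, Finset.le_max' _ _ (by simp [ha, ht]), fun r hr h => ?_⟩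
  exact absurd (Finset.le_max' (T.filter (· < t)) r (by simp [hr, h.2])) (not_le.2 h.1)

/-- A point off the grid lies in the interior of a grid interval. -/
theorem exists_cell (ha : a ∈ T) (hb : b ∈ T) {t : ℝ} (ht : t ∈ Icc a b) (hT : t ∉ T) :
    ∃ τ ∈ T, ∃ τ' ∈ T, a ≤ τ ∧ τ < t ∧ t < τ' ∧ τ' ≤ b ∧ ∀ r ∈ T, r ∉ Ioo τ τ' := by
  have h1 : a < t := lt_of_le_of_ne ht.1 fun h => hT (h ▸ ha)
  have h2 : t < b := lt_of_le_of_ne ht.2 fun h => hT (h ▸ hb)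
  obtain ⟨τ, hτ, hlt, hle, hn⟩ := exists_prev ha h1
  obtain ⟨τ', hτ', hlt', hle', hn'⟩ := exists_next hb h2
  refine ⟨τ, hτ, τ', hτ', hle, hlt, hlt', hle', fun r hr h => ?_⟩
  rcases lt_trichotomy r t with h3 | h3 | h3
  · exact hn r hr ⟨h.1, h3⟩
  · exact hT (h3 ▸ hr)
  · exact hn' r hr ⟨h3, h.2⟩

theorem PolyOn.lt (hf : PolyOn T f a b) (hg : PolyOn T g a b) (ha : a ∈ T) (hb : b ∈ T)
    (h : ∀ τ ∈ T, τ ∈ Icc a b → f τ < g τ) {t : ℝ} (ht : t ∈ Icc a b) : f t < g t := by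
  by_cases hT : t ∈ T
  · exact h t hT ht
  obtain ⟨τ, hτ, τ', hτ', h1, h2, h3, h4, h5⟩ := exists_cell ha hb ht hT
  exact (hf τ τ' h1 (h2.trans h3) h4 h5).lt (hg τ τ' h1 (h2.trans h3) h4 h5) ⟨h2.le, h3.le⟩
    (h τ hτ ⟨h1, by linarith⟩) (h τ' hτ' ⟨by linarith, h4⟩)

theorem PolyOn.le (hf : PolyOn T f a b) (hg : PolyOn T g a b) (ha : a ∈ T) (hb : b ∈ T)
    (h : ∀ τ ∈ T, τ ∈ Icc a b → f τ ≤ g τ) {t : ℝ} (ht : t ∈ Icc a b) : f t ≤ g t := by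
  by_cases hT : t ∈ T
  · exact h t hT ht
  obtain ⟨τ, hτ, τ', hτ', h1, h2, h3, h4, h5⟩ := exists_cell ha hb ht hT
  exact (hf τ τ' h1 (h2.trans h3) h4 h5).le (hg τ τ' h1 (h2.trans h3) h4 h5) ⟨h2.le, h3.le⟩
    (h τ hτ ⟨h1, by linarith⟩) (h τ' hτ' ⟨by linarith, h4⟩)

theorem PolyOn.eq (hf : PolyOn T f a b) (hg : PolyOn T g a b) (ha : a ∈ T) (hb : b ∈ T)
    (h : ∀ τ ∈ T, τ ∈ Icc a b → f τ = g τ) {t : ℝ} (ht : t ∈ Icc a b) : f t = g t :=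
  le_antisymm (hf.le hg ha hb (fun τ h1 h2 => (h τ h1 h2).le) ht)
    (hg.le hf ha hb (fun τ h1 h2 => (h τ h1 h2).ge) ht)

/-- It is enough to check the sign changes of a piecewise linear function at the grid points. -/
theorem PolyOn.transAt (h : PolyOn T φ a b) (ha : a ∈ T) (hb : b ∈ T)
    (hT : ∀ τ ∈ T, τ ∈ Icc a b → φ τ = 0 → τ ∈ Ioo a b ∧ TransAt φ τ) {t : ℝ}
    (ht : t ∈ Icc a b) (h0 : φ t = 0) : t ∈ Ioo a b ∧ TransAt φ t := by
  by_cases htT : t ∈ T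
  · exact hT t htT ht h0
  obtain ⟨τ, hτ, τ', hτ', h1, h2, h3, h4, h5⟩ := exists_cell ha hb ht htT
  have haff := h τ τ' h1 (h2.trans h3) h4 h5
  refine ⟨⟨by linarith, by linarith⟩, haff.transAt ⟨h2, h3⟩ h0 ?_⟩
  by_contra! hne
  obtain ⟨-, ε, hε, hr⟩ := hT τ hτ ⟨h1, by linarith⟩ hne.1
  set r := min (ε / 2) (τ' - τ)
  have r0 : 0 < r := lt_min (by linarith) (by linarith)
  have r1 : r ≤ ε / 2 := min_le_left _ _
  have r2 : r ≤ τ' - τ := min_le_right _ _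
  have := haff.interp (t := τ + r) ⟨by linarith, by linarith⟩
  rw [hne.1, hne.2] at this
  have h6 : φ (τ + r) = 0 := by
    have h7 : (τ' - τ) * φ (τ + r) = 0 := by linarith
    exact (mul_eq_zero.1 h7).resolve_left (by linarith)
  have := hr r ⟨r0, by linarith⟩
  rw [h6] at this
  simp at this

/-- Special case: no zero on the grid. -/
theorem PolyOn.transAt_of_ne (h : PolyOn T φ a b) (ha : a ∈ T) (hb : b ∈ T)
    (hT : ∀ τ ∈ T, τ ∈ Icc a b → φ τ ≠ 0) {t : ℝ}
    (ht : t ∈ Icc a b) (h0 : φ t = 0) : t ∈ Ioo a b ∧ TransAt φ t :=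
  h.transAt ha hb (fun τ h1 h2 h3 => absurd h3 (hT τ h1 h2)) ht h0

/-- A piecewise linear function that changes its sign at each of its zeros has finitely many. -/
theorem finite_zeros (h : PolyOn T φ a b) (ha : a ∈ T)
    (hz : ∀ t ∈ Icc a b, φ t = 0 → TransAt φ t) : {t | t ∈ Icc a b ∧ φ t = 0}.Finite := by
  have key : ∀ t ∈ {t | t ∈ Icc a b ∧ φ t = 0}, ∃ τ ∈ T, τ ≤ t ∧ ∀ r ∈ T, r ∉ Ioc τ t := by
    intro t ht
    by_cases htT : t ∈ T
    · exact ⟨t, htT, le_rfl, fun r _ h => absurd h.1 (not_lt.2 h.2)⟩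
    obtain ⟨τ, hτ, h1, -, h2⟩ := exists_prev ha (lt_of_le_of_ne ht.1.1 fun h => htT (h ▸ ha))
    refine ⟨τ, hτ, h1.le, fun r hr h => ?_⟩
    rcases eq_or_lt_of_le h.2 with rfl | h3
    · exact htT hr
    · exact h2 r hr ⟨h.1, h3⟩
  choose! P hP1 hP2 hP3 using key
  refine Set.Finite.of_finite_image (f := P) (T.finite_toSet.subset ?_) ?_
  · rintro _ ⟨t, ht, rfl⟩
    exact hP1 t ht
  -- two zeros with the same predecessor on the grid lie in one affine piece
  have main : ∀ t ∈ {t | t ∈ Icc a b ∧ φ t = 0}, ∀ t' ∈ {t | t ∈ Icc a b ∧ φ t = 0},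
      P t = P t' → ¬ t < t' := by
    intro t ht t' ht' e hlt
    have haff : AffineOn φ t t' := by
      refine h t t' ht.1.1 hlt ht'.1.2 fun r hr h' => hP3 t' ht' r hr ⟨?_, h'.2.le⟩
      rw [← e]
      exact (hP2 t ht).trans_lt h'.1
    have zero : ∀ r ∈ Icc t t', φ r = 0 := by
      intro r hr
      have := haff.interp hr
      rw [ht.2, ht'.2] at this
      exact (mul_eq_zero.1 (by linarith : (t' - t) * φ r = 0)).resolve_left (by linarith)
    obtain ⟨ε, hε, hε'⟩ := hz t ht.1 ht.2
    set r := min (ε / 2) (t' - t)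
    have r0 : 0 < r := lt_min (by linarith) (by linarith)
    have r1 : r ≤ ε / 2 := min_le_left _ _
    have r2 : r ≤ t' - t := min_le_right _ _
    have := hε' r ⟨r0, by linarith⟩
    rw [zero (t + r) ⟨by linarith, by linarith⟩] at this
    simp at this
  intro t ht t' ht' e
  rcases lt_trichotomy t t' with h' | h' | h'
  · exact absurd h' (main t ht t' ht' e)
  · exact h'
  · exact absurd h' (main t' ht' t ht e.symm)

/-- Piecewise linear interpolation on a grid. -/
theorem exists_interp (T : Finset ℝ) (v : ℝ → ℝ) :
    ∃ y : ℝ → ℝ, (∀ τ ∈ T, y τ = v τ) ∧ ∀ a ∈ T, ∀ b ∈ T, PolyOn T y a b := by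
  induction T using Finset.induction_on_max with
  | empty => exact ⟨v, by simp, by simp⟩
  | insert c T hc ih =>
    obtain ⟨y, hy, hP⟩ := ih
    rcases T.eq_empty_or_nonempty with rfl | hne
    · refine ⟨fun _ => v c, by simp, ?_⟩
      intro a _ b _
      exact PolyOn.const _ _ _ _
    set m := T.max' hne with hm
    have hmT : m ∈ T := T.max'_mem hne
    have hmc : m < c := hc m hmT
    have hle : ∀ r ∈ T, r ≤ m := fun r hr => T.le_max' r hr
    refine ⟨fun t => if t ≤ m then y t else line m (v m) c (v c) t, ?_, ?_⟩
    · intro τ hτ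
      rcases Finset.mem_insert.1 hτ with rfl | hτ
      · simp only [not_le.2 hmc, if_false, line_right hmc]
      · simp only [hle τ hτ, if_true, hy τ hτ]
    · intro a ha b hb s u hs hsu hu hr
      have hmr := hr m (Finset.mem_insert_of_mem hmT)
      rcases le_or_gt u m with h1 | h1
      · have haT : a ∈ T := by
          rcases Finset.mem_insert.1 ha with rfl | h
          · linarith
          · exact h
        refine (hP a haT m hmT s u hs hsu h1 fun r h => hr r (Finset.mem_insert_of_mem h)).congr
          fun t ht => ?_
        simp only [ht.2.trans h1, if_true]
      · have h2 : m ≤ s := by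
          by_contra h
          exact hmr ⟨not_le.1 h, h1⟩
        refine (line_affine m (v m) c (v c) s u).congr fun t ht => ?_
        rcases eq_or_lt_of_le (h2.trans ht.1) with h3 | h3
        · simp only [← h3, le_refl, if_true, line_left, hy m hmT]
        · simp only [not_le.2 h3, if_false]

theorem Ioo_disjoint_of_finite (T : Finset ℝ) (t : ℝ) {b : ℝ} (hb : t < b) :
    ∃ u, t < u ∧ u < b ∧ ∀ r ∈ T, r ∉ Ioc t u := by
  obtain ⟨τ, -, h1, h2, h3⟩ := exists_next (T := insert b T) (Finset.mem_insert_self _ _) hb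
  refine ⟨(t + τ) / 2, by linarith, by linarith, fun r hr h => ?_⟩
  exact h3 r (Finset.mem_insert_of_mem hr) ⟨h.1, by linarith [h.2]⟩

theorem Ioo_disjoint_of_finite' (T : Finset ℝ) (t : ℝ) {b : ℝ} (hb : b < t) :
    ∃ u, b < u ∧ u < t ∧ ∀ r ∈ T, r ∉ Ico u t := by
  obtain ⟨τ, -, h1, h2, h3⟩ := exists_prev (T := insert b T) (Finset.mem_insert_self _ _) hb
  refine ⟨(t + τ) / 2, by linarith, by linarith, fun r hr h => ?_⟩
  exact h3 r (Finset.mem_insert_of_mem hr) ⟨by linarith [h.1], h.2⟩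

end PolyOn

end Braidoids

namespace Braidoids
open Set

/-! ### Families of functions that describe braid diagrams -/

/-- The general position condition at the height `t` for strands that descend from the top line to
the bottom line. It depends only on the germs of the strands at `t`. -/
structure GoodAt {n : ℕ} (X : Fin n → ℝ → ℝ) (t : ℝ) : Prop where
  inner : ∀ i j, i ≠ j → X i t = X j t → t ∈ Ioo (0 : ℝ) 1
  trans : ∀ i j, i ≠ j → X i t = X j t → TransAt (fun r => X i r - X j r) t
  double : ∀ i j k, i ≠ j → i ≠ k → X i t = X j t → X i t = X k t → j = k

/-- The functions `X i` describe strands in general position, which descend from the top line to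
the bottom line. -/
structure Fam {n : ℕ} (X : Fin n → ℝ → ℝ) : Prop where
  pl : ∀ i, PiecewiseLinear (X i) 0 1
  mem : ∀ i, ∀ t ∈ Icc (0 : ℝ) 1, X i t ∈ Icc (0 : ℝ) 1
  good : ∀ t ∈ Icc (0 : ℝ) 1, GoodAt X t

theorem GoodAt.congr {n : ℕ} {X Y : Fin n → ℝ → ℝ} {t : ℝ} (h : GoodAt X t)
    (e0 : ∀ i, Y i t = X i t) (e : t ∈ Ioo (0 : ℝ) 1 → ∀ i, ∀ᶠ r in nhds t, Y i r = X i r) :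
    GoodAt Y t where
  inner i j hij hx := h.inner i j hij (by rw [← e0, ← e0, hx])
  trans i j hij hx := by
    have hx' : X i t = X j t := by rw [← e0, ← e0, hx]
    refine (h.trans i j hij hx').congr ?_
    have ht := h.inner i j hij hx'
    filter_upwards [e ht i, e ht j] with r h1 h2
    rw [h1, h2]
  double i j k hij hik h1 h2 :=
    h.double i j k hij hik (by rw [← e0, ← e0, h1]) (by rw [← e0, ← e0, h2])

theorem GoodAt.perm {n m : ℕ} {X : Fin n → ℝ → ℝ} {t : ℝ} (h : GoodAt X t) {σ : Fin m → Fin n}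
    (hσ : Function.Injective σ) : GoodAt (fun i => X (σ i)) t where
  inner _ _ hij hx := h.inner _ _ (hσ.ne hij) hx
  trans _ _ hij hx := h.trans _ _ (hσ.ne hij) hx
  double _ _ _ hij hik h1 h2 := hσ (h.double _ _ _ (hσ.ne hij) (hσ.ne hik) h1 h2)

theorem PiecewiseLinear.common {f g : ℝ → ℝ} {a b a' b' : ℝ} (hf : PiecewiseLinear f a b)
    (hg : PiecewiseLinear g a' b') : ∃ T : Finset ℝ, PolyOn T f a b ∧ PolyOn T g a' b' := by
  classical
  obtain ⟨T, hT⟩ := hf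
  obtain ⟨T', hT'⟩ := hg
  exact ⟨T ∪ T', PolyOn.mono hT Finset.subset_union_left,
    PolyOn.mono hT' Finset.subset_union_right⟩

theorem finite_coincidences {f g : ℝ → ℝ} {a b : ℝ} (hf : PiecewiseLinear f a b)
    (hg : PiecewiseLinear g a b)
    (hz : ∀ t ∈ Icc a b, f t = g t → TransAt (fun r => f r - g r) t) :
    {t | t ∈ Icc a b ∧ f t = g t}.Finite := by
  classical
  obtain ⟨T, h1, h2⟩ := hf.common hg
  have h3 := ((h1.sub h2).mono (Finset.subset_insert a T))
  refine (finite_zeros h3 (Finset.mem_insert_self _ _)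
    fun t ht h0 => hz t ht (sub_eq_zero.1 h0)).subset ?_
  rintro t ⟨ht, h0⟩
  exact ⟨ht, sub_eq_zero.2 h0⟩

namespace Fam

variable {n : ℕ} {X : Fin n → ℝ → ℝ}

/-- The braid diagram with given strands and crossing data. -/
def braid (h : Fam X) (hn : 0 < n) (ends : ∀ i, ∃ j, X i 1 = X j 0)
    (sg : Fin n → Fin n → ℝ → SignType) (hs : ∀ i j t, sg j i t = -sg i j t) :
    BraidDiagram n where
  a _ := 0
  b _ := 1
  x := X
  sign := sg
  a_nonneg _ := le_rfl
  a_lt_b _ := zero_lt_one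
  b_le_one _ := le_rfl
  x_mem := h.mem
  pl := h.pl
  sign_symm := hs
  finite i j hij := by
    refine (finite_coincidences (h.pl i) (h.pl j) fun t ht e =>
      (h.good t ht).trans i j hij e).subset ?_
    rintro t ⟨h1, -, h2⟩
    exact ⟨h1, h2⟩
  interior i j t hij ht _ e := (h.good t ht).inner i j hij e
  transversal i j t hij ht _ e := (h.good t ht).trans i j hij e
  double i j k t hij hik ht _ _ h1 h2 := (h.good t ht).double i j k hij hik h1 h2
  n_pos := hn
  a_eq _ := rfl
  b_eq _ := rfl
  ends := ends

end Fam

namespace BraidDiagram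

variable {n : ℕ} (D : BraidDiagram n)

theorem fam : Fam D.x where
  pl i := by simpa only [D.a_eq, D.b_eq] using D.pl i
  mem i t ht := D.x_mem i t (by simpa only [D.a_eq, D.b_eq] using ht)
  good t ht := by
    have hm : ∀ i, t ∈ Icc (D.a i) (D.b i) := fun i => by simpa only [D.a_eq, D.b_eq] using ht
    refine ⟨fun i j hij h => ?_, fun i j hij h => ?_, fun i j k hij hik h1 h2 => ?_⟩
    · simpa only [D.a_eq, D.b_eq] using D.interior i j t hij (hm i) (hm j) h
    · exact D.transversal i j t hij (hm i) (hm j) h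
    · exact D.double i j k t hij hik (hm i) (hm j) (hm k) h1 h2

theorem crosses_iff {i j : Fin n} {t : ℝ} :
    D.Crosses i j t ↔ i ≠ j ∧ t ∈ Icc (0 : ℝ) 1 ∧ D.x i t = D.x j t := by
  simp only [StrandDiagram.Crosses, D.a_eq, D.b_eq]
  tauto

end BraidDiagram

theorem StrandDiagram.Crosses.symm {n : ℕ} {D : StrandDiagram n} {i j : Fin n} {t : ℝ}
    (h : D.Crosses i j t) : D.Crosses j i t := ⟨h.1.symm, h.2.2.1, h.2.1, h.2.2.2.symm⟩

theorem StrandDiagram.Crosses.inner {n : ℕ} {D : BraidDiagram n} {i j : Fin n} {t : ℝ}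
    (h : D.Crosses i j t) : t ∈ Ioo (0 : ℝ) 1 := by
  rw [D.crosses_iff] at h
  exact (D.fam.good t h.2.1).inner i j h.1 h.2.2

/-- All strands stay in the interior of the square, horizontally. -/
def BraidDiagram.Roomy {n : ℕ} (D : BraidDiagram n) : Prop :=
  ∀ i, ∀ t ∈ Icc (0 : ℝ) 1, D.x i t ∈ Ioo (0 : ℝ) 1

/-- The crossing data `base`, changed to the type `s` on the arcs where `N` holds. -/
noncomputable def overlay {n : ℕ} (N : Fin n → ℝ → Prop) (s : SignType)
    (base : Fin n → Fin n → ℝ → SignType) (i j : Fin n) (t : ℝ) : SignType := by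
  classical
  exact if N i t ∧ ¬ N j t then s else if N j t ∧ ¬ N i t then -s else base i j t

section overlay

variable {n : ℕ} {N : Fin n → ℝ → Prop} {s : SignType} {base : Fin n → Fin n → ℝ → SignType}

theorem overlay_symm (h : ∀ i j t, base j i t = -base i j t) (i j : Fin n) (t : ℝ) :
    overlay N s base j i t = -overlay N s base i j t := by
  unfold overlay
  by_cases h1 : N i t <;> by_cases h2 : N j t <;>
    simp only [h1, h2, not_true, not_false_eq_true, and_true, and_false, if_true, if_false,
      neg_neg]
  · exact h i j t
  · exact h i j t

theorem overlay_left {i j : Fin n} {t : ℝ} (h1 : N i t) (h2 : ¬ N j t) :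
    overlay N s base i j t = s := by simp [overlay, h1, h2]

theorem overlay_base {i j : Fin n} {t : ℝ} (h1 : ¬ N i t) (h2 : ¬ N j t) :
    overlay N s base i j t = base i j t := by simp [overlay, h1, h2]

end overlay

/-! ### The equivalence of braid diagrams -/

/-- The diagrams that are considered: classical ones, unless `s = 0`. -/
def Adm {n : ℕ} (s : SignType) (D : StrandDiagram n) : Prop := s ≠ 0 → D.IsClassical

/-- The equivalence relation on (classical, if `s ≠ 0`) braid diagrams that is generated by isotopy
and the `L`-moves of type `s`. -/
def R (s : SignType) : (Σ n, BraidDiagram n) → (Σ n, BraidDiagram n) → Prop :=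
  Relation.EqvGen fun D D' => Adm s D.2.toStrandDiagram ∧ Adm s D'.2.toStrandDiagram ∧
    (BraidIsotopyMove D D' ∨ ∃ (n : ℕ) (E : BraidDiagram n) (E' : BraidDiagram (n + 1)),
      D = ⟨n, E⟩ ∧ D' = ⟨n + 1, E'⟩ ∧ E.LMove s E')

theorem R.refl (s : SignType) (D : Σ n, BraidDiagram n) : R s D D := Relation.EqvGen.refl _

theorem R.symm {s : SignType} {D D' : Σ n, BraidDiagram n} (h : R s D D') : R s D' D :=
  Relation.EqvGen.symm _ _ h

theorem R.trans {s : SignType} {D D' D'' : Σ n, BraidDiagram n} (h : R s D D')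
    (h' : R s D' D'') : R s D D'' := Relation.EqvGen.trans _ _ _ h h'

theorem R.adm_iff {s : SignType} {D D' : Σ n, BraidDiagram n} (h : R s D D') :
    Adm s D.2.toStrandDiagram ↔ Adm s D'.2.toStrandDiagram := by
  induction h with
  | rel _ _ h => exact ⟨fun _ => h.2.1, fun _ => h.1⟩
  | refl => rfl
  | symm _ _ _ ih => exact ih.symm
  | trans _ _ _ _ _ ih ih' => exact ih.trans ih'

theorem R.of_lmove {s : SignType} {n : ℕ} {D : BraidDiagram n} {D' : BraidDiagram (n + 1)}
    (h : D.LMove s D') (h1 : Adm s D.toStrandDiagram) (h2 : Adm s D'.toStrandDiagram) :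
    R s ⟨n, D⟩ ⟨n + 1, D'⟩ :=
  Relation.EqvGen.rel _ _ ⟨h1, h2, Or.inr ⟨n, D, D', rfl, rfl, h⟩⟩

theorem BraidDiagram.PlanarIsotopic.eq_iff {n : ℕ} {D D' : BraidDiagram n} {e : Equiv.Perm (Fin n)}
    (h : ∀ i j, ∀ t ∈ Icc (0 : ℝ) 1, D.x i t < D.x j t ↔ D'.x (e i) t < D'.x (e j) t)
    {i j : Fin n} {t : ℝ} (ht : t ∈ Icc (0 : ℝ) 1) :
    D.x i t = D.x j t ↔ D'.x (e i) t = D'.x (e j) t := by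
  rw [le_antisymm_iff, le_antisymm_iff, ← not_lt, ← not_lt, ← not_lt, ← not_lt, h i j t ht,
    h j i t ht]

theorem BraidDiagram.PlanarIsotopic.classical {n : ℕ} {D D' : BraidDiagram n}
    (h : D.PlanarIsotopic D') (hD : D.IsClassical) : D'.IsClassical := by
  obtain ⟨e, h1, h2⟩ := h
  intro i j t hc
  obtain ⟨i, rfl⟩ := e.surjective i
  obtain ⟨j, rfl⟩ := e.surjective j
  rw [D'.crosses_iff] at hc
  have hc' : D.Crosses i j t := by
    rw [D.crosses_iff]
    exact ⟨fun h => hc.1 (h ▸ rfl), hc.2.1, (PlanarIsotopic.eq_iff h1 hc.2.1).2 hc.2.2⟩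
  rw [h2 i j t hc']
  exact hD i j t hc'

theorem R.of_planar {s : SignType} {n : ℕ} {D D' : BraidDiagram n} (h : D.PlanarIsotopic D')
    (hD : Adm s D.toStrandDiagram) : R s ⟨n, D⟩ ⟨n, D'⟩ :=
  Relation.EqvGen.rel _ _ ⟨hD, fun hs => h.classical (hD hs), Or.inl (.planar h)⟩

/-- Diagrams that differ only in the values without meaning. -/
theorem R.of_same {s : SignType} {n : ℕ} {D D' : BraidDiagram n}
    (h : ∀ i, ∀ t ∈ Icc (0 : ℝ) 1, D'.x i t = D.x i t)
    (h' : ∀ i j t, D.Crosses i j t → D'.sign i j t = D.sign i j t)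
    (hD : Adm s D.toStrandDiagram) : R s ⟨n, D⟩ ⟨n, D'⟩ :=
  .of_planar ⟨Equiv.refl _, fun i j t ht => by simp [h _ t ht], h'⟩ hD

namespace BraidDiagram

/-- Renumbering of the strands. -/
def relabel {n : ℕ} (D : BraidDiagram n) (σ : Equiv.Perm (Fin n)) : BraidDiagram n :=
  Fam.braid (X := fun i => D.x (σ i))
    ⟨fun i => D.fam.pl _, fun i => D.fam.mem _, fun t ht => (D.fam.good t ht).perm σ.injective⟩
    D.n_pos
    (fun i => by
      obtain ⟨j, hj⟩ := D.ends (σ i)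
      exact ⟨σ.symm j, by simpa using hj⟩)
    (fun i j t => D.sign (σ i) (σ j) t) (fun i j t => D.sign_symm _ _ _)

theorem Roomy.relabel {n : ℕ} {D : BraidDiagram n} (h : D.Roomy) (σ : Equiv.Perm (Fin n)) :
    (D.relabel σ).Roomy := fun i t ht => h (σ i) t ht

theorem relabel_R {n : ℕ} (s : SignType) (D : BraidDiagram n) (σ : Equiv.Perm (Fin n))
    (hD : Adm s D.toStrandDiagram) : R s ⟨n, D⟩ ⟨n, D.relabel σ⟩ := by
  refine .of_planar (?_ : D.PlanarIsotopic _) hD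
  refine ⟨σ.symm, fun i j t _ => ?_, fun i j t _ => ?_⟩
  · change _ ↔ D.x (σ (σ.symm i)) t < D.x (σ (σ.symm j)) t
    simp
  · change D.sign (σ (σ.symm i)) (σ (σ.symm j)) t = _
    simp

end BraidDiagram

/-! ### Grids -/

/-- A finite set of heights that contains those of all extremities, break points and crossings of
a diagram. -/
structure IsGrid {n : ℕ} (D : StrandDiagram n) (T : Finset ℝ) : Prop where
  zero : (0 : ℝ) ∈ T
  one : (1 : ℝ) ∈ T
  a_mem : ∀ i, D.a i ∈ T
  b_mem : ∀ i, D.b i ∈ T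
  poly : ∀ i, PolyOn T (D.x i) (D.a i) (D.b i)
  cross : ∀ i j t, D.Crosses i j t → t ∈ T

theorem IsGrid.mono {n : ℕ} {D : StrandDiagram n} {T T' : Finset ℝ} (h : IsGrid D T)
    (hT : T ⊆ T') : IsGrid D T' :=
  ⟨hT h.zero, hT h.one, fun i => hT (h.a_mem i), fun i => hT (h.b_mem i),
    fun i => (h.poly i).mono hT, fun i j t hc => hT (h.cross i j t hc)⟩

theorem exists_isGrid {n : ℕ} (D : StrandDiagram n) : ∃ T, IsGrid D T := by
  classical
  choose S hS using D.pl
  have hfin : ∀ i j, {t | D.Crosses i j t}.Finite := by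
    intro i j
    by_cases hij : i = j
    · refine Set.finite_empty.subset fun t ht => (ht.1 hij).elim
    · exact (D.finite i j hij).subset fun t ht => ⟨ht.2.1, ht.2.2.1, ht.2.2.2⟩
  let T : Finset ℝ := {0, 1} ∪ Finset.univ.image D.a ∪ Finset.univ.image D.b ∪
    Finset.univ.biUnion S ∪ Finset.univ.biUnion fun i => Finset.univ.biUnion fun j =>
      (hfin i j).toFinset
  refine ⟨T, ?_, ?_, ?_, ?_, ?_, ?_⟩
  · simp [T]
  · simp [T]
  · intro i; simp [T]
  · intro i; simp [T]
  · intro i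
    refine PolyOn.mono (hS i) fun r hr => ?_
    simp only [T, Finset.mem_union, Finset.mem_biUnion]
    exact Or.inl (Or.inr ⟨i, Finset.mem_univ _, hr⟩)
  · intro i j t hc
    simp only [T, Finset.mem_union, Finset.mem_biUnion]
    exact Or.inr ⟨i, Finset.mem_univ _, j, Finset.mem_univ _, by simpa using hc⟩

theorem IsGrid.poly' {n : ℕ} {D : BraidDiagram n} {T : Finset ℝ} (h : IsGrid D.toStrandDiagram T)
    (i : Fin n) : PolyOn T (D.x i) 0 1 := by
  simpa only [D.a_eq, D.b_eq] using h.poly i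

end Braidoids

namespace Braidoids
open Set

/-! ### Moving one strand -/

theorem hull_le {α β γ xA tA xC tC xB tB : ℝ} (hA : α * xA + β * tA ≤ γ)
    (hC : α * xC + β * tC ≤ γ) (hB : α * xB + β * tB ≤ γ) {P : ℝ × ℝ}
    (hP : P ∈ convexHull ℝ {(xA, tA), (xC, tC), (xB, tB)}) : α * P.1 + β * P.2 ≤ γ := by
  have hconv : Convex ℝ {P : ℝ × ℝ | α * P.1 + β * P.2 ≤ γ} := by
    intro P hP Q hQ a b ha hb hab
    simp only [mem_ofPred_eq, Prod.fst_add, Prod.snd_add, Prod.smul_fst, Prod.smul_snd,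
      smul_eq_mul] at *
    have h1 := mul_le_mul_of_nonneg_left hP ha
    have h2 := mul_le_mul_of_nonneg_left hQ hb
    have h3 : a * γ + b * γ = γ := by rw [← add_mul, hab, one_mul]
    linarith
  refine convexHull_min ?_ hconv hP
  rintro Q (rfl | rfl | rfl) <;> assumption

/-- The horizontal slices of the triangle of a `Δ`-move lie between the old and the new arc. -/
theorem hull_slice {h h' : ℝ → ℝ} {tA tC tB : ℝ} (hAC : tA < tC) (hCB : tC < tB)
    (h1 : AffineOn h tA tB) (h2 : AffineOn h' tA tC) (h3 : AffineOn h' tC tB)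
    (eA : h' tA = h tA) (eB : h' tB = h tB) {P : ℝ × ℝ}
    (hP : P ∈ convexHull ℝ {(h tA, tA), (h' tC, tC), (h tB, tB)}) :
    P.2 ∈ Icc tA tB ∧ P.1 ∈ uIcc (h P.2) (h' P.2) := by
  have hm : P.2 ∈ Icc tA tB := by
    have ha := hull_le (α := 0) (β := -1) (γ := -tA) (by linarith) (by linarith) (by linarith) hP
    have hb := hull_le (α := 0) (β := 1) (γ := tB) (by linarith) (by linarith) (by linarith) hP
    constructor <;> linarith
  refine ⟨hm, ?_⟩
  obtain ⟨p₁, q₁, h1⟩ := h1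
  obtain ⟨p₂, q₂, h2⟩ := h2
  obtain ⟨p₃, q₃, h3⟩ := h3
  have vA := h1 tA ⟨le_rfl, by linarith⟩
  have vB := h1 tB ⟨by linarith, le_rfl⟩
  have vC := h1 tC ⟨by linarith, by linarith⟩
  have vA' := h2 tA ⟨le_rfl, by linarith⟩
  have vC' := h2 tC ⟨by linarith, by linarith⟩
  have vC'' := h3 tC ⟨by linarith, by linarith⟩
  have vB' := h3 tB ⟨by linarith, le_rfl⟩
  have key : ∀ σ : ℝ, 0 ≤ σ * (h' tC - h tC) →
      σ * h P.2 ≤ σ * P.1 ∧ σ * P.1 ≤ σ * h' P.2 := by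
    intro σ hσ
    have s2 : 0 ≤ σ * (p₂ - p₁) := by
      have : σ * (h' tC - h tC) = σ * (p₂ - p₁) * (tC - tA) := by
        rw [vC', vC]; linear_combination σ * (vA - vA' + eA)
      rw [this] at hσ
      exact nonneg_of_mul_nonneg_left hσ (by linarith)
    have s3 : 0 ≤ σ * (p₁ - p₃) := by
      have : σ * (h' tC - h tC) = σ * (p₁ - p₃) * (tB - tC) := by
        rw [vC'', vC]; linear_combination σ * (vB - vB' + eB)
      rw [this] at hσ
      exact nonneg_of_mul_nonneg_left hσ (by linarith)
    have m2 := mul_nonneg s2 (sub_nonneg.2 (hAC.trans hCB).le)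
    have m3 := mul_nonneg s3 (sub_nonneg.2 (hAC.trans hCB).le)
    have i1 := hull_le (α := -σ) (β := σ * p₁) (γ := -(σ * q₁)) (P := P)
      (xA := h tA) (tA := tA) (xC := h' tC) (tC := tC) (xB := h tB) (tB := tB)
      (by rw [vA]; linarith) (by have := hσ; rw [vC] at this; linarith) (by rw [vB]; linarith) hP
    have i2 := hull_le (α := σ) (β := -(σ * p₂)) (γ := σ * q₂) (P := P)
      (xA := h tA) (tA := tA) (xC := h' tC) (tC := tC) (xB := h tB) (tB := tB)
      (by rw [← eA, vA']; linarith) (by rw [vC']; linarith)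
      (by linear_combination m2 + σ * (vB - vA) + σ * (vA' - eA)) hP
    have i3 := hull_le (α := σ) (β := -(σ * p₃)) (γ := σ * q₃) (P := P)
      (xA := h tA) (tA := tA) (xC := h' tC) (tC := tC) (xB := h tB) (tB := tB)
      (by linear_combination m3 + σ * (vA - vB) + σ * (vB' - eB))
      (by rw [vC'']; linarith) (by rw [← eB, vB']; linarith) hP
    rw [h1 P.2 hm]
    refine ⟨by linarith, ?_⟩
    rcases le_total P.2 tC with hc | hc
    · rw [h2 P.2 ⟨hm.1, hc⟩]; linarith
    · rw [h3 P.2 ⟨hc, hm.2⟩]; linarith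
  rcases le_total (h tC) (h' tC) with hc | hc
  · obtain ⟨k1, k2⟩ := key 1 (by linarith)
    exact mem_uIcc.2 (Or.inl ⟨by linarith, by linarith⟩)
  · obtain ⟨k1, k2⟩ := key (-1) (by linarith)
    exact mem_uIcc.2 (Or.inr ⟨by linarith, by linarith⟩)

theorem good_update {n : ℕ} {X : Fin n → ℝ → ℝ} {c : Fin n} {h : ℝ → ℝ} {t : ℝ}
    (hX : GoodAt X t) (hc : ∀ k, k ≠ c → h t = X k t → t ∈ Ioo (0 : ℝ) 1 ∧
      TransAt (fun r => h r - X k r) t ∧ ∀ k', k' ≠ c → h t = X k' t → k' = k) :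
    GoodAt (Function.update X c h) t := by
  have ec : Function.update X c h c = h := Function.update_self _ _ _
  have en : ∀ {k}, k ≠ c → Function.update X c h k = X k := fun hk =>
    Function.update_of_ne hk _ _
  constructor
  · intro i j hij hx
    by_cases hi : i = c
    · subst hi
      rw [ec, en hij.symm] at hx
      exact (hc j hij.symm hx).1
    by_cases hj : j = c
    · subst hj
      rw [ec, en hi] at hx
      exact (hc i hi hx.symm).1
    rw [en hi, en hj] at hx
    exact hX.inner i j hij hx
  · intro i j hij hx
    by_cases hi : i = c
    · subst hi
      rw [ec, en hij.symm] at hx ⊢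
      exact (hc j hij.symm hx).2.1
    by_cases hj : j = c
    · subst hj
      rw [ec, en hi] at hx ⊢
      exact (hc i hi hx.symm).2.1.swap
    rw [en hi, en hj] at hx ⊢
    exact hX.trans i j hij hx
  · intro i j k hij hik h1 h2
    by_cases hi : i = c
    · subst hi
      rw [ec, en hij.symm] at h1
      rw [ec, en hik.symm] at h2
      exact (hc k hik.symm h2).2.2 j hij.symm h1
    rw [en hi] at h1 h2
    by_cases hj : j = c
    · subst hj
      by_cases hk : k = j
      · exact hk.symm
      rw [ec] at h1
      rw [en hk] at h2
      exact absurd ((hc i hi h1.symm).2.2 k hk (by rw [← h1, h2])).symm hik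
    rw [en hj] at h1
    by_cases hk : k = c
    · subst hk
      rw [ec] at h2
      exact absurd ((hc i hi h2.symm).2.2 j hj (by rw [← h1, h2])).symm hij
    rw [en hk] at h2
    exact hX.double i j k hij hik h1 h2

theorem GoodAt.of_update {n : ℕ} {X : Fin n → ℝ → ℝ} {c : Fin n} {h : ℝ → ℝ} {t : ℝ}
    (hX : GoodAt (Function.update X c h) t) {k : Fin n} (hk : k ≠ c) (hx : h t = X k t) :
    t ∈ Ioo (0 : ℝ) 1 ∧
      TransAt (fun r => h r - X k r) t ∧ ∀ k', k' ≠ c → h t = X k' t → k' = k := by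
  have ec : Function.update X c h c = h := Function.update_self _ _ _
  have en : ∀ {k}, k ≠ c → Function.update X c h k = X k := fun hk =>
    Function.update_of_ne hk _ _
  refine ⟨hX.inner c k hk.symm (by rw [ec, en hk, hx]), ?_, fun k' hk' hx' => ?_⟩
  · have := hX.trans c k hk.symm (by rw [ec, en hk, hx])
    rwa [ec, en hk] at this
  · exact hX.double c k' k hk'.symm hk.symm (by rw [ec, en hk', hx']) (by rw [ec, en hk, hx])

/-- The function `h` may replace the strand `c` of `D` between the heights `u` and `v`. -/
structure Repl {n : ℕ} (D : BraidDiagram n) (c : Fin n) (u v : ℝ) (h : ℝ → ℝ) : Prop where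
  fam : Fam (Function.update D.x c h)
  eq : ∀ t ∈ Icc (0 : ℝ) 1, t ∉ Ioo u v → h t = D.x c t
  zero_le : 0 ≤ u
  le_one : v ≤ 1

/-- The heights in `T` include those of the break points and the crossings of the strands of `D`
other than `c`. -/
structure IsGridOff {n : ℕ} (D : BraidDiagram n) (c : Fin n) (T : Finset ℝ) : Prop where
  zero : (0 : ℝ) ∈ T
  one : (1 : ℝ) ∈ T
  poly : ∀ j, j ≠ c → PolyOn T (D.x j) 0 1
  cross : ∀ j k t, j ≠ c → k ≠ c → D.Crosses j k t → t ∈ T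

theorem IsGridOff.mono {n : ℕ} {D : BraidDiagram n} {c : Fin n} {T T' : Finset ℝ}
    (h : IsGridOff D c T) (hT : T ⊆ T') : IsGridOff D c T' :=
  ⟨hT h.zero, hT h.one, fun j hj => (h.poly j hj).mono hT,
    fun j k t hj hk hc => hT (h.cross j k t hj hk hc)⟩

namespace Repl

variable {n : ℕ} {D : BraidDiagram n} {c : Fin n} {u v : ℝ} {h h' : ℝ → ℝ} {s s' : SignType}
  {T : Finset ℝ}

/-- The diagram in which `h` has replaced the strand `c`, all crossings of this strand between the
heights `u` and `v` being of type `s`. -/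
noncomputable def braid (hh : Repl D c u v h) (s : SignType) : BraidDiagram n :=
  hh.fam.braid D.n_pos
    (fun i => by
      have e : ∀ t ∈ Icc (0 : ℝ) 1, t ∉ Ioo u v → ∀ i, Function.update D.x c h i t = D.x i t := by
        intro t ht ht' i
        by_cases hi : i = c
        · subst hi; rw [Function.update_self, hh.eq t ht ht']
        · rw [Function.update_of_ne hi]
      obtain ⟨j, hj⟩ := D.ends i
      refine ⟨j, ?_⟩
      rw [e 1 (by simp) (fun h' => by linarith [h'.2, hh.le_one]),
        e 0 (by simp) (fun h' => by linarith [h'.1, hh.zero_le]), hj])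
    (overlay (fun j t => j = c ∧ t ∈ Icc u v) s D.sign) (overlay_symm D.sign_symm)

theorem braid_x_self (hh : Repl D c u v h) : (hh.braid s).x c = h := Function.update_self _ _ _

theorem braid_x_of_ne (hh : Repl D c u v h) {j : Fin n} (hj : j ≠ c) : (hh.braid s).x j = D.x j :=
  Function.update_of_ne hj _ _

theorem crosses_of_ne (hh : Repl D c u v h) {j k : Fin n} {t : ℝ} (hj : j ≠ c) (hk : k ≠ c) :
    (hh.braid s).Crosses j k t ↔ D.Crosses j k t := by
  rw [BraidDiagram.crosses_iff, BraidDiagram.crosses_iff, hh.braid_x_of_ne hj, hh.braid_x_of_ne hk]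

theorem crosses_self (hh : Repl D c u v h) {k : Fin n} {t : ℝ} :
    (hh.braid s).Crosses c k t ↔ k ≠ c ∧ t ∈ Icc (0 : ℝ) 1 ∧ h t = D.x k t := by
  rw [BraidDiagram.crosses_iff, hh.braid_x_self]
  constructor
  · rintro ⟨h1, h2, h3⟩
    rw [hh.braid_x_of_ne h1.symm] at h3
    exact ⟨h1.symm, h2, h3⟩
  · rintro ⟨h1, h2, h3⟩
    rw [hh.braid_x_of_ne h1]
    exact ⟨h1.symm, h2, h3⟩

theorem braid_sign (hh : Repl D c u v h) :
    (hh.braid s).sign = overlay (fun j t => j = c ∧ t ∈ Icc u v) s D.sign := rfl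

theorem sign_self (hh : Repl D c u v h) {k : Fin n} {t : ℝ} (hk : k ≠ c) (ht : t ∈ Icc u v) :
    (hh.braid s).sign c k t = s := by
  rw [hh.braid_sign]
  exact overlay_left ⟨rfl, ht⟩ (fun h => hk h.1)

theorem sign_eq (hh : Repl D c u v h) {j k : Fin n} {t : ℝ}
    (h1 : (j ≠ c ∧ k ≠ c) ∨ t ∉ Icc u v) : (hh.braid s).sign j k t = D.sign j k t := by
  rw [hh.braid_sign]
  refine overlay_base ?_ ?_
  · rintro ⟨h2, h3⟩
    rcases h1 with h1 | h1
    · exact h1.1 h2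
    · exact h1 h3
  · rintro ⟨h2, h3⟩
    rcases h1 with h1 | h1
    · exact h1.2 h2
    · exact h1 h3

theorem classical (hh : Repl D c u v h) (hD : D.IsClassical) (hs : s ≠ 0) :
    (hh.braid s).IsClassical := by
  have key : ∀ k t, (hh.braid s).Crosses c k t → (hh.braid s).sign c k t ≠ 0 := by
    intro k t hc
    have hc' := hh.crosses_self.1 hc
    by_cases ht : t ∈ Icc u v
    · rwa [hh.sign_self hc'.1 ht]
    · rw [hh.sign_eq (Or.inr ht)]
      refine hD c k t (D.crosses_iff.2 ⟨hc'.1.symm, hc'.2.1, ?_⟩)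
      rw [← hh.eq t hc'.2.1 fun h => ht ⟨h.1.le, h.2.le⟩]
      exact hc'.2.2
  intro j k t hc
  by_cases hj : j = c
  · subst hj; exact key k t hc
  by_cases hk : k = c
  · subst hk
    rw [(hh.braid s).sign_symm]
    simpa using key j t hc.symm
  rw [hh.sign_eq (Or.inl ⟨hj, hk⟩)]
  exact hD j k t ((hh.crosses_of_ne hj hk).1 hc)

/-- A triangular change of the strand `c` is a `Δ`-move. -/
theorem delta (hh : Repl D c u v h) (hh' : Repl D c u v h') {tA tC tB : ℝ} (hA : u ≤ tA)
    (hAC : tA < tC) (hCB : tC < tB) (hB : tB ≤ v) (h1 : AffineOn h tA tB)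
    (h2 : AffineOn h' tA tC) (h3 : AffineOn h' tC tB)
    (e : ∀ t ∈ Icc (0 : ℝ) 1, t ∉ Ioo tA tB → h' t = h t)
    (virt : s' ≠ 0 → ∀ j k t, j ≠ c → k ≠ c → t ∈ Ioo tA tB → D.Crosses j k t →
      D.sign j k t = 0 → D.x j t ∉ uIcc (h t) (h' t))
    (hadm : s ≠ 0 → s' ≠ 0 ∧ D.IsClassical) :
    R s ⟨n, hh.braid s'⟩ ⟨n, hh'.braid s'⟩ := by
  refine Relation.EqvGen.rel _ _ ⟨fun hs => hh.classical (hadm hs).2 (hadm hs).1,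
    fun hs => hh'.classical (hadm hs).2 (hadm hs).1, Or.inl (.delta ?_)⟩
  have hA0 : 0 ≤ tA := hh.zero_le.trans hA
  have hB1 : tB ≤ 1 := hB.trans hh.le_one
  have eA := e tA ⟨hA0, by linarith⟩ (by simp)
  have eB := e tB ⟨by linarith, hB1⟩ (by simp)
  have sub : Icc tA tB ⊆ Icc u v := Icc_subset_Icc hA hB
  have sub' : Icc u v ⊆ Icc 0 1 := Icc_subset_Icc hh.zero_le hh.le_one
  refine ⟨c, s', tA, tC, tB, rfl, rfl, hA0, hAC, hCB, hB1, ?_, ?_, ?_, ?_, ?_, ?_, ?_, ?_, ?_⟩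
  · rwa [hh.braid_x_self]
  · rwa [hh'.braid_x_self]
  · rwa [hh'.braid_x_self]
  · intro j t ht hj
    by_cases hjc : j = c
    · subst hjc
      rw [hh.braid_x_self, hh'.braid_x_self]
      exact e t ht (hj.resolve_left (not_not.2 rfl))
    · rw [hh.braid_x_of_ne hjc, hh'.braid_x_of_ne hjc]
  · intro j k t _ _
    rfl
  · intro j t ht hc
    exact hh.sign_self (hh.crosses_self.1 hc).1 (sub ht)
  · intro j t ht hc
    exact hh'.sign_self (hh'.crosses_self.1 hc).1 (sub ht)
  · simp
  · intro hs j k t hj hk hc hP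
    have hc' := (hh.crosses_of_ne hj hk).1 hc
    rw [hh.sign_eq (Or.inl ⟨hj, hk⟩)]
    simp only [StrandDiagram.pt, hh.braid_x_self, hh'.braid_x_self, hh.braid_x_of_ne hj] at hP
    obtain ⟨m1, m2⟩ := hull_slice hAC hCB h1 h2 h3 eA eB hP
    simp only at m1 m2
    intro h0
    by_cases hm : t ∈ Ioo tA tB
    · exact virt hs j k t hj hk hm hc' h0 m2
    -- at the ends of the moving arc the slice is one point, which is not a double point
    rw [e t (sub' (sub m1)) hm, uIcc_self, mem_singleton_iff] at m2
    rw [D.crosses_iff] at hc'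
    exact hc'.1 (((hh.fam.good t (sub' (sub m1))).of_update hj m2.symm).2.2 k hk
      (by rw [← m2, hc'.2.2])).symm

theorem modify (hh : Repl D c u v h) (hT : IsGridOff D c T) {A B : ℝ} (hA : u ≤ A) (hAB : A < B)
    (hB : B ≤ v) (hAT : A ∈ T) (hBT : B ∈ T) (hP : PolyOn T h' 0 1)
    (e : ∀ t ∈ Icc (0 : ℝ) 1, t ∉ Ioo A B → h' t = h t)
    (gA : ∀ k, k ≠ c → h A ≠ D.x k A) (gB : ∀ k, k ≠ c → h B ≠ D.x k B)
    (mem : ∀ τ ∈ T, τ ∈ Ioo A B → h' τ ∈ Icc (0 : ℝ) 1)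
    (on : ∀ τ ∈ T, τ ∈ Ioo A B → ∀ k, k ≠ c → h' τ = D.x k τ →
      TransAt (fun r => h' r - D.x k r) τ ∧ ∀ k', k' ≠ c → h' τ = D.x k' τ → k' = k) :
    Repl D c u v h' := by
  have hA0 : 0 ≤ A := hh.zero_le.trans hA
  have hB1 : B ≤ 1 := hB.trans hh.le_one
  have hmem : ∀ t ∈ Icc (0 : ℝ) 1, h t ∈ Icc (0 : ℝ) 1 := fun t ht => by
    simpa using hh.fam.mem c t ht
  have hmemT : ∀ τ ∈ T, τ ∈ Icc (0 : ℝ) 1 → h' τ ∈ Icc (0 : ℝ) 1 := by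
    intro τ hτ hτ'
    by_cases hm : τ ∈ Ioo A B
    · exact mem τ hτ hm
    · rw [e τ hτ' hm]; exact hmem τ hτ'
  refine ⟨⟨fun i => ?_, fun i t ht => ?_, fun t ht => ?_⟩, fun t ht ht' => ?_, hh.zero_le,
    hh.le_one⟩
  · by_cases hi : i = c
    · subst hi; rw [Function.update_self]; exact hP.pl
    · rw [Function.update_of_ne hi]; exact D.fam.pl i
  · by_cases hi : i = c
    · subst hi; rw [Function.update_self]
      exact ⟨(PolyOn.const T 0 0 1).le hP hT.zero hT.one (fun τ h1 h2 => (hmemT τ h1 h2).1) ht,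
        hP.le (PolyOn.const T 1 0 1) hT.zero hT.one (fun τ h1 h2 => (hmemT τ h1 h2).2) ht⟩
    · rw [Function.update_of_ne hi]; exact D.fam.mem i t ht
  · refine good_update (D.fam.good t ht) fun k hk hx => ?_
    by_cases hm : t ∈ Ioo A B
    · have hsub := ((hP.sub (hT.poly k hk)).sub_interval hA0 hB1)
      obtain ⟨-, htr⟩ := hsub.transAt hAT hBT (fun τ hτ hτ' h0 => by
        have h0' := sub_eq_zero.1 h0
        have hτ'' : τ ∈ Ioo A B := by
          refine ⟨lt_of_le_of_ne hτ'.1 ?_, lt_of_le_of_ne hτ'.2 ?_⟩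
          · rintro rfl
            rw [e A ⟨hA0, by linarith⟩ (by simp)] at h0'
            exact gA k hk h0'
          · rintro rfl
            rw [e τ ⟨by linarith, hB1⟩ (by simp)] at h0'
            exact gB k hk h0'
        exact ⟨hτ'', (on τ hτ hτ'' k hk h0').1⟩) ⟨hm.1.le, hm.2.le⟩ (sub_eq_zero.2 hx)
      refine ⟨⟨by linarith [hm.1], by linarith [hm.2]⟩, htr, fun k' hk' hx' => ?_⟩
      by_contra hne
      have htT := hT.cross k' k t hk' hk (D.crosses_iff.2 ⟨hne, ht, by rw [← hx', hx]⟩)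
      exact hne ((on t htT hm k hk hx).2 k' hk' hx')
    · have ht' := e t ht hm
      rw [ht'] at hx
      obtain ⟨h1, h2, h3⟩ := (hh.fam.good t ht).of_update hk hx
      refine ⟨h1, h2.congr ?_, by rwa [ht']⟩
      have hne : t ∉ Icc A B := by
        rintro ⟨h4, h5⟩
        rcases eq_or_lt_of_le h4 with rfl | h4
        · exact gA k hk hx
        rcases eq_or_lt_of_le h5 with rfl | h5
        · exact gB k hk hx
        exact hm ⟨h4, h5⟩
      filter_upwards [isOpen_Ioo.mem_nhds h1, isClosed_Icc.isOpen_compl.mem_nhds hne] with r h4 h5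
      rw [e r ⟨h4.1.le, h4.2.le⟩ fun h6 => h5 ⟨h6.1.le, h6.2.le⟩]
  · rw [e t ht fun h4 => ht' ⟨hA.trans_lt h4.1, h4.2.trans_le hB⟩, hh.eq t ht ht']

end Repl

end Braidoids

namespace Braidoids
open Set

/-- Two numbers on the same side of `y`: `y` does not separate them from a third one differently. -/
theorem not_mem_uIcc_of_side {a b x y : ℝ} (h : y ∉ uIcc x b) (hs : 0 < (a - y) * (b - y)) :
    y ∉ uIcc x a := by
  rw [mem_uIcc, not_or, not_and_or, not_and_or] at *
  simp only [not_le] at *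
  rcases mul_pos_iff.1 hs with ⟨h1, h2⟩ | ⟨h1, h2⟩ <;>
    refine ⟨?_, ?_⟩ <;> rcases h with ⟨h3 | h3, h4 | h4⟩ <;>
    first
      | exact Or.inl (by linarith)
      | exact Or.inr (by linarith)

theorem not_mem_uIcc_of_mul_pos {a b y : ℝ} (hs : 0 < (a - y) * (b - y)) : y ∉ uIcc a b := by
  rw [mem_uIcc]
  rintro (⟨h1, h2⟩ | ⟨h1, h2⟩) <;> rcases mul_pos_iff.1 hs with ⟨h3, h4⟩ | ⟨h3, h4⟩ <;> linarith

theorem mul_neg_of_sides {a b x y : ℝ} (h1 : a * b < 0) (h2 : 0 < x * b) (h3 : 0 < y * x) :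
    a * y < 0 := by
  rcases mul_pos_iff.1 h2 with ⟨hx, hb⟩ | ⟨hx, hb⟩
  · exact mul_neg_of_neg_of_pos (neg_of_mul_neg_left h1 hb.le) (pos_of_mul_pos_left h3 hx.le)
  · refine mul_neg_of_pos_of_neg (pos_of_mul_neg_left h1 hb.le) ?_
    by_contra hy
    exact absurd h3 (not_lt.2 (mul_nonpos_of_nonneg_of_nonpos (not_lt.1 hy) hx.le))

open Filter Topology in
/-- The choice of the auxiliary vertex in `Repl.vertex_move`: shortly after `τ`. -/
theorem exists_aux_vertex {ι : Type*} [Finite ι] (P : ι → Prop) (X : ι → ℝ → ℝ) {L : ℝ → ℝ}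
    {A τ B : ℝ} (yA : ℝ) (hA : A < τ) (hB : τ < B) (hX : ∀ k, P k → AffineOn (X k) τ B)
    (hL : AffineOn L τ B) (hne : ∀ k, P k → L τ ≠ X k τ) (hL1 : L τ ∈ Ioo (0 : ℝ) 1) :
    ∃ w, τ < w ∧ w < B ∧ line A yA w (L w) τ ∈ Ioo (0 : ℝ) 1 ∧ ∀ k, P k →
      0 < (L w - X k w) * (L τ - X k τ) ∧
      0 < (line A yA w (L w) τ - X k τ) * (L τ - X k τ) := by
  obtain ⟨p, q, hL⟩ := hL
  have hLτ := hL τ ⟨le_rfl, hB.le⟩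
  have hc : ContinuousAt (fun w => line A yA w (p * w + q) τ) τ := by
    unfold line
    have : τ - A ≠ 0 := by linarith
    fun_prop (disch := assumption)
  have hv : line A yA τ (p * τ + q) τ = L τ := by rw [line_right hA, hLτ]
  have e1 : ∀ᶠ w in 𝓝[>] τ, line A yA w (p * w + q) τ ∈ Ioo (0 : ℝ) 1 :=
    (hc.eventually_mem (by rw [hv]; exact isOpen_Ioo.mem_nhds hL1)).filter_mono nhdsWithin_le_nhds
  have e2 : ∀ᶠ w in 𝓝[>] τ, ∀ k, P k →
      0 < (p * w + q - X k w) * (L τ - X k τ) ∧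
      0 < (line A yA w (p * w + q) τ - X k τ) * (L τ - X k τ) := by
    refine eventually_all.2 fun k => ?_
    by_cases hk : P k
    · obtain ⟨p', q', hX'⟩ := hX k hk
      have hXτ := hX' τ ⟨le_rfl, hB.le⟩
      have hpos : 0 < (L τ - X k τ) * (L τ - X k τ) :=
        mul_self_pos.2 (sub_ne_zero.2 (hne k hk))
      have c1 : ContinuousAt (fun w => (p * w + q - (p' * w + q')) * (L τ - X k τ)) τ := by
        fun_prop
      have c2 : ContinuousAt
          (fun w => (line A yA w (p * w + q) τ - X k τ) * (L τ - X k τ)) τ := by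
        fun_prop
      have f1 := (Tendsto.eventually_const_lt (u := 0) (by rw [← hLτ, ← hXτ]; exact hpos)
        c1.tendsto).filter_mono (nhdsWithin_le_nhds (s := Ioi τ))
      have f2 := (Tendsto.eventually_const_lt (u := 0) (by rw [hv]; exact hpos)
        c2.tendsto).filter_mono (nhdsWithin_le_nhds (s := Ioi τ))
      filter_upwards [f1, f2, Ioo_mem_nhdsGT hB] with w h1 h2 h3 _
      rw [hX' w ⟨h3.1.le, h3.2.le⟩]
      exact ⟨h1, h2⟩
    · exact Eventually.of_forall fun w h => absurd h hk
  obtain ⟨w, h1, h2, h3⟩ := (e1.and (e2.and (Ioo_mem_nhdsGT hB))).exists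
  have hLw := hL w ⟨h3.1.le, h3.2.le⟩
  rw [← hLw] at h1 h2
  exact ⟨w, h3.1, h3.2, h1, h2⟩

namespace Repl

variable {n : ℕ} {D : BraidDiagram n} {c : Fin n} {u v : ℝ} {h h' : ℝ → ℝ} {s s' : SignType}
  {T : Finset ℝ}

/-- The vertex of the strand `c` at the height `τ` is moved along the horizontal line. If it lies on
another strand, it is moved to the side to which the strand `c` goes on from there. With
`A`, `V`, `B` the neighbouring vertices, `V'` the new vertex and `W` a point of `V'B` shortly below
`V'`, the moves are `AVB → AVWB → AWB → AV'WB`. -/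
theorem vertex_move (hh : Repl D c u v h) (hT : IsGridOff D c T) (hP : PolyOn T h 0 1)
    {A τ B : ℝ} (hAT : A ∈ T) (hτT : τ ∈ T) (hBT : B ∈ T) (huA : u ≤ A) (hAτ : A < τ)
    (hτB : τ < B) (hBv : B ≤ v) (only : ∀ r ∈ T, r ∈ Ioo A B → r = τ)
    (gA : ∀ k, k ≠ c → h A ≠ D.x k A) (gB : ∀ k, k ≠ c → h B ≠ D.x k B)
    (hm' : h' τ ∈ Ioo (0 : ℝ) 1) (gτ : ∀ k, k ≠ c → h' τ ≠ D.x k τ)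
    (compat : ∀ k, k ≠ c → h τ = D.x k τ → 0 < (h' τ - D.x k τ) * (h B - D.x k B))
    (virt : s' ≠ 0 → ∀ j k, j ≠ c → k ≠ c → D.Crosses j k τ → D.sign j k τ = 0 →
      D.x j τ ∉ uIcc (h τ) (h' τ))
    (hadm : s ≠ 0 → s' ≠ 0 ∧ D.IsClassical)
    (hP' : PolyOn T h' 0 1) (he : ∀ r ∈ T, r ≠ τ → h' r = h r) :
    ∃ hh' : Repl D c u v h', R s ⟨n, hh.braid s'⟩ ⟨n, hh'.braid s'⟩ := by
  have hA0 : 0 ≤ A := hh.zero_le.trans huA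
  have hB1 : B ≤ 1 := hBv.trans hh.le_one
  have noAτ : ∀ r ∈ T, r ∉ Ioo A τ := fun r hr hr' => by
    have := only r hr ⟨hr'.1, hr'.2.trans hτB⟩
    exact absurd hr'.2 (by rw [this]; exact lt_irrefl _)
  have noτB : ∀ r ∈ T, r ∉ Ioo τ B := fun r hr hr' => by
    have := only r hr ⟨hAτ.trans hr'.1, hr'.2⟩
    exact absurd hr'.1 (by rw [this]; exact lt_irrefl _)
  have off : ∀ {T' : Finset ℝ} {g : ℝ → ℝ}, 0 ∈ T' → 1 ∈ T' → A ∈ T' → B ∈ T' →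
      PolyOn T' h 0 1 → PolyOn T' g 0 1 →
      (∀ r ∈ T', r ∉ Ioo A B → g r = h r) → ∀ t ∈ Icc (0 : ℝ) 1, t ∉ Ioo A B → g t = h t := by
    intro T' g h0 h1 hA' hB' q1 q2 hv t ht hn
    rcases le_or_gt t A with h3 | h3
    · exact (q2.sub_interval le_rfl (by linarith)).eq (q1.sub_interval le_rfl (by linarith))
        h0 hA' (fun r hr hr' => hv r hr fun h5 => by linarith [h5.1, hr'.2]) ⟨ht.1, h3⟩
    · have h4 : B ≤ t := not_lt.1 fun h4 => hn ⟨h3, h4⟩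
      exact (q2.sub_interval (by linarith) le_rfl).eq (q1.sub_interval (by linarith) le_rfl)
        hB' h1 (fun r hr hr' => hv r hr fun h5 => by linarith [h5.2, hr'.1]) ⟨h4, ht.2⟩
  have e' : ∀ t ∈ Icc (0 : ℝ) 1, t ∉ Ioo A B → h' t = h t :=
    off hT.zero hT.one hAT hBT hP hP' fun r hr hr' => he r hr fun h0 => hr' (by
      rw [h0]; exact ⟨hAτ, hτB⟩)
  have hh' : Repl D c u v h' := by
    refine hh.modify hT huA (hAτ.trans hτB) hBv hAT hBT hP' e' gA gB ?_ ?_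
    · intro r hr hr'
      rw [only r hr hr']
      exact ⟨hm'.1.le, hm'.2.le⟩
    · intro r hr hr' k hk hx
      rw [only r hr hr'] at hx
      exact absurd hx (gτ k hk)
  refine ⟨hh', ?_⟩
  obtain ⟨w, hτw, hwB, ha1, hw⟩ := exists_aux_vertex (fun k => k ≠ c) (fun k => D.x k) (h A)
    hAτ hτB (fun k hk => hT.poly k hk τ B (by linarith) hτB hB1 noτB)
    (hP' τ B (by linarith) hτB hB1 noτB) gτ hm'
  set a := line A (h A) w (h' w) τ with ha
  have hw01 : w ∈ Icc (0 : ℝ) 1 := ⟨by linarith, by linarith⟩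
  have hwm : h' w ∈ Icc (0 : ℝ) 1 := by simpa using hh'.fam.mem c w hw01
  have gw : ∀ k, k ≠ c → h' w ≠ D.x k w := fun k hk e => by
    have := (hw k hk).1
    rw [e, sub_self, zero_mul] at this
    exact lt_irrefl _ this
  have ga : ∀ k, k ≠ c → a ≠ D.x k τ := fun k hk e => by
    have := (hw k hk).2
    rw [e, sub_self, zero_mul] at this
    exact lt_irrefl _ this
  have hwT : w ∉ T := fun hwT => noτB w hwT ⟨hτw, hwB⟩
  have hAB := hAτ.trans hτB
  -- the polygons `AVWB` and `AWB`
  classical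
  set val : ℝ → ℝ := fun r => if r = w then h' w else h r with hval
  obtain ⟨h₁, v₁, P₁⟩ := exists_interp (insert w T) val
  obtain ⟨h₂, v₂, P₂⟩ := exists_interp (insert w (T.erase τ)) val
  have hT' : IsGridOff D c (insert w T) := hT.mono (Finset.subset_insert _ _)
  have ne0 : (0 : ℝ) ≠ τ := by linarith
  have ne1 : (1 : ℝ) ≠ τ := by linarith
  have neA : A ≠ τ := by linarith
  have neB : B ≠ τ := by linarith
  have P₁' : PolyOn (insert w T) h₁ 0 1 := P₁ 0 hT'.zero 1 hT'.one
  have P₂'' : PolyOn (insert w (T.erase τ)) h₂ 0 1 :=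
    P₂ 0 (by simp [hT.zero, ne0]) 1 (by simp [hT.one, ne1])
  have P₂' : PolyOn (insert w T) h₂ 0 1 :=
    P₂''.mono (Finset.insert_subset_insert _ (Finset.erase_subset _ _))
  have hP₁ : PolyOn (insert w T) h 0 1 := hP.mono (Finset.subset_insert _ _)
  have v₁w : h₁ w = h' w := by rw [v₁ w (by simp)]; simp [hval]
  have v₁T : ∀ r ∈ T, h₁ r = h r := fun r hr => by
    rw [v₁ r (by simp [hr])]
    simp only [hval]
    rw [if_neg]
    rintro rfl
    exact hwT hr
  have v₂w : h₂ w = h' w := by rw [v₂ w (by simp)]; simp [hval]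
  have v₂T : ∀ r ∈ T, r ≠ τ → h₂ r = h r := fun r hr hr' => by
    rw [v₂ r (by simp [hr, hr'])]
    simp only [hval]
    rw [if_neg]
    rintro rfl
    exact hwT hr
  have hATi : A ∈ insert w T := by simp [hAT]
  have hBTi : B ∈ insert w T := by simp [hBT]
  have only' : ∀ r ∈ insert w T, r ∈ Ioo A B → r = τ ∨ r = w := by
    intro r hr hr'
    rcases Finset.mem_insert.1 hr with h0 | h0
    · exact Or.inr h0
    · exact Or.inl (only r h0 hr')
  have e₁ : ∀ t ∈ Icc (0 : ℝ) 1, t ∉ Ioo A B → h₁ t = h t := by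
    refine off hT'.zero hT'.one hATi hBTi hP₁ P₁' fun r hr hr' => ?_
    rcases Finset.mem_insert.1 hr with rfl | h0
    · exact absurd ⟨by linarith, hwB⟩ hr'
    · exact v₁T r h0
  have e₂ : ∀ t ∈ Icc (0 : ℝ) 1, t ∉ Ioo A B → h₂ t = h t := by
    refine off hT'.zero hT'.one hATi hBTi hP₁ P₂' fun r hr hr' => ?_
    rcases Finset.mem_insert.1 hr with rfl | h0
    · exact absurd ⟨by linarith, hwB⟩ hr'
    · exact v₂T r h0 fun h1 => hr' (by rw [h1]; exact ⟨hAτ, hτB⟩)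
  have no₁ : ∀ r ∈ insert w T, r ∉ Ioo A τ := fun r hr hr' => by
    rcases only' r hr ⟨hr'.1, hr'.2.trans hτB⟩ with rfl | rfl <;> linarith [hr'.2]
  have no₂ : ∀ r ∈ insert w T, r ∉ Ioo τ w := fun r hr hr' => by
    rcases only' r hr ⟨hAτ.trans hr'.1, hr'.2.trans hwB⟩ with rfl | rfl <;> linarith [hr'.1, hr'.2]
  have no₃ : ∀ r ∈ insert w T, r ∉ Ioo w B := fun r hr hr' => by
    rcases only' r hr ⟨by linarith [hr'.1], hr'.2⟩ with rfl | rfl <;> linarith [hr'.1]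
  have no₄ : ∀ r ∈ insert w (T.erase τ), r ∉ Ioo A w := fun r hr hr' => by
    rcases Finset.mem_insert.1 hr with rfl | h0
    · linarith [hr'.2]
    · rw [Finset.mem_erase] at h0
      exact h0.1 (only r h0.2 ⟨hr'.1, by linarith [hr'.2]⟩)
  have a₁Aτ := P₁' A τ hA0 hAτ (by linarith) no₁
  have a₁τw := P₁' τ w (by linarith) hτw (by linarith) no₂
  have a₁wB := P₁' w B (by linarith) hwB hB1 no₃
  have a₂Aw := P₂'' A w hA0 (by linarith) (by linarith) no₄
  have a₂wB := P₂' w B (by linarith) hwB hB1 no₃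
  have h₂τ : h₂ τ = a := by
    refine a₂Aw.eq (line_affine A (h A) w (h' w) A w) ⟨hAτ.le, hτw.le⟩ ?_ ?_
    · rw [line_left, v₂T A hAT neA]
    · rw [line_right (by linarith), v₂w]
  have hh₁ : Repl D c u v h₁ := by
    refine hh.modify hT' huA hAB hBv hATi hBTi P₁' e₁ gA gB ?_ ?_
    · intro r hr hr'
      rcases only' r hr hr' with rfl | rfl
      · rw [v₁T r hτT]
        simpa using hh.fam.mem c r ⟨by linarith, by linarith⟩
      · rw [v₁w]; exact hwm
    · intro r hr hr' k hk hx
      rcases only' r hr hr' with rfl | rfl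
      · rw [v₁T r hτT] at hx ⊢
        have hg := (hh.fam.good r ⟨by linarith, by linarith⟩).of_update hk hx
        refine ⟨transAt_of_affine (a₁Aτ.sub ?_) (a₁τw.sub ?_) hAτ hτw ?_ ?_, hg.2.2⟩
        · exact hT.poly k hk A r hA0 hAτ (by linarith) noAτ
        · exact (hT.poly k hk r B (by linarith) hτB hB1 noτB).mono le_rfl hwB.le
        · rw [v₁T r hτT, hx, sub_self]
        · have hneg := hg.2.1.mul_neg
            ((hP A r hA0 hAτ (by linarith) noAτ).sub
              (hT.poly k hk A r hA0 hAτ (by linarith) noAτ))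
            ((hP r B (by linarith) hτB hB1 noτB).sub
              (hT.poly k hk r B (by linarith) hτB hB1 noτB)) hAτ hτB (by rw [hx, sub_self])
          rw [v₁T A hAT, v₁w]
          exact mul_neg_of_sides hneg (compat k hk hx) (hw k hk).1
      · rw [v₁w] at hx
        exact absurd hx (gw k hk)
  have hh₂ : Repl D c u v h₂ := by
    refine hh.modify hT' huA hAB hBv hATi hBTi P₂' e₂ gA gB ?_ ?_
    · intro r hr hr'
      rcases only' r hr hr' with rfl | rfl
      · rw [h₂τ]; exact ⟨ha1.1.le, ha1.2.le⟩
      · rw [v₂w]; exact hwm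
    · intro r hr hr' k hk hx
      rcases only' r hr hr' with rfl | rfl
      · rw [h₂τ] at hx
        exact absurd hx (ga k hk)
      · rw [v₂w] at hx
        exact absurd hx (gw k hk)
  have m₁ : R s ⟨n, hh.braid s'⟩ ⟨n, hh₁.braid s'⟩ := by
    refine hh.delta hh₁ (tA := τ) (tC := w) (tB := B) (by linarith) hτw hwB hBv
      (hP τ B (by linarith) hτB hB1 noτB) a₁τw a₁wB ?_ ?_ hadm
    · intro t ht hn
      by_cases hm : t ∈ Ioo A B
      · have htτ : t ≤ τ := not_lt.1 fun h0 => hn ⟨h0, hm.2⟩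
        exact a₁Aτ.eq (hP A τ hA0 hAτ (by linarith) noAτ) ⟨hm.1.le, htτ⟩ (v₁T A hAT) (v₁T τ hτT)
      · exact e₁ t ht hm
    · intro _ j k t hj hk ht hc
      exact absurd ht (noτB t (hT.cross j k t hj hk hc))
  have m₂ : R s ⟨n, hh₂.braid s'⟩ ⟨n, hh₁.braid s'⟩ := by
    refine hh₂.delta hh₁ (tA := A) (tC := τ) (tB := w) huA hAτ hτw (by linarith)
      a₂Aw a₁Aτ a₁τw ?_ ?_ hadm
    · intro t ht hn
      by_cases hm : t ∈ Ioo A B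
      · have htw : w ≤ t := not_lt.1 fun h0 => hn ⟨hm.1, h0⟩
        exact a₁wB.eq a₂wB ⟨htw, hm.2.le⟩ (by rw [v₁w, v₂w])
          (by rw [v₁T B hBT, v₂T B hBT neB])
      · rw [e₁ t ht hm, e₂ t ht hm]
    · intro hs' j k t hj hk ht hc h0
      obtain rfl := only t (hT.cross j k t hj hk hc) ⟨ht.1, by linarith [ht.2]⟩
      rw [h₂τ, v₁T t hτT, uIcc_comm]
      exact not_mem_uIcc_of_side (virt hs' j k hj hk hc h0) (hw j hj).2
  have m₃ : R s ⟨n, hh₂.braid s'⟩ ⟨n, hh'.braid s'⟩ := by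
    refine hh₂.delta hh' (tA := A) (tC := τ) (tB := w) huA hAτ hτw (by linarith)
      a₂Aw (hP' A τ hA0 hAτ (by linarith) noAτ)
      ((hP' τ B (by linarith) hτB hB1 noτB).mono le_rfl hwB.le) ?_ ?_ hadm
    · intro t ht hn
      by_cases hm : t ∈ Ioo A B
      · have htw : w ≤ t := not_lt.1 fun h0 => hn ⟨hm.1, h0⟩
        exact ((hP' τ B (by linarith) hτB hB1 noτB).mono hτw.le le_rfl).eq a₂wB
          ⟨htw, hm.2.le⟩ v₂w.symm (by rw [he B hBT neB, v₂T B hBT neB])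
      · rw [e' t ht hm, e₂ t ht hm]
    · intro hs' j k t hj hk ht hc h0
      obtain rfl := only t (hT.cross j k t hj hk hc) ⟨ht.1, by linarith [ht.2]⟩
      rw [h₂τ]
      exact not_mem_uIcc_of_mul_pos (hw j hj).2
  exact (m₁.trans m₂.symm).trans m₃

end Repl

end Braidoids

namespace Braidoids
open Set

namespace Repl

variable {n : ℕ} {D : BraidDiagram n} {c : Fin n} {u v : ℝ} {h : ℝ → ℝ} {s s' : SignType}
  {T : Finset ℝ}

open Filter Topology in
/-- The new position of a vertex at `y` that lies on another strand: near `y`, on the side of the sign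
of `b`. -/
theorem exists_side_value {ι : Type*} [Finite ι] (P : ι → Prop) (X : ι → ℝ) {y b : ℝ}
    (hy : y ∈ Ioo (0 : ℝ) 1) (hb : b ≠ 0) :
    ∃ y' ∈ Ioo (0 : ℝ) 1, 0 < (y' - y) * b ∧
      ∀ k, P k → y ≠ X k → 0 < (y' - X k) * (y - X k) := by
  have e1 : ∀ᶠ η in 𝓝[>] (0 : ℝ), y + η * b ∈ Ioo (0 : ℝ) 1 := by
    have c : ContinuousAt (fun η => y + η * b) 0 := by fun_prop
    exact (c.eventually_mem (isOpen_Ioo.mem_nhds (by simpa using hy))).filter_mono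
      nhdsWithin_le_nhds
  have e2 : ∀ᶠ η in 𝓝[>] (0 : ℝ), ∀ k, P k → y ≠ X k → 0 < (y + η * b - X k) * (y - X k) := by
    refine eventually_all.2 fun k => ?_
    by_cases hk : y = X k
    · exact Eventually.of_forall fun _ _ h => absurd hk h
    have c : ContinuousAt (fun η => (y + η * b - X k) * (y - X k)) 0 := by fun_prop
    have := (Tendsto.eventually_const_lt (u := 0)
      (by simpa using mul_self_pos.2 (sub_ne_zero.2 hk)) c.tendsto).filter_mono
      (nhdsWithin_le_nhds (s := Ioi 0))
    filter_upwards [this] with η hη _ _ using hη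
  obtain ⟨η, h1, h2, h3⟩ := (e1.and (e2.and self_mem_nhdsWithin)).exists
  refine ⟨_, h1, ?_, h2⟩
  have : (y + η * b - y) * b = η * (b * b) := by ring
  rw [this]
  exact mul_pos h3 (mul_self_pos.2 hb)

/-- The vertices that lie on other strands can be moved off them, if their neighbours on the grid
do not lie on other strands. -/
theorem perturb (hT : IsGridOff D c T) (hadm : s ≠ 0 → s' ≠ 0 ∧ D.IsClassical) (N : ℕ) :
    ∀ h, ∀ hh : Repl D c u v h, PolyOn T h 0 1 →
      (∀ τ ∈ T, τ ∈ Ioo u v → h τ ∈ Ioo (0 : ℝ) 1) →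
      (∀ τ ∈ T, τ ∈ Ioo u v → (∃ k, k ≠ c ∧ h τ = D.x k τ) → ∃ A ∈ T, ∃ B ∈ T, u ≤ A ∧ A < τ ∧
        τ < B ∧ B ≤ v ∧ (∀ r ∈ T, r ∈ Ioo A B → r = τ) ∧ (∀ k, k ≠ c → h A ≠ D.x k A) ∧
        (∀ k, k ≠ c → h B ≠ D.x k B)) →
      {τ | τ ∈ T ∧ τ ∈ Ioo u v ∧ ∃ k, k ≠ c ∧ h τ = D.x k τ}.ncard = N →
      ∃ g, ∃ hg : Repl D c u v g, R s ⟨n, hh.braid s'⟩ ⟨n, hg.braid s'⟩ ∧ PolyOn T g 0 1 ∧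
        (∀ τ ∈ T, τ ∈ Ioo u v → g τ ∈ Ioo (0 : ℝ) 1) ∧
        (∀ τ ∈ T, τ ∈ Ioo u v → ∀ k, k ≠ c → g τ ≠ D.x k τ) ∧
        (∀ τ ∈ T, τ ∈ Ioo u v → ∀ k, k ≠ c → h τ ≠ D.x k τ →
          0 < (g τ - D.x k τ) * (h τ - D.x k τ)) := by
  have hfin : ∀ h : ℝ → ℝ, {τ | τ ∈ T ∧ τ ∈ Ioo u v ∧ ∃ k, k ≠ c ∧ h τ = D.x k τ}.Finite :=
    fun h => T.finite_toSet.subset fun τ hτ => hτ.1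
  induction N with
  | zero =>
    intro h hh hP hm _ hN
    rw [Set.ncard_eq_zero (hfin h), Set.eq_empty_iff_forall_notMem] at hN
    have gen : ∀ τ ∈ T, τ ∈ Ioo u v → ∀ k, k ≠ c → h τ ≠ D.x k τ :=
      fun τ h1 h2 k h3 h4 => hN τ ⟨h1, h2, k, h3, h4⟩
    exact ⟨h, hh, R.refl _ _, hP, hm, gen,
      fun τ h1 h2 k h3 h4 => mul_self_pos.2 (sub_ne_zero.2 h4)⟩
  | succ N ih =>
    intro h hh hP hm hsep hN
    have hne : {τ | τ ∈ T ∧ τ ∈ Ioo u v ∧ ∃ k, k ≠ c ∧ h τ = D.x k τ}.Nonempty := by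
      rw [← Set.ncard_pos (hfin h)]; omega
    obtain ⟨τ, hτ⟩ := hne
    have ⟨hτT, hτuv, k, hk, hx⟩ := hτ
    obtain ⟨A, hAT, B, hBT, huA, hAτ, hτB, hBv, only, gA, gB⟩ := hsep τ hτT hτuv ⟨k, hk, hx⟩
    have hτ01 : τ ∈ Icc (0 : ℝ) 1 :=
      ⟨hh.zero_le.trans hτuv.1.le, hτuv.2.le.trans hh.le_one⟩
    have huniq := ((hh.fam.good τ hτ01).of_update hk hx).2.2
    obtain ⟨y, hy, hyb, hyk⟩ := exists_side_value (fun k => k ≠ c) (fun k => D.x k τ)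
      (hm τ hτT hτuv) (sub_ne_zero.2 (gB k hk))
    obtain ⟨h', v', P'⟩ := exists_interp T fun r => if r = τ then y else h r
    have h'τ : h' τ = y := by rw [v' τ hτT, if_pos rfl]
    have he : ∀ r ∈ T, r ≠ τ → h' r = h r := fun r hr hr' => by rw [v' r hr, if_neg hr']
    have gτ : ∀ k', k' ≠ c → h' τ ≠ D.x k' τ := by
      intro k' hk' e
      rw [h'τ] at e
      by_cases h0 : h τ = D.x k' τ
      · rw [e, ← h0, sub_self, zero_mul] at hyb
        exact lt_irrefl _ hyb
      · have := hyk k' hk' h0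
        rw [e, sub_self, zero_mul] at this
        exact lt_irrefl _ this
    obtain ⟨hh', hR⟩ := hh.vertex_move (s := s) (s' := s') (h' := h') hT hP hAT hτT hBT huA hAτ
      hτB hBv only gA gB (by rw [h'τ]; exact hy) gτ (fun k' hk' hx' => by
        obtain rfl := huniq k' hk' hx'
        rw [h'τ, ← hx]; exact hyb) (fun _ j k' hj hk' hc _ => by
        have hne : h τ ≠ D.x j τ := fun h0 => by
          obtain rfl := huniq j hj h0
          rw [D.crosses_iff] at hc
          exact hc.1 (huniq k' hk' (by rw [h0, hc.2.2])).symm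
        rw [h'τ]
        have := hyk j hj hne
        rw [mul_comm] at this
        exact not_mem_uIcc_of_mul_pos this) hadm (P' 0 hT.zero 1 hT.one) he
    have hset : {r | r ∈ T ∧ r ∈ Ioo u v ∧ ∃ k, k ≠ c ∧ h' r = D.x k r} =
        {r | r ∈ T ∧ r ∈ Ioo u v ∧ ∃ k, k ≠ c ∧ h r = D.x k r} \ {τ} := by
      ext r
      simp only [mem_ofPred_eq, mem_sdiff, mem_singleton_iff]
      constructor
      · rintro ⟨h1, h2, k', h3, h4⟩
        have hr : r ≠ τ := fun h0 => gτ k' h3 (by rw [← h0]; exact h4)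
        exact ⟨⟨h1, h2, k', h3, by rw [← he r h1 hr]; exact h4⟩, hr⟩
      · rintro ⟨⟨h1, h2, k', h3, h4⟩, h5⟩
        exact ⟨h1, h2, k', h3, by rw [he r h1 h5]; exact h4⟩
    have gen' : ∀ r ∈ T, (∀ k, k ≠ c → h r ≠ D.x k r) → ∀ k, k ≠ c → h' r ≠ D.x k r := by
      intro r hr hg k' hk'
      by_cases h0 : r = τ
      · rw [h0]; exact gτ k' hk'
      · rw [he r hr h0]; exact hg k' hk'
    obtain ⟨g, hg, hR', hPg, hmg, geng, side⟩ := ih h' hh' (P' 0 hT.zero 1 hT.one)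
      (fun r h1 h2 => by
        by_cases h0 : r = τ
        · rw [h0, h'τ]; exact hy
        · rw [he r h1 h0]; exact hm r h1 h2)
      (fun r h1 h2 ⟨k', h3, h4⟩ => by
        have h0 : r ≠ τ := fun h0 => gτ k' h3 (by rw [← h0]; exact h4)
        obtain ⟨A, hAT, B, hBT, a1, a2, a3, a4, a5, a6, a7⟩ :=
          hsep r h1 h2 ⟨k', h3, by rw [← he r h1 h0]; exact h4⟩
        exact ⟨A, hAT, B, hBT, a1, a2, a3, a4, a5, gen' A hAT a6, gen' B hBT a7⟩)
      (by rw [hset, Set.ncard_sdiff_singleton_of_mem hτ, hN]; rfl)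
    refine ⟨g, hg, hR.trans hR', hPg, hmg, geng, fun r h1 h2 k' h3 h4 => ?_⟩
    by_cases h0 : r = τ
    · subst h0
      have a1 := hyk k' h3 h4
      have a2 := side r h1 h2 k' h3 (gτ k' h3)
      rw [h'τ] at a2
      rcases mul_pos_iff.1 a1 with ⟨b1, b2⟩ | ⟨b1, b2⟩
      · exact mul_pos (pos_of_mul_pos_left a2 b1.le) b2
      · rw [← neg_mul_neg] at a2
        have := pos_of_mul_pos_left a2 (by linarith)
        exact mul_pos_of_neg_of_neg (by linarith) b2
    · have := side r h1 h2 k' h3 (by rw [he r h1 h0]; exact h4)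
      rwa [he r h1 h0] at this

/-- Two polygons whose vertices do not lie on other strands differ by moves of one vertex at a
time. -/
theorem connect (hT : IsGridOff D c T) (hadm : s ≠ 0 → s' ≠ 0 ∧ D.IsClassical) (huT : u ∈ T)
    (hvT : v ∈ T) (gu : ∀ k, k ≠ c → D.x c u ≠ D.x k u) (gv : ∀ k, k ≠ c → D.x c v ≠ D.x k v)
    {g : ℝ → ℝ} (hg : Repl D c u v g) (hPg : PolyOn T g 0 1)
    (hmg : ∀ τ ∈ T, τ ∈ Ioo u v → g τ ∈ Ioo (0 : ℝ) 1)
    (gg : ∀ τ ∈ T, τ ∈ Ioo u v → ∀ k, k ≠ c → g τ ≠ D.x k τ) (N : ℕ) :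
    ∀ h, ∀ hh : Repl D c u v h, PolyOn T h 0 1 →
      (∀ τ ∈ T, τ ∈ Ioo u v → ∀ k, k ≠ c → h τ ≠ D.x k τ) →
      (s' ≠ 0 → ∀ j k t, j ≠ c → k ≠ c → t ∈ Ioo u v → D.Crosses j k t → D.sign j k t = 0 →
        D.x j t ∉ uIcc (h t) (g t)) →
      {τ | τ ∈ T ∧ τ ∈ Ioo u v ∧ h τ ≠ g τ}.ncard = N →
      R s ⟨n, hh.braid s'⟩ ⟨n, hg.braid s'⟩ := by
  have hfin : ∀ h : ℝ → ℝ, {τ | τ ∈ T ∧ τ ∈ Ioo u v ∧ h τ ≠ g τ}.Finite :=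
    fun h => T.finite_toSet.subset fun τ hτ => hτ.1
  have mem01 : ∀ {τ}, τ ∈ Icc u v → τ ∈ Icc (0 : ℝ) 1 := fun hτ =>
    ⟨hg.zero_le.trans hτ.1, hτ.2.trans hg.le_one⟩
  induction N with
  | zero =>
    intro h hh hP _ _ hN
    rw [Set.ncard_eq_zero (hfin h), Set.eq_empty_iff_forall_notMem] at hN
    have e : ∀ t ∈ Icc (0 : ℝ) 1, g t = h t := by
      intro t ht
      refine (hPg.eq hP hT.zero hT.one (fun τ h1 h2 => ?_) ht)
      by_contra h3
      by_cases h4 : τ ∈ Ioo u v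
      · exact hN τ ⟨h1, h4, fun h5 => h3 h5.symm⟩
      · exact h3 (by rw [hh.eq τ h2 h4, hg.eq τ h2 h4])
    refine R.of_same (fun i t ht => ?_) (fun i j t _ => rfl)
      fun hs => hh.classical (hadm hs).2 (hadm hs).1
    by_cases hi : i = c
    · subst hi; rw [hg.braid_x_self, hh.braid_x_self, e t ht]
    · rw [hg.braid_x_of_ne hi, hh.braid_x_of_ne hi]
  | succ N ih =>
    intro h hh hP gh virt hN
    have hne : {τ | τ ∈ T ∧ τ ∈ Ioo u v ∧ h τ ≠ g τ}.Nonempty := by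
      rw [← Set.ncard_pos (hfin h)]; omega
    obtain ⟨τ, hτ⟩ := hne
    have ⟨hτT, hτuv, hx⟩ := hτ
    obtain ⟨A, hAT, hAτ, huA, noA⟩ := exists_prev huT hτuv.1
    obtain ⟨B, hBT, hτB, hBv, noB⟩ := exists_next hvT hτuv.2
    have only : ∀ r ∈ T, r ∈ Ioo A B → r = τ := by
      intro r hr hr'
      rcases lt_trichotomy r τ with h0 | h0 | h0
      · exact absurd ⟨hr'.1, h0⟩ (noA r hr)
      · exact h0
      · exact absurd ⟨h0, hr'.2⟩ (noB r hr)
    have gen : ∀ r ∈ T, r ∈ Icc u v → ∀ k, k ≠ c → h r ≠ D.x k r := by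
      intro r hr hr' k hk
      by_cases hr'' : r ∈ Ioo u v
      · exact gh r hr hr'' k hk
      rw [hh.eq r (mem01 hr') hr'']
      rcases eq_or_lt_of_le hr'.1 with rfl | h1
      · exact gu k hk
      rcases eq_or_lt_of_le hr'.2 with rfl | h2
      · exact gv k hk
      exact absurd ⟨h1, h2⟩ hr''
    obtain ⟨h', v', P'⟩ := exists_interp T fun r => if r = τ then g τ else h r
    have h'τ : h' τ = g τ := by rw [v' τ hτT, if_pos rfl]
    have he : ∀ r ∈ T, r ≠ τ → h' r = h r := fun r hr hr' => by rw [v' r hr, if_neg hr']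
    obtain ⟨hh', hR⟩ := hh.vertex_move (s := s) (s' := s') (h' := h') hT hP hAT hτT hBT huA hAτ
      hτB hBv only (gen A hAT ⟨huA, hAτ.le.trans hτuv.2.le⟩)
      (gen B hBT ⟨hτuv.1.le.trans hτB.le, hBv⟩) (by rw [h'τ]; exact hmg τ hτT hτuv)
      (by rw [h'τ]; exact gg τ hτT hτuv)
      (fun k hk h0 => absurd h0 (gh τ hτT hτuv k hk))
      (fun hs j k hj hk hc h0 => by rw [h'τ]; exact virt hs j k τ hj hk hτuv hc h0)
      hadm (P' 0 hT.zero 1 hT.one) he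
    have hset : {r | r ∈ T ∧ r ∈ Ioo u v ∧ h' r ≠ g r} =
        {r | r ∈ T ∧ r ∈ Ioo u v ∧ h r ≠ g r} \ {τ} := by
      ext r
      simp only [mem_ofPred_eq, mem_sdiff, mem_singleton_iff]
      constructor
      · rintro ⟨h1, h2, h4⟩
        have hr : r ≠ τ := fun h0 => h4 (by rw [h0]; exact h'τ)
        exact ⟨⟨h1, h2, by rw [← he r h1 hr]; exact h4⟩, hr⟩
      · rintro ⟨⟨h1, h2, h4⟩, h5⟩
        exact ⟨h1, h2, by rw [he r h1 h5]; exact h4⟩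
    refine hR.trans (ih h' hh' (P' 0 hT.zero 1 hT.one) (fun r h1 h2 => ?_)
      (fun hs j k t hj hk ht hc h0 => ?_)
      (by rw [hset, Set.ncard_sdiff_singleton_of_mem hτ, hN]; rfl))
    · by_cases h0 : r = τ
      · subst h0; rw [h'τ]; exact gg r h1 h2
      · rw [he r h1 h0]; exact gh r h1 h2
    · have htT := hT.cross j k t hj hk hc
      by_cases h1 : t = τ
      · subst h1
        rw [h'τ, uIcc_self, mem_singleton_iff]
        exact fun h2 => gg t htT ht j hj h2.symm
      · rw [he t htT h1]
        exact virt hs j k t hj hk ht hc h0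

end Repl

variable {n : ℕ} {D D' : BraidDiagram n} {c : Fin n} {u v : ℝ} {s s' : SignType}

/-- The strand `c` is moved between the heights `u` and `v`, where all its crossings are of type
`s'` before and after the move. Unless `s' = 0`, no virtual crossing of other strands lies
horizontally between the old and the new arc. Nothing lies on the strand `c` at the heights `u` and
`v` themselves. -/
theorem arc_move_of_ne (hu : 0 ≤ u) (hv : v ≤ 1)
    (hx : ∀ j, j ≠ c → ∀ t ∈ Icc (0 : ℝ) 1, D'.x j t = D.x j t)
    (hc : ∀ t ∈ Icc (0 : ℝ) 1, t ∉ Ioo u v → D'.x c t = D.x c t)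
    (hs : ∀ j k t, j ≠ c → k ≠ c → D.Crosses j k t → D'.sign j k t = D.sign j k t)
    (hsc : ∀ k t, t ∉ Icc u v → D.Crosses c k t → D'.sign c k t = D.sign c k t)
    (ht : ∀ k t, t ∈ Icc u v → D.Crosses c k t → D.sign c k t = s')
    (ht' : ∀ k t, t ∈ Icc u v → D'.Crosses c k t → D'.sign c k t = s')
    (virt : s' ≠ 0 → ∀ j k t, j ≠ c → k ≠ c → t ∈ Ioo u v → D.Crosses j k t →
      D.sign j k t = 0 → D.x j t ∉ uIcc (D.x c t) (D'.x c t))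
    (hadm : s ≠ 0 → s' ≠ 0 ∧ D.IsClassical) (hr : D.Roomy) (hr' : D'.Roomy)
    (gu : ∀ k, k ≠ c → D.x c u ≠ D.x k u) (gv : ∀ k, k ≠ c → D.x c v ≠ D.x k v) :
    R s ⟨n, D⟩ ⟨n, D'⟩ := by
  classical
  have mem01 : ∀ {τ}, τ ∈ Ioo u v → τ ∈ Icc (0 : ℝ) 1 := fun hτ =>
    ⟨hu.trans hτ.1.le, hτ.2.le.trans hv⟩
  have hD : Repl D c u v (D.x c) := by
    refine ⟨?_, fun _ _ _ => rfl, hu, hv⟩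
    rw [Function.update_eq_self]
    exact D.fam
  have hD' : Repl D c u v (D'.x c) := by
    refine ⟨⟨fun i => ?_, fun i t ht₀ => ?_, fun t ht₀ => ?_⟩, hc, hu, hv⟩
    · by_cases hi : i = c
      · subst hi; rw [Function.update_self]; exact D'.fam.pl i
      · rw [Function.update_of_ne hi]; exact D.fam.pl i
    · by_cases hi : i = c
      · subst hi; rw [Function.update_self]; exact D'.fam.mem i t ht₀
      · rw [Function.update_of_ne hi]; exact D.fam.mem i t ht₀
    · have e : ∀ t ∈ Icc (0 : ℝ) 1, ∀ i, Function.update D.x c (D'.x c) i t = D'.x i t := by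
        intro t ht i
        by_cases hi : i = c
        · subst hi; rw [Function.update_self]
        · rw [Function.update_of_ne hi, hx i hi t ht]
      refine (D'.fam.good t ht₀).congr (e t ht₀) fun ht' i => ?_
      filter_upwards [isOpen_Ioo.mem_nhds ht'] with r hr using e r ⟨hr.1.le, hr.2.le⟩ i
  obtain ⟨T₁, hT₁⟩ := exists_isGrid D.toStrandDiagram
  obtain ⟨T₂, hT₂⟩ := exists_isGrid D'.toStrandDiagram
  set T₀ : Finset ℝ := (T₁ ∪ T₂) ∪ {u, v} with hT₀
  have sub₁ : T₁ ⊆ T₀ := fun r hr => by simp [hT₀, hr]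
  have sub₂ : T₂ ⊆ T₀ := fun r hr => by simp [hT₀, hr]
  -- between any two points of `T₀` there is a grid point off `T₀`, where nothing crosses
  have key : ∀ τ : ℝ, ∃ m, τ < m ∧ m < τ + 1 ∧ ∀ r ∈ T₀, r ∉ Ioc τ m := fun τ =>
    Ioo_disjoint_of_finite T₀ τ (by linarith)
  choose m hm1 _ hm3 using key
  set T : Finset ℝ := T₀ ∪ T₀.image m with hTdef
  have sub : T₀ ⊆ T := Finset.subset_union_left
  have huT : u ∈ T := sub (by simp [hT₀])
  have hvT : v ∈ T := sub (by simp [hT₀])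
  have hT : IsGridOff D c T :=
    ⟨sub (sub₁ hT₁.zero), sub (sub₁ hT₁.one), fun j _ => (hT₁.poly' j).mono (sub₁.trans sub),
      fun j k t _ _ hc => sub (sub₁ (hT₁.cross j k t hc))⟩
  have hP := (hT₁.poly' c).mono (sub₁.trans sub)
  have hP' := (hT₂.poly' c).mono (sub₂.trans sub)
  have sep : ∀ h : ℝ → ℝ,
      (∀ τ ∈ T, τ ∈ Icc (0 : ℝ) 1 → (∃ k, k ≠ c ∧ h τ = D.x k τ) → τ ∈ T₀) →
      ∀ τ ∈ T, τ ∈ Ioo u v → (∃ k, k ≠ c ∧ h τ = D.x k τ) → ∃ A ∈ T, ∃ B ∈ T, u ≤ A ∧ A < τ ∧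
        τ < B ∧ B ≤ v ∧ (∀ r ∈ T, r ∈ Ioo A B → r = τ) ∧ (∀ k, k ≠ c → h A ≠ D.x k A) ∧
        (∀ k, k ≠ c → h B ≠ D.x k B) := by
    intro h hh τ hτT hτ hk
    obtain ⟨A, hAT, hAτ, huA, noA⟩ := exists_prev huT hτ.1
    obtain ⟨B, hBT, hτB, hBv, noB⟩ := exists_next hvT hτ.2
    have hτ₀ := hh τ hτT (mem01 hτ) hk
    have inT : ∀ {r}, r ∈ T₀ → m r ∈ T := fun hr =>
      Finset.mem_union_right _ (Finset.mem_image_of_mem m hr)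
    refine ⟨A, hAT, B, hBT, huA, hAτ, hτB, hBv, fun r hr hr' => ?_, fun k hk h0 => ?_,
      fun k hk h0 => ?_⟩
    · rcases lt_trichotomy r τ with h0 | h0 | h0
      · exact absurd ⟨hr'.1, h0⟩ (noA r hr)
      · exact h0
      · exact absurd ⟨h0, hr'.2⟩ (noB r hr)
    · have hA₀ := hh A hAT ⟨hu.trans huA, by linarith [hτ.2]⟩ ⟨k, hk, h0⟩
      exact noA (m A) (inT hA₀) ⟨hm1 A, not_le.1 fun h1 => hm3 A τ hτ₀ ⟨hAτ, h1⟩⟩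
    · have hB₀ := hh B hBT ⟨by linarith [hτ.1], hBv.trans hv⟩ ⟨k, hk, h0⟩
      exact noB (m τ) (inT hτ₀) ⟨hm1 τ, not_le.1 fun h1 => hm3 τ B hB₀ ⟨hτB, h1⟩⟩
  -- the vertices of both arcs are moved off the other strands, then those of one arc to the other
  obtain ⟨g₁, hg₁, R₁, P₁, _, gen₁, side₁⟩ := Repl.perturb (s := s) (s' := s') hT hadm _ (D.x c) hD
    hP (fun τ _ h2 => hr c τ (mem01 h2)) (sep _ fun τ _ h2 ⟨k, hk, h0⟩ =>
      sub₁ (hT₁.cross c k τ (D.crosses_iff.2 ⟨hk.symm, h2, h0⟩))) rfl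
  obtain ⟨g₂, hg₂, R₂, P₂, m₂, gen₂, side₂⟩ := Repl.perturb (s := s) (s' := s') hT hadm _ (D'.x c)
    hD' hP' (fun τ _ h2 => hr' c τ (mem01 h2)) (sep _ fun τ _ h2 ⟨k, hk, h0⟩ =>
      sub₂ (hT₂.cross c k τ (D'.crosses_iff.2 ⟨hk.symm, h2, by rw [h0, hx k hk τ h2]⟩))) rfl
  have R₃ := Repl.connect (s := s) (s' := s') hT hadm huT hvT gu gv hg₂ P₂ m₂ gen₂ _ g₁ hg₁ P₁ gen₁
    (fun h0 j k t hj hk h1 hc h2 => by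
      have h3 := virt h0 j k t hj hk h1 hc h2
      have htT := hT.cross j k t hj hk hc
      have h4 := side₁ t htT h1 j hj fun h5 => h3 (by rw [← h5]; exact left_mem_uIcc)
      have h5 := side₂ t htT h1 j hj fun h5 => h3 (by rw [← h5]; exact right_mem_uIcc)
      have h6 := not_mem_uIcc_of_side h3 h5
      rw [uIcc_comm] at h6 ⊢
      exact not_mem_uIcc_of_side h6 h4) rfl
  have S₁ : R s ⟨n, hD.braid s'⟩ ⟨n, D⟩ := by
    refine R.of_same (fun i t ht => ?_) (fun i j t hcr => ?_)
      fun h0 => hD.classical (hadm h0).2 (hadm h0).1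
    · by_cases hi : i = c
      · subst hi; rw [hD.braid_x_self]
      · rw [hD.braid_x_of_ne hi]
    · have key : ∀ k, (hD.braid s').Crosses c k t →
          D.sign c k t = (hD.braid s').sign c k t := by
        intro k hcr
        have h1 := hD.crosses_self.1 hcr
        by_cases htuv : t ∈ Icc u v
        · rw [hD.sign_self h1.1 htuv]
          exact ht k t htuv (D.crosses_iff.2 ⟨h1.1.symm, h1.2⟩)
        · rw [hD.sign_eq (Or.inr htuv)]
      by_cases hi : i = c
      · subst hi; exact key j hcr
      by_cases hj : j = c
      · subst hj
        rw [D.sign_symm, (hD.braid s').sign_symm, key i hcr.symm]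
      rw [hD.sign_eq (Or.inl ⟨hi, hj⟩)]
  have S₂ : R s ⟨n, hD'.braid s'⟩ ⟨n, D'⟩ := by
    refine R.of_same (fun i t ht => ?_) (fun i j t hcr => ?_)
      fun h0 => hD'.classical (hadm h0).2 (hadm h0).1
    · by_cases hi : i = c
      · subst hi; rw [hD'.braid_x_self]
      · rw [hD'.braid_x_of_ne hi, hx i hi t ht]
    · have key : ∀ k, (hD'.braid s').Crosses c k t →
          D'.sign c k t = (hD'.braid s').sign c k t := by
        intro k hcr
        have h1 := hD'.crosses_self.1 hcr
        by_cases htuv : t ∈ Icc u v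
        · rw [hD'.sign_self h1.1 htuv]
          exact ht' k t htuv (D'.crosses_iff.2 ⟨h1.1.symm, h1.2.1, by rw [h1.2.2, hx k h1.1 t h1.2.1]⟩)
        · rw [hD'.sign_eq (Or.inr htuv)]
          refine hsc k t htuv (D.crosses_iff.2 ⟨h1.1.symm, h1.2.1, ?_⟩)
          rw [← hc t h1.2.1 fun h2 => htuv ⟨h2.1.le, h2.2.le⟩, h1.2.2]
      by_cases hi : i = c
      · subst hi; exact key j hcr
      by_cases hj : j = c
      · subst hj
        rw [D'.sign_symm, (hD'.braid s').sign_symm, key i hcr.symm]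
      rw [hD'.sign_eq (Or.inl ⟨hi, hj⟩)]
      exact hs i j t hi hj ((hD'.crosses_of_ne hi hj).1 hcr)
  exact S₁.symm.trans (R₁.trans (R₃.trans (R₂.symm.trans S₂)))

/-- The same as `arc_move_of_ne`, without the condition at the heights `u` and `v`. -/
theorem arc_move (hu : 0 ≤ u) (huv : u < v) (hv : v ≤ 1)
    (hx : ∀ j, j ≠ c → ∀ t ∈ Icc (0 : ℝ) 1, D'.x j t = D.x j t)
    (hc : ∀ t ∈ Icc (0 : ℝ) 1, t ∉ Ioo u v → D'.x c t = D.x c t)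
    (hs : ∀ j k t, j ≠ c → k ≠ c → D.Crosses j k t → D'.sign j k t = D.sign j k t)
    (hsc : ∀ k t, t ∉ Icc u v → D.Crosses c k t → D'.sign c k t = D.sign c k t)
    (ht : ∀ k t, t ∈ Icc u v → D.Crosses c k t → D.sign c k t = s')
    (ht' : ∀ k t, t ∈ Icc u v → D'.Crosses c k t → D'.sign c k t = s')
    (virt : s' ≠ 0 → ∀ j k t, j ≠ c → k ≠ c → t ∈ Ioo u v → D.Crosses j k t →
      D.sign j k t = 0 → D.x j t ∉ uIcc (D.x c t) (D'.x c t))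
    (hadm : s ≠ 0 → s' ≠ 0 ∧ D.IsClassical) (hr : D.Roomy) (hr' : D'.Roomy) :
    R s ⟨n, D⟩ ⟨n, D'⟩ := by
  classical
  obtain ⟨T, hT⟩ := exists_isGrid D.toStrandDiagram
  -- the interval is enlarged to one at whose ends nothing crosses
  have hL : ∃ u', 0 ≤ u' ∧ u' ≤ u ∧ ∀ k t, t ∈ Icc u' v → D.Crosses c k t → t ≠ u' ∧ u ≤ t := by
    rcases eq_or_lt_of_le hu with rfl | h0
    · exact ⟨0, le_rfl, le_rfl, fun k t h1 h2 => ⟨h2.inner.1.ne', h1.1⟩⟩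
    · obtain ⟨w, h1, h2, h3⟩ := Ioo_disjoint_of_finite' T u h0
      refine ⟨w, h1.le, h2.le, fun k t h4 h5 => ?_⟩
      have := h3 t (hT.cross c k t h5)
      have h6 : u ≤ t := not_lt.1 fun h => this ⟨h4.1, h⟩
      exact ⟨by linarith, h6⟩
  have hR : ∃ v', v' ≤ 1 ∧ v ≤ v' ∧ ∀ k t, t ∈ Icc u v' → D.Crosses c k t → t ≠ v' ∧ t ≤ v := by
    rcases eq_or_lt_of_le hv with rfl | h0
    · exact ⟨1, le_rfl, le_rfl, fun k t h1 h2 => ⟨h2.inner.2.ne, h1.2⟩⟩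
    · obtain ⟨w, h1, h2, h3⟩ := Ioo_disjoint_of_finite T v h0
      refine ⟨w, h2.le, h1.le, fun k t h4 h5 => ?_⟩
      have := h3 t (hT.cross c k t h5)
      have h6 : t ≤ v := not_lt.1 fun h => this ⟨h, h4.2⟩
      exact ⟨by linarith, h6⟩
  obtain ⟨u', hu0, huu, hL⟩ := hL
  obtain ⟨v', hv1, hvv, hR⟩ := hR
  have both : ∀ k t, t ∈ Icc u' v' → D.Crosses c k t → t ≠ u' ∧ t ≠ v' ∧ t ∈ Icc u v := by
    intro k t h1 h2
    rcases le_total t v with h3 | h3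
    · have a1 := hL k t ⟨h1.1, h3⟩ h2
      have a2 := hR k t ⟨a1.2, h1.2⟩ h2
      exact ⟨a1.1, a2.1, a1.2, h3⟩
    · have a2 := hR k t ⟨by linarith, h1.2⟩ h2
      have a1 := hL k t ⟨h1.1, a2.2⟩ h2
      exact ⟨a1.1, a2.1, a1.2, a2.2⟩
  have off : ∀ t ∈ Icc (0 : ℝ) 1, t ∉ Icc u v → ∀ k, D'.Crosses c k t → D.Crosses c k t := by
    intro t h1 h2 k h3
    rw [D'.crosses_iff] at h3
    refine D.crosses_iff.2 ⟨h3.1, h3.2.1, ?_⟩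
    rw [← hx k h3.1.symm t h1, ← hc t h1 fun h4 => h2 ⟨h4.1.le, h4.2.le⟩, h3.2.2]
  refine arc_move_of_ne (c := c) hu0 hv1 hx
    (fun t h1 h2 => hc t h1 fun h3 => h2 ⟨by linarith [h3.1], by linarith [h3.2]⟩) hs
    (fun k t h1 => hsc k t fun h3 => h1 ⟨by linarith [h3.1], by linarith [h3.2]⟩)
    (fun k t h1 h2 => ht k t (both k t h1 h2).2.2 h2) (fun k t h1 h2 => ?_)
    (fun h0 j k t hj hk h1 h2 h3 => ?_) hadm hr hr' (fun k hk h1 => ?_) (fun k hk h1 => ?_)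
  · by_cases h3 : t ∈ Icc u v
    · exact ht' k t h3 h2
    · exact absurd (both k t h1 (off t (D'.crosses_iff.1 h2).2.1 h3 k h2)).2.2 h3
  · by_cases h4 : t ∈ Ioo u v
    · exact virt h0 j k t hj hk h4 h2 h3
    · have h2' := D.crosses_iff.1 h2
      rw [hc t h2'.2.1 h4, uIcc_self, mem_singleton_iff]
      intro h5
      exact h2'.1 ((D.fam.good t h2'.2.1).double c j k hj.symm hk.symm h5.symm
        (by rw [← h5, h2'.2.2]))
  · exact (both k u' ⟨le_rfl, by linarith⟩
      (D.crosses_iff.2 ⟨hk.symm, ⟨hu0, by linarith⟩, h1⟩)).1 rfl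
  · exact (both k v' ⟨by linarith, le_rfl⟩
      (D.crosses_iff.2 ⟨hk.symm, ⟨by linarith, hv1⟩, h1⟩)).2.1 rfl

end Braidoids

namespace Braidoids
open Set

/-! ### Closures -/

/-- A braidoid diagram whose ends lie at arbitrary positions of the top and the bottom line,
vertically aligned in pairs. -/
structure OpenBraid (m : ℕ) extends StrandDiagram m where
  leg : Fin m
  head : Fin m
  a_eq : ∀ i, i ≠ leg → a i = 0
  b_eq : ∀ i, i ≠ head → b i = 1
  leg_pos : 0 < a leg
  head_lt : b head < 1
  aligned : ∀ y, (∃ i, i ≠ head ∧ x i 1 = y) ↔ ∃ j, j ≠ leg ∧ x j 0 = y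

namespace OpenBraid

variable {m n : ℕ}

/-- The height of the leg. -/
abbrev p (B : OpenBraid m) : ℝ := B.a B.leg

/-- The height of the head. -/
abbrev q (B : OpenBraid m) : ℝ := B.b B.head

/-- All strands stay in the interior of the square, horizontally. -/
def Roomy (B : OpenBraid m) : Prop := ∀ i, ∀ t ∈ Icc (B.a i) (B.b i), B.x i t ∈ Ioo (0 : ℝ) 1

theorem p_lt_one (B : OpenBraid m) : B.p < 1 := (B.a_lt_b _).trans_le (B.b_le_one _)

theorem q_pos (B : OpenBraid m) : 0 < B.q := (B.a_nonneg _).trans_lt (B.a_lt_b _)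

/-- The map `f` from the strands of `B` to the strands of a closure of `B` identifies precisely the
strands of the leg and the head, and these only if the head is higher than the leg. -/
structure Lab (B : OpenBraid m) (f : Fin m → Fin n) : Prop where
  surj : Function.Surjective f
  ker : ∀ i j, f i = f j ↔
    i = j ∨ (B.q < B.p ∧ ((i = B.leg ∧ j = B.head) ∨ (i = B.head ∧ j = B.leg)))

/-- The height `t` on the strand `c` of a closure of `B` belongs to an added arc. -/
def New (B : OpenBraid m) (f : Fin m → Fin n) (c : Fin n) (t : ℝ) : Prop :=
  ∀ i, f i = c → t ∉ Icc (B.a i) (B.b i)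

end OpenBraid

open OpenBraid

/-- `D` is a closure of `B`, with added arcs of type `s`. In contrast with `IsClosureVia`, the new
ends (if the leg is not lower than the head) may lie anywhere. -/
structure Clos {m n : ℕ} (s : SignType) (B : OpenBraid m) (D : BraidDiagram n)
    (f : Fin m → Fin n) : Prop where
  lab : B.Lab f
  ends : B.p ≤ B.q → D.x (f B.leg) 0 = D.x (f B.head) 1
  x_eq : ∀ i, ∀ t ∈ Icc (B.a i) (B.b i), D.x (f i) t = B.x i t
  sign_eq : ∀ i j t, B.Crosses i j t → D.sign (f i) (f j) t = B.sign i j t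
  sign_new : ∀ c j t, D.Crosses c j t → B.New f c t → D.sign c j t = s

namespace OpenBraid

variable {m n : ℕ} {B : OpenBraid m} {f : Fin m → Fin n}

theorem Lab.old_unique (hf : B.Lab f) {i j : Fin m} {t : ℝ} (hi : t ∈ Icc (B.a i) (B.b i))
    (hj : t ∈ Icc (B.a j) (B.b j)) (h : f i = f j) : i = j := by
  rcases (hf.ker i j).1 h with h | ⟨h1, ⟨rfl, rfl⟩ | ⟨rfl, rfl⟩⟩
  · exact h
  · linarith [hi.1, hj.2]
  · linarith [hj.1, hi.2]

theorem Lab.inj (hf : B.Lab f) (h : B.p ≤ B.q) : Function.Injective f := fun i j hij => by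
  rcases (hf.ker i j).1 hij with h' | ⟨h', -⟩
  · exact h'
  · linarith

theorem Lab.joined (hf : B.Lab f) (h : B.q < B.p) : f B.leg = f B.head :=
  (hf.ker _ _).2 (Or.inr ⟨h, Or.inl ⟨rfl, rfl⟩⟩)

theorem Lab.new_cases (hf : B.Lab f) {c : Fin n} {t : ℝ} (ht : t ∈ Icc (0 : ℝ) 1)
    (hn : B.New f c t) : (c = f B.leg ∧ t < B.p ∧ (B.q < B.p → B.q < t)) ∨
      (c = f B.head ∧ B.q < t ∧ (B.q < B.p → t < B.p)) := by
  have hleg : c = f B.leg → B.leg ≠ B.head → t < B.p := fun h h' => by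
    by_contra h1
    exact hn B.leg h.symm ⟨not_lt.1 h1, by rw [B.b_eq _ h']; exact ht.2⟩
  have hhead : c = f B.head → B.leg ≠ B.head → B.q < t := fun h h' => by
    by_contra h1
    exact hn B.head h.symm ⟨by rw [B.a_eq _ h'.symm]; exact ht.1, not_lt.1 h1⟩
  obtain ⟨i, rfl⟩ := hf.surj c
  by_cases h : B.leg = B.head
  · by_cases hi : i = B.leg
    · subst hi
      have h2 : B.p < B.q := by rw [q, ← h]; exact B.a_lt_b _
      have h1 := hn B.leg rfl
      rw [mem_Icc, not_and_or, not_le, not_le] at h1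
      rcases h1 with h1 | h1
      · exact Or.inl ⟨rfl, h1, fun h3 => absurd h3 (not_lt.2 h2.le)⟩
      · exact Or.inr ⟨by rw [← h], by rw [q, ← h]; exact h1,
          fun h3 => absurd h3 (not_lt.2 h2.le)⟩
    · exact absurd ht (by
        have := hn i rfl
        rwa [B.a_eq i hi, B.b_eq i (by rw [← h]; exact hi)] at this)
  · by_cases hi : i = B.leg
    · subst hi
      refine Or.inl ⟨rfl, hleg rfl h, fun h1 => hhead ?_ h⟩
      exact hf.joined h1
    by_cases hi' : i = B.head
    · subst hi'
      refine Or.inr ⟨rfl, hhead rfl h, fun h1 => hleg ?_ h⟩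
      exact (hf.joined h1).symm
    · exact absurd ht (by
        have := hn i rfl
        rwa [B.a_eq i hi, B.b_eq i hi'] at this)

theorem Lab.new_unique (hf : B.Lab f) {c c' : Fin n} {t : ℝ} (ht : t ∈ Icc (0 : ℝ) 1)
    (hn : B.New f c t) (hn' : B.New f c' t) : c = c' := by
  rcases lt_or_ge B.q B.p with h | h
  · have e := hf.joined h
    rcases hf.new_cases ht hn with ⟨h1, -⟩ | ⟨h1, -⟩ <;>
      rcases hf.new_cases ht hn' with ⟨h2, -⟩ | ⟨h2, -⟩ <;> simp [h1, h2, e]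
  · rcases hf.new_cases ht hn with ⟨h1, h3, -⟩ | ⟨h1, h3, -⟩ <;>
      rcases hf.new_cases ht hn' with ⟨h2, h4, -⟩ | ⟨h2, h4, -⟩
    · rw [h1, h2]
    · linarith
    · linarith
    · rw [h1, h2]

theorem Lab.new_of_lt (hf : B.Lab f) {t : ℝ} (h1 : t < B.p) (h2 : B.q < B.p → B.q < t) :
    B.New f (f B.leg) t := by
  intro i hi ht
  rcases (hf.ker i B.leg).1 hi with rfl | ⟨h, ⟨rfl, -⟩ | ⟨rfl, -⟩⟩
  · linarith [ht.1]
  · linarith [ht.1]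
  · linarith [ht.2, h2 h]

theorem Lab.new_of_gt (hf : B.Lab f) {t : ℝ} (h1 : B.q < t) (h2 : B.q < B.p → t < B.p) :
    B.New f (f B.head) t := by
  intro i hi ht
  rcases (hf.ker i B.head).1 hi with rfl | ⟨h, ⟨rfl, -⟩ | ⟨rfl, -⟩⟩
  · linarith [ht.2]
  · linarith [ht.1, h2 h]
  · linarith [ht.2]

theorem not_new {i : Fin m} {t : ℝ} (ht : t ∈ Icc (B.a i) (B.b i)) :
    ¬ B.New f (f i) t := fun h => h i rfl ht

theorem sub_unit (B : OpenBraid m) {i : Fin m} {t : ℝ} (ht : t ∈ Icc (B.a i) (B.b i)) :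
    t ∈ Icc (0 : ℝ) 1 := ⟨(B.a_nonneg i).trans ht.1, ht.2.trans (B.b_le_one i)⟩

open Classical in
/-- The strands of the closure of `B` with the arcs `Y`. -/
noncomputable def glueX (B : OpenBraid m) (f : Fin m → Fin n) (Y : Fin n → ℝ → ℝ) (c : Fin n)
    (t : ℝ) : ℝ :=
  if h : ∃ i, f i = c ∧ t ∈ Icc (B.a i) (B.b i) then B.x h.choose t else Y c t

open Classical in
/-- The crossing data of `B`, as those of the corresponding strands of a closure. -/
noncomputable def glueSign (B : OpenBraid m) (f : Fin m → Fin n) (c c' : Fin n) (t : ℝ) :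
    SignType :=
  if h : (∃ i, f i = c ∧ t ∈ Icc (B.a i) (B.b i)) ∧ ∃ i, f i = c' ∧ t ∈ Icc (B.a i) (B.b i) then
    B.sign h.1.choose h.2.choose t else 0

theorem glueSign_symm (c c' : Fin n) (t : ℝ) :
    B.glueSign f c' c t = -B.glueSign f c c' t := by
  unfold glueSign
  by_cases h : (∃ i, f i = c ∧ t ∈ Icc (B.a i) (B.b i)) ∧ ∃ i, f i = c' ∧ t ∈ Icc (B.a i) (B.b i)
  · rw [dif_pos h, dif_pos h.symm, B.sign_symm]
  · rw [dif_neg h, dif_neg fun h' => h h'.symm, neg_zero]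

variable {Y : Fin n → ℝ → ℝ}

theorem Lab.glueX_old (hf : B.Lab f) {i : Fin m} {t : ℝ} (ht : t ∈ Icc (B.a i) (B.b i)) :
    B.glueX f Y (f i) t = B.x i t := by
  have h : ∃ j, f j = f i ∧ t ∈ Icc (B.a j) (B.b j) := ⟨i, rfl, ht⟩
  rw [glueX, dif_pos h, hf.old_unique h.choose_spec.2 ht h.choose_spec.1]

theorem Lab.glueSign_old (hf : B.Lab f) {i j : Fin m} {t : ℝ} (ht : t ∈ Icc (B.a i) (B.b i))
    (ht' : t ∈ Icc (B.a j) (B.b j)) : B.glueSign f (f i) (f j) t = B.sign i j t := by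
  have h : (∃ k, f k = f i ∧ t ∈ Icc (B.a k) (B.b k)) ∧
    ∃ k, f k = f j ∧ t ∈ Icc (B.a k) (B.b k) := ⟨⟨i, rfl, ht⟩, ⟨j, rfl, ht'⟩⟩
  rw [glueSign, dif_pos h, hf.old_unique h.1.choose_spec.2 ht h.1.choose_spec.1,
    hf.old_unique h.2.choose_spec.2 ht' h.2.choose_spec.1]

theorem glueX_new {c : Fin n} {t : ℝ} (h : B.New f c t) : B.glueX f Y c t = Y c t := by
  rw [glueX, dif_neg]
  rintro ⟨i, h1, h2⟩
  exact h i h1 h2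

/-- The arcs `Y` can be added to `B`. -/
structure ArcsOK (B : OpenBraid m) (f : Fin m → Fin n) (Y : Fin n → ℝ → ℝ) : Prop where
  pl : ∀ c, PiecewiseLinear (Y c) 0 1
  mem : ∀ c, ∀ t ∈ Icc (0 : ℝ) 1, B.New f c t → Y c t ∈ Icc (0 : ℝ) 1
  legJ : Y (f B.leg) B.p = B.x B.leg B.p
  headJ : Y (f B.head) B.q = B.x B.head B.q
  cross : ∀ c i t, t ∈ Icc (0 : ℝ) 1 → B.New f c t → f i ≠ c → t ∈ Icc (B.a i) (B.b i) →
    Y c t = B.x i t → t ∈ Ioo (B.a i) (B.b i) ∧ TransAt (fun r => Y c r - B.x i r) t ∧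
      ∀ k, t ∈ Icc (B.a k) (B.b k) → B.x k t = B.x i t → k = i
  ends : B.p ≤ B.q → Y (f B.leg) 0 = Y (f B.head) 1

theorem new_eventually {c : Fin n} {t : ℝ} (h : B.New f c t) :
    ∀ᶠ r in nhds t, B.New f c r := by
  refine Filter.eventually_all.2 fun i => ?_
  by_cases hi : f i = c
  · filter_upwards [isClosed_Icc.isOpen_compl.mem_nhds (h i hi)] with r hr _ using hr
  · exact Filter.Eventually.of_forall fun r h' => absurd h' hi

theorem Lab.glue_poly (hf : B.Lab f) {T : Finset ℝ} (hT : IsGrid B.toStrandDiagram T)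
    (legJ : Y (f B.leg) B.p = B.x B.leg B.p) (headJ : Y (f B.head) B.q = B.x B.head B.q)
    {c : Fin n} (hY : PolyOn T (Y c) 0 1) : PolyOn T (B.glueX f Y c) 0 1 := by
  intro s u hs hsu hu hr1
  by_cases hold : ∃ i, f i = c ∧ B.a i ≤ s ∧ u ≤ B.b i
  · obtain ⟨i, rfl, h1, h2⟩ := hold
    exact (hT.poly i s u h1 hsu h2 hr1).congr fun t ht =>
      hf.glueX_old ⟨h1.trans ht.1, ht.2.trans h2⟩
  · push Not at hold
    refine (hY s u hs hsu hu hr1).congr fun t ht => ?_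
    by_cases hn : B.New f c t
    · exact glueX_new hn
    unfold New at hn
    push Not at hn
    obtain ⟨i, rfl, hi⟩ := hn
    rw [hf.glueX_old hi]
    have ha := hr1 _ (hT.a_mem i)
    have hb := hr1 _ (hT.b_mem i)
    rcases le_or_gt (B.a i) s with h1 | h1
    · have h2 := hold i rfl h1
      have h3 : B.b i ≤ s := not_lt.1 fun h3 => hb ⟨h3, h2⟩
      obtain rfl : t = B.b i := le_antisymm hi.2 (h3.trans ht.1)
      have : i = B.head := by
        by_contra h4
        have := B.b_eq i h4
        linarith
      subst this
      exact headJ.symm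
    · have h3 : u ≤ B.a i := not_lt.1 fun h3 => ha ⟨h1, h3⟩
      obtain rfl : t = B.a i := le_antisymm (ht.2.trans h3) hi.1
      have : i = B.leg := by
        by_contra h4
        have := B.a_eq i h4
        linarith
      subst this
      exact legJ.symm

theorem ArcsOK.glue_pl (hf : B.Lab f) (hY : ArcsOK B f Y) (c : Fin n) :
    PiecewiseLinear (B.glueX f Y c) 0 1 := by
  classical
  obtain ⟨T, hT⟩ := exists_isGrid B.toStrandDiagram
  obtain ⟨S, hS⟩ := hY.pl c
  exact (hf.glue_poly (hT.mono Finset.subset_union_left) hY.legJ hY.headJ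
    (PolyOn.mono hS Finset.subset_union_right)).pl

theorem ArcsOK.glue_fam (hf : B.Lab f) (hY : ArcsOK B f Y) : Fam (B.glueX f Y) := by
  have old : ∀ {c t}, ¬ B.New f c t → ∃ i, f i = c ∧ t ∈ Icc (B.a i) (B.b i) := fun h => by
    unfold New at h; push Not at h; exact h
  refine ⟨hY.glue_pl hf, fun c t ht => ?_, fun t ht => ?_⟩
  · by_cases hn : B.New f c t
    · rw [glueX_new hn]; exact hY.mem c t ht hn
    · obtain ⟨i, rfl, hi⟩ := old hn
      rw [hf.glueX_old hi]; exact B.x_mem i t hi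
  -- the three cases of a crossing: of two old strands, or of an old strand with a new arc
  have mixed : ∀ c i, B.New f c t → f i ≠ c → t ∈ Icc (B.a i) (B.b i) → Y c t = B.x i t →
      t ∈ Ioo (0 : ℝ) 1 ∧
        TransAt (fun r => B.glueX f Y c r - B.glueX f Y (f i) r) t := by
    intro c i hn hic hi hx
    obtain ⟨h1, h2, -⟩ := hY.cross c i t ht hn hic hi hx
    refine ⟨⟨(B.a_nonneg i).trans_lt h1.1, h1.2.trans_le (B.b_le_one i)⟩, h2.congr ?_⟩
    filter_upwards [new_eventually hn, isOpen_Ioo.mem_nhds h1] with r h3 h4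
    rw [glueX_new h3, hf.glueX_old ⟨h4.1.le, h4.2.le⟩]
  have olds : ∀ i j, i ≠ j → t ∈ Icc (B.a i) (B.b i) → t ∈ Icc (B.a j) (B.b j) →
      B.x i t = B.x j t → t ∈ Ioo (0 : ℝ) 1 ∧
        TransAt (fun r => B.glueX f Y (f i) r - B.glueX f Y (f j) r) t := by
    intro i j hij hi hj hx
    have h1 := B.interior i j t hij hi hj hx
    have h2 := B.interior j i t hij.symm hj hi hx.symm
    refine ⟨⟨(B.a_nonneg i).trans_lt h1.1, h1.2.trans_le (B.b_le_one i)⟩, ?_⟩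
    have : TransAt (fun r => B.x i r - B.x j r) t := B.transversal i j t hij hi hj hx
    refine this.congr ?_
    filter_upwards [isOpen_Ioo.mem_nhds h1, isOpen_Ioo.mem_nhds h2] with r h3 h4
    rw [hf.glueX_old ⟨h3.1.le, h3.2.le⟩, hf.glueX_old ⟨h4.1.le, h4.2.le⟩]
  have main : ∀ c c', c ≠ c' → B.glueX f Y c t = B.glueX f Y c' t → t ∈ Ioo (0 : ℝ) 1 ∧
        TransAt (fun r => B.glueX f Y c r - B.glueX f Y c' r) t := by
    intro c c' hcc hx
    by_cases hn : B.New f c t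
    · obtain ⟨i, rfl, hi⟩ := old fun hn' => hcc (hf.new_unique ht hn hn')
      rw [glueX_new hn, hf.glueX_old hi] at hx
      exact mixed c i hn hcc.symm hi hx
    obtain ⟨i, rfl, hi⟩ := old hn
    by_cases hn' : B.New f c' t
    · rw [glueX_new hn', hf.glueX_old hi] at hx
      obtain ⟨h1, h2⟩ := mixed c' i hn' hcc hi hx.symm
      exact ⟨h1, h2.swap⟩
    obtain ⟨j, rfl, hj⟩ := old hn'
    rw [hf.glueX_old hi, hf.glueX_old hj] at hx
    exact olds i j (fun h => hcc (h ▸ rfl)) hi hj hx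
  refine ⟨fun c c' h1 h2 => (main c c' h1 h2).1, fun c c' h1 h2 => (main c c' h1 h2).2,
    fun c c₁ c₂ h1 h2 hx1 hx2 => ?_⟩
  by_contra h3
  by_cases hn : B.New f c t
  · obtain ⟨i, rfl, hi⟩ := old fun hn' => h1 (hf.new_unique ht hn hn')
    obtain ⟨j, rfl, hj⟩ := old fun hn' => h2 (hf.new_unique ht hn hn')
    rw [glueX_new hn, hf.glueX_old hi] at hx1
    rw [glueX_new hn, hf.glueX_old hj] at hx2
    exact h3 (by rw [(hY.cross c j t ht hn h2.symm hj hx2).2.2 i hi (by rw [← hx1, hx2])])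
  obtain ⟨k, rfl, hk⟩ := old hn
  rw [hf.glueX_old hk] at hx1 hx2
  by_cases hn1 : B.New f c₁ t
  · obtain ⟨j, rfl, hj⟩ := old fun hn' => h3 (hf.new_unique ht hn1 hn')
    rw [glueX_new hn1] at hx1
    rw [hf.glueX_old hj] at hx2
    exact h2 (by rw [(hY.cross c₁ k t ht hn1 h1 hk hx1.symm).2.2 j hj hx2.symm])
  obtain ⟨i, rfl, hi⟩ := old hn1
  rw [hf.glueX_old hi] at hx1
  by_cases hn2 : B.New f c₂ t
  · rw [glueX_new hn2] at hx2
    exact h1 (by rw [(hY.cross c₂ k t ht hn2 h2 hk hx2.symm).2.2 i hi hx1.symm])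
  obtain ⟨j, rfl, hj⟩ := old hn2
  rw [hf.glueX_old hj] at hx2
  exact h3 (by rw [B.double k i j t (fun h => h1 (h ▸ rfl)) (fun h => h2 (h ▸ rfl)) hk hi hj hx1 hx2])

theorem new_zero (hf : B.Lab f) (h : B.p ≤ B.q) : B.New f (f B.leg) 0 :=
  hf.new_of_lt B.leg_pos fun h' => absurd h' (not_lt.2 h)

theorem new_one (hf : B.Lab f) (h : B.p ≤ B.q) : B.New f (f B.head) 1 :=
  hf.new_of_gt B.head_lt fun h' => absurd h' (not_lt.2 h)

/-- The closure of `B` with the arcs `Y`, of type `s`. -/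
noncomputable def glue (hf : B.Lab f) (hY : ArcsOK B f Y) (s : SignType) : BraidDiagram n :=
  (hY.glue_fam hf).braid (Fin.pos (f B.leg))
    (fun c => by
      have key : ∀ i, i ≠ B.head → ∃ j, B.glueX f Y (f i) 1 = B.glueX f Y j 0 := by
        intro i hi
        obtain ⟨j, hj, hx⟩ := (B.aligned (B.x i 1)).1 ⟨i, hi, rfl⟩
        refine ⟨f j, ?_⟩
        rw [hf.glueX_old ⟨(B.a_lt_b i).le.trans (B.b_le_one i), (B.b_eq i hi).ge⟩,
          hf.glueX_old ⟨(B.a_eq j hj).le, (B.a_nonneg j).trans (B.a_lt_b j).le⟩, hx]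
      obtain ⟨i, rfl⟩ := hf.surj c
      by_cases hi : i = B.head
      · subst hi
        rcases lt_or_ge B.q B.p with h | h
        · rw [← hf.joined h]
          refine key _ fun h' => ?_
          have := B.a_lt_b B.leg
          unfold p q at h
          rw [← h'] at h
          linarith
        · refine ⟨f B.leg, ?_⟩
          rw [glueX_new (new_zero hf h), glueX_new (new_one hf h), hY.ends h]
      · exact key i hi)
    (overlay (B.New f) s (B.glueSign f)) (overlay_symm glueSign_symm)

theorem glue_x (hf : B.Lab f) (hY : ArcsOK B f Y) (s : SignType) :
    (glue hf hY s).x = B.glueX f Y := rfl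

theorem glue_sign (hf : B.Lab f) (hY : ArcsOK B f Y) (s : SignType) :
    (glue hf hY s).sign = overlay (B.New f) s (B.glueSign f) := rfl

theorem glue_clos (hf : B.Lab f) (hY : ArcsOK B f Y) (s : SignType) :
    Clos s B (glue hf hY s) f where
  lab := hf
  ends h := by
    rw [glue_x, glueX_new (new_zero hf h), glueX_new (new_one hf h), hY.ends h]
  x_eq i t ht := by rw [glue_x, hf.glueX_old ht]
  sign_eq i j t hc := by
    rw [glue_sign, overlay_base (not_new (f := f) hc.2.1) (not_new (f := f) hc.2.2.1),
      hf.glueSign_old hc.2.1 hc.2.2.1]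
  sign_new c j t hc hn := by
    rw [BraidDiagram.crosses_iff] at hc
    rw [glue_sign, overlay_left hn fun h => hc.1 (hf.new_unique hc.2.1 hn h)]

/-- Polygonal arcs can be added if their vertices, at the heights of a grid, do not lie on the
strands of `B`. -/
theorem ArcsOK.of_poly {T : Finset ℝ} (hT : IsGrid B.toStrandDiagram T)
    (hP : ∀ c, PolyOn T (Y c) 0 1)
    (mem : ∀ c, ∀ t ∈ Icc (0 : ℝ) 1, B.New f c t → Y c t ∈ Icc (0 : ℝ) 1)
    (legJ : Y (f B.leg) B.p = B.x B.leg B.p) (headJ : Y (f B.head) B.q = B.x B.head B.q)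
    (off : ∀ c i, ∀ τ ∈ T, τ ∈ Icc (0 : ℝ) 1 → B.New f c τ → f i ≠ c →
      τ ∈ Icc (B.a i) (B.b i) → Y c τ ≠ B.x i τ)
    (ends : B.p ≤ B.q → Y (f B.leg) 0 = Y (f B.head) 1) : ArcsOK B f Y := by
  refine ⟨fun c => (hP c).pl, mem, legJ, headJ, fun c i t ht hn hic hi hx => ?_, ends⟩
  have htT : t ∉ T := fun h => off c i t h ht hn hic hi hx
  obtain ⟨τ, hτ, τ', hτ', h1, h2, h3, h4, h5⟩ := exists_cell hT.zero hT.one ht htT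
  have ha : B.a i ≤ τ := not_lt.1 fun h => by
    refine h5 _ (hT.a_mem i) ⟨h, lt_of_le_of_lt hi.1 h3⟩
  have hb : τ' ≤ B.b i := not_lt.1 fun h => by
    refine h5 _ (hT.b_mem i) ⟨lt_of_lt_of_le h2 hi.2, h⟩
  refine ⟨⟨by linarith, by linarith⟩, ?_, fun k hk hx' => ?_⟩
  · refine ((hP c τ τ' h1 (h2.trans h3) h4 h5).sub
      (hT.poly i τ τ' ha (h2.trans h3) hb h5)).transAt ⟨h2, h3⟩ (sub_eq_zero.2 hx) (Or.inl ?_)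
    rw [sub_ne_zero]
    have hτ01 : τ ∈ Icc (0 : ℝ) 1 := ⟨h1, by linarith⟩
    by_cases hnτ : B.New f c τ
    · exact off c i τ hτ hτ01 hnτ hic ⟨ha, by linarith⟩
    -- a grid point before a new arc that is not on it is the head
    · unfold New at hnτ
      push Not at hnτ
      obtain ⟨j, rfl, hj⟩ := hnτ
      have hlt : B.b j < t := not_le.1 fun h => hn j rfl ⟨by linarith [hj.1], h⟩
      have hjτ : B.b j = τ := le_antisymm
        (not_lt.1 fun h => h5 _ (hT.b_mem j) ⟨h, by linarith⟩) hj.2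
      have : j = B.head := by
        by_contra h4'
        have := B.b_eq j h4'
        linarith [ht.2]
      subst this
      rw [← hjτ]
      change Y (f B.head) B.q ≠ B.x i B.q
      rw [headJ]
      intro h6
      have hij : B.head ≠ i := fun h => hic (h ▸ rfl)
      have := B.interior B.head i B.q hij ⟨(B.a_lt_b _).le, le_rfl⟩
        ⟨by rw [← hjτ] at ha; exact ha, by linarith [hb, hjτ]⟩ h6
      exact lt_irrefl _ this.2
  · by_contra hne
    exact htT (hT.cross k i t ⟨hne, hk, hi, hx'⟩)

end OpenBraid

end Braidoids

namespace Braidoids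
open Set

namespace OpenBraid

variable {m n n' : ℕ} {B : OpenBraid m} {f : Fin m → Fin n} {s : SignType}

theorem exists_lab (B : OpenBraid m) : ∃ (n : ℕ) (f : Fin m → Fin n), B.Lab f := by
  classical
  let r : Setoid (Fin m) := ⟨fun i j => i = j ∨
    (B.q < B.p ∧ ((i = B.leg ∧ j = B.head) ∨ (i = B.head ∧ j = B.leg))),
    ⟨fun i => Or.inl rfl, fun h => by
      rcases h with h | ⟨h, h' | h'⟩
      · exact Or.inl h.symm
      · exact Or.inr ⟨h, Or.inr h'.symm⟩
      · exact Or.inr ⟨h, Or.inl h'.symm⟩, fun h h' => by grind⟩⟩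
  refine ⟨Fintype.card (Quotient r), fun i => Fintype.equivFin _ (Quotient.mk r i), ?_,
    fun i j => ?_⟩
  · exact (Fintype.equivFin _).surjective.comp Quotient.mk_surjective
  · rw [EmbeddingLike.apply_eq_iff_eq]
    exact Quotient.eq

theorem Lab.exists_equiv {f' : Fin m → Fin n'} (hf : B.Lab f) (hf' : B.Lab f') :
    ∃ e : Fin n ≃ Fin n', ∀ i, f' i = e (f i) := by
  have key : ∀ i j, f i = f j ↔ f' i = f' j := fun i j => by rw [hf.ker, hf'.ker]
  have hg : ∀ i, f' (Function.surjInv hf.surj (f i)) = f' i := fun i =>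
    (key _ _).1 (Function.surjInv_eq hf.surj (f i))
  refine ⟨Equiv.ofBijective (fun c => f' (Function.surjInv hf.surj c)) ⟨fun c c' h => ?_,
    fun c => ?_⟩, fun i => (hg i).symm⟩
  · have := (key _ _).2 h
    rwa [Function.surjInv_eq hf.surj c, Function.surjInv_eq hf.surj c'] at this
  · obtain ⟨i, rfl⟩ := hf'.surj c
    exact ⟨f i, hg i⟩

end OpenBraid

open OpenBraid

section

variable {m n : ℕ} {B : OpenBraid m} {f : Fin m → Fin n} {s : SignType} {D D' : BraidDiagram n}

theorem OpenBraid.exists_old {c : Fin n} {t : ℝ} (h : ¬ B.New f c t) :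
    ∃ i, f i = c ∧ t ∈ Icc (B.a i) (B.b i) := by
  unfold New at h; push Not at h; exact h

theorem Clos.relabel (h : Clos s B D f) (σ : Equiv.Perm (Fin n)) :
    Clos s B (D.relabel σ) (fun i => σ.symm (f i)) where
  lab := ⟨σ.symm.surjective.comp h.lab.surj, fun i j => by
    rw [EmbeddingLike.apply_eq_iff_eq, h.lab.ker]⟩
  ends h' := by
    change D.x (σ (σ.symm _)) 0 = D.x (σ (σ.symm _)) 1
    simpa using h.ends h'
  x_eq i t ht := by
    change D.x (σ (σ.symm _)) t = _
    simpa using h.x_eq i t ht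
  sign_eq i j t hc := by
    change D.sign (σ (σ.symm _)) (σ (σ.symm _)) t = _
    simpa using h.sign_eq i j t hc
  sign_new c j t hc hn := by
    refine h.sign_new (σ c) (σ j) t ?_ fun i hi => hn i (by simp [hi])
    rw [BraidDiagram.crosses_iff] at hc ⊢
    exact ⟨fun h => hc.1 (σ.injective h), hc.2⟩

theorem Clos.adm (h : Clos s B D f) (hB : Adm s B.toStrandDiagram) :
    Adm s D.toStrandDiagram := by
  intro hs c c' t hc
  by_cases hn : B.New f c t
  · rwa [h.sign_new c c' t hc hn]
  by_cases hn' : B.New f c' t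
  · rw [D.sign_symm, h.sign_new c' c t hc.symm hn']
    simpa using hs
  obtain ⟨i, rfl, hi⟩ := exists_old hn
  obtain ⟨j, rfl, hj⟩ := exists_old hn'
  rw [D.crosses_iff] at hc
  have hB' : B.Crosses i j t := ⟨fun e => hc.1 (e ▸ rfl), hi, hj, by
    rw [← h.x_eq i t hi, ← h.x_eq j t hj, hc.2.2]⟩
  rw [h.sign_eq i j t hB']
  exact hB hs i j t hB'

theorem Clos.x_congr (h : Clos s B D f) (h' : Clos s B D' f) {c : Fin n} {t : ℝ}
    (hc : ¬ B.New f c t) : D'.x c t = D.x c t := by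
  obtain ⟨i, rfl, hi⟩ := exists_old hc
  rw [h.x_eq i t hi, h'.x_eq i t hi]

theorem Clos.sign_congr (h : Clos s B D f) (h' : Clos s B D' f) {c c' : Fin n} {t : ℝ}
    (hc : ¬ B.New f c t) (hc' : ¬ B.New f c' t) (hcr : D.Crosses c c' t) :
    D'.sign c c' t = D.sign c c' t := by
  obtain ⟨i, rfl, hi⟩ := exists_old hc
  obtain ⟨j, rfl, hj⟩ := exists_old hc'
  rw [D.crosses_iff] at hcr
  have hB' : B.Crosses i j t := ⟨fun e => hcr.1 (e ▸ rfl), hi, hj, by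
    rw [← h.x_eq i t hi, ← h.x_eq j t hj, hcr.2.2]⟩
  rw [h.sign_eq i j t hB', h'.sign_eq i j t hB']

theorem Clos.leg_free (h : Clos s B D f) (k : Fin n) : ¬ D.Crosses (f B.leg) k B.p := by
  intro hc
  have ht : B.p ∈ Icc (B.a B.leg) (B.b B.leg) := ⟨le_rfl, (B.a_lt_b _).le⟩
  rw [D.crosses_iff] at hc
  by_cases hn : B.New f k B.p
  · rcases h.lab.new_cases hc.2.1 hn with ⟨-, h1, -⟩ | ⟨-, h1, h2⟩
    · exact lt_irrefl _ h1
    · exact lt_irrefl _ (h2 h1)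
  obtain ⟨i, rfl, hi⟩ := exists_old hn
  exact lt_irrefl _ (B.interior B.leg i B.p (fun e => hc.1 (e ▸ rfl)) ht hi (by
    rw [← h.x_eq _ _ ht, ← h.x_eq i _ hi, hc.2.2])).1

theorem Clos.head_free (h : Clos s B D f) (k : Fin n) : ¬ D.Crosses (f B.head) k B.q := by
  intro hc
  have ht : B.q ∈ Icc (B.a B.head) (B.b B.head) := ⟨(B.a_lt_b _).le, le_rfl⟩
  rw [D.crosses_iff] at hc
  by_cases hn : B.New f k B.q
  · rcases h.lab.new_cases hc.2.1 hn with ⟨-, h1, h2⟩ | ⟨-, h1, h2⟩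
    · exact lt_irrefl _ (h2 h1)
    · exact lt_irrefl _ h1
  obtain ⟨i, rfl, hi⟩ := exists_old hn
  exact lt_irrefl _ (B.interior B.head i B.q (fun e => hc.1 (e ▸ rfl)) ht hi (by
    rw [← h.x_eq _ _ ht, ← h.x_eq i _ hi, hc.2.2])).2

/-- The heights of the added arcs of a closure. -/
def OpenBraid.Gap (B : OpenBraid m) (t : ℝ) : Prop :=
  (B.q < B.p → B.q < t ∧ t < B.p) ∧ (t < B.p ∨ B.q < t)

theorem OpenBraid.Lab.gap (hf : B.Lab f) {c : Fin n} {t : ℝ} (ht : t ∈ Icc (0 : ℝ) 1)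
    (hn : B.New f c t) : B.Gap t := by
  rcases hf.new_cases ht hn with ⟨-, h1, h2⟩ | ⟨-, h1, h2⟩
  · exact ⟨fun h => ⟨h2 h, h1⟩, Or.inl h1⟩
  · exact ⟨fun h => ⟨h1, h2 h⟩, Or.inr h1⟩

theorem Clos.roomy (h : Clos s B D f) (hB : B.Roomy) {T : Finset ℝ}
    (h0 : (0 : ℝ) ∈ T) (h1 : (1 : ℝ) ∈ T) (hP : ∀ c, PolyOn T (D.x c) 0 1)
    (hm : ∀ c, ∀ τ ∈ T, τ ∈ Icc (0 : ℝ) 1 → B.New f c τ → D.x c τ ∈ Ioo (0 : ℝ) 1) :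
    D.Roomy := by
  have key : ∀ c, ∀ τ ∈ T, τ ∈ Icc (0 : ℝ) 1 → D.x c τ ∈ Ioo (0 : ℝ) 1 := by
    intro c τ hτ hτ'
    by_cases hn : B.New f c τ
    · exact hm c τ hτ hτ' hn
    · obtain ⟨i, rfl, hi⟩ := exists_old hn
      rw [h.x_eq i τ hi]; exact hB i τ hi
  exact fun c t ht =>
    ⟨(PolyOn.const T 0 0 1).lt (hP c) h0 h1 (fun τ h2 h3 => (key c τ h2 h3).1) ht,
      (hP c).lt (PolyOn.const T 1 0 1) h0 h1 (fun τ h2 h3 => (key c τ h2 h3).2) ht⟩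

/-- A closure can be prescribed by the positions `w` of its added arcs at the heights of a grid, if
these are not positions of strands. -/
theorem exists_clos (hf : B.Lab f) {T : Finset ℝ} (hT : IsGrid B.toStrandDiagram T) (s : SignType)
    (w : ℝ → ℝ) (mem : ∀ τ ∈ T, w τ ∈ Icc (0 : ℝ) 1)
    (off : ∀ τ ∈ T, B.Gap τ → ∀ i, τ ∈ Icc (B.a i) (B.b i) → w τ ≠ B.x i τ)
    (ends : B.p ≤ B.q → w 0 = w 1) :
    ∃ D : BraidDiagram n, Clos s B D f ∧ (∀ c, PolyOn T (D.x c) 0 1) ∧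
      (∀ c, ∀ τ ∈ T, τ ∈ Icc (0 : ℝ) 1 → B.New f c τ → D.x c τ = w τ) ∧
      (B.Roomy → (∀ τ ∈ T, w τ ∈ Ioo (0 : ℝ) 1) → D.Roomy) := by
  classical
  let v : Fin n → ℝ → ℝ := fun c τ => if B.New f c τ then w τ else B.glueX f 0 c τ
  choose Y hY1 hY2 using fun c => exists_interp T (v c)
  have hYn : ∀ c, ∀ τ ∈ T, B.New f c τ → Y c τ = w τ := fun c τ h1 h2 => by
    rw [hY1 c τ h1]; exact if_pos h2
  have hYo : ∀ i, ∀ τ ∈ T, τ ∈ Icc (B.a i) (B.b i) → Y (f i) τ = B.x i τ := fun i τ h1 h2 => by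
    rw [hY1 _ τ h1]
    have : v (f i) τ = B.glueX f 0 (f i) τ := if_neg fun h => h i rfl h2
    rw [this, hf.glueX_old h2]
  have hYP : ∀ c, PolyOn T (Y c) 0 1 := fun c => hY2 c 0 hT.zero 1 hT.one
  have hm : ∀ c, ∀ τ ∈ T, Y c τ ∈ Icc (0 : ℝ) 1 := by
    intro c τ h1
    by_cases hn : B.New f c τ
    · rw [hYn c τ h1 hn]; exact mem τ h1
    · obtain ⟨i, rfl, hi⟩ := exists_old hn
      rw [hYo i τ h1 hi]; exact B.x_mem i τ hi
  have legJ := hYo B.leg B.p (hT.a_mem _) ⟨le_rfl, (B.a_lt_b _).le⟩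
  have headJ := hYo B.head B.q (hT.b_mem _) ⟨(B.a_lt_b _).le, le_rfl⟩
  have ok : ArcsOK B f Y := ArcsOK.of_poly hT hYP (fun c t ht _ =>
      ⟨(PolyOn.const T 0 0 1).le (hYP c) hT.zero hT.one (fun τ h2 _ => (hm c τ h2).1) ht,
        (hYP c).le (PolyOn.const T 1 0 1) hT.zero hT.one (fun τ h2 _ => (hm c τ h2).2) ht⟩)
    legJ headJ (fun c i τ h1 h2 h3 _ h5 => by
      rw [hYn c τ h1 h3]; exact off τ h1 (hf.gap h2 h3) i h5)
    (fun h => by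
      rw [hYn _ 0 hT.zero (new_zero hf h), hYn _ 1 hT.one (new_one hf h), ends h])
  have hw : ∀ c, ∀ τ ∈ T, τ ∈ Icc (0 : ℝ) 1 → B.New f c τ → (glue hf ok s).x c τ = w τ :=
    fun c τ h1 _ h3 => by rw [glue_x, glueX_new h3, hYn c τ h1 h3]
  have hP : ∀ c, PolyOn T ((glue hf ok s).x c) 0 1 := fun c => by
    rw [glue_x]; exact hf.glue_poly hT legJ headJ (hYP c)
  refine ⟨glue hf ok s, glue_clos hf ok s, hP, hw, fun hB hw' => ?_⟩
  exact (glue_clos hf ok s).roomy hB hT.zero hT.one hP fun c τ h1 h2 h3 => by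
    rw [hw c τ h1 h2 h3]; exact hw' τ h1

/-! ### Changing the added arcs -/

/-- The strand `c₁` is changed above the height `u`, and the strand `c₂` below the height `v`, where
all their crossings are of type `s`. -/
theorem two_arcs_move {c₁ c₂ : Fin n} {u v : ℝ} (hu : 0 < u) (huv : u ≤ v) (hv : v < 1)
    (hx : ∀ j, ∀ t ∈ Icc (0 : ℝ) 1, (j = c₁ → u ≤ t) → (j = c₂ → t ≤ v) → D'.x j t = D.x j t)
    (h0 : D'.x c₁ 0 = D.x c₁ 0) (h1 : D'.x c₂ 1 = D.x c₂ 1)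
    (hs : ∀ j k t, D.Crosses j k t → (j = c₁ → u ≤ t) → (j = c₂ → t ≤ v) →
      (k = c₁ → u ≤ t) → (k = c₂ → t ≤ v) → D'.sign j k t = D.sign j k t)
    (hc₁ : ∀ k t, t ≤ u → D.Crosses c₁ k t → D.sign c₁ k t = s)
    (hc₁' : ∀ k t, t ≤ u → D'.Crosses c₁ k t → D'.sign c₁ k t = s)
    (hc₂ : ∀ k t, v ≤ t → D.Crosses c₂ k t → D.sign c₂ k t = s)
    (hc₂' : ∀ k t, v ≤ t → D'.Crosses c₂ k t → D'.sign c₂ k t = s)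
    (hfu : ∀ k, ¬ D.Crosses c₁ k u)
    (hA : Adm s D.toStrandDiagram) (hA' : Adm s D'.toStrandDiagram)
    (hr : D.Roomy) (hr' : D'.Roomy) : R s ⟨n, D⟩ ⟨n, D'⟩ := by
  classical
  -- the diagram in which only `c₁` has been changed: it is `D'` above `u` and `D` below
  let X : Fin n → ℝ → ℝ := fun j t => if t < u then D'.x j t else D.x j t
  have Xlt : ∀ {j t}, t < u → X j t = D'.x j t := fun h => if_pos h
  have Xge : ∀ {j t}, u ≤ t → X j t = D.x j t := fun h => if_neg (not_lt.2 h)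
  have Xne : ∀ j, j ≠ c₁ → ∀ t ∈ Icc (0 : ℝ) 1, X j t = D.x j t := by
    intro j hj t ht
    rcases lt_or_ge t u with h | h
    · rw [Xlt h]; exact hx j t ht (fun h' => absurd h' hj) fun _ => h.le.trans huv
    · exact Xge h
  have Xne' : ∀ j, j ≠ c₂ → ∀ t ∈ Icc (0 : ℝ) 1, X j t = D'.x j t := by
    intro j hj t ht
    rcases lt_or_ge t u with h | h
    · exact Xlt h
    · rw [Xge h]; exact (hx j t ht (fun _ => h) fun h' => absurd h' hj).symm
  have Xv : ∀ j, ∀ t ∈ Icc (0 : ℝ) 1, t ≤ v → X j t = D'.x j t := by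
    intro j t ht htv
    rcases lt_or_ge t u with h | h
    · exact Xlt h
    · rw [Xge h]; exact (hx j t ht (fun _ => h) fun _ => htv).symm
  have hF : Fam X := by
    refine ⟨fun j => ?_, fun j t ht => ?_, fun t ht => ?_⟩
    · obtain ⟨T, hT, hT'⟩ := (D.fam.pl j).common (D'.fam.pl j)
      have i1 : PolyOn (insert u T) (X j) 0 u :=
        ((hT'.mono (Finset.subset_insert u T)).sub_interval le_rfl (by linarith)).congr
          fun t ht => Xv j t ⟨ht.1, by linarith [ht.2]⟩ (by linarith [ht.2])
      have i2 : PolyOn (insert u T) (X j) u 1 :=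
        ((hT.mono (Finset.subset_insert u T)).sub_interval hu.le le_rfl).congr
          fun t ht => Xge ht.1
      exact (i1.append i2 (Finset.mem_insert_self _ _)).pl
    · rcases lt_or_ge t u with h | h
      · rw [Xlt h]; exact D'.fam.mem j t ht
      · rw [Xge h]; exact D.fam.mem j t ht
    · rcases lt_trichotomy t u with h | rfl | h
      · refine (D'.fam.good t ht).congr (fun j => Xlt h) fun _ j => ?_
        filter_upwards [isOpen_Iio.mem_nhds h] with r hr using Xlt hr
      · have hne : ∀ i j, i ≠ j → X i t = X j t → i ≠ c₁ ∧ j ≠ c₁ ∧ D.x i t = D.x j t := by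
          intro i j hij hX
          rw [Xge le_rfl, Xge le_rfl] at hX
          refine ⟨fun h => ?_, fun h => ?_, hX⟩
          · exact hfu j (D.crosses_iff.2 ⟨h ▸ hij, ht, h ▸ hX⟩)
          · exact hfu i (D.crosses_iff.2 ⟨h ▸ hij.symm, ht, h ▸ hX.symm⟩)
        have g := D.fam.good t ht
        refine ⟨fun i j hij hX => ⟨hu, by linarith⟩, fun i j hij hX => ?_,
          fun i j k hij hik h1 h2 => g.double i j k hij hik (hne i j hij h1).2.2 (hne i k hik h2).2.2⟩
        obtain ⟨h2, h3, h4⟩ := hne i j hij hX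
        refine (g.trans i j hij h4).congr ?_
        filter_upwards [isOpen_Ioo.mem_nhds (⟨hu, by linarith⟩ : t ∈ Ioo (0 : ℝ) 1)] with r hr
        rw [Xne i h2 r ⟨hr.1.le, hr.2.le⟩, Xne j h3 r ⟨hr.1.le, hr.2.le⟩]
      · refine (D.fam.good t ht).congr (fun j => Xge h.le) fun _ j => ?_
        filter_upwards [isOpen_Ioi.mem_nhds h] with r hr using Xge (le_of_lt hr)
  have X0 : ∀ j, X j 0 = D.x j 0 := fun j => by
    by_cases hj : j = c₁
    · rw [Xlt hu, hj, h0]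
    · exact Xne j hj 0 ⟨le_rfl, zero_le_one⟩
  let D'' : BraidDiagram n := hF.braid D.n_pos
    (fun i => by
      obtain ⟨j, hj⟩ := D.ends i
      exact ⟨j, by rw [X0, Xge (by linarith), hj]⟩)
    (fun i j t => if t < u then D'.sign i j t else D.sign i j t)
    (fun i j t => by split_ifs; exacts [D'.sign_symm _ _ _, D.sign_symm _ _ _])
  have Slt : ∀ {i j t}, t < u → D''.sign i j t = D'.sign i j t := fun h => if_pos h
  have Sge : ∀ {i j t}, u ≤ t → D''.sign i j t = D.sign i j t := fun h => if_neg (not_lt.2 h)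
  have hr'' : D''.Roomy := fun j t ht => by
    rcases lt_or_ge t u with h | h
    · change X j t ∈ _
      rw [Xlt h]; exact hr' j t ht
    · change X j t ∈ _
      rw [Xge h]; exact hr j t ht
  have cr : ∀ {i j t}, D''.Crosses i j t ↔ i ≠ j ∧ t ∈ Icc (0 : ℝ) 1 ∧ X i t = X j t :=
    D''.crosses_iff
  have crlt : ∀ {i j t}, t ≤ v → D''.Crosses i j t → D'.Crosses i j t := fun h h' => by
    rw [cr] at h'
    rw [D'.crosses_iff]
    rwa [Xv _ _ h'.2.1 h, Xv _ _ h'.2.1 h] at h'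
  have crge : ∀ {i j t}, u ≤ t → D''.Crosses i j t → D.Crosses i j t := fun h h' => by
    rw [cr] at h'
    rw [D.crosses_iff]
    rwa [Xge h, Xge h] at h'
  have hA'' : Adm s D''.toStrandDiagram := fun hs0 i j t hc => by
    rcases lt_or_ge t u with h | h
    · rw [Slt h]; exact hA' hs0 i j t (crlt (h.le.trans huv) hc)
    · rw [Sge h]; exact hA hs0 i j t (crge h hc)
  have m1 : R s ⟨n, D⟩ ⟨n, D''⟩ := by
    refine arc_move (c := c₁) (u := 0) (v := u) (s' := s) le_rfl hu (by linarith) Xne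
      (fun t ht ht' => ?_) (fun j k t hj hk hc => ?_) (fun k t ht hc => ?_)
      (fun k t ht hc => hc₁ k t ht.2 hc) (fun k t ht hc => ?_) (fun h j k t _ _ _ hc h' =>
        absurd h' (hA h j k t hc)) (fun h => ⟨h, hA h⟩) hr hr''
    · rcases eq_or_lt_of_le ht.1 with rfl | h
      · exact X0 _
      · exact Xge (not_lt.1 fun h' => ht' ⟨h, h'⟩)
    · rcases lt_or_ge t u with h | h
      · rw [Slt h]
        exact hs j k t hc (fun h' => absurd h' hj) (fun _ => h.le.trans huv)
          (fun h' => absurd h' hk) (fun _ => h.le.trans huv)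
      · exact Sge h
    · exact Sge (not_lt.1 fun h => ht ⟨hc.inner.1.le, h.le⟩)
    · rcases eq_or_lt_of_le ht.2 with rfl | h
      · exact absurd (crge le_rfl hc) (hfu k)
      · rw [Slt h]; exact hc₁' k t h.le (crlt (h.le.trans huv) hc)
  have m2 : R s ⟨n, D''⟩ ⟨n, D'⟩ := by
    refine arc_move (c := c₂) (u := v) (v := 1) (s' := s) (by linarith) hv le_rfl
      (fun j hj t ht => (Xne' j hj t ht).symm)
      (fun t ht ht' => ?_) (fun j k t hj hk hc => ?_) (fun k t ht hc => ?_)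
      (fun k t ht hc => ?_) (fun k t ht hc => hc₂' k t ht.1 hc) (fun h j k t _ _ _ hc h' =>
        absurd h' (hA'' h j k t hc)) (fun h => ⟨h, hA'' h⟩) hr'' hr'
    · rcases eq_or_lt_of_le ht.2 with rfl | h
      · rw [h1]; exact (Xge (by linarith)).symm
      · exact (Xv c₂ t ht (not_lt.1 fun h' => ht' ⟨h', h⟩)).symm
    · rcases lt_or_ge t u with h | h
      · exact (Slt h).symm
      · rw [Sge h]
        exact hs j k t (crge h hc) (fun _ => h) (fun h' => absurd h' hj) (fun _ => h)
          (fun h' => absurd h' hk)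
    · have htv : t ≤ v := not_lt.1 fun h => ht ⟨h.le, hc.inner.2.le⟩
      rcases lt_or_ge t u with h | h
      · exact (Slt h).symm
      · rw [Sge h]
        exact hs c₂ k t (crge h hc) (fun _ => h) (fun _ => htv) (fun _ => h) (fun _ => htv)
    · have h : u ≤ t := huv.trans ht.1
      rw [Sge h]; exact hc₂ k t ht.1 (crge h hc)
  exact m1.trans m2

/-- Two closures with the same new ends are equivalent. -/
theorem Clos.move (h : Clos s B D f) (h' : Clos s B D' f) (hA : Adm s B.toStrandDiagram)
    (hr : D.Roomy) (hr' : D'.Roomy) (he : B.p ≤ B.q → D'.x (f B.leg) 0 = D.x (f B.leg) 0) :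
    R s ⟨n, D⟩ ⟨n, D'⟩ := by
  have hAD := h.adm hA
  rcases lt_or_ge B.q B.p with hqp | hpq
  · have e := h.lab.joined hqp
    have not_new : ∀ {c t}, t ∈ Icc (0 : ℝ) 1 → (c = f B.leg → t ∉ Ioo B.q B.p) →
        ¬ B.New f c t := fun ht h1 hn => by
      rcases h.lab.new_cases ht hn with ⟨h2, h3, h4⟩ | ⟨h2, h3, h4⟩
      · exact h1 h2 ⟨h4 hqp, h3⟩
      · exact h1 (by rw [h2, e]) ⟨h3, h4 hqp⟩
    have new : ∀ {D : BraidDiagram n} {k t}, Clos s B D f → t ∈ Icc B.q B.p →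
        D.Crosses (f B.leg) k t → D.sign (f B.leg) k t = s := fun {D k t} hD ht hc => by
      rcases eq_or_lt_of_le ht.1 with rfl | h1
      · exact absurd (e ▸ hc) (hD.head_free k)
      rcases eq_or_lt_of_le ht.2 with rfl | h2
      · exact absurd hc (hD.leg_free k)
      exact hD.sign_new _ _ _ hc (hD.lab.new_of_lt h2 fun _ => h1)
    have hn : ∀ {j t}, t ∈ Icc (0 : ℝ) 1 → j ≠ f B.leg → ¬ B.New f j t := fun ht hj =>
      not_new ht fun h => absurd h hj
    refine arc_move (c := f B.leg) (u := B.q) (v := B.p) (s' := s) B.q_pos.le hqp B.p_lt_one.le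
      (fun j hj t ht => h.x_congr h' (hn ht hj))
      (fun t ht ht' => h.x_congr h' (not_new ht fun _ => ht'))
      (fun j k t hj hk hc => ?_) (fun k t ht hc => ?_)
      (fun k t ht hc => new h ht hc) (fun k t ht hc => new h' ht hc)
      (fun h j k t _ _ _ hc h' => absurd h' (hAD h j k t hc)) (fun h => ⟨h, hAD h⟩) hr hr'
    · have ht := (D.crosses_iff.1 hc).2.1
      exact h.sign_congr h' (hn ht hj) (hn ht hk) hc
    · have hc' := D.crosses_iff.1 hc
      exact h.sign_congr h' (not_new hc'.2.1 fun _ h1 => ht ⟨h1.1.le, h1.2.le⟩)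
        (hn hc'.2.1 hc'.1.symm) hc
  · have hqp := not_lt.2 hpq
    have not_new : ∀ {c t}, t ∈ Icc (0 : ℝ) 1 → (c = f B.leg → B.p ≤ t) → (c = f B.head → t ≤ B.q) →
        ¬ B.New f c t := fun ht h1 h1' hn => by
      rcases h.lab.new_cases ht hn with ⟨h2, h3, -⟩ | ⟨h2, h3, -⟩
      · linarith [h1 h2]
      · linarith [h1' h2]
    have new : ∀ {D : BraidDiagram n} {k t}, Clos s B D f → t ≤ B.p →
        D.Crosses (f B.leg) k t → D.sign (f B.leg) k t = s := fun {D k t} hD ht hc => by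
      rcases eq_or_lt_of_le ht with rfl | h2
      · exact absurd hc (hD.leg_free k)
      exact hD.sign_new _ _ _ hc (hD.lab.new_of_lt h2 fun h => absurd h hqp)
    have new' : ∀ {D : BraidDiagram n} {k t}, Clos s B D f → B.q ≤ t →
        D.Crosses (f B.head) k t → D.sign (f B.head) k t = s := fun {D k t} hD ht hc => by
      rcases eq_or_lt_of_le ht with rfl | h2
      · exact absurd hc (hD.head_free k)
      exact hD.sign_new _ _ _ hc (hD.lab.new_of_gt h2 fun h => absurd h hqp)
    refine two_arcs_move (c₁ := f B.leg) (c₂ := f B.head) B.leg_pos hpq B.head_lt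
      (fun j t ht h1 h2 => h.x_congr h' (not_new ht h1 h2)) (he hpq)
      (by rw [← h'.ends hpq, ← h.ends hpq, he hpq])
      (fun j k t hc h1 h2 h3 h4 => ?_) (fun k t ht hc => new h ht hc)
      (fun k t ht hc => new h' ht hc) (fun k t ht hc => new' h ht hc)
      (fun k t ht hc => new' h' ht hc) (fun k => h.leg_free k)
      hAD (h'.adm hA) hr hr'
    have ht := (D.crosses_iff.1 hc).2.1
    exact h.sign_congr h' (not_new ht h1 h2) (not_new ht h3 h4) hc

end

end Braidoids

namespace Braidoids
open Set

theorem AffineOn.mem_Icc {f : ℝ → ℝ} {s u t a b : ℝ} (h : AffineOn f s u) (ht : t ∈ Icc s u)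
    (h1 : f s ∈ Icc a b) (h2 : f u ∈ Icc a b) : f t ∈ Icc a b :=
  ⟨(AffineOn.const a s u).le h ht h1.1 h2.1, h.le (AffineOn.const b s u) ht h1.2 h2.2⟩

theorem AffineOn.mem_Ioo {f : ℝ → ℝ} {s u t a b : ℝ} (h : AffineOn f s u) (ht : t ∈ Icc s u)
    (h1 : f s ∈ Ioo a b) (h2 : f u ∈ Ioo a b) : f t ∈ Ioo a b :=
  ⟨(AffineOn.const a s u).lt h ht h1.1 h2.1, h.lt (AffineOn.const b s u) ht h1.2 h2.2⟩

theorem AffineOn.mem_uIcc {f : ℝ → ℝ} {s u t a b : ℝ} (h : AffineOn f s u) (ht : t ∈ Icc s u)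
    (h1 : f s ∈ uIcc a b) (h2 : f u ∈ uIcc a b) : f t ∈ uIcc a b := h.mem_Icc ht h1 h2

theorem AffineOn.exists_zero {φ : ℝ → ℝ} {s u : ℝ} (h : AffineOn φ s u) (hsu : s ≤ u)
    (hs : φ s < 0) (hu : 0 ≤ φ u) : ∃ t ∈ Icc s u, φ t = 0 := by
  obtain ⟨p, q, hpq⟩ := h
  have h1 := hpq s ⟨le_rfl, hsu⟩
  have h2 := hpq u ⟨hsu, le_rfl⟩
  have hp : 0 < p := by
    by_contra hp
    nlinarith
  have e : p * (-q / p) = -q := by field_simp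
  have hm : -q / p ∈ Icc s u := ⟨by rw [le_div_iff₀ hp]; linarith, by rw [div_le_iff₀ hp]; linarith⟩
  exact ⟨_, hm, by rw [hpq _ hm, e]; ring⟩

namespace BraidDiagram

variable {n : ℕ} {D : BraidDiagram n} {i j : Fin n} {s u : ℝ}

/-- Strands that do not cross keep their order. -/
theorem lt_of_not_crosses (hs : 0 ≤ s) (hu : u ≤ 1) (hi : AffineOn (D.x i) s u)
    (hj : AffineOn (D.x j) s u) (hn : ∀ t ∈ Icc s u, ¬ D.Crosses i j t)
    (h : D.x i s < D.x j s) {t : ℝ} (ht : t ∈ Icc s u) : D.x i t < D.x j t := by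
  by_contra hc
  obtain ⟨r, hr, h0⟩ := ((hi.sub hj).mono le_rfl ht.2).exists_zero ht.1 (by linarith) (by linarith)
  have hr' : r ∈ Icc s u := ⟨hr.1, hr.2.trans ht.2⟩
  exact hn r hr' (D.crosses_iff.2
    ⟨fun e => by rw [e] at h; exact lt_irrefl _ h, ⟨by linarith [hr.1], by linarith [hr'.2]⟩,
      sub_eq_zero.1 h0⟩)

theorem inj_of_not_crosses {t : ℝ} (ht : t ∈ Icc (0 : ℝ) 1) (hn : ∀ i j, ¬ D.Crosses i j t)
    (h : D.x i t = D.x j t) : i = j := by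
  by_contra hij
  exact hn i j (D.crosses_iff.2 ⟨hij, ht, h⟩)

theorem exists_no_crossing_near_ends (D : BraidDiagram n) {b : ℝ} (hb : 0 < b) :
    ∃ ε, 0 < ε ∧ ε < b ∧ ε < 1 / 2 ∧ (∀ i, AffineOn (D.x i) 0 ε) ∧
      (∀ i, AffineOn (D.x i) (1 - ε) 1) ∧
      ∀ t, t ≤ ε ∨ 1 - ε ≤ t → ∀ i j, ¬ D.Crosses i j t := by
  obtain ⟨T, hT⟩ := exists_isGrid D.toStrandDiagram
  obtain ⟨u, h1, h2, h3⟩ := Ioo_disjoint_of_finite T 0 (b := min b (1 / 2)) (by positivity)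
  obtain ⟨u', h1', h2', h3'⟩ := Ioo_disjoint_of_finite' T 1 (b := 1 / 2) (by norm_num)
  have e1 := min_le_left u (1 - u')
  have e2 := min_le_right u (1 - u')
  have e3 := min_le_left b (1 / 2)
  have e4 := min_le_right b (1 / 2)
  have e0 : 0 < min u (1 - u') := lt_min h1 (by linarith)
  refine ⟨min u (1 - u'), e0, by linarith, by linarith, fun i => ?_, fun i => ?_,
    fun t ht i j hc => ?_⟩
  · exact hT.poly' i 0 _ le_rfl e0 (by linarith) fun r hr hr' =>
      h3 r hr ⟨hr'.1, hr'.2.le.trans e1⟩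
  · exact hT.poly' i _ 1 (by linarith) (by linarith) le_rfl fun r hr hr' =>
      h3' r hr ⟨by linarith [hr'.1], hr'.2⟩
  · have hi := hc.inner
    rcases ht with ht | ht
    · exact h3 t (hT.cross i j t hc) ⟨hi.1, ht.trans e1⟩
    · exact h3' t (hT.cross i j t hc) ⟨by linarith, hi.2⟩

/-- The ends of the strands are moved along the top and the bottom line, in the same way, without
passing each other. -/
theorem exists_move_ends (D : BraidDiagram n) (φ : ℝ → ℝ)
    (mono : ∀ i j, D.x i 0 < D.x j 0 → φ (D.x i 0) < φ (D.x j 0))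
    (mem : ∀ i, φ (D.x i 0) ∈ Icc (0 : ℝ) 1) {b : ℝ} (hb : 0 < b) :
    ∃ (ε : ℝ) (D' : BraidDiagram n), 0 < ε ∧ ε < b ∧ ε < 1 / 2 ∧
      (∀ i j, ∀ t ∈ Icc (0 : ℝ) 1, D.x i t < D.x j t ↔ D'.x i t < D'.x j t) ∧
      D'.sign = D.sign ∧ (∀ i, ∀ t ∈ Icc ε (1 - ε), D'.x i t = D.x i t) ∧
      (∀ i, D'.x i 0 = φ (D.x i 0)) ∧ (∀ i, D'.x i 1 = φ (D.x i 1)) ∧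
      (∀ i, φ (D.x i 0) = D.x i 0 → ∀ t ∈ Icc 0 ε, D'.x i t = D.x i t) ∧
      (∀ i, φ (D.x i 1) = D.x i 1 → ∀ t ∈ Icc (1 - ε) 1, D'.x i t = D.x i t) ∧
      (D.Roomy → (∀ i, φ (D.x i 0) ∈ Ioo (0 : ℝ) 1) → D'.Roomy) := by
  classical
  obtain ⟨ε, h0, hεb, hε, aff0, aff1, hn⟩ := D.exists_no_crossing_near_ends hb
  have mono' : ∀ i j, D.x i 1 < D.x j 1 → φ (D.x i 1) < φ (D.x j 1) := fun i j h => by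
    obtain ⟨k, hk⟩ := D.ends i
    obtain ⟨l, hl⟩ := D.ends j
    rw [hk, hl] at h ⊢
    exact mono k l h
  have h00 : (0 : ℝ) ∈ Icc (0 : ℝ) ε := ⟨le_rfl, h0.le⟩
  have h0ε : ε ∈ Icc (0 : ℝ) ε := ⟨h0.le, le_rfl⟩
  have h11 : (1 : ℝ) ∈ Icc (1 - ε) (1 : ℝ) := ⟨by linarith, le_rfl⟩
  have h1ε : 1 - ε ∈ Icc (1 - ε) (1 : ℝ) := ⟨le_rfl, by linarith⟩
  -- the strands are straight and do not cross above `ε` and below `1 - ε`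
  let X : Fin n → ℝ → ℝ := fun i t => if t < ε then line 0 (φ (D.x i 0)) ε (D.x i ε) t else
    if t ≤ 1 - ε then D.x i t else line (1 - ε) (D.x i (1 - ε)) 1 (φ (D.x i 1)) t
  have X0 : ∀ i, ∀ t ∈ Icc 0 ε, X i t = line 0 (φ (D.x i 0)) ε (D.x i ε) t := by
    intro i t ht
    rcases eq_or_lt_of_le ht.2 with rfl | h
    · rw [line_right h0]
      exact (if_neg (lt_irrefl _)).trans (if_pos (by linarith))
    · exact if_pos h
  have X1 : ∀ i, ∀ t ∈ Icc (1 - ε) 1,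
      X i t = line (1 - ε) (D.x i (1 - ε)) 1 (φ (D.x i 1)) t := by
    intro i t ht
    refine (if_neg (by linarith [ht.1])).trans ?_
    rcases eq_or_lt_of_le ht.1 with rfl | h
    · rw [if_pos le_rfl, line_left]
    · exact if_neg (not_le.2 h)
  have Xm : ∀ i, ∀ t ∈ Icc ε (1 - ε), X i t = D.x i t := fun i t ht =>
    (if_neg (not_lt.2 ht.1)).trans (if_pos ht.2)
  have A0 : ∀ i, AffineOn (X i) 0 ε := fun i => (line_affine 0 (φ (D.x i 0)) ε (D.x i ε) 0 ε).congr
    fun t ht => X0 i t ht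
  have A1 : ∀ i, AffineOn (X i) (1 - ε) 1 := fun i =>
    (line_affine (1 - ε) (D.x i (1 - ε)) 1 (φ (D.x i 1)) _ 1).congr fun t ht => X1 i t ht
  have V00 : ∀ i, X i 0 = φ (D.x i 0) := fun i => by rw [X0 i 0 h00, line_left]
  have V0ε : ∀ i, X i ε = D.x i ε := fun i => Xm i ε ⟨le_rfl, by linarith⟩
  have V11 : ∀ i, X i 1 = φ (D.x i 1) := fun i => by rw [X1 i 1 h11, line_right (by linarith)]
  have V1ε : ∀ i, X i (1 - ε) = D.x i (1 - ε) := fun i => Xm i _ ⟨by linarith, le_rfl⟩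
  have O0 : ∀ i j, D.x i 0 < D.x j 0 → ∀ t ∈ Icc 0 ε, D.x i t < D.x j t ∧ X i t < X j t := by
    intro i j h t ht
    have key : ∀ t ∈ Icc 0 ε, D.x i t < D.x j t := fun t ht =>
      lt_of_not_crosses le_rfl (by linarith) (aff0 i) (aff0 j)
        (fun t ht => hn t (Or.inl ht.2) i j) h ht
    exact ⟨key t ht, (A0 i).lt (A0 j) ht (by rw [V00, V00]; exact mono i j h)
      (by rw [V0ε, V0ε]; exact key ε h0ε)⟩
  have O1 : ∀ i j, D.x i (1 - ε) < D.x j (1 - ε) → ∀ t ∈ Icc (1 - ε) 1,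
      D.x i t < D.x j t ∧ X i t < X j t := by
    intro i j h t ht
    have key : ∀ t ∈ Icc (1 - ε) 1, D.x i t < D.x j t := fun t ht =>
      lt_of_not_crosses (by linarith) le_rfl (aff1 i) (aff1 j)
        (fun t ht => hn t (Or.inr ht.1) i j) h ht
    exact ⟨key t ht, (A1 i).lt (A1 j) ht (by rw [V1ε, V1ε]; exact h)
      (by rw [V11, V11]; exact mono' i j (key 1 h11))⟩
  have tri : ∀ i j, ∀ t ∈ Icc (0 : ℝ) 1, (i = j) ∨ (D.x i t = D.x j t ∧ t ∈ Ioo ε (1 - ε)) ∨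
      (t ∈ Ioo ε (1 - ε)) ∨ (D.x i t < D.x j t ∧ X i t < X j t) ∨
      (D.x j t < D.x i t ∧ X j t < X i t) := by
    intro i j t ht
    by_cases hij : i = j
    · exact Or.inl hij
    rcases le_or_gt t ε with h1 | h1
    · rcases lt_trichotomy (D.x i 0) (D.x j 0) with h | h | h
      · exact Or.inr (Or.inr (Or.inr (Or.inl (O0 i j h t ⟨ht.1, h1⟩))))
      · exact absurd (inj_of_not_crosses ⟨le_rfl, zero_le_one⟩ (hn 0 (Or.inl h0.le)) h) hij
      · exact Or.inr (Or.inr (Or.inr (Or.inr (O0 j i h t ⟨ht.1, h1⟩))))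
    rcases le_or_gt (1 - ε) t with h2 | h2
    · rcases lt_trichotomy (D.x i (1 - ε)) (D.x j (1 - ε)) with h | h | h
      · exact Or.inr (Or.inr (Or.inr (Or.inl (O1 i j h t ⟨h2, ht.2⟩))))
      · exact absurd (inj_of_not_crosses ⟨by linarith, by linarith⟩ (hn _ (Or.inr le_rfl)) h) hij
      · exact Or.inr (Or.inr (Or.inr (Or.inr (O1 j i h t ⟨h2, ht.2⟩))))
    · exact Or.inr (Or.inr (Or.inl ⟨h1, h2⟩))
  have order : ∀ i j, ∀ t ∈ Icc (0 : ℝ) 1, D.x i t < D.x j t ↔ X i t < X j t := by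
    intro i j t ht
    rcases tri i j t ht with rfl | h | h | h | h
    · exact ⟨fun h => absurd h (lt_irrefl _), fun h => absurd h (lt_irrefl _)⟩
    · rw [Xm i t ⟨h.2.1.le, h.2.2.le⟩, Xm j t ⟨h.2.1.le, h.2.2.le⟩]
    · rw [Xm i t ⟨h.1.le, h.2.le⟩, Xm j t ⟨h.1.le, h.2.le⟩]
    · simp [h.1, h.2]
    · exact ⟨fun h' => absurd h' h.1.not_gt, fun h' => absurd h' h.2.not_gt⟩
  have inj : ∀ i j, ∀ t ∈ Icc (0 : ℝ) 1, i ≠ j → X i t = X j t → t ∈ Ioo ε (1 - ε) := by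
    intro i j t ht hij h
    rcases tri i j t ht with h1 | h1 | h1 | h1 | h1
    · exact absurd h1 hij
    · exact h1.2
    · exact h1
    · exact absurd h h1.2.ne
    · exact absurd h h1.2.ne'
  have Xroom : ∀ a b, (∀ i, φ (D.x i 0) ∈ Icc a b) → (∀ i, ∀ t ∈ Icc (0 : ℝ) 1, D.x i t ∈ Icc a b) →
      ∀ i, ∀ t ∈ Icc (0 : ℝ) 1, X i t ∈ Icc a b := by
    intro a b ha hD i t ht
    rcases le_or_gt t ε with h1 | h1
    · exact (A0 i).mem_Icc ⟨ht.1, h1⟩ (by rw [V00]; exact ha i)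
        (by rw [V0ε]; exact hD i ε ⟨h0.le, by linarith⟩)
    rcases le_or_gt (1 - ε) t with h2 | h2
    · refine (A1 i).mem_Icc ⟨h2, ht.2⟩ (by rw [V1ε]; exact hD i _ ⟨by linarith, by linarith⟩) ?_
      rw [V11]
      obtain ⟨k, hk⟩ := D.ends i
      rw [hk]; exact ha k
    · rw [Xm i t ⟨h1.le, h2.le⟩]; exact hD i t ht
  have hF : Fam X := by
    refine ⟨fun i => ?_, Xroom 0 1 mem D.fam.mem, fun t ht => ?_⟩
    · obtain ⟨T, hT, -⟩ := (D.fam.pl i).common (D.fam.pl i)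
      have p0 : PolyOn (insert ε (insert (1 - ε) T)) (X i) 0 ε := fun s u hs hsu hu _ =>
        (A0 i).mono hs hu
      have p1 : PolyOn (insert ε (insert (1 - ε) T)) (X i) (1 - ε) 1 := fun s u hs hsu hu _ =>
        (A1 i).mono hs hu
      have p2 : PolyOn (insert ε (insert (1 - ε) T)) (X i) ε (1 - ε) :=
        ((hT.mono ((Finset.subset_insert _ _).trans (Finset.subset_insert _ _))).sub_interval
          h0.le (by linarith)).congr fun t ht => Xm i t ht
      exact ((p0.append p2 (by simp)).append p1 (by simp)).pl
    · by_cases h : t ∈ Ioo ε (1 - ε)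
      · refine (D.fam.good t ht).congr (fun i => Xm i t ⟨h.1.le, h.2.le⟩) fun _ i => ?_
        filter_upwards [isOpen_Ioo.mem_nhds h] with r hr using Xm i r ⟨hr.1.le, hr.2.le⟩
      · exact ⟨fun i j h1 h2 => absurd (inj i j t ht h1 h2) h,
          fun i j h1 h2 => absurd (inj i j t ht h1 h2) h,
          fun i j k h1 _ h2 _ => absurd (inj i j t ht h1 h2) h⟩
  refine ⟨ε, hF.braid D.n_pos (fun i => ?_) D.sign D.sign_symm, h0, hεb, hε, order, rfl, Xm, V00,
    V11, fun i hi t ht => ?_, fun i hi t ht => ?_, fun hr hφ i t ht => ?_⟩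
  · obtain ⟨k, hk⟩ := D.ends i
    exact ⟨k, by rw [V11, V00, hk]⟩
  · exact (A0 i).eq (aff0 i) ht (by rw [V00, hi]) (V0ε i)
  · exact (A1 i).eq (aff1 i) ht (V1ε i) (by rw [V11, hi])
  · change X i t ∈ _
    rcases le_or_gt t ε with h1 | h1
    · exact (A0 i).mem_Ioo ⟨ht.1, h1⟩ (by rw [V00]; exact hφ i)
        (by rw [V0ε]; exact hr i ε ⟨h0.le, by linarith⟩)
    rcases le_or_gt (1 - ε) t with h2 | h2
    · refine (A1 i).mem_Ioo ⟨h2, ht.2⟩ (by rw [V1ε]; exact hr i _ ⟨by linarith, by linarith⟩) ?_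
      rw [V11]
      obtain ⟨k, hk⟩ := D.ends i
      rw [hk]; exact hφ k
    · rw [Xm i t ⟨h1.le, h2.le⟩]; exact hr i t ht

end BraidDiagram

end Braidoids

namespace Braidoids
open Set

/-! ### Opening a strand -/

theorem GoodAt.snoc {n : ℕ} {X : Fin n → ℝ → ℝ} {h : ℝ → ℝ} {t : ℝ} (hX : GoodAt X t)
    (hh : ∀ k, h t = X k t → t ∈ Ioo (0 : ℝ) 1 ∧ TransAt (fun r => h r - X k r) t ∧
      ∀ k', h t = X k' t → k' = k) :
    GoodAt (fun c : Fin (n + 1) => Fin.lastCases (motive := fun _ => ℝ → ℝ) h X c) t where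
  inner i j hij hx := by
    induction i using Fin.lastCases <;> induction j using Fin.lastCases <;>
      simp only [Fin.lastCases_last, Fin.lastCases_castSucc, ne_eq, not_true] at hij hx
    · exact (hh _ hx).1
    · exact (hh _ hx.symm).1
    · exact hX.inner _ _ (fun h => hij (congrArg _ h)) hx
  trans i j hij hx := by
    induction i using Fin.lastCases <;> induction j using Fin.lastCases <;>
      simp only [Fin.lastCases_last, Fin.lastCases_castSucc, ne_eq, not_true] at hij hx ⊢
    · exact (hh _ hx).2.1
    · exact (hh _ hx.symm).2.1.swap
    · exact hX.trans _ _ (fun h => hij (congrArg _ h)) hx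
  double i j k hij hik h1 h2 := by
    induction i using Fin.lastCases <;> induction j using Fin.lastCases <;>
      induction k using Fin.lastCases <;>
      simp only [Fin.lastCases_last, Fin.lastCases_castSucc, ne_eq, not_true] at hij hik h1 h2
    · rw [(hh _ h1).2.2 _ h2]
    · rfl
    · exact absurd ((hh _ h1.symm).2.2 _ (h1.symm.trans h2)) fun h => hik (h ▸ rfl)
    · exact absurd ((hh _ h2.symm).2.2 _ (h2.symm.trans h1)) fun h => hij (h ▸ rfl)
    · rw [hX.double _ _ _ (fun h => hij (congrArg _ h)) (fun h => hik (congrArg _ h)) h1 h2]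

variable {n : ℕ} {D : BraidDiagram n} {i : Fin n} {t₁ t₂ x₀ : ℝ}

/-- The data at which a strand is opened: the strand `i` is affine between the heights `t₁` and
`t₂`, nothing else lies near this segment, and the vertical line at `x₀` meets the segment, and
the rest of the diagram in general position. -/
structure CanOpen (D : BraidDiagram n) (i : Fin n) (t₁ t₂ x₀ : ℝ) : Prop where
  pos : 0 < t₁
  lt : t₁ < t₂
  lt_one : t₂ < 1
  between : (D.x i t₁ < x₀ ∧ x₀ < D.x i t₂) ∨ (D.x i t₂ < x₀ ∧ x₀ < D.x i t₁)
  aff : AffineOn (D.x i) t₁ t₂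
  box : ∀ j, j ≠ i → ∀ t ∈ Icc t₁ t₂, D.x j t ∉ uIcc (D.x i t₁) (D.x i t₂)
  gen : ∀ j, ∀ t ∈ Icc (0 : ℝ) 1, (j = i → t ∉ Icc t₁ t₂) → D.x j t = x₀ →
    t ∈ Ioo (0 : ℝ) 1 ∧ TransAt (fun r => D.x j r - x₀) t ∧ ∀ k, D.x k t = x₀ → k = j

/-- The strand of `D` of which a strand of the opened diagram contains a part. The numbering is that
of `BraidDiagram.Opening`: the upper part of the opened strand keeps its number `i.castSucc`, and the
lower part is the last strand. -/
def openedFrom (i : Fin n) : Fin (n + 1) → Fin n :=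
  Fin.lastCases (motive := fun _ => Fin n) i id

@[simp] theorem openedFrom_last (i : Fin n) : openedFrom i (Fin.last n) = i := by
  simp [openedFrom]

@[simp] theorem openedFrom_castSucc (i j : Fin n) : openedFrom i j.castSucc = j := by
  simp [openedFrom]

/-- The height `t` of a strand of the opened diagram is on one of the two new arcs. -/
def OpenedNew (i : Fin n) (t₁ t₂ : ℝ) (c : Fin (n + 1)) (t : ℝ) : Prop :=
  (c = i.castSucc ∧ t₁ ≤ t) ∨ (c = Fin.last n ∧ t ≤ t₂)

theorem exists_opening (h : CanOpen D i t₁ t₂ x₀) (s : SignType) :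
    ∃ D' : BraidDiagram (n + 1), D.Opening D' i t₁ t₂ x₀ ∧ D.LMove s D' ∧
      (∀ c t, t ∈ Icc (0 : ℝ) 1 → ¬ OpenedNew i t₁ t₂ c t →
        D'.x c t = D.x (openedFrom i c) t) ∧
      (∀ c c' t, ¬ OpenedNew i t₁ t₂ c t → ¬ OpenedNew i t₁ t₂ c' t →
        D'.sign c c' t = D.sign (openedFrom i c) (openedFrom i c') t) ∧
      (∀ c c' t, OpenedNew i t₁ t₂ c t → D'.Crosses c c' t → D'.sign c c' t = s) ∧
      (Adm s D.toStrandDiagram → Adm s D'.toStrandDiagram) ∧ (D.Roomy → D'.Roomy) := by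
  classical
  obtain ⟨h0, h12, h1, hbt, aff, box, gen⟩ := h
  have m1 : t₁ ∈ Icc t₁ t₂ := ⟨le_rfl, h12.le⟩
  have m2 : t₂ ∈ Icc t₁ t₂ := ⟨h12.le, le_rfl⟩
  have hx0 : x₀ ∈ uIcc (D.x i t₁) (D.x i t₂) := by
    rw [mem_uIcc]
    rcases hbt with h | h
    · exact Or.inl ⟨h.1.le, h.2.le⟩
    · exact Or.inr ⟨h.1.le, h.2.le⟩
  have hx1 : D.x i t₁ ∈ uIcc (D.x i t₁) (D.x i t₂) := left_mem_uIcc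
  have hx2 : D.x i t₂ ∈ uIcc (D.x i t₁) (D.x i t₂) := right_mem_uIcc
  -- the upper part `U` and the lower part `W` of the strand `i`
  let U : ℝ → ℝ := fun t => if t ≤ t₁ then D.x i t else
    if t < t₂ then line t₁ (D.x i t₁) t₂ x₀ t else x₀
  let W : ℝ → ℝ := fun t => if t ≤ t₁ then x₀ else
    if t < t₂ then line t₁ x₀ t₂ (D.x i t₂) t else D.x i t
  have U1 : ∀ {t}, t ≤ t₁ → U t = D.x i t := fun h => if_pos h
  have W1 : ∀ {t}, t ≤ t₁ → W t = x₀ := fun h => if_pos h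
  have U2 : ∀ {t}, t₂ ≤ t → U t = x₀ := fun h =>
    (if_neg (by linarith)).trans (if_neg (not_lt.2 h))
  have W2 : ∀ {t}, t₂ ≤ t → W t = D.x i t := fun h =>
    (if_neg (by linarith)).trans (if_neg (not_lt.2 h))
  have Um : AffineOn U t₁ t₂ := (line_affine t₁ (D.x i t₁) t₂ x₀ _ _).congr fun t ht => by
    rcases eq_or_lt_of_le ht.1 with rfl | h3
    · rw [line_left, U1 le_rfl]
    rcases eq_or_lt_of_le ht.2 with rfl | h4
    · rw [line_right h3, U2 le_rfl]
    · exact (if_neg (not_le.2 h3)).trans (if_pos h4)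
  have Wm : AffineOn W t₁ t₂ := (line_affine t₁ x₀ t₂ (D.x i t₂) _ _).congr fun t ht => by
    rcases eq_or_lt_of_le ht.1 with rfl | h3
    · rw [line_left, W1 le_rfl]
    rcases eq_or_lt_of_le ht.2 with rfl | h4
    · rw [line_right h3, W2 le_rfl]
    · exact (if_neg (not_le.2 h3)).trans (if_pos h4)
  have UW : ∀ t ∈ Icc t₁ t₂, U t ≠ W t := fun t ht => by
    rcases hbt with h | h
    · exact (Um.lt Wm ht (by rw [U1 le_rfl, W1 le_rfl]; exact h.1)
        (by rw [U2 le_rfl, W2 le_rfl]; exact h.2)).ne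
    · exact (Wm.lt Um ht (by rw [U1 le_rfl, W1 le_rfl]; exact h.2)
        (by rw [U2 le_rfl, W2 le_rfl]; exact h.1)).ne'
  have Ubox : ∀ t ∈ Icc t₁ t₂, U t ∈ uIcc (D.x i t₁) (D.x i t₂) := fun t ht =>
    Um.mem_uIcc ht (by rw [U1 le_rfl]; exact hx1) (by rw [U2 le_rfl]; exact hx0)
  have Wbox : ∀ t ∈ Icc t₁ t₂, W t ∈ uIcc (D.x i t₁) (D.x i t₂) := fun t ht =>
    Wm.mem_uIcc ht (by rw [W1 le_rfl]; exact hx0) (by rw [W2 le_rfl]; exact hx2)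
  let X : Fin (n + 1) → ℝ → ℝ := Fin.lastCases (motive := fun _ => ℝ → ℝ) W
    (Function.update D.x i U)
  have Xl : X (Fin.last n) = W := by simp [X]
  have Xi : X i.castSucc = U := by simp [X]
  have Xj : ∀ j, j ≠ i → X j.castSucc = D.x j := fun j hj => by simp [X, hj]
  have Xold : ∀ c t, ¬ OpenedNew i t₁ t₂ c t → X c t = D.x (openedFrom i c) t := by
    intro c t hc
    unfold OpenedNew at hc
    push Not at hc
    induction c using Fin.lastCases with
    | last => rw [Xl, W2 (hc.2 rfl).le, openedFrom_last]
    | cast j =>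
      rw [openedFrom_castSucc]
      by_cases hj : j = i
      · subst hj; rw [Xi, U1 (hc.1 rfl).le]
      · rw [Xj j hj]
  -- nothing meets the new arcs between the two heights
  have mid : ∀ c c' t, t ∈ Icc t₁ t₂ → c ≠ c' → X c t = X c' t →
      ∃ j k, j ≠ i ∧ k ≠ i ∧ c = j.castSucc ∧ c' = k.castSucc := by
    intro c c' t ht hcc hx
    have nU : ∀ j, j ≠ i → U t ≠ D.x j t := fun j hj h => box j hj t ht (h ▸ Ubox t ht)
    have nW : ∀ j, j ≠ i → W t ≠ D.x j t := fun j hj h => box j hj t ht (h ▸ Wbox t ht)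
    induction c using Fin.lastCases with
    | last =>
      induction c' using Fin.lastCases with
      | last => exact absurd rfl hcc
      | cast k =>
        by_cases hk : k = i
        · subst hk; rw [Xl, Xi] at hx; exact absurd hx.symm (UW t ht)
        · rw [Xl, Xj k hk] at hx; exact absurd hx (nW k hk)
    | cast j =>
      induction c' using Fin.lastCases with
      | last =>
        by_cases hj : j = i
        · subst hj; rw [Xl, Xi] at hx; exact absurd hx (UW t ht)
        · rw [Xl, Xj j hj] at hx; exact absurd hx.symm (nW j hj)
      | cast k =>
        by_cases hj : j = i
        · subst hj
          have hk : k ≠ j := fun h => hcc (h ▸ rfl)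
          rw [Xi, Xj k hk] at hx; exact absurd hx (nU k hk)
        by_cases hk : k = i
        · subst hk
          rw [Xi, Xj j hj] at hx; exact absurd hx.symm (nU j hj)
        exact ⟨j, k, hj, hk, rfl, rfl⟩
  have good : ∀ t ∈ Icc (0 : ℝ) 1, t ∉ Icc t₁ t₂ →
      GoodAt (fun c : Fin (n + 1) => Fin.lastCases (motive := fun _ => ℝ → ℝ)
        (fun _ => x₀) D.x c) t := by
    intro t ht htn
    refine (D.fam.good t ht).snoc fun k hk => ?_
    obtain ⟨g1, g2, g3⟩ := gen k t ht (fun _ => htn) hk.symm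
    exact ⟨g1, g2.swap, fun k' hk' => g3 k' hk'.symm⟩
  have hF : Fam X := by
    refine ⟨fun c => ?_, fun c t ht => ?_, fun t ht => ?_⟩
    · obtain ⟨T, hT, -⟩ := (D.fam.pl i).common (D.fam.pl i)
      have hT' : PolyOn (insert t₁ (insert t₂ T)) (D.x i) 0 1 :=
        hT.mono ((Finset.subset_insert _ _).trans (Finset.subset_insert _ _))
      have c1 : PolyOn (insert t₁ (insert t₂ T)) (fun _ => x₀) 0 1 := PolyOn.const _ _ _ _
      induction c using Fin.lastCases with
      | last =>
        rw [Xl]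
        exact ((((c1.sub_interval le_rfl (by linarith)).congr fun t ht => W1 ht.2).append
          (fun s u hs hsu hu _ => Wm.mono hs hu) (by simp)).append
          ((hT'.sub_interval (by linarith) le_rfl).congr fun t ht => W2 ht.1) (by simp)).pl
      | cast j =>
        by_cases hj : j = i
        · subst hj
          rw [Xi]
          exact ((((hT'.sub_interval le_rfl (by linarith)).congr fun t ht => U1 ht.2).append
            (fun s u hs hsu hu _ => Um.mono hs hu) (by simp)).append
            ((c1.sub_interval (by linarith) le_rfl).congr fun t ht => U2 ht.1) (by simp)).pl
        · rw [Xj j hj]; exact D.fam.pl j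
    · have b1 := D.fam.mem i t₁ ⟨h0.le, by linarith⟩
      have b2 := D.fam.mem i t₂ ⟨by linarith, h1.le⟩
      have sub : uIcc (D.x i t₁) (D.x i t₂) ⊆ Icc 0 1 := uIcc_subset_Icc b1 b2
      by_cases hc : OpenedNew i t₁ t₂ c t
      · rcases hc with ⟨rfl, hc⟩ | ⟨rfl, hc⟩
        · rw [Xi]
          rcases le_or_gt t t₂ with h | h
          · exact sub (Ubox t ⟨hc, h⟩)
          · rw [U2 h.le]; exact sub hx0
        · rw [Xl]
          rcases le_or_gt t₁ t with h | h
          · exact sub (Wbox t ⟨h, hc⟩)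
          · rw [W1 h.le]; exact sub hx0
      · rw [Xold c t hc]; exact D.fam.mem _ t ht
    · by_cases htm : t ∈ Icc t₁ t₂
      · refine ⟨fun c c' hcc hx => ⟨by linarith [htm.1], by linarith [htm.2]⟩,
          fun c c' hcc hx => ?_, fun c c' c'' h2 h3 hx hx' => ?_⟩
        · obtain ⟨j, k, hj, hk, rfl, rfl⟩ := mid c c' t htm hcc hx
          rw [Xj j hj, Xj k hk] at hx ⊢
          exact (D.fam.good t ht).trans j k (fun h => hcc (h ▸ rfl)) hx
        · obtain ⟨j, k, hj, hk, rfl, rfl⟩ := mid c c' t htm h2 hx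
          obtain ⟨j', l, -, hl, hjj, rfl⟩ := mid _ c'' t htm h3 hx'
          rw [Xj j hj, Xj k hk] at hx
          rw [Xj j hj, Xj l hl] at hx'
          rw [(D.fam.good t ht).double j k l (fun h => h2 (h ▸ rfl)) (fun h => h3 (h ▸ rfl)) hx hx']
      · have g := good t ht htm
        rcases lt_or_ge t t₁ with h | h
        · have key : ∀ r, r < t₁ → ∀ c, X c r =
              Fin.lastCases (motive := fun _ => ℝ → ℝ) (fun _ => x₀) D.x c r := by
            intro r hr c
            induction c using Fin.lastCases with
            | last => rw [Xl, W1 hr.le, Fin.lastCases_last]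
            | cast j =>
              rw [Fin.lastCases_castSucc]
              by_cases hj : j = i
              · subst hj; rw [Xi, U1 hr.le]
              · rw [Xj j hj]
          refine g.congr (key t h) fun _ c => ?_
          filter_upwards [isOpen_Iio.mem_nhds h] with r hr using key r hr c
        · have h' : t₂ < t := not_le.1 fun h' => htm ⟨h, h'⟩
          have key : ∀ r, t₂ < r → ∀ c, X c r =
              Fin.lastCases (motive := fun _ => ℝ → ℝ) (fun _ => x₀) D.x
                (Equiv.swap i.castSucc (Fin.last n) c) r := by
            intro r hr c
            induction c using Fin.lastCases with
            | last => rw [Xl, W2 hr.le, Equiv.swap_apply_right, Fin.lastCases_castSucc]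
            | cast j =>
              by_cases hj : j = i
              · subst hj; rw [Xi, U2 hr.le, Equiv.swap_apply_left, Fin.lastCases_last]
              · rw [Xj j hj, Equiv.swap_apply_of_ne_of_ne
                  (fun h => hj (Fin.castSucc_injective _ h)) (Fin.castSucc_lt_last j).ne,
                  Fin.lastCases_castSucc]
          refine (g.perm (Equiv.swap i.castSucc (Fin.last n)).injective).congr (key t h')
            fun _ c => ?_
          filter_upwards [isOpen_Ioi.mem_nhds h'] with r hr using key r hr c
  let D' : BraidDiagram (n + 1) := hF.braid (Nat.succ_pos n)
    (fun c => by
      induction c using Fin.lastCases with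
      | last =>
        obtain ⟨j, hj⟩ := D.ends i
        refine ⟨j.castSucc, ?_⟩
        rw [Xl, W2 h1.le, hj]
        by_cases h : j = i
        · subst h; rw [Xi, U1 h0.le]
        · rw [Xj j h]
      | cast k =>
        by_cases h : k = i
        · subst h; exact ⟨Fin.last n, by rw [Xi, Xl, U2 h1.le, W1 h0.le]⟩
        · obtain ⟨j, hj⟩ := D.ends k
          refine ⟨j.castSucc, ?_⟩
          rw [Xj k h, hj]
          by_cases h : j = i
          · subst h; rw [Xi, U1 h0.le]
          · rw [Xj j h])
    (overlay (OpenedNew i t₁ t₂) s fun c c' t => D.sign (openedFrom i c) (openedFrom i c') t)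
    (overlay_symm fun c c' t => D.sign_symm _ _ _)
  have cr : ∀ {c c' t}, D'.Crosses c c' t ↔ c ≠ c' ∧ t ∈ Icc (0 : ℝ) 1 ∧ X c t = X c' t :=
    D'.crosses_iff
  have sold : ∀ c c' t, ¬ OpenedNew i t₁ t₂ c t → ¬ OpenedNew i t₁ t₂ c' t →
      D'.sign c c' t = D.sign (openedFrom i c) (openedFrom i c') t := by
    intro c c' t a b
    change overlay _ s (fun c c' t => D.sign (openedFrom i c) (openedFrom i c') t) _ _ _ = _
    exact overlay_base a b
  have both : ∀ c c' t, OpenedNew i t₁ t₂ c t → D'.Crosses c c' t → ¬ OpenedNew i t₁ t₂ c' t := by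
    intro c c' t a hc b
    rw [cr] at hc
    have ht : t ∈ Icc t₁ t₂ := by
      rcases a with ⟨a, a'⟩ | ⟨a, a'⟩ <;> rcases b with ⟨b, b'⟩ | ⟨b, b'⟩
      · exact absurd (a.trans b.symm) hc.1
      · exact ⟨a', b'⟩
      · exact ⟨b', a'⟩
      · exact absurd (a.trans b.symm) hc.1
    obtain ⟨j, k, hj, -, rfl, -⟩ := mid c c' t ht hc.1 hc.2.2
    rcases a with ⟨a, -⟩ | ⟨a, -⟩
    · exact hj (Fin.castSucc_injective _ a)
    · exact (Fin.castSucc_lt_last j).ne a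
  have snew : ∀ c c' t, OpenedNew i t₁ t₂ c t → D'.Crosses c c' t → D'.sign c c' t = s := by
    intro c c' t a hc
    change overlay _ s (fun c c' t => D.sign (openedFrom i c) (openedFrom i c') t) _ _ _ = _
    exact overlay_left a (both c c' t a hc)
  have free : ∀ j t, t ∈ Icc t₁ t₂ → ¬ D.Crosses i j t := fun j t ht hc => by
    rw [D.crosses_iff] at hc
    exact box j hc.1.symm t ht (hc.2.2 ▸ aff.mem_uIcc ht hx1 hx2)
  have notnew : ∀ j t, j ≠ i → ¬ OpenedNew i t₁ t₂ j.castSucc t := fun j t hj h => by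
    rcases h with ⟨a, -⟩ | ⟨a, -⟩
    · exact hj (Fin.castSucc_injective _ a)
    · exact (Fin.castSucc_lt_last j).ne a
  have hop : D.Opening D' i t₁ t₂ x₀ := by
    refine ⟨h0, h12, h1, free, fun j hj t _ => congrFun (Xj j hj) t, fun t ht => ?_, ?_,
      fun t ht => ?_, fun t ht => ?_, ?_, fun t ht => ?_, fun j k t hj hk _ => ?_,
      fun k t ht hc => ?_, fun k t ht hc => ?_⟩
    · exact (congrFun Xi t).trans (U1 ht.2)
    · exact Um.congr fun t _ => congrFun Xi t
    · exact (congrFun Xi t).trans (U2 ht.1)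
    · exact (congrFun Xl t).trans (W1 ht.2)
    · exact Wm.congr fun t _ => congrFun Xl t
    · exact (congrFun Xl t).trans (W2 ht.1)
    · rw [sold _ _ t (notnew j t hj) (notnew k t hk), openedFrom_castSucc, openedFrom_castSucc]
    · have h : t < t₁ := lt_of_le_of_ne ht fun h => free k t (h ▸ m1) hc
      rw [sold _ _ t _ (notnew k t hc.1.symm), openedFrom_castSucc, openedFrom_castSucc]
      rintro (⟨-, a⟩ | ⟨a, -⟩)
      · exact absurd a (not_le.2 h)
      · exact (Fin.castSucc_lt_last i).ne a
    · have h : t₂ < t := lt_of_le_of_ne ht fun h => free k t (h ▸ m2) hc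
      rw [sold _ _ t _ (notnew k t hc.1.symm), openedFrom_last, openedFrom_castSucc]
      rintro (⟨a, -⟩ | ⟨-, a⟩)
      · exact (Fin.castSucc_lt_last i).ne' a
      · exact absurd a (not_le.2 h)
  refine ⟨D', hop, ⟨i, t₁, t₂, x₀, hop, hbt, fun k t ht => snew _ k t (Or.inl ⟨rfl, ht⟩),
    fun k t ht => snew _ k t (Or.inr ⟨rfl, ht⟩)⟩, fun c t _ => Xold c t, sold, snew,
    fun hA hs c c' t hc => ?_, fun hr c t ht => ?_⟩
  · by_cases a : OpenedNew i t₁ t₂ c t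
    · rwa [snew c c' t a hc]
    by_cases b : OpenedNew i t₁ t₂ c' t
    · rw [D'.sign_symm, snew c' c t b hc.symm]; simpa using hs
    rw [sold c c' t a b]
    rw [cr, Xold c t a, Xold c' t b] at hc
    refine hA hs _ _ t (D.crosses_iff.2 ⟨fun e => ?_, hc.2⟩)
    unfold OpenedNew at a b
    push Not at a b
    induction c using Fin.lastCases with
    | last =>
      induction c' using Fin.lastCases with
      | last => exact hc.1 rfl
      | cast k =>
        rw [openedFrom_last, openedFrom_castSucc] at e
        linarith [a.2 rfl, b.1 (by rw [e])]
    | cast j =>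
      induction c' using Fin.lastCases with
      | last =>
        rw [openedFrom_last, openedFrom_castSucc] at e
        linarith [b.2 rfl, a.1 (by rw [e])]
      | cast k =>
        rw [openedFrom_castSucc, openedFrom_castSucc] at e
        exact hc.1 (by rw [e])
  · have sub : uIcc (D.x i t₁) (D.x i t₂) ⊆ Ioo 0 1 :=
      OrdConnected.uIcc_subset ordConnected_Ioo (hr i t₁ ⟨h0.le, by linarith⟩)
        (hr i t₂ ⟨by linarith, h1.le⟩)
    change X c t ∈ _
    by_cases hc : OpenedNew i t₁ t₂ c t
    · rcases hc with ⟨rfl, hc⟩ | ⟨rfl, hc⟩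
      · rw [Xi]
        rcases le_or_gt t t₂ with h | h
        · exact sub (Ubox t ⟨hc, h⟩)
        · rw [U2 h.le]; exact sub hx0
      · rw [Xl]
        rcases le_or_gt t₁ t with h | h
        · exact sub (Wbox t ⟨h, hc⟩)
        · rw [W1 h.le]; exact sub hx0
    · rw [Xold c t hc]; exact hr _ t ht

end Braidoids

namespace Braidoids
open Set OpenBraid

variable {m n : ℕ} {B : OpenBraid m} {f : Fin m → Fin n} {s : SignType} {D : BraidDiagram n}

/-- The strands `g c` of `E` have the crossings among each other that a closure of `B` has. -/
structure ClosIn {N : ℕ} (s : SignType) (B : OpenBraid m) (f : Fin m → Fin n) (E : BraidDiagram N)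
    (g : Fin n → Fin N) : Prop where
  sign_eq : ∀ i j t, B.Crosses i j t → E.sign (g (f i)) (g (f j)) t = B.sign i j t
  x_eq : ∀ i, ∀ t ∈ Icc (B.a i) (B.b i), E.x (g (f i)) t = B.x i t
  sign_new : ∀ c c' t, E.Crosses (g c) (g c') t → B.New f c t → E.sign (g c) (g c') t = s

theorem ClosIn.sign_congr {N : ℕ} {E E' : BraidDiagram N} {g : Fin n → Fin N}
    (h : ClosIn s B f E g) (h' : ClosIn s B f E' g) {c c' : Fin n} {t : ℝ}
    (hc : E.Crosses (g c) (g c') t) (hc' : E'.Crosses (g c) (g c') t) :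
    E'.sign (g c) (g c') t = E.sign (g c) (g c') t := by
  by_cases hn : B.New f c t
  · rw [h.sign_new c c' t hc hn, h'.sign_new c c' t hc' hn]
  by_cases hn' : B.New f c' t
  · rw [E.sign_symm, E'.sign_symm, h.sign_new c' c t hc.symm hn', h'.sign_new c' c t hc'.symm hn']
  obtain ⟨i, rfl, hi⟩ := exists_old hn
  obtain ⟨j, rfl, hj⟩ := exists_old hn'
  rw [E.crosses_iff] at hc
  have hB : B.Crosses i j t := ⟨fun e => hc.1 (e ▸ rfl), hi, hj, by
    rw [← h.x_eq i t hi, ← h.x_eq j t hj, hc.2.2]⟩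
  rw [h.sign_eq i j t hB, h'.sign_eq i j t hB]

theorem Clos.closIn (h : Clos s B D f) {N : ℕ} {E : BraidDiagram N} {g : Fin n → Fin N}
    {O : Fin n → ℝ → Prop} (hO : ∀ c t, O c t → B.New f c t)
    (hx : ∀ c t, t ∈ Icc (0 : ℝ) 1 → ¬ O c t → E.x (g c) t = D.x c t)
    (hs : ∀ c c' t, ¬ O c t → ¬ O c' t → E.sign (g c) (g c') t = D.sign c c' t)
    (hn : ∀ c d t, O c t → E.Crosses (g c) d t → E.sign (g c) d t = s) :
    ClosIn s B f E g := by
  have old : ∀ i t, t ∈ Icc (B.a i) (B.b i) → ¬ O (f i) t := fun i t hi ho =>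
    not_new hi (hO _ _ ho)
  refine ⟨fun i j t hc => ?_, fun i t hi => ?_, fun c c' t hc hN => ?_⟩
  · rw [hs _ _ t (old i t hc.2.1) (old j t hc.2.2.1), h.sign_eq i j t hc]
  · rw [hx _ t (sub_unit B hi) (old i t hi), h.x_eq i t hi]
  · by_cases ho : O c t
    · exact hn c _ t ho hc
    have hc' := E.crosses_iff.1 hc
    have ho' : ¬ O c' t := fun ho' => hc'.1 (congrArg g (h.lab.new_unique hc'.2.1 hN (hO _ _ ho')))
    rw [hs c c' t ho ho']
    refine h.sign_new c c' t (D.crosses_iff.2 ⟨fun e => hc'.1 (congrArg g e), hc'.2.1, ?_⟩) hN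
    rw [← hx c t hc'.2.1 ho, ← hx c' t hc'.2.1 ho', hc'.2.2]

theorem BraidDiagram.Opening.poly {D' : BraidDiagram (n + 1)} {i : Fin n} {t₁ t₂ x₀ : ℝ}
    (h : D.Opening D' i t₁ t₂ x₀) {T : Finset ℝ} (hT : ∀ c, PolyOn T (D.x c) 0 1) (h1 : t₁ ∈ T)
    (h2 : t₂ ∈ T) (c : Fin (n + 1)) : PolyOn T (D'.x c) 0 1 := by
  have p1 := h.pos
  have p2 := h.lt
  have p3 := h.lt_one
  induction c using Fin.lastCases with
  | last =>
    exact ((((PolyOn.const T x₀ 0 1).sub_interval le_rfl (by linarith)).congr h.lower_new).append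
      (fun s u hs hsu hu _ => h.lower_mid.mono hs hu) h1).append
      (((hT i).sub_interval (by linarith) le_rfl).congr h.lower_old) h2
  | cast j =>
    by_cases hj : j = i
    · subst hj
      exact ((((hT j).sub_interval le_rfl (by linarith)).congr h.upper_old).append
        (fun s u hs hsu hu _ => h.upper_mid.mono hs hu) h1).append
        (((PolyOn.const T x₀ 0 1).sub_interval (by linarith) le_rfl).congr h.upper_new) h2
    · exact (hT j).congr (h.other j hj)

theorem exists_bounds_of_finite (S : Finset ℝ) (h : ∀ y ∈ S, y ∈ Ioo (0 : ℝ) 1) :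
    ∃ δ, 0 < δ ∧ δ < 1 / 2 ∧ ∀ y ∈ S, δ < y ∧ y < 1 - δ := by
  obtain ⟨u, h1, h2, h3⟩ := Ioo_disjoint_of_finite S 0 (b := 1 / 2) (by norm_num)
  obtain ⟨u', h1', h2', h3'⟩ := Ioo_disjoint_of_finite' S 1 (b := 1 / 2) (by norm_num)
  refine ⟨min u (1 - u'), lt_min h1 (by linarith), (min_le_left _ _).trans_lt h2, fun y hy => ?_⟩
  have a := h3 y hy
  have b := h3' y hy
  have c := h y hy
  have e1 := min_le_left u (1 - u')
  have e2 := min_le_right u (1 - u')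
  have : u < y := not_le.1 fun h => a ⟨c.1, h⟩
  have : y < u' := not_le.1 fun h => b ⟨h, c.2⟩
  exact ⟨by linarith, by linarith⟩

/-- The strands keep a distance from the vertical sides of the square. -/
theorem OpenBraid.Roomy.exists_margin (hB : B.Roomy) : ∃ δ, 0 < δ ∧ δ < 1 / 2 ∧
    ∀ i, ∀ t ∈ Icc (B.a i) (B.b i), δ < B.x i t ∧ B.x i t < 1 - δ := by
  classical
  obtain ⟨T, hT⟩ := exists_isGrid B.toStrandDiagram
  obtain ⟨δ, h0, h1, h2⟩ := exists_bounds_of_finite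
    (Finset.univ.biUnion fun i => (T.filter fun τ => τ ∈ Icc (B.a i) (B.b i)).image (B.x i))
    (fun y hy => by
      simp only [Finset.mem_biUnion, Finset.mem_image, Finset.mem_filter] at hy
      obtain ⟨i, -, τ, ⟨-, hτ⟩, rfl⟩ := hy
      exact hB i τ hτ)
  have key : ∀ i, ∀ τ ∈ T, τ ∈ Icc (B.a i) (B.b i) → δ < B.x i τ ∧ B.x i τ < 1 - δ :=
    fun i τ hτ hi => h2 _ (Finset.mem_biUnion.2 ⟨i, Finset.mem_univ _,
      Finset.mem_image.2 ⟨τ, Finset.mem_filter.2 ⟨hτ, hi⟩, rfl⟩⟩)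
  exact ⟨δ, h0, h1, fun i t ht =>
    ⟨(PolyOn.const T δ _ _).lt (hT.poly i) (hT.a_mem i) (hT.b_mem i)
      (fun τ a b => (key i τ a b).1) ht,
    (hT.poly i).lt (PolyOn.const T (1 - δ) _ _) (hT.a_mem i) (hT.b_mem i)
      (fun τ a b => (key i τ a b).2) ht⟩⟩

/-- The new ends of a closure can be moved a little, in order to avoid a finite set of
positions. -/
theorem Clos.exists_shift (h : Clos s B D f) (hA : Adm s B.toStrandDiagram) (hr : D.Roomy)
    (hpq : B.p ≤ B.q) (F : Finset ℝ) :
    ∃ D' : BraidDiagram n, Clos s B D' f ∧ D'.Roomy ∧ D'.x (f B.leg) 0 ∉ F ∧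
      R s ⟨n, D⟩ ⟨n, D'⟩ := by
  classical
  have m0 : (0 : ℝ) ∈ Icc (0 : ℝ) 1 := ⟨le_rfl, zero_le_one⟩
  have m1 : (1 : ℝ) ∈ Icc (0 : ℝ) 1 := ⟨zero_le_one, le_rfl⟩
  obtain ⟨y, h1, h2, h3⟩ := Ioo_disjoint_of_finite (F ∪ Finset.univ.image fun i => D.x i 0)
    (D.x (f B.leg) 0) (hr (f B.leg) 0 m0).2
  have hend : ∀ i, D.x i 0 ∉ Ioc (D.x (f B.leg) 0) y := fun i => h3 _ (by simp)
  have hy : y ∈ Ioo (0 : ℝ) 1 := ⟨(hr (f B.leg) 0 m0).1.trans h1, h2⟩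
  obtain ⟨ε, D', e0, eb, e2, ord, sg, mid, top, bot, top', bot', room⟩ := D.exists_move_ends
    (fun x => if x = D.x (f B.leg) 0 then y else x)
    (fun i j hij => by
      split_ifs with hi hj hj
      · linarith
      · exact not_le.1 fun h => hend j ⟨by rw [← hi]; exact hij, h⟩
      · linarith
      · exact hij)
    (fun i => by
      split_ifs
      · exact ⟨hy.1.le, hy.2.le⟩
      · exact D.fam.mem i 0 m0) (b := min B.p (1 - B.q))
    (lt_min B.leg_pos (by linarith [B.head_lt]))
  have ep : ε < B.p := eb.trans_le (min_le_left _ _)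
  have eq' : ε < 1 - B.q := eb.trans_le (min_le_right _ _)
  have hx : ∀ i, ∀ t ∈ Icc (B.a i) (B.b i), D'.x (f i) t = D.x (f i) t := by
    intro i t ht
    rcases le_or_gt t ε with h4 | h4
    · refine top' _ (if_neg fun e => ?_) t ⟨(sub_unit B ht).1, h4⟩
      have : f i = f B.leg := by
        by_contra hne
        exact lt_irrefl _ ((D.fam.good 0 m0).inner _ _ hne e).1
      have := h.lab.inj hpq this
      subst this
      linarith [ht.1]
    rcases le_or_gt (1 - ε) t with h5 | h5
    · refine bot' _ (if_neg fun e => ?_) t ⟨h5, (sub_unit B ht).2⟩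
      rw [h.ends hpq] at e
      have : f i = f B.head := by
        by_contra hne
        exact lt_irrefl _ ((D.fam.good 1 m1).inner _ _ hne e).2
      have := h.lab.inj hpq this
      subst this
      linarith [ht.2]
    · exact mid _ t ⟨h4.le, h5.le⟩
  have v0 : D'.x (f B.leg) 0 = y := by rw [top]; exact if_pos rfl
  have hcr : ∀ {i j t}, D'.Crosses i j t → D.Crosses i j t := fun hc => by
    rw [D'.crosses_iff] at hc
    refine D.crosses_iff.2 ⟨hc.1, hc.2.1, ?_⟩
    exact (BraidDiagram.PlanarIsotopic.eq_iff (e := Equiv.refl _) ord hc.2.1).2 hc.2.2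
  refine ⟨D', ⟨h.lab, fun _ => ?_, fun i t ht => by rw [hx i t ht, h.x_eq i t ht],
    fun i j t hc => by rw [sg]; exact h.sign_eq i j t hc,
    fun c j t hc hn => by rw [sg]; exact h.sign_new c j t (hcr hc) hn⟩,
    room hr fun i => ?_, fun hF => ?_, .of_planar ⟨Equiv.refl _, ord, fun i j t _ => by
      rw [sg]; rfl⟩ (h.adm hA)⟩
  · rw [v0, bot, ← h.ends hpq, if_pos rfl]
  · split_ifs
    · exact hy
    · exact hr i 0 m0
  · rw [v0] at hF
    exact h3 y (Finset.mem_union_left _ hF) ⟨h1, le_rfl⟩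

end Braidoids

namespace Braidoids
open Set OpenBraid

variable {m n : ℕ} {B : OpenBraid m} {f : Fin m → Fin n} {s : SignType} {D : BraidDiagram n}

/-- A vertical line in general position to the vertices of `B` meets `B` in general position. -/
theorem IsGrid.transAt_line {T : Finset ℝ} (hT : IsGrid B.toStrandDiagram T) {x₀ : ℝ}
    (gen : ∀ i, ∀ τ ∈ T, τ ∈ Icc (B.a i) (B.b i) → B.x i τ ≠ x₀) {i : Fin m} {t : ℝ}
    (ht : t ∈ Icc (B.a i) (B.b i)) (hx : B.x i t = x₀) :
    t ∈ Ioo (B.a i) (B.b i) ∧ TransAt (fun r => B.x i r - x₀) t :=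
  ((hT.poly i).sub (PolyOn.const T x₀ _ _)).transAt_of_ne (hT.a_mem i) (hT.b_mem i)
    (fun τ h1 h2 => sub_ne_zero.2 (gen i τ h1 h2)) ht (sub_eq_zero.2 hx)

theorem IsGrid.exists_with_line {T : Finset ℝ} (hT : IsGrid B.toStrandDiagram T) {x₀ : ℝ}
    (gen : ∀ i, ∀ τ ∈ T, τ ∈ Icc (B.a i) (B.b i) → B.x i τ ≠ x₀) :
    ∃ T', T ⊆ T' ∧ ∀ i, ∀ t ∈ Icc (B.a i) (B.b i), B.x i t = x₀ → t ∈ T' := by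
  classical
  have fin : ∀ i, {t | t ∈ Icc (B.a i) (B.b i) ∧ B.x i t - x₀ = 0}.Finite := fun i =>
    finite_zeros ((hT.poly i).sub (PolyOn.const T x₀ _ _)) (hT.a_mem i)
      fun t ht h0 => (hT.transAt_line gen ht (sub_eq_zero.1 h0)).2
  refine ⟨T ∪ Finset.univ.biUnion fun i => (fin i).toFinset, Finset.subset_union_left,
    fun i t ht hx => Finset.mem_union_right _ ?_⟩
  rw [Finset.mem_biUnion]
  exact ⟨i, Finset.mem_univ _, by simpa using ⟨ht, sub_eq_zero.2 hx⟩⟩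

theorem BraidDiagram.relabel_crosses {σ : Equiv.Perm (Fin n)} {i j : Fin n} {t : ℝ} :
    (D.relabel σ).Crosses i j t ↔ D.Crosses (σ i) (σ j) t := by
  rw [BraidDiagram.crosses_iff, BraidDiagram.crosses_iff, σ.injective.ne_iff]
  exact Iff.rfl

/-- The strand of the opened diagram that continues strand `j`; for the opened strand, this is its
lower part. -/
theorem openedFrom_swap (i j : Fin n) :
    openedFrom i (Equiv.swap i.castSucc (Fin.last n) j.castSucc) = j := by
  by_cases h : j = i
  · subst h; rw [Equiv.swap_apply_left, openedFrom_last]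
  · rw [Equiv.swap_apply_of_ne_of_ne (fun e => h (Fin.castSucc_injective _ e))
      (Fin.castSucc_lt_last j).ne, openedFrom_castSucc]

theorem openedNew_castSucc {i j : Fin n} {t₁ t₂ t : ℝ} :
    OpenedNew i t₁ t₂ j.castSucc t ↔ j = i ∧ t₁ ≤ t :=
  ⟨fun h => by
    rcases h with ⟨h, h'⟩ | ⟨h, -⟩
    · exact ⟨Fin.castSucc_injective _ h, h'⟩
    · exact absurd h (Fin.castSucc_lt_last j).ne, fun h => Or.inl ⟨h.1 ▸ rfl, h.2⟩⟩

theorem openedNew_swap {i j : Fin n} {t₁ t₂ t : ℝ} :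
    OpenedNew i t₁ t₂ (Equiv.swap i.castSucc (Fin.last n) j.castSucc) t ↔ j = i ∧ t ≤ t₂ := by
  by_cases h : j = i
  · subst h
    rw [Equiv.swap_apply_left]
    exact ⟨fun h => ⟨rfl, by
      rcases h with ⟨h, -⟩ | ⟨-, h⟩
      · exact absurd h (Fin.castSucc_lt_last j).ne'
      · exact h⟩, fun h => Or.inr ⟨rfl, h.2⟩⟩
  · rw [Equiv.swap_apply_of_ne_of_ne (fun e => h (Fin.castSucc_injective _ e))
      (Fin.castSucc_lt_last j).ne, openedNew_castSucc]
    simp [h]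

set_option maxHeartbeats 1000000 in
/-- The new ends of a closure can be moved to the left of everything else. The strand of the head is
opened near the bottom line at the new position, and, in another closure, the strand of the leg is
opened near the top line at the old position. The two results differ in one strand only, which joins
the new position to the old one and has only crossings of type `s`. -/
theorem Clos.exists_left (h : Clos s B D f) (hA : Adm s B.toStrandDiagram) (hB : B.Roomy)
    (hr : D.Roomy) (hpq : B.p ≤ B.q) {T₀ : Finset ℝ} (hT₀ : IsGrid B.toStrandDiagram T₀)
    (gen : ∀ i, ∀ τ ∈ T₀, τ ∈ Icc (B.a i) (B.b i) → B.x i τ ≠ D.x (f B.leg) 0) {δ δ' : ℝ}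
    (hδ : 0 < δ) (hδδ : δ < δ') (hδx : δ' < D.x (f B.leg) 0)
    (hδB : ∀ i, ∀ t ∈ Icc (B.a i) (B.b i), δ' < B.x i t) :
    ∃ D' : BraidDiagram n, Clos s B D' f ∧ D'.Roomy ∧ D'.x (f B.leg) 0 = δ ∧
      R s ⟨n, D⟩ ⟨n, D'⟩ := by
  classical
  have m0 : (0 : ℝ) ∈ Icc (0 : ℝ) 1 := ⟨le_rfl, zero_le_one⟩
  have m1 : (1 : ℝ) ∈ Icc (0 : ℝ) 1 := ⟨zero_le_one, le_rfl⟩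
  have hqp := not_lt.2 hpq
  have hp0 := B.leg_pos
  have hp1 := B.p_lt_one
  have hq0 := B.q_pos
  have hq1 := B.head_lt
  set x₀ := D.x (f B.leg) 0 with hx₀
  have x₀1 : x₀ < 1 := (hr (f B.leg) 0 m0).2
  obtain ⟨T₁, hT₀₁, hline⟩ := hT₀.exists_with_line gen
  have hT₁ := hT₀.mono hT₀₁
  -- the strands are opened between `t₁` and `t₂`, near the top line, or between `r₁` and `r₂`, near
  -- the bottom line
  obtain ⟨t₂, t₂0, t₂p, htop⟩ := Ioo_disjoint_of_finite T₁ 0 hp0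
  obtain ⟨r₁, r₁q, r₁1, hbot⟩ := Ioo_disjoint_of_finite' T₁ 1 hq1
  obtain ⟨t₁, t₁0, t₁₂⟩ := exists_between t₂0
  obtain ⟨r₂, r₁₂, r₂1⟩ := exists_between r₁1
  let S : Finset ℝ := (Finset.univ.image fun i => B.x i t₁) ∪ Finset.univ.image fun i => B.x i t₂
  obtain ⟨xp, xp0, xp1, hxp⟩ := Ioo_disjoint_of_finite S x₀ x₀1
  obtain ⟨xm, xm1, xm0, hxm⟩ := Ioo_disjoint_of_finite' S x₀ hδx
  -- the strands near the top line avoid the two positions near the old one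
  have near : ∀ i, ∀ t ∈ Icc (B.a i) (B.b i), t ∈ Icc t₁ t₂ → B.x i t < xm ∨ xp < B.x i t := by
    intro i t ht ht'
    have hi : i ≠ B.leg := by
      rintro rfl; linarith [ht.1, ht'.2]
    have ha : B.a i = 0 := B.a_eq i hi
    have hb : t₂ < B.b i := not_le.1 fun h' =>
      htop _ (hT₁.b_mem i) ⟨by linarith [ht.2, ht'.1], h'⟩
    have i1 : t₁ ∈ Icc (B.a i) (B.b i) := ⟨by linarith, by linarith⟩
    have i2 : t₂ ∈ Icc (B.a i) (B.b i) := ⟨by linarith, hb.le⟩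
    have aff : AffineOn (B.x i) t₁ t₂ := hT₁.poly i t₁ t₂ i1.1 t₁₂ i2.2
      fun r hr hr' => htop r hr ⟨by linarith [hr'.1], hr'.2.le⟩
    have nz : ∀ r ∈ Icc t₁ t₂, B.x i r ≠ x₀ := fun r hr he =>
      htop r (hline i r ⟨i1.1.trans hr.1, hr.2.trans i2.2⟩ he) ⟨by linarith [hr.1], hr.2⟩
    have far : ∀ r, B.x i r ∈ S → (B.x i r < x₀ → B.x i r < xm) ∧
        (x₀ < B.x i r → xp < B.x i r) := fun r hr =>
      ⟨fun h1 => not_le.1 fun h2 => hxm _ hr ⟨h2, h1⟩,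
        fun h1 => not_le.1 fun h2 => hxp _ hr ⟨h1, h2⟩⟩
    have f1 := far t₁ (by simp [S])
    have f2 := far t₂ (by simp [S])
    have n1 := nz t₁ ⟨le_rfl, t₁₂.le⟩
    have n2 := nz t₂ ⟨t₁₂.le, le_rfl⟩
    rcases lt_or_gt_of_ne n1 with g1 | g1 <;> rcases lt_or_gt_of_ne n2 with g2 | g2
    · exact Or.inl (aff.lt (AffineOn.const xm _ _) ht' (f1.1 g1) (f2.1 g2))
    · obtain ⟨r, hr, h0⟩ := (aff.sub (AffineOn.const x₀ _ _)).exists_zero t₁₂.le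
        (sub_neg.2 g1) (sub_nonneg.2 g2.le)
      exact absurd (sub_eq_zero.1 h0) (nz r hr)
    · obtain ⟨r, hr, h0⟩ := ((AffineOn.const x₀ _ _).sub aff).exists_zero t₁₂.le
        (sub_neg.2 g1) (sub_nonneg.2 g2.le)
      exact absurd (sub_eq_zero.1 h0).symm (nz r hr)
    · exact Or.inr ((AffineOn.const xp _ _).lt aff ht' (f1.2 g1) (f2.2 g2))
  let T : Finset ℝ := T₁ ∪ {t₁, t₂, r₁, r₂}
  have hT₁T : T₁ ⊆ T := Finset.subset_union_left
  have hT : IsGrid B.toStrandDiagram T := hT₁.mono hT₁T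
  have t₁T : t₁ ∈ T := by simp [T]
  have t₂T : t₂ ∈ T := by simp [T]
  have r₁T : r₁ ∈ T := by simp [T]
  have r₂T : r₂ ∈ T := by simp [T]
  have free12 : ∀ r ∈ T, r ∉ Ioo t₁ t₂ := by
    intro r hr hr'
    simp only [T, Finset.mem_union, Finset.mem_insert, Finset.mem_singleton] at hr
    rcases hr with hr | rfl | rfl | rfl | rfl
    · exact htop r hr ⟨by linarith [hr'.1], hr'.2.le⟩
    · exact lt_irrefl _ hr'.1
    · exact lt_irrefl _ hr'.2
    · linarith [hr'.2]
    · linarith [hr'.2]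
  have freer : ∀ r ∈ T, r ∉ Ioo r₁ r₂ := by
    intro r hr hr'
    simp only [T, Finset.mem_union, Finset.mem_insert, Finset.mem_singleton] at hr
    rcases hr with hr | rfl | rfl | rfl | rfl
    · exact hbot r hr ⟨hr'.1.le, by linarith [hr'.2]⟩
    · linarith [hr'.1]
    · linarith [hr'.1]
    · exact lt_irrefl _ hr'.1
    · exact lt_irrefl _ hr'.2
  have cell0 : ∀ r ∈ T, r ∈ Icc 0 t₁ → r = 0 ∨ r = t₁ := by
    intro r hr hr'
    simp only [T, Finset.mem_union, Finset.mem_insert, Finset.mem_singleton] at hr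
    rcases hr with hr | rfl | rfl | rfl | rfl
    · rcases eq_or_lt_of_le hr'.1 with h' | h'
      · exact Or.inl h'.symm
      · exact absurd ⟨h', by linarith [hr'.2]⟩ (htop r hr)
    · exact Or.inr rfl
    · linarith [hr'.2]
    · linarith [hr'.2]
    · linarith [hr'.2]
  -- the positions of the arcs of the two closures: `C₁` has its new ends at `x₀`, `C₂` at `δ`
  let w₁ : ℝ → ℝ := fun τ => if τ ≤ t₁ then x₀ else if τ ≤ t₂ then xp else if τ < B.p then δ' else
    if τ ≤ r₁ then δ / 2 else if τ < 1 then δ' else x₀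
  let w₂ : ℝ → ℝ := fun τ => if τ ≤ 0 then δ else if τ ≤ t₁ then xm else if τ ≤ t₂ then xp else
    if τ < B.p then δ' else if τ ≤ r₁ then δ / 2 else δ
  have val₁ : ∀ τ, w₁ τ ∈ Ioo 0 1 ∧ w₁ τ ≠ δ ∧ (x₀ ≤ w₁ τ → (w₁ τ = x₀ ∧ (τ ≤ t₁ ∨ 1 ≤ τ)) ∨
      (w₁ τ = xp ∧ τ ∈ Ioc t₁ t₂)) ∧ (¬ x₀ ≤ w₁ τ → w₁ τ ≤ δ') := by
    intro τ
    simp only [w₁]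
    split_ifs <;> refine ⟨⟨by linarith, by linarith⟩, by grind, ?_, ?_⟩ <;> grind
  have val₂ : ∀ τ, w₂ τ ∈ Ioo 0 1 ∧ w₂ τ ≠ x₀ ∧ (δ' < w₂ τ → τ ∈ Icc 0 t₂ ∧
      ((w₂ τ = xm ∧ τ ∈ Ioc 0 t₁) ∨ (w₂ τ = xp ∧ τ ∈ Ioc t₁ t₂))) := by
    intro τ
    simp only [w₂]
    split_ifs <;> refine ⟨⟨by linarith, by linarith⟩, by grind, ?_⟩ <;> grind
  have off₁ : ∀ τ ∈ T, B.Gap τ → ∀ i, τ ∈ Icc (B.a i) (B.b i) → w₁ τ ≠ B.x i τ := by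
    intro τ hτ _ i hi he
    obtain ⟨-, -, v1, v2⟩ := val₁ τ
    have g1 := hδB i τ hi
    have g2 := sub_unit B hi
    rw [he] at v1 v2
    rcases v1 (by_contra fun h' => by linarith [v2 h']) with ⟨h1, h2⟩ | ⟨h1, h2⟩
    · have h3 := hline i τ hi h1
      have h4 : τ ∈ T₀ := by
        rcases h2 with h2 | h2
        · rcases eq_or_lt_of_le g2.1 with h5 | h5
          · rw [← h5]; exact hT₀.zero
          · exact absurd ⟨h5, by linarith⟩ (htop τ h3)
        · rw [le_antisymm g2.2 h2]; exact hT₀.one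
      exact gen i τ h4 hi h1
    · rcases near i τ hi ⟨h2.1.le, h2.2⟩ with h3 | h3 <;> linarith
  have off₂ : ∀ τ ∈ T, B.Gap τ → ∀ i, τ ∈ Icc (B.a i) (B.b i) → w₂ τ ≠ B.x i τ := by
    intro τ hτ _ i hi he
    obtain ⟨-, -, v1⟩ := val₂ τ
    have g1 := hδB i τ hi
    rw [he] at v1
    obtain ⟨h0, ⟨h1, h2⟩ | ⟨h1, h2⟩⟩ := v1 g1
    · rcases cell0 τ hτ ⟨h0.1, h2.2⟩ with h3 | h3
      · exact h2.1.ne' h3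
      · rcases near i τ hi ⟨h3.ge, h0.2⟩ with h3 | h3 <;> linarith
    · rcases near i τ hi ⟨h2.1.le, h2.2⟩ with h3 | h3 <;> linarith
  have w₁0 : w₁ 0 = x₀ := if_pos t₁0.le
  have w₁1 : w₁ 1 = x₀ := by
    simp only [w₁]
    split_ifs <;> first | rfl | linarith
  have w₂0 : w₂ 0 = δ := if_pos le_rfl
  have w₂1 : w₂ 1 = δ := by
    simp only [w₂]
    split_ifs <;> first | rfl | linarith
  obtain ⟨C₁, hC₁, P₁, W₁, room₁⟩ := exists_clos h.lab hT s w₁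
    (fun τ _ => ⟨(val₁ τ).1.1.le, (val₁ τ).1.2.le⟩) off₁ (fun _ => by rw [w₁0, w₁1])
  obtain ⟨C₂, hC₂, P₂, W₂, room₂⟩ := exists_clos h.lab hT s w₂
    (fun τ _ => ⟨(val₂ τ).1.1.le, (val₂ τ).1.2.le⟩) off₂ (fun _ => by rw [w₂0, w₂1])
  have hr₁ := room₁ hB fun τ _ => (val₁ τ).1
  have hr₂ := room₂ hB fun τ _ => (val₂ τ).1
  have newleg : ∀ t, t < B.p → B.New f (f B.leg) t := fun t ht =>
    h.lab.new_of_lt ht fun h' => absurd h' hqp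
  have newhead : ∀ t, B.q < t → B.New f (f B.head) t := fun t ht =>
    h.lab.new_of_gt ht fun h' => absurd h' hqp
  have leg₁ : ∀ τ ∈ T, 0 ≤ τ → τ < B.p → C₁.x (f B.leg) τ = w₁ τ := fun τ hτ h0 h1 =>
    W₁ _ τ hτ ⟨h0, by linarith⟩ (newleg τ h1)
  have leg₂ : ∀ τ ∈ T, 0 ≤ τ → τ < B.p → C₂.x (f B.leg) τ = w₂ τ := fun τ hτ h0 h1 =>
    W₂ _ τ hτ ⟨h0, by linarith⟩ (newleg τ h1)
  have head₁ : ∀ τ ∈ T, B.q < τ → τ ≤ 1 → C₁.x (f B.head) τ = w₁ τ := fun τ hτ h0 h1 =>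
    W₁ _ τ hτ ⟨by linarith, h1⟩ (newhead τ h0)
  have head₂ : ∀ τ ∈ T, B.q < τ → τ ≤ 1 → C₂.x (f B.head) τ = w₂ τ := fun τ hτ h0 h1 =>
    W₂ _ τ hτ ⟨by linarith, h1⟩ (newhead τ h0)
  have w₁r₁ : w₁ r₁ = δ / 2 := by
    simp only [w₁]
    split_ifs <;> first | rfl | linarith
  have w₁r₂ : w₁ r₂ = δ' := by
    simp only [w₁]
    split_ifs <;> first | rfl | linarith
  have w₂t₁ : w₂ t₁ = xm := by
    simp only [w₂]
    split_ifs <;> first | rfl | linarith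
  have w₂t₂ : w₂ t₂ = xp := by
    simp only [w₂]
    split_ifs <;> first | rfl | linarith
  have v₁r₁ := (head₁ r₁ r₁T r₁q r₁1.le).trans w₁r₁
  have v₁r₂ := (head₁ r₂ r₂T (by linarith) r₂1.le).trans w₁r₂
  have v₂t₁ := (leg₂ t₁ t₁T t₁0.le (by linarith)).trans w₂t₁
  have v₂t₂ := (leg₂ t₂ t₂T t₂0.le t₂p).trans w₂t₂
  have can₁ : CanOpen C₁ (f B.head) r₁ r₂ δ := by
    refine ⟨by linarith, r₁₂, r₂1, Or.inl ⟨by linarith, by linarith⟩,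
      P₁ _ r₁ r₂ (by linarith) r₁₂ r₂1.le freer, fun j hj t ht => ?_, fun j t ht _ hx => ?_⟩
    · have ht' : t ∈ Icc (0 : ℝ) 1 := ⟨by linarith [ht.1], by linarith [ht.2]⟩
      obtain ⟨i, rfl, hi⟩ := exists_old fun hn : B.New f j t =>
        hj (h.lab.new_unique ht' hn (newhead t (by linarith [ht.1])))
      rw [hC₁.x_eq i t hi, v₁r₁, v₁r₂, uIcc_of_le (by linarith)]
      exact fun h' => absurd h'.2 (not_le.2 (hδB i t hi))
    · have isnew : ∀ k, C₁.x k t = δ → B.New f k t := fun k hk => by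
        by_contra hn
        obtain ⟨i, rfl, hi⟩ := exists_old hn
        rw [hC₁.x_eq i t hi] at hk
        linarith [hδB i t hi]
      have := ((P₁ j).sub (PolyOn.const T δ 0 1)).transAt_of_ne hT.zero hT.one
        (fun τ hτ hτ' => ?_) ht (sub_eq_zero.2 hx)
      · exact ⟨this.1, this.2, fun k hk => h.lab.new_unique ht (isnew k hk) (isnew j hx)⟩
      · rw [sub_ne_zero]
        by_cases hn : B.New f j τ
        · rw [W₁ j τ hτ hτ' hn]; exact (val₁ τ).2.1
        · obtain ⟨i, rfl, hi⟩ := exists_old hn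
          rw [hC₁.x_eq i τ hi]
          exact ne_of_gt (by linarith [hδB i τ hi])
  have can₂ : CanOpen C₂ (f B.leg) t₁ t₂ x₀ := by
    refine ⟨t₁0, t₁₂, by linarith, Or.inl ⟨by linarith, by linarith⟩,
      P₂ _ t₁ t₂ t₁0.le t₁₂ (by linarith) free12, fun j hj t ht => ?_, fun j t ht _ hx => ?_⟩
    · have ht' : t ∈ Icc (0 : ℝ) 1 := ⟨by linarith [ht.1], by linarith [ht.2]⟩
      obtain ⟨i, rfl, hi⟩ := exists_old fun hn : B.New f j t =>
        hj (h.lab.new_unique ht' hn (newleg t (by linarith [ht.2])))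
      rw [hC₂.x_eq i t hi, v₂t₁, v₂t₂, uIcc_of_le (by linarith)]
      intro h'
      rcases near i t hi ht with h3 | h3
      · linarith [h'.1]
      · linarith [h'.2]
    · have old : ∀ i t, t ∈ Icc (B.a i) (B.b i) → B.x i t = x₀ → t ∈ Ioo (0 : ℝ) 1 ∧
          TransAt (fun r => C₂.x (f i) r - x₀) t := by
        intro i t hi hx
        obtain ⟨g1, g2⟩ := hT₀.transAt_line gen hi hx
        refine ⟨⟨(B.a_nonneg i).trans_lt g1.1, g1.2.trans_le (B.b_le_one i)⟩, g2.congr ?_⟩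
        filter_upwards [isOpen_Ioo.mem_nhds g1] with r hr
        rw [hC₂.x_eq i r ⟨hr.1.le, hr.2.le⟩]
      have main := ((P₂ j).sub (PolyOn.const T x₀ 0 1)).transAt hT.zero hT.one
        (fun τ hτ hτ' h0 => ?_) ht (sub_eq_zero.2 hx)
      · refine ⟨main.1, main.2, fun k hk => ?_⟩
        have mixed : ∀ j k, B.New f j t → ¬ B.New f k t → C₂.x j t = x₀ → C₂.x k t = x₀ →
            False := fun j k hj hk h1 h2 => by
          obtain ⟨i, rfl, hi⟩ := exists_old hk
          rw [hC₂.x_eq i t hi] at h2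
          have htT := hT₁T (hline i t hi h2)
          rw [W₂ j t htT ht hj] at h1
          exact (val₂ t).2.1 h1
        by_cases hn : B.New f j t <;> by_cases hn' : B.New f k t
        · exact h.lab.new_unique ht hn' hn
        · exact (mixed j k hn hn' hx hk).elim
        · exact (mixed k j hn' hn hk hx).elim
        · obtain ⟨i, rfl, hi⟩ := exists_old hn
          obtain ⟨i', rfl, hi'⟩ := exists_old hn'
          rw [hC₂.x_eq i t hi] at hx
          rw [hC₂.x_eq i' t hi'] at hk
          by_contra hne
          exact gen i t (hT₀.cross i i' t ⟨fun e => hne (e ▸ rfl), hi, hi', by rw [hx, hk]⟩) hi hx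
      · have h0 := sub_eq_zero.1 h0
        by_cases hn : B.New f j τ
        · rw [W₂ j τ hτ hτ' hn] at h0; exact absurd h0 (val₂ τ).2.1
        · obtain ⟨i, rfl, hi⟩ := exists_old hn
          rw [hC₂.x_eq i τ hi] at h0
          exact old i τ hi h0
  obtain ⟨E₁, op₁, lm₁, X₁, S₁, N₁, A₁, R₁⟩ := exists_opening can₁ s
  obtain ⟨E₂, op₂, lm₂, X₂, S₂, N₂, A₂, R₂⟩ := exists_opening can₂ s
  have aC₁ := hC₁.adm hA
  have aC₂ := hC₂.adm hA
  -- in `E₂` the lower part of the strand of the leg is the last strand; after the renumbering, the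
  -- last strand joins `δ` at the top to `x₀` at the bottom, as in `E₁`
  set σ := Equiv.swap (f B.leg).castSucc (Fin.last n) with hσ
  have in₁ : ClosIn s B f E₁ Fin.castSucc := by
    refine hC₁.closIn (O := fun c t => c = f B.head ∧ r₁ ≤ t) (fun c t ho => ?_)
      (fun c t ht ho => ?_) (fun c c' t ho ho' => ?_) (fun c d t ho => ?_)
    · rw [ho.1]; exact newhead t (by linarith [ho.2])
    · rw [X₁ _ t ht (fun h' => ho (openedNew_castSucc.1 h')), openedFrom_castSucc]
    · rw [S₁ _ _ t (fun h' => ho (openedNew_castSucc.1 h'))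
        (fun h' => ho' (openedNew_castSucc.1 h')), openedFrom_castSucc, openedFrom_castSucc]
    · exact N₁ _ d t (openedNew_castSucc.2 ho)
  have in₂ : ClosIn s B f (E₂.relabel σ) Fin.castSucc := by
    refine hC₂.closIn (O := fun c t => c = f B.leg ∧ t ≤ t₂) (fun c t ho => ?_)
      (fun c t ht ho => ?_) (fun c c' t ho ho' => ?_) (fun c d t ho hc => ?_)
    · rw [ho.1]; exact newleg t (by linarith [ho.2])
    · exact (X₂ _ t ht (fun h' => ho (openedNew_swap.1 h'))).trans (by rw [openedFrom_swap])
    · exact (S₂ _ _ t (fun h' => ho (openedNew_swap.1 h'))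
        (fun h' => ho' (openedNew_swap.1 h'))).trans (by rw [openedFrom_swap, openedFrom_swap])
    · exact N₂ _ _ t (openedNew_swap.2 ho) (BraidDiagram.relabel_crosses.1 hc)
  have agreeT : ∀ k : Fin n, ∀ τ ∈ T, τ ∈ Icc (0 : ℝ) 1 →
      E₂.x (σ k.castSucc) τ = E₁.x k.castSucc τ := by
    intro k τ hτ hτ'
    by_cases hn : B.New f k τ
    · rcases h.lab.new_cases hτ' hn with ⟨rfl, h1, -⟩ | ⟨rfl, h1, -⟩
      · have e1 : E₁.x (f B.leg).castSucc τ = w₁ τ := by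
          rw [X₁ _ τ hτ' fun h' => by linarith [(openedNew_castSucc.1 h').2], openedFrom_castSucc,
            leg₁ τ hτ hτ'.1 h1]
        rw [e1, hσ, Equiv.swap_apply_left]
        rcases le_or_gt τ t₁ with h2 | h2
        · rw [op₂.lower_new τ ⟨hτ'.1, h2⟩]; exact (if_pos h2).symm
        · have h3 : t₂ ≤ τ := not_lt.1 fun h3 => free12 τ hτ ⟨h2, h3⟩
          rw [op₂.lower_old τ ⟨h3, hτ'.2⟩, leg₂ τ hτ hτ'.1 h1]
          simp only [w₁, w₂]
          split_ifs <;> first | rfl | linarith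
      · have e2 : E₂.x (σ (f B.head).castSucc) τ = w₂ τ := by
          rw [X₂ _ τ hτ' fun h' => by linarith [(openedNew_swap.1 h').2], openedFrom_swap,
            head₂ τ hτ h1 hτ'.2]
        rw [e2]
        rcases le_or_gt τ r₁ with h2 | h2
        · rw [op₁.upper_old τ ⟨hτ'.1, h2⟩, head₁ τ hτ h1 hτ'.2]
          simp only [w₁, w₂]
          split_ifs <;> first | rfl | linarith
        · have h3 : r₂ ≤ τ := not_lt.1 fun h3 => freer τ hτ ⟨h2, h3⟩
          rw [op₁.upper_new τ ⟨h3, hτ'.2⟩]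
          simp only [w₂]
          split_ifs <;> first | rfl | linarith
    · obtain ⟨i, rfl, hi⟩ := exists_old hn
      rw [in₁.x_eq i τ hi]
      exact in₂.x_eq i τ hi
  have agree : ∀ k : Fin n, ∀ t ∈ Icc (0 : ℝ) 1, (E₂.relabel σ).x k.castSucc t = E₁.x k.castSucc t :=
    fun k t ht => (op₂.poly P₂ t₁T t₂T (σ k.castSucc)).eq (op₁.poly P₁ r₁T r₂T k.castSucc)
      hT.zero hT.one (fun τ h1 h2 => agreeT k τ h1 h2) ht
  have aE₁ := A₁ aC₁
  have step : R s ⟨n + 1, E₁⟩ ⟨n + 1, E₂.relabel σ⟩ := by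
    refine arc_move (c := Fin.last n) (u := 0) (v := 1) (s' := s) le_rfl zero_lt_one le_rfl
      (fun j hj t ht => ?_) (fun t ht ht' => ?_) (fun j k t hj hk hc => ?_)
      (fun k t ht hc => absurd (E₁.crosses_iff.1 hc).2.1 ht) (fun k t ht hc => ?_)
      (fun k t ht hc => ?_) (fun h' j k t _ _ _ hc h'' => absurd h'' (aE₁ h' j k t hc))
      (fun h' => ⟨h', aE₁ h'⟩) (R₁ hr₁) ((R₂ hr₂).relabel σ)
    · obtain ⟨k, rfl⟩ := Fin.exists_castSucc_eq.2 hj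
      exact agree k t ht
    · change E₂.x (σ (Fin.last n)) t = _
      rw [hσ, Equiv.swap_apply_right]
      rcases eq_or_lt_of_le ht.1 with rfl | h1
      · rw [op₂.upper_old 0 ⟨le_rfl, t₁0.le⟩, op₁.lower_new 0 ⟨le_rfl, by linarith⟩,
          leg₂ 0 hT.zero le_rfl hp0, w₂0]
      rcases eq_or_lt_of_le ht.2 with rfl | h2
      · rw [op₂.upper_new 1 ⟨by linarith, le_rfl⟩, op₁.lower_old 1 ⟨by linarith, le_rfl⟩,
          head₁ 1 hT.one hq1 le_rfl, w₁1]
      · exact absurd ⟨h1, h2⟩ ht'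
    · obtain ⟨j, rfl⟩ := Fin.exists_castSucc_eq.2 hj
      obtain ⟨k, rfl⟩ := Fin.exists_castSucc_eq.2 hk
      refine in₁.sign_congr in₂ hc ?_
      rw [E₁.crosses_iff] at hc
      refine (E₂.relabel σ).crosses_iff.2 ⟨hc.1, hc.2.1, ?_⟩
      rw [agree j t hc.2.1, agree k t hc.2.1, hc.2.2]
    · rcases le_or_gt t r₂ with h1 | h1
      · exact N₁ _ k t (Or.inr ⟨rfl, h1⟩) hc
      have hc' := E₁.crosses_iff.1 hc
      obtain ⟨k, rfl⟩ := Fin.exists_castSucc_eq.2 hc'.1.symm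
      rw [op₁.lower_old t ⟨h1.le, ht.2⟩] at hc'
      by_cases hk : k = f B.head
      · subst hk
        rw [op₁.upper_new t ⟨h1.le, ht.2⟩] at hc'
        have : δ < C₁.x (f B.head) t := (PolyOn.const T δ r₂ 1).lt
          ((P₁ _).sub_interval (by linarith) le_rfl) r₂T hT.one (fun τ h2 h3 => by
            rw [head₁ τ h2 (by linarith [h3.1]) h3.2]
            simp only [w₁]
            split_ifs <;> linarith [h3.1]) ⟨h1.le, ht.2⟩
        exact absurd hc'.2.2 this.ne'
      · have hk' : ¬ OpenedNew (f B.head) r₁ r₂ k.castSucc t := fun h' =>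
          hk (openedNew_castSucc.1 h').1
        have hl : ¬ OpenedNew (f B.head) r₁ r₂ (Fin.last n) t := fun h' => by
          rcases h' with ⟨h', -⟩ | ⟨-, h'⟩
          · exact (Fin.castSucc_lt_last _).ne' h'
          · linarith
        rw [S₁ _ _ t hl hk', openedFrom_last, openedFrom_castSucc]
        rw [X₁ _ t ht hk', openedFrom_castSucc] at hc'
        exact hC₁.sign_new _ _ t (C₁.crosses_iff.2 ⟨Ne.symm hk, ht, hc'.2.2⟩)
          (newhead t (by linarith))
    · rw [BraidDiagram.relabel_crosses] at hc
      change E₂.sign (σ (Fin.last n)) (σ k) t = s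
      rw [hσ, Equiv.swap_apply_right, ← hσ] at hc ⊢
      rcases le_or_gt t₁ t with h1 | h1
      · exact N₂ _ _ t (Or.inl ⟨rfl, h1⟩) hc
      have hc' := E₂.crosses_iff.1 hc
      have hk : k ≠ Fin.last n := by
        rintro rfl
        exact hc'.1 (by rw [hσ, Equiv.swap_apply_right])
      obtain ⟨k, rfl⟩ := Fin.exists_castSucc_eq.2 hk
      rw [op₂.upper_old t ⟨ht.1, h1.le⟩] at hc'
      by_cases hk : k = f B.leg
      · subst hk
        rw [hσ, Equiv.swap_apply_left, op₂.lower_new t ⟨ht.1, h1.le⟩] at hc'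
        have : C₂.x (f B.leg) t < x₀ := PolyOn.lt
          ((P₂ _).sub_interval le_rfl (by linarith)) (PolyOn.const T x₀ 0 t₁) hT.zero t₁T
          (fun τ h2 h3 => by
            rcases cell0 τ h2 h3 with rfl | rfl
            · rw [leg₂ 0 h2 le_rfl hp0, w₂0]; linarith
            · rw [v₂t₁]; exact xm0) ⟨ht.1, h1.le⟩
        exact absurd hc'.2.2 this.ne
      · have hk' : ¬ OpenedNew (f B.leg) t₁ t₂ (σ k.castSucc) t := fun h' =>
          hk (openedNew_swap.1 h').1
        have hl : ¬ OpenedNew (f B.leg) t₁ t₂ (f B.leg).castSucc t := fun h' => by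
          linarith [(openedNew_castSucc.1 h').2]
        rw [S₂ _ _ t hl hk', openedFrom_swap, openedFrom_castSucc]
        rw [X₂ _ t ht hk', openedFrom_swap] at hc'
        exact hC₂.sign_new _ _ t (C₂.crosses_iff.2 ⟨Ne.symm hk, ht, hc'.2.2⟩)
          (newleg t (by linarith))
  refine ⟨C₂, hC₂, hr₂, by rw [leg₂ 0 hT.zero le_rfl hp0, w₂0], ?_⟩
  have e1 : R s ⟨n, D⟩ ⟨n, C₁⟩ := h.move hC₁ hA hr hr₁ fun _ => by
    rw [leg₁ 0 hT.zero le_rfl hp0, w₁0]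
  exact e1.trans ((R.of_lmove lm₁ aC₁ aE₁).trans (step.trans
    (((BraidDiagram.relabel_R s E₂ σ (A₂ aC₂)).symm).trans (R.of_lmove lm₂ aC₂ (A₂ aC₂)).symm)))

/-- Any two closures of a diagram are equivalent. -/
theorem Clos.equiv {n' : ℕ} {f' : Fin m → Fin n'} {D' : BraidDiagram n'} (h : Clos s B D f)
    (h' : Clos s B D' f') (hA : Adm s B.toStrandDiagram) (hB : B.Roomy) (hr : D.Roomy)
    (hr' : D'.Roomy) : R s ⟨n, D⟩ ⟨n', D'⟩ := by
  classical
  obtain ⟨e, he⟩ := h.lab.exists_equiv h'.lab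
  obtain rfl : n = n' := by simpa using Fintype.card_congr e
  -- the strands of `D'` are renumbered so that both closures have the same labelling `f`
  have hrel := h'.relabel e
  rw [show (fun i => e.symm (f' i)) = f from funext fun i => by rw [he, Equiv.symm_apply_apply]]
    at hrel
  refine R.trans ?_ (BraidDiagram.relabel_R s D' e (h'.adm hA)).symm
  have hrr := hr'.relabel e
  generalize D'.relabel e = D' at hrel hrr
  rcases lt_or_ge B.q B.p with hqp | hpq
  · exact h.move hrel hA hr hrr fun h => absurd hqp (not_lt.2 h)
  obtain ⟨T, hT⟩ := exists_isGrid B.toStrandDiagram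
  obtain ⟨δ₀, d0, d1, hδ₀⟩ := hB.exists_margin
  -- the new ends of both closures are moved to the same position on the left
  let F : Finset ℝ := Finset.univ.biUnion fun i => T.image (B.x i)
  obtain ⟨C, hC, rC, fC, eC⟩ := h.exists_shift hA hr hpq F
  obtain ⟨C', hC', rC', fC', eC'⟩ := hrel.exists_shift hA hrr hpq F
  have m0 : (0 : ℝ) ∈ Icc (0 : ℝ) 1 := ⟨le_rfl, zero_le_one⟩
  have p1 := (rC (f B.leg) 0 m0).1
  have p2 := (rC' (f B.leg) 0 m0).1
  obtain ⟨δ', a1, a2⟩ := exists_between (lt_min d0 (lt_min p1 p2))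
  obtain ⟨δ, b1, b2⟩ := exists_between a1
  rw [lt_min_iff, lt_min_iff] at a2
  have genF : ∀ x, x ∉ F → ∀ i, ∀ τ ∈ T, τ ∈ Icc (B.a i) (B.b i) → B.x i τ ≠ x :=
    fun x hx i τ hτ _ he => hx (Finset.mem_biUnion.2 ⟨i, Finset.mem_univ _,
      Finset.mem_image.2 ⟨τ, hτ, he⟩⟩)
  obtain ⟨E, hE, rE, xE, eE⟩ := hC.exists_left hA hB rC hpq hT (genF _ fC) b1 b2 a2.2.1
    fun i t ht => a2.1.trans (hδ₀ i t ht).1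
  obtain ⟨E', hE', rE', xE', eE'⟩ := hC'.exists_left hA hB rC' hpq hT (genF _ fC') b1 b2 a2.2.2
    fun i t ht => a2.1.trans (hδ₀ i t ht).1
  exact eC.trans (eE.trans ((hE.move hE' hA rE rE' fun _ => by rw [xE, xE']).trans
    (eE'.symm.trans eC'.symm)))

end Braidoids

namespace Braidoids
open Set OpenBraid

variable {m n : ℕ} {B B' : OpenBraid m} {f : Fin m → Fin n} {s s' : SignType}
  {D D' : BraidDiagram n}

/-! ### Diagrams with equivalent closures -/

theorem exists_not_mem_finite (S : Finset ℝ) : ∃ y ∈ Ioo (0 : ℝ) 1, y ∉ S := by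
  obtain ⟨u, h1, h2, h3⟩ := Ioo_disjoint_of_finite S 0 zero_lt_one
  exact ⟨u, ⟨h1, h2⟩, fun h => h3 u h ⟨h1, le_rfl⟩⟩

theorem OpenBraid.Roomy.exists_clos_end (hB : B.Roomy) (hf : B.Lab f) (s : SignType) :
    ∃ S : Finset ℝ, ∀ y ∈ Ioo (0 : ℝ) 1, y ∉ S → ∃ D : BraidDiagram n, Clos s B D f ∧ D.Roomy ∧
      (B.p ≤ B.q → D.x (f B.leg) 0 = y) := by
  classical
  obtain ⟨T, hT⟩ := exists_isGrid B.toStrandDiagram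
  refine ⟨Finset.univ.biUnion fun i => T.image (B.x i), fun y hy hyS => ?_⟩
  obtain ⟨D, hD, -, W, hr⟩ := Braidoids.exists_clos hf hT s (fun _ => y)
    (fun _ _ => ⟨hy.1.le, hy.2.le⟩) (fun τ hτ _ i _ he => hyS (Finset.mem_biUnion.2
      ⟨i, Finset.mem_univ _, Finset.mem_image.2 ⟨τ, hτ, he.symm⟩⟩)) fun _ => rfl
  exact ⟨D, hD, hr hB fun _ _ => hy, fun h => W _ 0 hT.zero ⟨le_rfl, zero_le_one⟩ (new_zero hf h)⟩

theorem OpenBraid.Roomy.exists_clos (hB : B.Roomy) (s : SignType) :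
    ∃ (n : ℕ) (f : Fin m → Fin n) (D : BraidDiagram n), Clos s B D f ∧ D.Roomy := by
  obtain ⟨n, f, hf⟩ := B.exists_lab
  obtain ⟨S, hS⟩ := hB.exists_clos_end hf s
  obtain ⟨y, hy, hyS⟩ := exists_not_mem_finite S
  obtain ⟨D, hD, hr, -⟩ := hS y hy hyS
  exact ⟨n, f, D, hD, hr⟩

/-- Some closures of `B` and `B'` are equivalent; then all are, by `Clos.equiv`. -/
def Eqv {m m' : ℕ} (s : SignType) (B : OpenBraid m) (B' : OpenBraid m') : Prop :=
  ∃ (n : ℕ) (f : Fin m → Fin n) (D : BraidDiagram n) (n' : ℕ) (f' : Fin m' → Fin n')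
    (D' : BraidDiagram n'), Clos s B D f ∧ D.Roomy ∧ Clos s B' D' f' ∧ D'.Roomy ∧
      R s ⟨n, D⟩ ⟨n', D'⟩

theorem Eqv.refl (s : SignType) (hB : B.Roomy) : Eqv s B B := by
  obtain ⟨n, f, D, hD, hr⟩ := hB.exists_clos s
  exact ⟨n, f, D, n, f, D, hD, hr, hD, hr, .refl _ _⟩

theorem Eqv.symm {m m' : ℕ} {B : OpenBraid m} {B' : OpenBraid m'} (h : Eqv s B B') :
    Eqv s B' B := by
  obtain ⟨n, f, D, n', f', D', h1, h2, h3, h4, h5⟩ := h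
  exact ⟨n', f', D', n, f, D, h3, h4, h1, h2, h5.symm⟩

theorem Eqv.trans {m₁ m₂ m₃ : ℕ} {B₁ : OpenBraid m₁} {B₂ : OpenBraid m₂} {B₃ : OpenBraid m₃}
    (h : Eqv s B₁ B₂) (h' : Eqv s B₂ B₃) (hA : Adm s B₂.toStrandDiagram) (hr : B₂.Roomy) :
    Eqv s B₁ B₃ := by
  obtain ⟨n, f, D, n', f', D', h1, h2, h3, h4, h5⟩ := h
  obtain ⟨k, g, E, k', g', E', k1, k2, k3, k4, k5⟩ := h'
  exact ⟨n, f, D, k', g', E', h1, h2, k3, k4, h5.trans ((h3.equiv k1 hA hr h4 k2).trans k5)⟩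

theorem Eqv.all {m m' n n' : ℕ} {B : OpenBraid m} {B' : OpenBraid m'} {f : Fin m → Fin n}
    {f' : Fin m' → Fin n'} {D : BraidDiagram n} {D' : BraidDiagram n'} (h : Eqv s B B')
    (hA : Adm s B.toStrandDiagram) (hA' : Adm s B'.toStrandDiagram) (hB : B.Roomy) (hB' : B'.Roomy)
    (hD : Clos s B D f) (hD' : Clos s B' D' f') (hr : D.Roomy) (hr' : D'.Roomy) :
    R s ⟨n, D⟩ ⟨n', D'⟩ := by
  obtain ⟨k, g, E, k', g', E', h1, h2, h3, h4, h5⟩ := h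
  exact (hD.equiv h1 hA hB hr h2).trans (h5.trans (h3.equiv hD' hA' hB' h4 hr'))

/-! ### Changes of one strand -/

/-- `B'` is obtained from `B` by a change of strand `i` between the heights `u` and `v`, which
sweeps no endpoint. All crossings of strand `i` there are of type `s'`. -/
structure WindowChange (s' : SignType) (B B' : OpenBraid m) (i : Fin m) (u v : ℝ) : Prop where
  leg : B'.leg = B.leg
  head : B'.head = B.head
  a : B'.a = B.a
  b : B'.b = B.b
  a_le : B.a i ≤ u
  lt : u < v
  le_b : v ≤ B.b i
  x_ne : ∀ j, j ≠ i → ∀ t ∈ Icc (B.a j) (B.b j), B'.x j t = B.x j t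
  x_off : ∀ t ∈ Icc (B.a i) (B.b i), t ∉ Ioo u v → B'.x i t = B.x i t
  sign_off : ∀ j k t, B.Crosses j k t → (j ≠ i ∧ k ≠ i) ∨ t ∉ Icc u v →
    B'.sign j k t = B.sign j k t
  sign_on : ∀ k, ∀ t ∈ Icc u v, B.Crosses i k t → B.sign i k t = s'
  sign_on' : ∀ k, ∀ t ∈ Icc u v, B'.Crosses i k t → B'.sign i k t = s'
  leg_off : B.leg ≠ i → B.p ∈ Icc u v → B.x B.leg B.p ∉ uIcc (B.x i B.p) (B'.x i B.p)
  head_off : B.head ≠ i → B.q ∈ Icc u v → B.x B.head B.q ∉ uIcc (B.x i B.q) (B'.x i B.q)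
  virt : s' ≠ 0 → ∀ j k t, j ≠ i → k ≠ i → t ∈ Ioo u v → B.Crosses j k t → B.sign j k t = 0 →
    B.x j t ∉ uIcc (B.x i t) (B'.x i t)

namespace WindowChange

variable {i : Fin m} {u v : ℝ}

theorem p_eq (h : WindowChange s' B B' i u v) : B'.p = B.p := by
  unfold OpenBraid.p; rw [h.a, h.leg]

theorem q_eq (h : WindowChange s' B B' i u v) : B'.q = B.q := by
  unfold OpenBraid.q; rw [h.b, h.head]

theorem new_iff (h : WindowChange s' B B' i u v) {c : Fin n} {t : ℝ} :
    B'.New f c t ↔ B.New f c t := by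
  unfold New; rw [h.a, h.b]

theorem lab (h : WindowChange s' B B' i u v) (hf : B.Lab f) : B'.Lab f :=
  ⟨hf.surj, fun j k => by rw [h.p_eq, h.q_eq, h.leg, h.head, hf.ker]⟩

/-- Closures with the same added arcs are equivalent, if these are not swept. -/
theorem move (h : WindowChange s' B B' i u v) (hD : Clos s B D f) (hD' : Clos s B' D' f)
    (hA : Adm s B.toStrandDiagram) (hs : s ≠ 0 → s' ≠ 0) (hr : D.Roomy) (hr' : D'.Roomy)
    (hnew : ∀ c, ∀ t ∈ Icc (0 : ℝ) 1, B.New f c t → D'.x c t = D.x c t)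
    (hoff : ∀ c, ∀ t ∈ Icc u v, B.New f c t → D.x c t ∉ uIcc (B.x i t) (B'.x i t)) :
    R s ⟨n, D⟩ ⟨n, D'⟩ := by
  have hAD := hD.adm hA
  have old : ∀ {j t}, t ∈ Icc (B.a j) (B.b j) → D'.x (f j) t = B'.x j t := fun {j t} ht =>
    hD'.x_eq j t (by rw [h.a, h.b]; exact ht)
  have hiw : ∀ t ∈ Icc u v, t ∈ Icc (B.a i) (B.b i) := fun t ht =>
    ⟨h.a_le.trans ht.1, ht.2.trans h.le_b⟩
  have xeq : ∀ c, ∀ t ∈ Icc (0 : ℝ) 1, c ≠ f i ∨ t ∉ Ioo u v → D'.x c t = D.x c t := by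
    intro c t ht hc
    by_cases hn : B.New f c t
    · exact hnew c t ht hn
    obtain ⟨j, rfl, hj⟩ := exists_old hn
    rw [hD.x_eq j t hj, old hj]
    by_cases hji : j = i
    · subst hji
      exact h.x_off t hj (hc.resolve_left fun h => h rfl)
    · exact h.x_ne j hji t hj
  have sgn : ∀ j k t, D.Crosses j k t → D'.x j t = D.x j t → D'.x k t = D.x k t →
      (j ≠ f i ∧ k ≠ f i) ∨ t ∉ Icc u v → D'.sign j k t = D.sign j k t := by
    intro j k t hc hj hk hw
    have hc' : D'.Crosses j k t := by
      rw [D.crosses_iff] at hc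
      exact D'.crosses_iff.2 ⟨hc.1, hc.2.1, by rw [hj, hk, hc.2.2]⟩
    by_cases hn : B.New f j t
    · rw [hD.sign_new j k t hc hn, hD'.sign_new j k t hc' (h.new_iff.2 hn)]
    by_cases hn' : B.New f k t
    · rw [D.sign_symm, D'.sign_symm, hD.sign_new k j t hc.symm hn',
        hD'.sign_new k j t hc'.symm (h.new_iff.2 hn')]
    obtain ⟨j, rfl, hj1⟩ := exists_old hn
    obtain ⟨k, rfl, hk1⟩ := exists_old hn'
    rw [D.crosses_iff] at hc
    have hB : B.Crosses j k t := ⟨fun e => hc.1 (e ▸ rfl), hj1, hk1, by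
      rw [← hD.x_eq j t hj1, ← hD.x_eq k t hk1, hc.2.2]⟩
    have hB' : B'.Crosses j k t := ⟨hB.1, by rw [h.a, h.b]; exact hj1,
      by rw [h.a, h.b]; exact hk1, by rw [← old hj1, ← old hk1, hj, hk, hc.2.2]⟩
    rw [hD.sign_eq j k t hB, hD'.sign_eq j k t hB']
    exact h.sign_off j k t hB (hw.imp_left fun h' =>
      ⟨fun e => h'.1 (e ▸ rfl), fun e => h'.2 (e ▸ rfl)⟩)
  refine arc_move (c := f i) (u := u) (v := v) (s' := s') ((B.a_nonneg i).trans h.a_le) h.lt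
    (h.le_b.trans (B.b_le_one i)) (fun j hj t ht => xeq j t ht (Or.inl hj))
    (fun t ht ht' => xeq _ t ht (Or.inr ht')) (fun j k t hj hk hc => ?_) (fun k t ht hc => ?_)
    (fun k t ht hc => ?_) (fun k t ht hc => ?_) (fun h0 j k t hj hk ht hc hv => ?_)
    (fun h0 => ⟨hs h0, hAD h0⟩) hr hr'
  · have hc' := D.crosses_iff.1 hc
    exact sgn j k t hc (xeq j t hc'.2.1 (Or.inl hj)) (xeq k t hc'.2.1 (Or.inl hk))
      (Or.inl ⟨hj, hk⟩)
  · have hc' := D.crosses_iff.1 hc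
    exact sgn _ k t hc (xeq _ t hc'.2.1 (Or.inr fun h' => ht ⟨h'.1.le, h'.2.le⟩))
      (xeq k t hc'.2.1 (Or.inl hc'.1.symm)) (Or.inr ht)
  · have hc' := D.crosses_iff.1 hc
    rw [hD.x_eq i t (hiw t ht)] at hc'
    by_cases hn : B.New f k t
    · exact absurd (by rw [← hc'.2.2]; exact left_mem_uIcc) (hoff k t ht hn)
    obtain ⟨k, rfl, hk⟩ := exists_old hn
    rw [hD.x_eq k t hk] at hc'
    have hB : B.Crosses i k t := ⟨fun e => hc'.1 (e ▸ rfl), hiw t ht, hk, hc'.2.2⟩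
    rw [hD.sign_eq i k t hB]
    exact h.sign_on k t ht hB
  · have hc' := D'.crosses_iff.1 hc
    rw [old (hiw t ht)] at hc'
    by_cases hn : B.New f k t
    · exact absurd (by rw [← hnew k t hc'.2.1 hn, ← hc'.2.2]; exact right_mem_uIcc)
        (hoff k t ht hn)
    obtain ⟨k, rfl, hk⟩ := exists_old hn
    rw [old hk] at hc'
    have hB : B'.Crosses i k t := ⟨fun e => hc'.1 (e ▸ rfl), by rw [h.a, h.b]; exact hiw t ht,
      by rw [h.a, h.b]; exact hk, hc'.2.2⟩
    rw [hD'.sign_eq i k t hB]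
    exact h.sign_on' k t ht hB
  · have ht' : t ∈ Icc u v := ⟨ht.1.le, ht.2.le⟩
    have hc' := D.crosses_iff.1 hc
    rw [hD.x_eq i t (hiw t ht'), old (hiw t ht')]
    by_cases hn : B.New f j t
    · exact hoff j t ht' hn
    by_cases hn' : B.New f k t
    · rw [hc'.2.2]; exact hoff k t ht' hn'
    obtain ⟨j, rfl, hj1⟩ := exists_old hn
    obtain ⟨k, rfl, hk1⟩ := exists_old hn'
    rw [hD.x_eq j t hj1, hD.x_eq k t hk1] at hc'
    have hB : B.Crosses j k t := ⟨fun e => hc'.1 (e ▸ rfl), hj1, hk1, hc'.2.2⟩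
    rw [hD.sign_eq j k t hB] at hv
    rw [hD.x_eq j t hj1]
    exact h.virt h0 j k t (fun e => hj (e ▸ rfl)) (fun e => hk (e ▸ rfl)) ht hB hv

end WindowChange

/-- A polygon whose vertices are on one side of two others does not lie between them. -/
theorem not_mem_uIcc_of_poly {T : Finset ℝ} {g h h' : ℝ → ℝ} {u v t : ℝ} (hu : u ∈ T) (hv : v ∈ T)
    (hg : PolyOn T g u v) (hh : PolyOn T h u v) (hh' : PolyOn T h' u v)
    (side : (∀ τ ∈ T, τ ∈ Icc u v → g τ < h τ ∧ g τ < h' τ) ∨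
      ∀ τ ∈ T, τ ∈ Icc u v → h τ < g τ ∧ h' τ < g τ) (ht : t ∈ Icc u v) :
    g t ∉ uIcc (h t) (h' t) := by
  rcases side with hs | hs
  · have h1 := hg.lt hh hu hv (fun τ a b => (hs τ a b).1) ht
    have h2 := hg.lt hh' hu hv (fun τ a b => (hs τ a b).2) ht
    rw [mem_uIcc]
    rintro (⟨h3, -⟩ | ⟨h3, -⟩) <;> linarith
  · have h1 := hh.lt hg hu hv (fun τ a b => (hs τ a b).1) ht
    have h2 := hh'.lt hg hu hv (fun τ a b => (hs τ a b).2) ht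
    rw [mem_uIcc]
    rintro (⟨-, h3⟩ | ⟨-, h3⟩) <;> linarith

/-- A change of a strand between heights that do not contain both ends of an added arc, respectively
the new ends of both arcs: there are closures whose added arcs are not swept. These arcs run
along a side of the square, and this side can be chosen for each of the two ends of the gap, but a
change of sides is possible only at a height where the strand does not move. -/
theorem WindowChange.eqv_of_small {i : Fin m} {u v : ℝ} (h : WindowChange s' B B' i u v)
    (hA : Adm s B.toStrandDiagram) (hs : s ≠ 0 → s' ≠ 0) (hB : B.Roomy) (hB' : B'.Roomy)
    (hop : B.p ≤ B.q → ¬ (u = 0 ∧ v = 1))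
    (hjo : B.q < B.p → ¬ (B.q ∈ Icc u v ∧ B.p ∈ Icc u v)) : Eqv s B B' := by
  classical
  obtain ⟨n, f, hf⟩ := B.exists_lab
  obtain ⟨T₁, hT₁⟩ := exists_isGrid B.toStrandDiagram
  obtain ⟨T₂, hT₂⟩ := exists_isGrid B'.toStrandDiagram
  obtain ⟨δ₁, d1, d1', hδ₁⟩ := hB.exists_margin
  obtain ⟨δ₂, d2, d2', hδ₂⟩ := hB'.exists_margin
  let δ := min δ₁ δ₂
  have d0 : 0 < δ := lt_min d1 d2
  have dle1 : δ ≤ δ₁ := min_le_left _ _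
  have dle2 : δ ≤ δ₂ := min_le_right _ _
  have hδ : ∀ j, ∀ t ∈ Icc (B.a j) (B.b j), δ < B.x j t ∧ B.x j t < 1 - δ := fun j t ht =>
    ⟨dle1.trans_lt (hδ₁ j t ht).1, by linarith [(hδ₁ j t ht).2]⟩
  have hδ' : ∀ j, ∀ t ∈ Icc (B.a j) (B.b j), δ < B'.x j t ∧ B'.x j t < 1 - δ := fun j t ht => by
    have := hδ₂ j t (by rw [h.a, h.b]; exact ht)
    exact ⟨dle2.trans_lt this.1, by linarith [this.2]⟩
  let T : Finset ℝ := T₁ ∪ T₂ ∪ {u, v}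
  have hT : IsGrid B.toStrandDiagram T :=
    hT₁.mono (Finset.subset_union_left.trans Finset.subset_union_left)
  have hT' : IsGrid B'.toStrandDiagram T :=
    hT₂.mono (Finset.subset_union_right.trans Finset.subset_union_left)
  have uT : u ∈ T := by simp [T]
  have vT : v ∈ T := by simp [T]
  -- in the window the arcs are on the same side of the strand `i` as the endpoint that they reach
  let eα := if B.x B.leg B.p < B.x i B.p then δ else 1 - δ
  let eβ := if B.x B.head B.q < B.x i B.q then δ else 1 - δ
  let w : ℝ → ℝ := fun τ => if B.q < B.p then (if B.q ∈ Icc u v then eβ else eα) else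
    if τ = 0 ∨ τ = 1 then (if u = 0 then eα else eβ) else if τ < B.p then eα else eβ
  have hα : eα = δ ∨ eα = 1 - δ := by simp only [eα]; split_ifs <;> simp
  have hβ : eβ = δ ∨ eβ = 1 - δ := by simp only [eβ]; split_ifs <;> simp
  have hw : ∀ τ, w τ = δ ∨ w τ = 1 - δ := fun τ => by
    simp only [w]; split_ifs <;> assumption
  have hw01 : ∀ τ, w τ ∈ Ioo (0 : ℝ) 1 := fun τ => by
    rcases hw τ with h | h <;> rw [h] <;> constructor <;> linarith
  have w01 : B.p ≤ B.q → w 0 = w 1 := fun h => by simp [w, not_lt.2 h]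
  obtain ⟨D, hD, P, W, hr⟩ := exists_clos hf hT s w (fun τ _ => ⟨(hw01 τ).1.le, (hw01 τ).2.le⟩)
    (fun τ _ _ j hj he => by
      have := hδ j τ hj
      rcases hw τ with h | h <;> rw [h] at he <;> linarith) w01
  obtain ⟨D', hD', P', W', hr'⟩ := exists_clos (h.lab hf) hT' s w
    (fun τ _ => ⟨(hw01 τ).1.le, (hw01 τ).2.le⟩)
    (fun τ _ _ j hj he => by
      rw [h.a, h.b] at hj
      have := hδ' j τ hj
      rcases hw τ with h | h <;> rw [h] at he <;> linarith) (by rw [h.p_eq, h.q_eq]; exact w01)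
  have hrD := hr hB fun τ _ => hw01 τ
  have hrD' := hr' hB' fun τ _ => hw01 τ
  have lp : B.p ∈ Icc (B.a B.leg) (B.b B.leg) := ⟨le_rfl, (B.a_lt_b _).le⟩
  have hq : B.q ∈ Icc (B.a B.head) (B.b B.head) := ⟨(B.a_lt_b _).le, le_rfl⟩
  have pT : B.p ∈ T := hT.a_mem _
  have qT : B.q ∈ T := hT.b_mem _
  have vleg : D.x (f B.leg) B.p = B.x B.leg B.p := hD.x_eq _ _ lp
  have vhead : D.x (f B.head) B.q = B.x B.head B.q := hD.x_eq _ _ hq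
  have vleg' : D'.x (f B.leg) B.p = B.x B.leg B.p := by
    rw [hD'.x_eq _ _ (by rw [h.a, h.b]; exact lp)]
    by_cases hi : B.leg = i
    · rw [hi] at lp ⊢
      refine h.x_off _ lp fun h' => ?_
      have := h.a_le
      rw [← hi] at this
      linarith [h'.1]
    · exact h.x_ne _ hi _ lp
  have vhead' : D'.x (f B.head) B.q = B.x B.head B.q := by
    rw [hD'.x_eq _ _ (by rw [h.a, h.b]; exact hq)]
    by_cases hi : B.head = i
    · rw [hi] at hq ⊢
      refine h.x_off _ hq fun h' => ?_
      have := h.le_b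
      rw [← hi] at this
      linarith [h'.2]
    · exact h.x_ne _ hi _ hq
  -- the strands between which the region of the change lies
  have hpi : ∀ {a b}, u ≤ a → b ≤ v → PolyOn T (B.x i) a b := fun h1 h2 =>
    (hT.poly i).sub_interval (h.a_le.trans h1) (h2.trans h.le_b)
  have hpi' : ∀ {a b}, u ≤ a → b ≤ v → PolyOn T (B'.x i) a b := fun h1 h2 =>
    (hT'.poly i).sub_interval (by rw [h.a]; exact h.a_le.trans h1)
      (by rw [h.b]; exact h2.trans h.le_b)
  have hiw : ∀ {t}, u ≤ t → t ≤ v → t ∈ Icc (B.a i) (B.b i) := fun h1 h2 =>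
    ⟨h.a_le.trans h1, h2.trans h.le_b⟩
  have sideδ : ∀ {t}, u ≤ t → t ≤ v → δ < B.x i t ∧ δ < B'.x i t := fun h1 h2 =>
    ⟨(hδ i _ (hiw h1 h2)).1, (hδ' i _ (hiw h1 h2)).1⟩
  have sideδ' : ∀ {t}, u ≤ t → t ≤ v → B.x i t < 1 - δ ∧ B'.x i t < 1 - δ := fun h1 h2 =>
    ⟨(hδ i _ (hiw h1 h2)).2, (hδ' i _ (hiw h1 h2)).2⟩
  have legside : B.leg ≠ i → B.p ∈ Icc u v →
      (eα = δ ∧ B.x B.leg B.p < B.x i B.p ∧ B.x B.leg B.p < B'.x i B.p) ∨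
      (eα = 1 - δ ∧ B.x i B.p < B.x B.leg B.p ∧ B'.x i B.p < B.x B.leg B.p) := by
    intro h1 h2
    have h3 := h.leg_off h1 h2
    rw [mem_uIcc] at h3
    push Not at h3
    by_cases h4 : B.x B.leg B.p < B.x i B.p
    · exact Or.inl ⟨if_pos h4, h4, not_le.1 fun h5 => absurd (h3.2 h5) (not_lt.2 h4.le)⟩
    · exact Or.inr ⟨if_neg h4, lt_of_le_of_ne (not_lt.1 h4) fun e =>
        absurd (h3.2 ((h3.1 e.le).le)) (not_lt.2 e.ge), h3.1 (not_lt.1 h4)⟩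
  have headside : B.head ≠ i → B.q ∈ Icc u v →
      (eβ = δ ∧ B.x B.head B.q < B.x i B.q ∧ B.x B.head B.q < B'.x i B.q) ∨
      (eβ = 1 - δ ∧ B.x i B.q < B.x B.head B.q ∧ B'.x i B.q < B.x B.head B.q) := by
    intro h1 h2
    have h3 := h.head_off h1 h2
    rw [mem_uIcc] at h3
    push Not at h3
    by_cases h4 : B.x B.head B.q < B.x i B.q
    · exact Or.inl ⟨if_pos h4, h4, not_le.1 fun h5 => absurd (h3.2 h5) (not_lt.2 h4.le)⟩
    · exact Or.inr ⟨if_neg h4, lt_of_le_of_ne (not_lt.1 h4) fun e =>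
        absurd (h3.2 ((h3.1 e.le).le)) (not_lt.2 e.ge), h3.1 (not_lt.1 h4)⟩
  -- an arc whose vertices in the window are at `e`, up to an endpoint on the same side
  have off : ∀ (c : Fin n) (a b e : ℝ), a ∈ T → b ∈ T → u ≤ a → b ≤ v → 0 ≤ a → b ≤ 1 →
      (∀ τ ∈ T, τ ∈ Icc a b → D.x c τ = e ∨
        (e = δ ∧ D.x c τ < B.x i τ ∧ D.x c τ < B'.x i τ) ∨
        (e = 1 - δ ∧ B.x i τ < D.x c τ ∧ B'.x i τ < D.x c τ)) →
      (e = δ ∨ e = 1 - δ) → ∀ t ∈ Icc a b, D.x c t ∉ uIcc (B.x i t) (B'.x i t) := by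
    intro c a b e ha hb hua hbv h0 h1 hv he t ht
    refine not_mem_uIcc_of_poly ha hb ((P c).sub_interval h0 h1) (hpi hua hbv) (hpi' hua hbv) ?_ ht
    rcases he with rfl | rfl
    · refine Or.inl fun τ hτ hτ' => ?_
      rcases hv τ hτ hτ' with h2 | ⟨-, h2⟩ | ⟨h2, -⟩
      · rw [h2]; exact sideδ (hua.trans hτ'.1) (hτ'.2.trans hbv)
      · exact h2
      · linarith
    · refine Or.inr fun τ hτ hτ' => ?_
      rcases hv τ hτ hτ' with h2 | ⟨h2, -⟩ | ⟨-, h2⟩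
      · rw [h2]; exact sideδ' (hua.trans hτ'.1) (hτ'.2.trans hbv)
      · linarith
      · exact h2
  have hu0 : 0 ≤ u := (B.a_nonneg i).trans h.a_le
  have hv1 : v ≤ 1 := h.le_b.trans (B.b_le_one i)
  have newleg : ∀ t, t < B.p → (B.q < B.p → B.q < t) → B.New f (f B.leg) t := fun t =>
    hf.new_of_lt
  have newhead : ∀ t, B.q < t → (B.q < B.p → t < B.p) → B.New f (f B.head) t := fun t =>
    hf.new_of_gt
  have i_ne_leg : ∀ {t}, u ≤ t → t < B.p → B.leg ≠ i := fun h1 h2 e => by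
    have := h.a_le
    rw [← e] at this
    linarith
  have i_ne_head : ∀ {t}, t ≤ v → B.q < t → B.head ≠ i := fun h1 h2 e => by
    have := h.le_b
    rw [← e] at this
    linarith
  refine ⟨n, f, D, n, f, D', hD, hrD, hD', hrD', ?_⟩
  rcases lt_or_ge B.q B.p with hqp | hpq
  · have e := hf.joined hqp
    have hwv : ∀ τ, w τ = if B.q ∈ Icc u v then eβ else eα := fun τ => if_pos hqp
    have val : ∀ τ ∈ T, τ ∈ Ioo B.q B.p → D.x (f B.leg) τ = w τ := fun τ h1 h2 =>
      W _ τ h1 ⟨by linarith [h2.1, B.q_pos], by linarith [h2.2, B.p_lt_one]⟩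
        (newleg τ h2.2 fun _ => h2.1)
    have val' : ∀ τ ∈ T, τ ∈ Ioo B.q B.p → D'.x (f B.leg) τ = w τ := fun τ h1 h2 =>
      W' _ τ h1 ⟨by linarith [h2.1, B.q_pos], by linarith [h2.2, B.p_lt_one]⟩
        (h.new_iff.2 (newleg τ h2.2 fun _ => h2.1))
    have isarc : ∀ {c t}, t ∈ Icc (0 : ℝ) 1 → B.New f c t → c = f B.leg ∧ t ∈ Ioo B.q B.p := by
      intro c t ht hn
      rcases hf.new_cases ht hn with ⟨h1, h2, h3⟩ | ⟨h1, h2, h3⟩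
      · exact ⟨h1, h3 hqp, h2⟩
      · exact ⟨by rw [h1, e], h2, h3 hqp⟩
    refine h.move hD hD' hA hs hrD hrD' (fun c t ht hn => ?_) fun c t ht hn => ?_
    · obtain ⟨rfl, ht'⟩ := isarc ht hn
      refine ((P' _).sub_interval B.q_pos.le B.p_lt_one.le).eq
        ((P _).sub_interval B.q_pos.le B.p_lt_one.le) qT pT (fun τ h1 h2 => ?_) ⟨ht'.1.le, ht'.2.le⟩
      rcases eq_or_lt_of_le h2.1 with rfl | h3
      · rw [e, vhead, vhead']
      rcases eq_or_lt_of_le h2.2 with h4 | h4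
      · rw [h4, vleg, vleg']
      · rw [val τ h1 ⟨h3, h4⟩, val' τ h1 ⟨h3, h4⟩]
    · obtain ⟨rfl, ht'⟩ := isarc ⟨hu0.trans ht.1, ht.2.trans hv1⟩ hn
      refine off _ (max u B.q) (min v B.p) (w t) (by rcases max_choice u B.q with h | h <;> rwa [h])
        (by rcases min_choice v B.p with h | h <;> rwa [h]) (le_max_left _ _) (min_le_left _ _)
        (hu0.trans (le_max_left _ _)) ((min_le_left _ _).trans hv1) (fun τ h1 h2 => ?_) (hw t) t
        ⟨max_le ht.1 ht'.1.le, le_min ht.2 ht'.2.le⟩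
      have m1 := (le_max_left _ _).trans h2.1
      have m2 := (le_max_right _ _).trans h2.1
      have m3 := h2.2.trans (min_le_left _ _)
      have m4 := h2.2.trans (min_le_right _ _)
      rcases eq_or_lt_of_le m2 with h3 | h3
      · have hqw : B.q ∈ Icc u v := ⟨by linarith, by linarith⟩
        have hh := headside (i_ne_head ht.2 ht'.1) hqw
        rw [hwv, if_pos hqw, ← h3, e, vhead]
        exact Or.inr hh
      rcases eq_or_lt_of_le m4 with h4 | h4
      · have hpw : B.p ∈ Icc u v := ⟨by linarith, by linarith⟩
        have hh := legside (i_ne_leg ht.1 ht'.2) hpw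
        rw [hwv, if_neg fun h5 => hjo hqp ⟨h5, hpw⟩, h4, vleg]
        exact Or.inr hh
      · rw [val τ h1 ⟨h3, h4⟩, hwv, hwv]; exact Or.inl rfl
  · have hqp := not_lt.2 hpq
    have p0 := B.leg_pos
    have p1 := B.p_lt_one
    have q0 := B.q_pos
    have q1 := B.head_lt
    have wα : ∀ τ, 0 < τ → τ < B.p → w τ = eα := fun τ h1 h2 => by
      have e1 : τ ≠ 1 := by linarith
      simp only [w]
      rw [if_neg hqp, if_neg (by simp [h1.ne', e1]), if_pos h2]
    have wβ : ∀ τ, B.q < τ → τ < 1 → w τ = eβ := fun τ h1 h2 => by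
      have e1 : τ ≠ 0 := by linarith
      simp only [w]
      rw [if_neg hqp, if_neg (by simp [h2.ne, e1]), if_neg (by linarith)]
    have wu : u = 0 → w 0 = eα := fun h => by
      simp only [w]
      rw [if_neg hqp, if_pos (by simp), if_pos h]
    have wv : u ≠ 0 → w 1 = eβ := fun h => by
      simp only [w]
      rw [if_neg hqp, if_pos (by simp), if_neg h]
    have val : ∀ τ ∈ T, 0 ≤ τ → τ < B.p → D.x (f B.leg) τ = w τ := fun τ h1 h2 h3 =>
      W _ τ h1 ⟨h2, by linarith⟩ (newleg τ h3 fun h => absurd h hqp)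
    have val' : ∀ τ ∈ T, 0 ≤ τ → τ < B.p → D'.x (f B.leg) τ = w τ := fun τ h1 h2 h3 =>
      W' _ τ h1 ⟨h2, by linarith⟩ (h.new_iff.2 (newleg τ h3 fun h => absurd h hqp))
    have vah : ∀ τ ∈ T, B.q < τ → τ ≤ 1 → D.x (f B.head) τ = w τ := fun τ h1 h2 h3 =>
      W _ τ h1 ⟨by linarith, h3⟩ (newhead τ h2 fun h => absurd h hqp)
    have vah' : ∀ τ ∈ T, B.q < τ → τ ≤ 1 → D'.x (f B.head) τ = w τ := fun τ h1 h2 h3 =>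
      W' _ τ h1 ⟨by linarith, h3⟩ (h.new_iff.2 (newhead τ h2 fun h => absurd h hqp))
    refine h.move hD hD' hA hs hrD hrD' (fun c t ht hn => ?_) fun c t ht hn => ?_
    · rcases hf.new_cases ht hn with ⟨rfl, h1, -⟩ | ⟨rfl, h1, -⟩
      · refine ((P' _).sub_interval le_rfl p1.le).eq ((P _).sub_interval le_rfl p1.le) hT.zero pT
          (fun τ h2 h3 => ?_) ⟨ht.1, h1.le⟩
        rcases eq_or_lt_of_le h3.2 with h4 | h4
        · rw [h4, vleg, vleg']
        · rw [val τ h2 h3.1 h4, val' τ h2 h3.1 h4]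
      · refine ((P' _).sub_interval q0.le le_rfl).eq ((P _).sub_interval q0.le le_rfl) qT hT.one
          (fun τ h2 h3 => ?_) ⟨h1.le, ht.2⟩
        rcases eq_or_lt_of_le h3.1 with h4 | h4
        · rw [← h4, vhead, vhead']
        · rw [vah τ h2 h4 h3.2, vah' τ h2 h4 h3.2]
    · rcases hf.new_cases ⟨hu0.trans ht.1, ht.2.trans hv1⟩ hn with ⟨rfl, h1, -⟩ | ⟨rfl, h1, -⟩
      · refine off _ u (min v B.p) eα uT (by rcases min_choice v B.p with h | h <;> rwa [h])
          le_rfl (min_le_left _ _) hu0 ((min_le_left _ _).trans hv1) (fun τ h2 h3 => ?_) hα t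
          ⟨ht.1, le_min ht.2 h1.le⟩
        have m3 := h3.2.trans (min_le_left _ _)
        have m4 := h3.2.trans (min_le_right _ _)
        rcases eq_or_lt_of_le m4 with h4 | h4
        · have hpw : B.p ∈ Icc u v := ⟨by linarith [h3.1], by linarith⟩
          have hh := legside (i_ne_leg ht.1 h1) hpw
          rw [h4, vleg]
          exact Or.inr hh
        · refine Or.inl ?_
          rw [val τ h2 (hu0.trans h3.1) h4]
          rcases eq_or_lt_of_le (hu0.trans h3.1) with h5 | h5
          · rw [← h5]; exact wu (le_antisymm (by linarith [h3.1]) hu0)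
          · exact wα τ h5 h4
      · refine off _ (max u B.q) v eβ (by rcases max_choice u B.q with h | h <;> rwa [h]) vT
          (le_max_left _ _) le_rfl (hu0.trans (le_max_left _ _)) hv1 (fun τ h2 h3 => ?_) hβ t
          ⟨max_le ht.1 h1.le, ht.2⟩
        have m1 := (le_max_left _ _).trans h3.1
        have m2 := (le_max_right _ _).trans h3.1
        rcases eq_or_lt_of_le m2 with h4 | h4
        · have hqw : B.q ∈ Icc u v := ⟨by linarith, by linarith [h3.2]⟩
          have hh := headside (i_ne_head ht.2 h1) hqw
          rw [← h4, vhead]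
          exact Or.inr hh
        · refine Or.inl ?_
          rw [vah τ h2 h4 (h3.2.trans hv1)]
          rcases eq_or_lt_of_le (h3.2.trans hv1) with h5 | h5
          · rw [h5]; exact wv fun h6 => hop hpq ⟨h6, le_antisymm hv1 (by linarith [h3.2])⟩
          · exact wβ τ h4 h5

end Braidoids

namespace Braidoids
open Set OpenBraid

variable {m : ℕ} {B B' : OpenBraid m} {s s' : SignType} {i : Fin m} {u v : ℝ}

namespace WindowChange

/-- A change of a strand is made in two steps: `B₁` has the new strand above the height `τ₁` and
the old one below the height `τ₂`; between these heights it has a segment that joins the two. As the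
old and the new strand do not pass each other there, the segment lies between them. -/
theorem exists_split (h : WindowChange s' B B' i u v) {T : Finset ℝ}
    (hT : IsGrid B.toStrandDiagram T) (hT' : IsGrid B'.toStrandDiagram T) {τ₁ τ₂ : ℝ}
    (h1 : u < τ₁) (h12 : τ₁ < τ₂) (h2 : τ₂ < v) (free : ∀ r ∈ T, r ∉ Icc τ₁ τ₂)
    (sgn : 0 ≤ (B'.x i τ₁ - B.x i τ₁) * (B'.x i τ₂ - B.x i τ₂)) :
    ∃ B₁ : OpenBraid m, WindowChange s' B B₁ i u τ₂ ∧ WindowChange s' B₁ B' i τ₁ v ∧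
      (B.Roomy → B'.Roomy → B₁.Roomy) ∧ (s' ≠ 0 → B.IsClassical → B₁.IsClassical) := by
  classical
  have ea := h.a
  have eb := h.b
  have hau := h.a_le
  have hvb := h.le_b
  have hu0 : 0 ≤ u := (B.a_nonneg i).trans hau
  have hv1 : v ≤ 1 := hvb.trans (B.b_le_one i)
  have m1 : τ₁ ∈ Icc (B.a i) (B.b i) := ⟨by linarith, by linarith⟩
  have m2 : τ₂ ∈ Icc (B.a i) (B.b i) := ⟨by linarith, by linarith⟩
  have aff : AffineOn (B.x i) τ₁ τ₂ := hT.poly i _ _ m1.1 h12 m2.2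
    fun r hr hr' => free r hr ⟨hr'.1.le, hr'.2.le⟩
  have aff' : AffineOn (B'.x i) τ₁ τ₂ := hT'.poly i _ _ (by rw [ea]; exact m1.1) h12
    (by rw [eb]; exact m2.2) fun r hr hr' => free r hr ⟨hr'.1.le, hr'.2.le⟩
  let g : ℝ → ℝ := fun t => if t ≤ τ₁ then B'.x i t else
    if t < τ₂ then line τ₁ (B'.x i τ₁) τ₂ (B.x i τ₂) t else B.x i t
  have g1 : ∀ {t}, t ≤ τ₁ → g t = B'.x i t := fun h => if_pos h
  have g2 : ∀ {t}, τ₂ ≤ t → g t = B.x i t := fun h =>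
    (if_neg (by linarith)).trans (if_neg (not_lt.2 h))
  have gm : AffineOn g τ₁ τ₂ := (line_affine τ₁ (B'.x i τ₁) τ₂ (B.x i τ₂) _ _).congr
    fun t ht => by
      rcases eq_or_lt_of_le ht.1 with rfl | h3
      · rw [line_left, g1 le_rfl]
      rcases eq_or_lt_of_le ht.2 with rfl | h4
      · rw [line_right h3, g2 le_rfl]
      · exact (if_neg (not_le.2 h3)).trans (if_pos h4)
  have between : ∀ t ∈ Icc τ₁ τ₂, g t ∈ uIcc (B.x i t) (B'.x i t) := by
    intro t ht
    rcases mul_nonneg_iff.1 sgn with ⟨p1, p2⟩ | ⟨p1, p2⟩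
    · rw [mem_uIcc]
      exact Or.inl ⟨aff.le gm ht (by rw [g1 le_rfl]; linarith) (by rw [g2 le_rfl]),
        gm.le aff' ht (by rw [g1 le_rfl]) (by rw [g2 le_rfl]; linarith)⟩
    · rw [mem_uIcc]
      exact Or.inr ⟨aff'.le gm ht (by rw [g1 le_rfl]) (by rw [g2 le_rfl]; linarith),
        gm.le aff ht (by rw [g1 le_rfl]; linarith) (by rw [g2 le_rfl])⟩
  have between' : ∀ t, g t ∈ uIcc (B.x i t) (B'.x i t) := fun t => by
    rcases le_or_gt t τ₁ with h3 | h3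
    · rw [g1 h3]; exact right_mem_uIcc
    rcases le_or_gt τ₂ t with h4 | h4
    · rw [g2 h4]; exact left_mem_uIcc
    · exact between t ⟨h3.le, h4.le⟩
  let X : Fin m → ℝ → ℝ := Function.update B.x i g
  have Xi : X i = g := Function.update_self _ _ _
  have Xj : ∀ {j}, j ≠ i → X j = B.x j := fun hj => Function.update_of_ne hj _ _
  have X1 : ∀ {j t}, t ≤ τ₁ → t ∈ Icc (B.a j) (B.b j) → X j t = B'.x j t := by
    intro j t h3 h4
    by_cases hj : j = i
    · rw [hj, Xi, g1 h3]
    · rw [Xj hj, h.x_ne j hj t h4]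
  have X2 : ∀ {j t}, τ₂ ≤ t → X j t = B.x j t := by
    intro j t h3
    by_cases hj : j = i
    · rw [hj, Xi, g2 h3]
    · rw [Xj hj]
  have cover : ∀ {j t}, t ∈ Icc τ₁ τ₂ → t ∈ Icc (B.a j) (B.b j) →
      B.a j < τ₁ ∧ τ₂ < B.b j := fun {j t} h3 h4 =>
    ⟨not_le.1 fun h5 => free _ (hT.a_mem j) ⟨h5, h4.1.trans h3.2⟩,
      not_le.1 fun h5 => free _ (hT.b_mem j) ⟨h3.1.trans h4.2, h5⟩⟩
  have cr' : ∀ {j k t}, j ≠ k → t ∈ Icc (B.a j) (B.b j) → t ∈ Icc (B.a k) (B.b k) →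
      B'.x j t = B'.x k t → B'.Crosses j k t := fun h3 h4 h5 h6 =>
    ⟨h3, by rw [ea, eb]; exact h4, by rw [ea, eb]; exact h5, h6⟩
  -- a crossing with the connecting segment
  have mid : ∀ {k t}, k ≠ i → t ∈ Icc τ₁ τ₂ → t ∈ Icc (B.a k) (B.b k) → g t = B.x k t →
      t ∈ Ioo τ₁ τ₂ ∧ TransAt (fun r => g r - B.x k r) t := by
    intro k t hk ht hkt hx
    obtain ⟨c1, c2⟩ := cover ht hkt
    have n1 : g τ₁ - B.x k τ₁ ≠ 0 := fun h0 => by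
      have hk1 : τ₁ ∈ Icc (B.a k) (B.b k) := ⟨c1.le, by linarith⟩
      refine free τ₁ (hT'.cross i k τ₁ (cr' hk.symm m1 hk1 ?_)) ⟨le_rfl, h12.le⟩
      rw [g1 le_rfl] at h0
      rw [h.x_ne k hk _ hk1]; linarith
    have n2 : g τ₂ - B.x k τ₂ ≠ 0 := fun h0 => by
      have hk1 : τ₂ ∈ Icc (B.a k) (B.b k) := ⟨by linarith, c2.le⟩
      refine free τ₂ (hT.cross i k τ₂ ⟨hk.symm, m2, hk1, ?_⟩) ⟨h12.le, le_rfl⟩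
      rw [g2 le_rfl] at h0
      linarith
    have ht' : t ∈ Ioo τ₁ τ₂ := by
      refine ⟨lt_of_le_of_ne ht.1 fun e => n1 ?_, lt_of_le_of_ne ht.2 fun e => n2 ?_⟩
      · rw [e, hx, sub_self]
      · rw [← e, hx, sub_self]
    refine ⟨ht', (gm.sub (hT.poly k _ _ c1.le h12 c2.le fun r hr hr' =>
      free r hr ⟨hr'.1.le, hr'.2.le⟩)).transAt ht' (sub_eq_zero.2 hx) (Or.inl n1)⟩
  have nocross : ∀ {j k t}, j ≠ k → t ∈ Icc τ₁ τ₂ → t ∈ Icc (B.a j) (B.b j) →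
      t ∈ Icc (B.a k) (B.b k) → B.x j t ≠ B.x k t := fun hjk ht hj hk hx =>
    free _ (hT.cross _ _ _ ⟨hjk, hj, hk, hx⟩) ht
  have good : ∀ j k t, j ≠ k → t ∈ Icc (B.a j) (B.b j) → t ∈ Icc (B.a k) (B.b k) →
      X j t = X k t → t ∈ Ioo (B.a j) (B.b j) ∧ TransAt (fun r => X j r - X k r) t := by
    have one : ∀ k t, k ≠ i → t ∈ Icc (B.a i) (B.b i) → t ∈ Icc (B.a k) (B.b k) →
        g t = B.x k t → t ∈ Ioo (B.a i) (B.b i) ∧ t ∈ Ioo (B.a k) (B.b k) ∧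
          TransAt (fun r => g r - B.x k r) t := by
      intro k t hk hi hkt hx
      rcases lt_or_ge t τ₁ with h3 | h3
      · rw [g1 h3.le, ← h.x_ne k hk t hkt] at hx
        have c := cr' hk.symm hi hkt hx
        have o1 := B'.interior i k t c.1 c.2.1 c.2.2.1 hx
        have o2 := B'.interior k i t c.1.symm c.2.2.1 c.2.1 hx.symm
        have tr : TransAt (fun r => B'.x i r - B'.x k r) t :=
          B'.transversal i k t c.1 c.2.1 c.2.2.1 hx
        rw [ea, eb] at o1 o2
        refine ⟨o1, o2, tr.congr ?_⟩
        filter_upwards [isOpen_Iio.mem_nhds h3, isOpen_Ioo.mem_nhds o2] with r hr hr'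
        rw [g1 (le_of_lt hr), h.x_ne k hk r ⟨hr'.1.le, hr'.2.le⟩]
      rcases le_or_gt t τ₂ with h4 | h4
      · obtain ⟨o1, tr⟩ := mid hk ⟨h3, h4⟩ hkt hx
        obtain ⟨c1, c2⟩ := cover ⟨h3, h4⟩ hkt
        exact ⟨⟨by linarith [o1.1], by linarith [o1.2]⟩, ⟨by linarith [o1.1], by linarith [o1.2]⟩,
          tr⟩
      · rw [g2 h4.le] at hx
        have tr : TransAt (fun r => B.x i r - B.x k r) t := B.transversal i k t hk.symm hi hkt hx
        refine ⟨B.interior i k t hk.symm hi hkt hx, B.interior k i t hk hkt hi hx.symm, tr.congr ?_⟩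
        filter_upwards [isOpen_Ioi.mem_nhds h4] with r hr
        rw [g2 (le_of_lt hr)]
    intro j k t hjk hj hk hx
    by_cases hji : j = i
    · subst hji
      rw [Xi, Xj hjk.symm] at hx
      obtain ⟨o1, -, tr⟩ := one k t hjk.symm hj hk hx
      exact ⟨o1, by rw [Xi, Xj hjk.symm]; exact tr⟩
    by_cases hki : k = i
    · subst hki
      rw [Xi, Xj hji] at hx
      obtain ⟨-, o2, tr⟩ := one j t hji hk hj hx.symm
      exact ⟨o2, by rw [Xi, Xj hji]; exact tr.swap⟩
    · rw [Xj hji, Xj hki] at hx ⊢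
      exact ⟨B.interior j k t hjk hj hk hx, B.transversal j k t hjk hj hk hx⟩
  have pl : ∀ j, PolyOn (insert τ₁ (insert τ₂ T)) (X j) (B.a j) (B.b j) := by
    have sub : T ⊆ insert τ₁ (insert τ₂ T) :=
      (Finset.subset_insert _ _).trans (Finset.subset_insert _ _)
    intro j
    by_cases hj : j = i
    · subst hj
      rw [Xi]
      have P' : PolyOn (insert τ₁ (insert τ₂ T)) (B'.x j) (B.a j) (B.b j) := by
        have := (hT'.poly j).mono sub
        rwa [ea, eb] at this
      exact (((P'.sub_interval le_rfl m1.2).congr fun t ht => g1 ht.2).append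
        (fun a b ha _ hb _ => gm.mono ha hb) (by simp)).append
        ((((hT.poly j).mono sub).sub_interval m2.1 le_rfl).congr fun t ht => g2 ht.1) (by simp)
    · rw [Xj hj]; exact (hT.poly j).mono sub
  have aff_end0 : ∀ j, j ≠ B.leg → X j 0 = B.x j 0 := by
    intro j hj
    by_cases hji : j = i
    · subst hji
      rw [Xi, g1 (by linarith)]
      refine h.x_off 0 ⟨(B.a_eq j hj).le, by linarith⟩ fun h' => by linarith [h'.1]
    · rw [Xj hji]
  have aff_end1 : ∀ j, X j 1 = B.x j 1 := fun j => X2 (by linarith)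
  let B₁ : OpenBraid m :=
    { a := B.a
      b := B.b
      x := X
      sign := overlay (fun j t => j = i ∧ t ∈ Icc u v) s' B.sign
      a_nonneg := B.a_nonneg
      a_lt_b := B.a_lt_b
      b_le_one := B.b_le_one
      x_mem := fun j t ht => by
        by_cases hj : j = i
        · subst hj
          rw [Xi]
          exact uIcc_subset_Icc (B.x_mem j t ht) (B'.x_mem j t (by rw [ea, eb]; exact ht))
            (between' t)
        · rw [Xj hj]; exact B.x_mem j t ht
      pl := fun j => (pl j).pl
      sign_symm := overlay_symm B.sign_symm
      finite := fun j k hjk => by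
        refine (finite_coincidences (f := X j) (g := X k) (a := max (B.a j) (B.a k))
          (b := min (B.b j) (B.b k)) ((pl j).sub_interval (le_max_left _ _) (min_le_left _ _)).pl
          ((pl k).sub_interval (le_max_right _ _) (min_le_right _ _)).pl fun t ht hx => ?_).subset
          fun t ht => ⟨⟨max_le ht.1.1 ht.2.1.1, le_min ht.1.2 ht.2.1.2⟩, ht.2.2⟩
        exact (good j k t hjk ⟨(le_max_left _ _).trans ht.1, ht.2.trans (min_le_left _ _)⟩
          ⟨(le_max_right _ _).trans ht.1, ht.2.trans (min_le_right _ _)⟩ hx).2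
      interior := fun j k t hjk hj hk hx => (good j k t hjk hj hk hx).1
      transversal := fun j k t hjk hj hk hx => (good j k t hjk hj hk hx).2
      double := fun j k l t hjk hjl hj hk hl hx hx' => by
        rcases le_or_gt t τ₁ with h3 | h3
        · rw [X1 h3 hj, X1 h3 hk] at hx
          rw [X1 h3 hj, X1 h3 hl] at hx'
          have c := cr' hjk hj hk hx
          have c' := cr' hjl hj hl hx'
          exact B'.double j k l t hjk hjl c.2.1 c.2.2.1 c'.2.2.1 hx hx'
        rcases le_or_gt τ₂ t with h4 | h4
        · rw [X2 h4, X2 h4] at hx hx'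
          exact B.double j k l t hjk hjl hj hk hl hx hx'
        · have ht : t ∈ Icc τ₁ τ₂ := ⟨h3.le, h4.le⟩
          by_contra hkl
          by_cases hji : j = i
          · have hki : k ≠ i := fun e => hjk (hji.trans e.symm)
            have hli : l ≠ i := fun e => hjl (hji.trans e.symm)
            rw [Xj hki] at hx
            rw [Xj hli] at hx'
            exact nocross hkl ht hk hl (hx.symm.trans hx')
          by_cases hki : k = i
          · have hli : l ≠ i := fun e => hkl (hki.trans e.symm)
            rw [Xj hji, Xj hli] at hx'
            exact nocross hjl ht hj hl hx'
          · rw [Xj hji, Xj hki] at hx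
            exact nocross hjk ht hj hk hx
      leg := B.leg
      head := B.head
      a_eq := B.a_eq
      b_eq := B.b_eq
      leg_pos := B.leg_pos
      head_lt := B.head_lt
      aligned := fun y => by
        have h := B.aligned y
        constructor
        · rintro ⟨j, hj, rfl⟩
          obtain ⟨k, hk, e⟩ := (B.aligned _).1 ⟨j, hj, (aff_end1 j).symm⟩
          exact ⟨k, hk, by rw [aff_end0 k hk, e]⟩
        · rintro ⟨j, hj, rfl⟩
          obtain ⟨k, hk, e⟩ := (B.aligned _).2 ⟨j, hj, (aff_end0 j hj).symm⟩
          exact ⟨k, hk, by rw [aff_end1 k, e]⟩ }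
  have son : ∀ k t, k ≠ i → t ∈ Icc u v → B₁.sign i k t = s' := fun k t hk ht =>
    overlay_left (N := fun j t => j = i ∧ t ∈ Icc u v) ⟨rfl, ht⟩ fun h' => hk h'.1
  have soff : ∀ j k t, (j ≠ i ∧ k ≠ i) ∨ t ∉ Icc u v → B₁.sign j k t = B.sign j k t := by
    intro j k t hw
    refine overlay_base (N := fun j t => j = i ∧ t ∈ Icc u v) ?_ ?_
    · rintro ⟨e, e'⟩; rcases hw with hw | hw
      · exact hw.1 e
      · exact hw e'
    · rintro ⟨e, e'⟩; rcases hw with hw | hw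
      · exact hw.2 e
      · exact hw e'
  have sub : ∀ t, ∀ {y}, y ∉ uIcc (B.x i t) (B'.x i t) → y ∉ uIcc (B.x i t) (X i t) := by
    intro t y hy h'
    rw [Xi] at h'
    exact hy (uIcc_subset_uIcc left_mem_uIcc (between' t) h')
  have sub' : ∀ t, ∀ {y}, y ∉ uIcc (B.x i t) (B'.x i t) → y ∉ uIcc (X i t) (B'.x i t) := by
    intro t y hy h'
    rw [Xi] at h'
    exact hy (uIcc_subset_uIcc (between' t) right_mem_uIcc h')
  refine ⟨B₁, ?_, ?_, fun hr hr' j t ht => ?_, fun h0 hc j k t hcr => ?_⟩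
  · refine ⟨rfl, rfl, rfl, rfl, hau, by linarith, m2.2, fun j hj t _ => congrFun (Xj hj) t,
      fun t ht ht' => ?_, fun j k t hc hw => ?_, fun k t ht hc => ?_, fun k t ht hc => ?_,
      fun h3 h4 => ?_, fun h3 h4 => ?_, fun h0 j k t hj hk ht hc hv => ?_⟩
    · change X i t = _
      rw [Xi]
      rcases le_or_gt τ₂ t with h4 | h4
      · exact g2 h4
      · have : t ≤ u := not_lt.1 fun h5 => ht' ⟨h5, h4⟩
        rw [g1 (by linarith)]
        exact h.x_off t ht fun h5 => by linarith [h5.1]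
    · by_cases hw' : (j ≠ i ∧ k ≠ i) ∨ t ∉ Icc u v
      · exact soff j k t hw'
      · push Not at hw'
        have hji : j = i ∨ k = i := by
          by_contra h5; push Not at h5; exact h5.2 (hw'.1 h5.1)
        rcases hji with rfl | rfl
        · rw [son k t hc.1.symm hw'.2, h.sign_on k t hw'.2 hc]
        · rw [B₁.sign_symm, son j t hc.1 hw'.2, B.sign_symm, h.sign_on j t hw'.2 hc.symm]
    · exact h.sign_on k t ⟨ht.1, by linarith [ht.2]⟩ hc
    · exact son k t hc.1.symm ⟨ht.1, by linarith [ht.2]⟩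
    · exact sub _ (h.leg_off h3 ⟨h4.1, by linarith [h4.2]⟩)
    · exact sub _ (h.head_off h3 ⟨h4.1, by linarith [h4.2]⟩)
    · exact sub _ (h.virt h0 j k t hj hk ⟨ht.1, by linarith [ht.2]⟩ hc hv)
  · have cross : ∀ j k t, B₁.Crosses j k t → (j ≠ i ∧ k ≠ i) ∨ t ∉ Icc u v →
        B.Crosses j k t := by
      intro j k t hc hw
      have e : ∀ {j}, t ∈ Icc (B.a j) (B.b j) → j ≠ i ∨ t ∉ Icc u v → X j t = B.x j t := by
        intro j hj hw
        by_cases hji : j = i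
        · have ht := hw.resolve_left fun h => h hji
          subst hji
          rcases lt_or_ge t u with h3 | h3
          · rw [Xi, g1 (by linarith)]
            exact h.x_off t hj fun h5 => by linarith [h5.1]
          · exact X2 (by linarith [not_le.1 fun h4 => ht ⟨h3, h4⟩])
        · rw [Xj hji]
      refine ⟨hc.1, hc.2.1, hc.2.2.1, ?_⟩
      rw [← e hc.2.1 (hw.imp_left And.left), ← e hc.2.2.1 (hw.imp_left And.right)]
      exact hc.2.2.2
    refine ⟨h.leg, h.head, h.a, h.b, m1.1, by linarith, hvb, fun j hj t ht => ?_,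
      fun t ht ht' => ?_, fun j k t hc hw => ?_, fun k t ht hc => ?_, fun k t ht hc => ?_,
      fun h3 h4 => ?_, fun h3 h4 => ?_, fun h0 j k t hj hk ht hc hv => ?_⟩
    · rw [h.x_ne j hj t ht]; exact (congrFun (Xj hj) t).symm
    · change _ = X i t
      rw [Xi]
      rcases le_or_gt t τ₁ with h4 | h4
      · exact (g1 h4).symm
      · have : v ≤ t := not_lt.1 fun h5 => ht' ⟨h4, h5⟩
        rw [g2 (by linarith)]
        exact h.x_off t ht fun h5 => by linarith [h5.2]
    · by_cases hw' : (j ≠ i ∧ k ≠ i) ∨ t ∉ Icc u v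
      · rw [soff j k t hw', h.sign_off j k t (cross j k t hc hw') hw']
      · have hw2 := hw'
        push Not at hw'
        have htτ : t < τ₁ := by
          rcases hw with hw | hw
          · exact absurd (Or.inl hw) hw2
          · exact not_le.1 fun h5 => hw ⟨h5, hw'.2.2⟩
        have hx : B'.x j t = B'.x k t := by
          rw [← X1 htτ.le hc.2.1, ← X1 htτ.le hc.2.2.1]; exact hc.2.2.2
        have hB' := cr' hc.1 hc.2.1 hc.2.2.1 hx
        have hji : j = i ∨ k = i := by
          by_contra h5; push Not at h5; exact h5.2 (hw'.1 h5.1)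
        rcases hji with rfl | rfl
        · rw [son k t hc.1.symm hw'.2, h.sign_on' k t hw'.2 hB']
        · rw [B₁.sign_symm, son j t hc.1 hw'.2, B'.sign_symm, h.sign_on' j t hw'.2 hB'.symm]
    · exact son k t hc.1.symm ⟨by linarith [ht.1], ht.2⟩
    · exact h.sign_on' k t ⟨by linarith [ht.1], ht.2⟩ hc
    · rw [show B₁.x B₁.leg = B.x B.leg from Xj h3]
      exact sub' _ (h.leg_off h3 ⟨by linarith [h4.1], h4.2⟩)
    · rw [show B₁.x B₁.head = B.x B.head from Xj h3]
      exact sub' _ (h.head_off h3 ⟨by linarith [h4.1], h4.2⟩)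
    · have hc' := cross j k t hc (Or.inl ⟨hj, hk⟩)
      rw [soff j k t (Or.inl ⟨hj, hk⟩)] at hv
      rw [show B₁.x j = B.x j from Xj hj]
      exact sub' _ (h.virt h0 j k t hj hk ⟨by linarith [ht.1], ht.2⟩ hc' hv)
  · change X j t ∈ _
    by_cases hj : j = i
    · subst hj
      rw [Xi]
      exact OrdConnected.uIcc_subset ordConnected_Ioo (hr j t ht)
        (hr' j t (by rw [ea, eb]; exact ht)) (between' t)
    · rw [Xj hj]; exact hr j t ht
  · by_cases hw : (j ≠ i ∧ k ≠ i) ∨ t ∉ Icc u v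
    · rw [soff j k t hw]
      refine hc j k t ⟨hcr.1, hcr.2.1, hcr.2.2.1, ?_⟩
      have hx : X j t = X k t := hcr.2.2.2
      have e : ∀ {j}, t ∈ Icc (B.a j) (B.b j) → j ≠ i ∨ t ∉ Icc u v → X j t = B.x j t := by
        intro j hj hw
        by_cases hji : j = i
        · have ht := hw.resolve_left fun h => h hji
          subst hji
          rcases lt_or_ge t u with h3 | h3
          · rw [Xi, g1 (by linarith)]
            exact h.x_off t hj fun h5 => by linarith [h5.1]
          · exact X2 (by linarith [not_le.1 fun h4 => ht ⟨h3, h4⟩])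
        · rw [Xj hji]
      rw [← e hcr.2.1 (hw.imp_left And.left), ← e hcr.2.2.1 (hw.imp_left And.right), hx]
    · push Not at hw
      have hji : j = i ∨ k = i := by
        by_contra h5; push Not at h5; exact h5.2 (hw.1 h5.1)
      rcases hji with rfl | rfl
      · rw [son k t hcr.1.symm hw.2]; exact h0
      · rw [B₁.sign_symm, son j t hcr.1 hw.2]; simpa using h0

/-- A change of a strand does not change the closures, up to equivalence. -/
theorem eqv (h : WindowChange s' B B' i u v) (hA : Adm s B.toStrandDiagram)
    (hs : s ≠ 0 → s' ≠ 0) (hB : B.Roomy) (hB' : B'.Roomy) : Eqv s B B' := by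
  classical
  by_cases hsmall : (B.p ≤ B.q → ¬ (u = 0 ∧ v = 1)) ∧
      (B.q < B.p → ¬ (B.q ∈ Icc u v ∧ B.p ∈ Icc u v))
  · exact h.eqv_of_small hA hs hB hB' hsmall.1 hsmall.2
  -- the change is split at a height between `lo` and `hi`: each of the two windows then contains one
  -- end only
  have hlo : ∃ lo hi, lo < hi ∧ u ≤ lo ∧ hi ≤ v ∧ ((B.p ≤ B.q ∧ 0 ≤ lo ∧ hi ≤ 1) ∨
      (B.q < B.p ∧ lo = B.q ∧ hi = B.p)) := by
    rcases lt_or_ge B.q B.p with hqp | hpq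
    · have : B.q ∈ Icc u v ∧ B.p ∈ Icc u v := by
        by_contra h'
        exact hsmall ⟨fun h => absurd hqp (not_lt.2 h), fun _ => h'⟩
      exact ⟨B.q, B.p, hqp, this.1.1, this.2.2, Or.inr ⟨hqp, rfl, rfl⟩⟩
    · exact ⟨u, v, h.lt, le_rfl, le_rfl, Or.inl ⟨hpq, (B.a_nonneg i).trans h.a_le,
        h.le_b.trans (B.b_le_one i)⟩⟩
  obtain ⟨lo, hi, hlh, hul, hhv, hcase⟩ := hlo
  obtain ⟨T₁, hT₁⟩ := exists_isGrid B.toStrandDiagram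
  obtain ⟨T₂, hT₂⟩ := exists_isGrid B'.toStrandDiagram
  have hT := hT₁.mono (T' := T₁ ∪ T₂) Finset.subset_union_left
  have hT' := hT₂.mono (T' := T₁ ∪ T₂) Finset.subset_union_right
  obtain ⟨r, r1, r2, hr⟩ := Ioo_disjoint_of_finite (T₁ ∪ T₂) lo hlh
  obtain ⟨z, z1, z2⟩ := exists_between r1
  -- if the old and the new strand pass each other, the split is made at one of the sides of this point
  have hsplit : ∃ τ₁ τ₂, lo < τ₁ ∧ τ₁ < τ₂ ∧ τ₂ ≤ r ∧
      0 ≤ (B'.x i τ₁ - B.x i τ₁) * (B'.x i τ₂ - B.x i τ₂) := by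
    by_cases hpos : 0 ≤ (B'.x i z - B.x i z) * (B'.x i r - B.x i r)
    · exact ⟨z, r, z1, z2, le_rfl, hpos⟩
    have ha := h.a_le
    have hb := h.le_b
    have free : ∀ y ∈ T₁ ∪ T₂, y ∉ Ioo z r := fun y hy hy' => hr y hy ⟨z1.trans hy'.1, hy'.2.le⟩
    have A1 : AffineOn (B.x i) z r := hT.poly i z r (by linarith) z2 (by linarith) free
    have A2 : AffineOn (B'.x i) z r := hT'.poly i z r (by rw [h.a]; linarith) z2
      (by rw [h.b]; linarith) free
    have key : ∃ y ∈ Icc z r, B'.x i y - B.x i y = 0 := by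
      rcases lt_trichotomy (B'.x i z - B.x i z) 0 with h1 | h1 | h1
      · exact (A2.sub A1).exists_zero z2.le h1 (by nlinarith)
      · exact ⟨z, ⟨le_rfl, z2.le⟩, h1⟩
      · obtain ⟨y, hy, h0⟩ := (A1.sub A2).exists_zero z2.le (by linarith) (by nlinarith)
        exact ⟨y, hy, by linarith⟩
    obtain ⟨y, hy, h0⟩ := key
    rcases eq_or_lt_of_le hy.1 with rfl | h1
    · exact absurd (by rw [h0, zero_mul]) hpos
    · exact ⟨z, y, z1, h1, hy.2, by rw [h0, mul_zero]⟩
  obtain ⟨τ₁, τ₂, t1, t12, t2, hsg⟩ := hsplit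
  obtain ⟨B₁, w1, w2, hroom, hcl⟩ := h.exists_split hT hT' (by linarith) t12 (by linarith)
    (fun y hy hy' => hr y hy ⟨by linarith [hy'.1], by linarith [hy'.2]⟩) hsg
  have hr₁ := hroom hB hB'
  have hA₁ : Adm s B₁.toStrandDiagram := fun h0 => hcl (hs h0) (hA h0)
  refine (w1.eqv_of_small hA hs hB hr₁ (fun h1 h2 => ?_) fun h1 h2 => ?_).trans
    (w2.eqv_of_small hA₁ hs hr₁ hB' (fun h1 h2 => ?_) fun h1 h2 => ?_) hA₁ hr₁
  · rcases hcase with ⟨h3, h4, h5⟩ | ⟨h3, h4, h5⟩ <;> linarith [h2.2]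
  · rcases hcase with ⟨h3, h4, h5⟩ | ⟨h3, h4, h5⟩ <;> linarith [h2.2.2]
  · rw [w1.p_eq, w1.q_eq] at h1
    rcases hcase with ⟨h3, h4, h5⟩ | ⟨h3, h4, h5⟩ <;> linarith [h2.1]
  · rw [w1.p_eq, w1.q_eq] at h1 h2
    rcases hcase with ⟨h3, h4, h5⟩ | ⟨h3, h4, h5⟩ <;> linarith [h2.1.1]

end WindowChange

end Braidoids

namespace Braidoids
open Set OpenBraid

variable {m n : ℕ} {B B' : OpenBraid m} {f : Fin m → Fin n} {s : SignType}
  {D D' : BraidDiagram n} {tH tL : ℝ}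

/-! ### Moves of the endpoints -/

theorem Clos.crosses_old (h : Clos s B D f) {i j : Fin m} {t : ℝ} (hc : D.Crosses (f i) (f j) t)
    (hi : t ∈ Icc (B.a i) (B.b i)) (hj : t ∈ Icc (B.a j) (B.b j)) : B.Crosses i j t :=
  ⟨fun e => hc.1 (congrArg f e), hi, hj, by rw [← h.x_eq i t hi, ← h.x_eq j t hj, hc.2.2.2]⟩

/-- `B'` is obtained from `B` by a change of the strand of the leg above the height `tL` and of the
strand of the head below the height `tH`, in regions without crossings. The heights of the leg and
the head may change. -/
structure EndMove (B B' : OpenBraid m) (tH tL : ℝ) : Prop where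
  leg : B'.leg = B.leg
  head : B'.head = B.head
  a : ∀ j, j ≠ B.leg → B'.a j = B.a j
  b : ∀ j, j ≠ B.head → B'.b j = B.b j
  p_le : B.p ≤ tL
  p_le' : B'.p ≤ tL
  le_q : tH ≤ B.q
  le_q' : tH ≤ B'.q
  x_eq : ∀ j, ∀ t ∈ Icc (B.a j) (B.b j), (j = B.leg → tL ≤ t) → (j = B.head → t ≤ tH) →
    B'.x j t = B.x j t
  sign_eq : ∀ j k t, B.Crosses j k t → B'.sign j k t = B.sign j k t
  leg_free : ∀ k t, t ≤ tL → ¬ B.Crosses B.leg k t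
  leg_free' : ∀ k t, t ≤ tL → ¬ B'.Crosses B.leg k t
  head_free : ∀ k t, tH ≤ t → ¬ B.Crosses B.head k t
  head_free' : ∀ k t, tH ≤ t → ¬ B'.Crosses B.head k t

namespace EndMove

theorem mem_iff (h : EndMove B B' tH tL) {j : Fin m} {t : ℝ} (h1 : j = B.leg → tL ≤ t)
    (h2 : j = B.head → t ≤ tH) : t ∈ Icc (B'.a j) (B'.b j) ↔ t ∈ Icc (B.a j) (B.b j) := by
  have e1 : B'.a j ≤ t ↔ B.a j ≤ t := by
    by_cases hj : j = B.leg
    · have := h1 hj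
      subst hj
      have h3 := h.p_le'
      rw [OpenBraid.p, h.leg] at h3
      exact iff_of_true (h3.trans this) (h.p_le.trans this)
    · rw [h.a j hj]
  have e2 : t ≤ B'.b j ↔ t ≤ B.b j := by
    by_cases hj : j = B.head
    · have := h2 hj
      subst hj
      have h3 := h.le_q'
      rw [OpenBraid.q, h.head] at h3
      exact iff_of_true (this.trans h3) (this.trans h.le_q)
    · rw [h.b j hj]
  rw [mem_Icc, mem_Icc, e1, e2]

theorem away (h : EndMove B B' tH tL) {j k : Fin m} {t : ℝ} (hc : B.Crosses j k t) :
    ((j = B.leg → tL ≤ t) ∧ (j = B.head → t ≤ tH)) ∧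
      (k = B.leg → tL ≤ t) ∧ (k = B.head → t ≤ tH) := by
  refine ⟨⟨?_, ?_⟩, ?_, ?_⟩ <;> rintro rfl <;> by_contra h'
  · exact h.leg_free _ _ (not_le.1 h').le hc
  · exact h.head_free _ _ (not_le.1 h').le hc
  · exact h.leg_free _ _ (not_le.1 h').le hc.symm
  · exact h.head_free _ _ (not_le.1 h').le hc.symm

theorem crosses (h : EndMove B B' tH tL) {j k : Fin m} {t : ℝ} (hc : B.Crosses j k t) :
    B'.Crosses j k t := by
  obtain ⟨⟨h1, h2⟩, h3, h4⟩ := h.away hc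
  exact ⟨hc.1, (h.mem_iff h1 h2).2 hc.2.1, (h.mem_iff h3 h4).2 hc.2.2.1, by
    rw [h.x_eq j t hc.2.1 h1 h2, h.x_eq k t hc.2.2.1 h3 h4, hc.2.2.2]⟩

theorem symm (h : EndMove B B' tH tL) : EndMove B' B tH tL := by
  have x_eq : ∀ j, ∀ t ∈ Icc (B'.a j) (B'.b j), (j = B.leg → tL ≤ t) → (j = B.head → t ≤ tH) →
      B.x j t = B'.x j t := fun j t ht h1 h2 => (h.x_eq j t ((h.mem_iff h1 h2).1 ht) h1 h2).symm
  refine ⟨h.leg.symm, h.head.symm, fun j hj => (h.a j (h.leg ▸ hj)).symm,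
    fun j hj => (h.b j (h.head ▸ hj)).symm, h.p_le', h.p_le, h.le_q', h.le_q,
    fun j t ht h1 h2 => x_eq j t ht (h.leg ▸ h1) (h.head ▸ h2), fun j k t hc => ?_,
    fun k t ht => h.leg ▸ h.leg_free' k t ht, fun k t ht => h.leg ▸ h.leg_free k t ht,
    fun k t ht => h.head ▸ h.head_free' k t ht, fun k t ht => h.head ▸ h.head_free k t ht⟩
  have away : ∀ j k, B'.Crosses j k t → (j = B.leg → tL ≤ t) ∧ (j = B.head → t ≤ tH) := by
    refine fun j k hc => ⟨?_, ?_⟩ <;> rintro rfl <;> by_contra h'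
    · exact h.leg_free' _ _ (not_le.1 h').le hc
    · exact h.head_free' _ _ (not_le.1 h').le hc
  obtain ⟨h1, h2⟩ := away j k hc
  obtain ⟨h3, h4⟩ := away k j hc.symm
  exact (h.sign_eq j k t ⟨hc.1, (h.mem_iff h1 h2).1 hc.2.1, (h.mem_iff h3 h4).1 hc.2.2.1, by
    rw [x_eq j t hc.2.1 h1 h2, x_eq k t hc.2.2.1 h3 h4, hc.2.2.2]⟩).symm

theorem adm (h : EndMove B B' tH tL) (hA : Adm s B.toStrandDiagram) :
    Adm s B'.toStrandDiagram := fun hs j k t hc => by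
  have hc' := h.symm.crosses hc
  rw [h.sign_eq j k t hc']
  exact hA hs j k t hc'

theorem mono (h : EndMove B B' tH tL) {tH' tL' : ℝ} (h1 : tH' ≤ tH) (h2 : tL ≤ tL')
    (h3 : ∀ k t, t ≤ tL' → ¬ B.Crosses B.leg k t) (h4 : ∀ k t, tH' ≤ t → ¬ B.Crosses B.head k t) :
    EndMove B B' tH' tL' :=
  ⟨h.leg, h.head, h.a, h.b, h.p_le.trans h2, h.p_le'.trans h2, h1.trans h.le_q, h1.trans h.le_q',
    fun j t ht h5 h6 => h.x_eq j t ht (fun e => h2.trans (h5 e)) fun e => (h6 e).trans h1,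
    h.sign_eq, h3, fun k t ht hc => h3 k t ht (h.symm.crosses hc), h4,
    fun k t ht hc => h4 k t ht (h.symm.crosses hc)⟩

theorem trans {B'' : OpenBraid m} (h : EndMove B B' tH tL) (h' : EndMove B' B'' tH tL) :
    EndMove B B'' tH tL := by
  refine ⟨h'.leg.trans h.leg, h'.head.trans h.head, fun j hj => ?_, fun j hj => ?_, h.p_le,
    h'.p_le', h.le_q, h'.le_q', fun j t ht h1 h2 => ?_, fun j k t hc => ?_, h.leg_free,
    fun k t ht => h.leg ▸ h'.leg_free' k t ht, h.head_free,
    fun k t ht => h.head ▸ h'.head_free' k t ht⟩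
  · rw [h'.a j (h.leg ▸ hj), h.a j hj]
  · rw [h'.b j (h.head ▸ hj), h.b j hj]
  · rw [h'.x_eq j t ((h.mem_iff h1 h2).2 ht) (h.leg ▸ h1) (h.head ▸ h2), h.x_eq j t ht h1 h2]
  · rw [h'.sign_eq j k t (h.crosses hc), h.sign_eq j k t hc]

theorem lab (h : EndMove B B' tH tL) (hf : B.Lab f) (hq : B.q < B.p ↔ B'.q < B'.p) : B'.Lab f :=
  ⟨hf.surj, fun j k => by rw [← hq, h.leg, h.head, hf.ker]⟩

theorem clos_x (h : EndMove B B' tH tL) (hD : Clos s B D f) (hD' : Clos s B' D' f) {i : Fin m}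
    {t : ℝ} (hi : t ∈ Icc (B.a i) (B.b i)) (h1 : i = B.leg → tL ≤ t) (h2 : i = B.head → t ≤ tH) :
    D'.x (f i) t = D.x (f i) t := by
  rw [hD.x_eq i t hi, hD'.x_eq i t ((h.mem_iff h1 h2).2 hi), h.x_eq i t hi h1 h2]

theorem clos_sign (h : EndMove B B' tH tL) (hD : Clos s B D f) (hD' : Clos s B' D' f)
    {i j : Fin m} {t : ℝ} (hc : D.Crosses (f i) (f j) t) (hi : t ∈ Icc (B.a i) (B.b i))
    (hj : t ∈ Icc (B.a j) (B.b j)) : D'.sign (f i) (f j) t = D.sign (f i) (f j) t := by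
  have hB := hD.crosses_old hc hi hj
  rw [hD.sign_eq i j t hB, hD'.sign_eq i j t (h.crosses hB), h.sign_eq i j t hB]

/-- If both diagrams have their heads above their legs, their closures differ in one arc. -/
theorem move_joined (h : EndMove B B' tH tL) (hD : Clos s B D f) (hD' : Clos s B' D' f)
    (hA : Adm s B.toStrandDiagram) (hr : D.Roomy) (hr' : D'.Roomy) (hqp : B.q < B.p)
    (hqp' : B'.q < B'.p) (hlt : tH < tL) (h0 : 0 ≤ tH) (h1 : tL ≤ 1) : R s ⟨n, D⟩ ⟨n, D'⟩ := by
  have e := hD.lab.joined hqp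
  have ne : B.leg ≠ B.head := fun e => by
    have := B.a_lt_b B.leg
    unfold p q at hqp
    rw [← e] at hqp
    linarith
  have mh : ∀ {t}, 0 ≤ t → t ≤ tH → t ∈ Icc (B.a B.head) (B.b B.head) := fun h0 h1 =>
    ⟨by rw [B.a_eq _ ne.symm]; exact h0, h1.trans h.le_q⟩
  have ml : ∀ {t}, t ≤ 1 → tL ≤ t → t ∈ Icc (B.a B.leg) (B.b B.leg) := fun h0 h1 =>
    ⟨h.p_le.trans h1, by rw [B.b_eq _ ne]; exact h0⟩
  have old : ∀ {j t}, t ∈ Icc (0 : ℝ) 1 → j ≠ f B.leg →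
      ∃ i, f i = j ∧ i ≠ B.leg ∧ i ≠ B.head ∧ t ∈ Icc (B.a i) (B.b i) := by
    intro j t ht hj
    obtain ⟨i, rfl, hi⟩ := exists_old fun hn : B.New f j t => by
      rcases hD.lab.new_cases ht hn with ⟨h1, -⟩ | ⟨h1, -⟩
      · exact hj h1
      · exact hj (h1.trans e.symm)
    exact ⟨i, rfl, fun h' => hj (congrArg f h'), fun h' => hj ((congrArg f h').trans e.symm), hi⟩
  have typ : ∀ {B B' : OpenBraid m} {D : BraidDiagram n} {k t}, EndMove B B' tH tL →
      Clos s B D f → B.q < B.p → t ∈ Icc tH tL → D.Crosses (f B.leg) k t →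
      D.sign (f B.leg) k t = s := by
    intro B B' D k t h hD hqp ht hc
    by_cases hn : B.New f (f B.leg) t
    · exact hD.sign_new _ _ _ hc hn
    obtain ⟨i, hi, hi'⟩ := exists_old hn
    have hc' := D.crosses_iff.1 hc
    obtain ⟨j, rfl, hj⟩ := exists_old fun hn : B.New f k t => by
      rcases hD.lab.new_cases hc'.2.1 hn with ⟨h1, -⟩ | ⟨h1, -⟩
      · exact hc'.1 h1.symm
      · exact hc'.1 ((hD.lab.joined hqp).trans h1.symm)
    rw [← hi] at hc
    have hB := hD.crosses_old hc hi' hj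
    rcases (hD.lab.ker i B.leg).1 hi with rfl | ⟨-, ⟨rfl, -⟩ | ⟨rfl, -⟩⟩
    · exact (h.leg_free _ _ ht.2 hB).elim
    · exact (h.leg_free _ _ ht.2 hB).elim
    · exact (h.head_free _ _ ht.1 hB).elim
  have hx : ∀ j, j ≠ f B.leg → ∀ t ∈ Icc (0 : ℝ) 1, D'.x j t = D.x j t := fun j hj t ht => by
    obtain ⟨i, rfl, h1, h2, hi⟩ := old ht hj
    exact h.clos_x hD hD' hi (fun e => absurd e h1) fun e => absurd e h2
  have hAD := hD.adm hA
  refine arc_move (c := f B.leg) (s' := s) h0 hlt h1 hx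
    (fun t ht ht' => ?_) (fun j k t hj hk hc => ?_) (fun k t ht hc => ?_)
    (fun k t ht hc => typ h hD hqp ht hc)
    (fun k t ht hc => by
      rw [← h.leg] at hc ⊢; exact typ h.symm hD' hqp' ht hc)
    (fun h j k t _ _ _ hc h' => absurd h' (hAD h j k t hc)) (fun h => ⟨h, hAD h⟩) hr hr'
  · rcases le_or_gt t tH with h3 | h3
    · rw [e]
      exact h.clos_x hD hD' (mh ht.1 h3) (fun e => absurd e.symm ne) fun _ => h3
    · have h4 : tL ≤ t := not_lt.1 fun h4 => ht' ⟨h3, h4⟩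
      exact h.clos_x hD hD' (ml ht.2 h4) (fun _ => h4) fun e => absurd e ne
  · have ht := (D.crosses_iff.1 hc).2.1
    obtain ⟨i, rfl, -, -, hi⟩ := old ht hj
    obtain ⟨i', rfl, -, -, hi'⟩ := old ht hk
    exact h.clos_sign hD hD' hc hi hi'
  · have hc' := D.crosses_iff.1 hc
    obtain ⟨i, rfl, -, -, hi⟩ := old hc'.2.1 hc'.1.symm
    rcases le_or_gt t tH with h3 | h3
    · rw [e] at hc ⊢
      exact h.clos_sign hD hD' hc (mh hc'.2.1.1 h3) hi
    · exact h.clos_sign hD hD' hc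
        (ml hc'.2.1.2 (not_lt.1 fun h4 => ht ⟨h3.le, h4.le⟩)) hi

/-- If both diagrams have their legs above their heads, their closures differ in two arcs. -/
theorem move_opened (h : EndMove B B' tH tL) (hD : Clos s B D f) (hD' : Clos s B' D' f)
    (hA : Adm s B.toStrandDiagram) (hr : D.Roomy) (hr' : D'.Roomy) (hlt : tL ≤ tH)
    (he : D'.x (f B.leg) 0 = D.x (f B.leg) 0) : R s ⟨n, D⟩ ⟨n, D'⟩ := by
  have hpq : ∀ {B B' : OpenBraid m}, EndMove B B' tH tL → B.p ≤ B.q := fun h =>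
    h.p_le.trans (hlt.trans h.le_q)
  have hqp := not_lt.2 (hpq h)
  have old : ∀ {B B' : OpenBraid m} {D : BraidDiagram n} {j t}, EndMove B B' tH tL →
      Clos s B D f → t ∈ Icc (0 : ℝ) 1 → (j = f B.leg → tL ≤ t) → (j = f B.head → t ≤ tH) →
      ∃ i, f i = j ∧ t ∈ Icc (B.a i) (B.b i) := by
    intro B B' D j t h hD ht h1 h2
    refine exists_old fun hn : B.New f j t => ?_
    rcases hD.lab.new_cases ht hn with ⟨h3, h4, -⟩ | ⟨h3, h4, -⟩
    · linarith [h1 h3, h.p_le]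
    · linarith [h2 h3, h.le_q]
  have typ : ∀ {B B' : OpenBraid m} {D : BraidDiagram n} {k t}, EndMove B B' tH tL →
      Clos s B D f → t ≤ tL → D.Crosses (f B.leg) k t → D.sign (f B.leg) k t = s := by
    intro B B' D k t h hD ht hc
    have hc' := D.crosses_iff.1 hc
    by_cases hn : B.New f (f B.leg) t
    · exact hD.sign_new _ _ _ hc hn
    obtain ⟨i, hi, hi'⟩ := exists_old hn
    obtain rfl := hD.lab.inj (hpq h) hi
    obtain ⟨j, rfl, hj⟩ := old h hD hc'.2.1 (fun e => absurd e.symm hc'.1) fun _ => ht.trans hlt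
    exact (h.leg_free _ _ ht (hD.crosses_old hc hi' hj)).elim
  have typ' : ∀ {B B' : OpenBraid m} {D : BraidDiagram n} {k t}, EndMove B B' tH tL →
      Clos s B D f → tH ≤ t → D.Crosses (f B.head) k t → D.sign (f B.head) k t = s := by
    intro B B' D k t h hD ht hc
    have hc' := D.crosses_iff.1 hc
    by_cases hn : B.New f (f B.head) t
    · exact hD.sign_new _ _ _ hc hn
    obtain ⟨i, hi, hi'⟩ := exists_old hn
    obtain rfl := hD.lab.inj (hpq h) hi
    obtain ⟨j, rfl, hj⟩ := old h hD hc'.2.1 (fun _ => hlt.trans ht) fun e => absurd e.symm hc'.1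
    exact (h.head_free _ _ ht (hD.crosses_old hc hi' hj)).elim
  refine two_arcs_move (c₁ := f B.leg) (c₂ := f B.head) (u := tL) (v := tH)
    (B.leg_pos.trans_le h.p_le) hlt (h.le_q.trans_lt B.head_lt)
    (fun j t ht h1 h2 => ?_) he ?_ (fun j k t hc h1 h2 h3 h4 => ?_) (fun k t ht hc => typ h hD ht hc)
    (fun k t ht hc => ?_) (fun k t ht hc => typ' h hD ht hc) (fun k t ht hc => ?_)
    (fun k hc => ?_) (hD.adm hA) (hD'.adm (h.adm hA)) hr hr'
  · obtain ⟨i, rfl, hi⟩ := old h hD ht h1 h2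
    exact h.clos_x hD hD' hi (fun e => h1 (congrArg f e)) fun e => h2 (congrArg f e)
  · have e1 := hD'.ends (hpq h.symm)
    rw [h.leg, h.head] at e1
    rw [← e1, he, hD.ends (hpq h)]
  · have ht := (D.crosses_iff.1 hc).2.1
    obtain ⟨i, rfl, hi⟩ := old h hD ht h1 h2
    obtain ⟨i', rfl, hi'⟩ := old h hD ht h3 h4
    exact h.clos_sign hD hD' hc hi hi'
  · rw [← h.leg] at hc ⊢; exact typ h.symm hD' ht hc
  · rw [← h.head] at hc ⊢; exact typ' h.symm hD' ht hc
  · have hc' := D.crosses_iff.1 hc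
    obtain ⟨i, hi, hi'⟩ := old h hD (j := f B.leg) hc'.2.1 (fun _ => le_rfl) (fun _ => hlt)
    obtain ⟨j, rfl, hj⟩ := old h hD hc'.2.1 (fun e => absurd e.symm hc'.1) fun _ => hlt
    obtain rfl := hD.lab.inj (hpq h) hi
    exact h.leg_free _ _ le_rfl (hD.crosses_old hc hi' hj)

theorem eqv_of_joined (h : EndMove B B' tH tL) (hA : Adm s B.toStrandDiagram) (hB : B.Roomy)
    (hB' : B'.Roomy) (hqp : B.q < B.p) (hqp' : B'.q < B'.p) (hlt : tH < tL) (h0 : 0 ≤ tH)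
    (h1 : tL ≤ 1) : Eqv s B B' := by
  obtain ⟨n, f, hf⟩ := B.exists_lab
  have hf' := h.lab hf (iff_of_true hqp hqp')
  obtain ⟨S, hS⟩ := hB.exists_clos_end hf s
  obtain ⟨S', hS'⟩ := hB'.exists_clos_end hf' s
  obtain ⟨y, hy, hy1⟩ := exists_not_mem_finite S
  obtain ⟨y', hy', hy1'⟩ := exists_not_mem_finite S'
  obtain ⟨D, hD, hr, -⟩ := hS y hy hy1
  obtain ⟨D', hD', hr', -⟩ := hS' y' hy' hy1'
  exact ⟨n, f, D, n, f, D', hD, hr, hD', hr', h.move_joined hD hD' hA hr hr' hqp hqp' hlt h0 h1⟩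

theorem eqv_of_opened (h : EndMove B B' tH tL) (hA : Adm s B.toStrandDiagram) (hB : B.Roomy)
    (hB' : B'.Roomy) (hlt : tL ≤ tH) : Eqv s B B' := by
  classical
  have hpq : B.p ≤ B.q := h.p_le.trans (hlt.trans h.le_q)
  have hpq' : B'.p ≤ B'.q := h.p_le'.trans (hlt.trans h.le_q')
  obtain ⟨n, f, hf⟩ := B.exists_lab
  have hf' := h.lab hf (iff_of_false (not_lt.2 hpq) (not_lt.2 hpq'))
  obtain ⟨S, hS⟩ := hB.exists_clos_end hf s
  obtain ⟨S', hS'⟩ := hB'.exists_clos_end hf' s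
  obtain ⟨y, hy, hy1⟩ := exists_not_mem_finite (S ∪ S')
  rw [Finset.mem_union, not_or] at hy1
  obtain ⟨D, hD, hr, e⟩ := hS y hy hy1.1
  obtain ⟨D', hD', hr', e'⟩ := hS' y hy hy1.2
  refine ⟨n, f, D, n, f, D', hD, hr, hD', hr', h.move_opened hD hD' hA hr hr' hlt ?_⟩
  rw [e hpq, ← e' hpq', h.leg]

end EndMove

end Braidoids

namespace Braidoids
open Set OpenBraid

variable {m n : ℕ} {B : OpenBraid m} {f : Fin m → Fin n} {s : SignType}

/-! ### Opening the arc of a closure -/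

/-- The strands of a closure in which the arc from the head to the leg has been opened. -/
def openLab (B : OpenBraid m) (f : Fin m → Fin n) (i : Fin m) : Fin (n + 1) :=
  if i = B.leg then Fin.last n else (f i).castSucc

theorem openLab_leg : openLab B f B.leg = Fin.last n := if_pos rfl

theorem openLab_of_ne {i : Fin m} (h : i ≠ B.leg) : openLab B f i = (f i).castSucc := if_neg h

theorem OpenBraid.leg_ne_head (hqp : B.q < B.p) : B.leg ≠ B.head := fun e => by
  have := B.a_lt_b B.leg
  unfold p q at hqp
  rw [← e] at hqp
  linarith

theorem OpenBraid.Lab.openLab_injective (hf : B.Lab f) : Function.Injective (openLab B f) := by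
  intro i j h
  by_cases hi : i = B.leg <;> by_cases hj : j = B.leg
  · rw [hi, hj]
  · rw [hi, openLab_leg, openLab_of_ne hj] at h
    exact absurd h (Fin.castSucc_lt_last _).ne'
  · rw [hj, openLab_leg, openLab_of_ne hi] at h
    exact absurd h (Fin.castSucc_lt_last _).ne
  · rw [openLab_of_ne hi, openLab_of_ne hj] at h
    rcases (hf.ker i j).1 (Fin.castSucc_injective _ h) with h | ⟨-, ⟨h, -⟩ | ⟨-, h⟩⟩
    · exact h
    · exact absurd h hi
    · exact absurd h hj

theorem OpenBraid.Lab.openLab_surjective (hf : B.Lab f) (hqp : B.q < B.p) :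
    Function.Surjective (openLab B f) := by
  intro c
  induction c using Fin.lastCases with
  | last => exact ⟨_, openLab_leg⟩
  | cast j =>
    obtain ⟨i, rfl⟩ := hf.surj j
    by_cases hi : i = B.leg
    · refine ⟨B.head, ?_⟩
      rw [openLab_of_ne (leg_ne_head hqp).symm, hi, hf.joined hqp]
    · exact ⟨i, openLab_of_ne hi⟩

theorem openedFrom_openLab (i : Fin m) : openedFrom (f B.leg) (openLab B f i) = f i := by
  by_cases hi : i = B.leg
  · rw [hi, openLab_leg, openedFrom_last]
  · rw [openLab_of_ne hi, openedFrom_castSucc]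

/-- A closure of a diagram whose head is above its leg, with an added arc near one of the sides of
the square, can be opened at this arc. In the result the strand of the head continues to the bottom
line, and the strand of the leg comes from the top line, both at `e₀`. -/
theorem exists_opened_closure (hf : B.Lab f) (hqp : B.q < B.p) (hB : B.Roomy) {T : Finset ℝ}
    (hT : IsGrid B.toStrandDiagram T) {t₁ t₂ e₀ e₁ e₂ lo hi : ℝ} (ht₁ : t₁ ∈ T) (ht₂ : t₂ ∈ T)
    (hq1 : B.q < t₁) (h12 : t₁ < t₂) (h2p : t₂ < B.p) (free : ∀ r ∈ T, r ∉ Ioo t₁ t₂)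
    (hlo : 0 < lo) (hhi : hi < 1) (he₁ : e₁ ∈ Icc lo hi) (he₂ : e₂ ∈ Icc lo hi)
    (hbt : (e₁ < e₀ ∧ e₀ < e₂) ∨ (e₂ < e₀ ∧ e₀ < e₁))
    (hm : ∀ i, ∀ t ∈ Icc (B.a i) (B.b i), B.x i t ∉ Icc lo hi) (s : SignType) :
    ∃ (D : BraidDiagram n) (E : BraidDiagram (n + 1)), Clos s B D f ∧ D.Roomy ∧ E.Roomy ∧
      (Adm s B.toStrandDiagram → R s ⟨n, D⟩ ⟨n + 1, E⟩) ∧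
      (∀ i, ∀ t ∈ Icc (B.a i) (B.b i), E.x (openLab B f i) t = B.x i t) ∧
      (∀ i j t, B.Crosses i j t →
        E.sign (openLab B f i) (openLab B f j) t = B.sign i j t) ∧
      (∀ c, PolyOn T (E.x c) 0 1) ∧
      (∀ τ ∈ T, B.q < τ → τ ≤ 1 → E.x (openLab B f B.head) τ = if τ ≤ t₁ then e₁ else e₀) ∧
      (∀ τ ∈ T, 0 ≤ τ → τ < B.p → E.x (openLab B f B.leg) τ = if τ ≤ t₁ then e₀ else e₂) ∧
      (∀ k t, E.Crosses (openLab B f B.head) k t → B.q < t → (k = openLab B f B.leg → t₁ ≤ t) →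
        E.sign (openLab B f B.head) k t = s) ∧
      (∀ k t, E.Crosses (openLab B f B.leg) k t → t < B.p → (k = openLab B f B.head → t ≤ t₂) →
        E.sign (openLab B f B.leg) k t = s) := by
  have e := hf.joined hqp
  have hne := leg_ne_head hqp
  have q0 := B.q_pos
  have p1 := B.p_lt_one
  have he₀ : e₀ ∈ Icc lo hi := by
    rcases hbt with h | h
    · exact ⟨he₁.1.trans h.1.le, h.2.le.trans he₂.2⟩
    · exact ⟨he₂.1.trans h.1.le, h.2.le.trans he₁.2⟩
  let w : ℝ → ℝ := fun τ => if τ ≤ t₁ then e₁ else e₂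
  have hw : ∀ τ, w τ ∈ Icc lo hi := fun τ => by
    simp only [w]; split_ifs <;> assumption
  have hw0 : ∀ τ, w τ ≠ e₀ := fun τ => by
    simp only [w]
    rcases hbt with h | h <;> split_ifs <;> linarith [h.1, h.2]
  have inner : ∀ {y}, y ∈ Icc lo hi → y ∈ Ioo (0 : ℝ) 1 := fun h =>
    ⟨hlo.trans_le h.1, h.2.trans_lt hhi⟩
  obtain ⟨D, hD, P, W, hr⟩ := exists_clos hf hT s w
    (fun τ _ => Ioo_subset_Icc_self (inner (hw τ)))
    (fun τ _ _ i hi he => hm i τ hi (he ▸ hw τ)) fun h => absurd h (not_le.2 hqp)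
  have hrD := hr hB fun τ _ => inner (hw τ)
  have new : ∀ {t}, B.q < t → t < B.p → B.New f (f B.leg) t := fun h1 h2 =>
    hf.new_of_lt h2 fun _ => h1
  have val : ∀ τ ∈ T, B.q < τ → τ < B.p → D.x (f B.leg) τ = w τ := fun τ h1 h2 h3 =>
    W _ τ h1 ⟨by linarith, by linarith⟩ (new h2 h3)
  have v₁ : D.x (f B.leg) t₁ = e₁ := by rw [val t₁ ht₁ hq1 (by linarith)]; exact if_pos le_rfl
  have v₂ : D.x (f B.leg) t₂ = e₂ := by
    rw [val t₂ ht₂ (by linarith) h2p]; exact if_neg (not_le.2 h12)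
  have can : CanOpen D (f B.leg) t₁ t₂ e₀ := by
    refine ⟨by linarith, h12, by linarith, by rw [v₁, v₂]; exact hbt,
      P _ t₁ t₂ (by linarith) h12 (by linarith) free, fun j hj t ht => ?_, fun j t ht _ hx => ?_⟩
    · have ht' : t ∈ Icc (0 : ℝ) 1 := ⟨by linarith [ht.1], by linarith [ht.2]⟩
      obtain ⟨i, rfl, hi⟩ := exists_old fun hn : B.New f j t =>
        hj (hf.new_unique ht' hn (new (by linarith [ht.1]) (by linarith [ht.2])))
      rw [hD.x_eq i t hi, v₁, v₂]
      exact fun h => hm i t hi (uIcc_subset_Icc he₁ he₂ h)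
    · have isnew : ∀ k, D.x k t = e₀ → B.New f k t := fun k hk => by
        by_contra hn
        obtain ⟨i, rfl, hi⟩ := exists_old hn
        rw [hD.x_eq i t hi] at hk
        exact hm i t hi (hk ▸ he₀)
      have := ((P j).sub (PolyOn.const T e₀ 0 1)).transAt_of_ne hT.zero hT.one
        (fun τ hτ hτ' => ?_) ht (sub_eq_zero.2 hx)
      · exact ⟨this.1, this.2, fun k hk => hf.new_unique ht (isnew k hk) (isnew j hx)⟩
      · rw [sub_ne_zero]
        by_cases hn : B.New f j τ
        · rw [W j τ hτ hτ' hn]; exact hw0 τ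
        · obtain ⟨i, rfl, hi⟩ := exists_old hn
          rw [hD.x_eq i τ hi]
          exact fun h => hm i τ hi (h ▸ he₀)
  obtain ⟨E, op, lm, X, S, N, A, Ro⟩ := exists_opening can s
  have hU : openLab B f B.head = (f B.leg).castSucc := by rw [openLab_of_ne hne.symm, e]
  have hL : openLab B f B.leg = Fin.last n := openLab_leg
  have notnew : ∀ i t, t ∈ Icc (B.a i) (B.b i) →
      ¬ OpenedNew (f B.leg) t₁ t₂ (openLab B f i) t := by
    intro i t ht hn
    by_cases hi : i = B.leg
    · subst hi
      rw [hL] at hn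
      rcases hn with ⟨h, -⟩ | ⟨-, h⟩
      · exact (Fin.castSucc_lt_last _).ne' h
      · linarith [ht.1]
    · rw [openLab_of_ne hi, openedNew_castSucc] at hn
      rcases (hf.ker i B.leg).1 hn.1 with h | ⟨-, ⟨h, -⟩ | ⟨rfl, -⟩⟩
      · exact hi h
      · exact hi h
      · linarith [ht.2, hn.2]
  have other : ∀ k, k ≠ openLab B f B.head → k ≠ openLab B f B.leg → ∃ j, k = j.castSucc ∧
      openedFrom (f B.leg) k = j ∧ j ≠ f B.leg ∧ ∀ t, ¬ OpenedNew (f B.leg) t₁ t₂ k t := by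
    intro k h1 h2
    induction k using Fin.lastCases with
    | last => exact absurd hL.symm h2
    | cast j =>
      have hj : j ≠ f B.leg := fun h => h1 (by rw [hU, h])
      exact ⟨j, rfl, openedFrom_castSucc _ _, hj, fun t h => hj (openedNew_castSucc.1 h).1⟩
  -- the crossings of the parts of the arc that are not new
  have rest : ∀ c k t, E.Crosses c k t → openedFrom (f B.leg) c = f B.leg →
      ¬ OpenedNew (f B.leg) t₁ t₂ c t → k ≠ openLab B f B.head → k ≠ openLab B f B.leg →
      B.q < t → t < B.p → E.sign c k t = s := by
    intro c k t hc hfr hn h1 h2 h3 h4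
    obtain ⟨j, rfl, hj, hj', hn'⟩ := other k h1 h2
    have hc' := E.crosses_iff.1 hc
    rw [S c _ t hn (hn' t), hfr, hj]
    refine hD.sign_new _ _ _ (D.crosses_iff.2 ⟨hj'.symm, hc'.2.1, ?_⟩) (new h3 h4)
    have e1 := X c t hc'.2.1 hn
    have e2 := X _ t hc'.2.1 (hn' t)
    rw [hfr] at e1
    rw [hj] at e2
    rw [← e1, ← e2, hc'.2.2]
  refine ⟨D, E, hD, hrD, Ro hrD, fun hA => .of_lmove lm (hD.adm hA) (A (hD.adm hA)),
    fun i t ht => ?_, fun i j t hc => ?_, op.poly P ht₁ ht₂, fun τ h1 h2 h3 => ?_,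
    fun τ h1 h2 h3 => ?_, fun k t hc h1 h2 => ?_, fun k t hc h1 h2 => ?_⟩
  · rw [X _ t (sub_unit B ht) (notnew i t ht), openedFrom_openLab, hD.x_eq i t ht]
  · rw [S _ _ t (notnew i t hc.2.1) (notnew j t hc.2.2.1), openedFrom_openLab,
      openedFrom_openLab, hD.sign_eq i j t hc]
  · rw [hU]
    split_ifs with h
    · rw [op.upper_old τ ⟨by linarith, h⟩, val τ h1 h2 (by linarith)]; exact if_pos h
    · exact op.upper_new τ ⟨not_lt.1 fun h' => free τ h1 ⟨not_le.1 h, h'⟩, h3⟩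
  · rw [hL]
    split_ifs with h
    · exact op.lower_new τ ⟨h2, h⟩
    · rw [op.lower_old τ ⟨not_lt.1 fun h' => free τ h1 ⟨not_le.1 h, h'⟩, by linarith⟩,
        val τ h1 (by linarith) h3]; exact if_neg h
  · rw [hU] at hc ⊢
    rcases le_or_gt t₁ t with h | h
    · exact N _ k t (Or.inl ⟨rfl, h⟩) hc
    · exact rest _ k t hc (openedFrom_castSucc _ _)
        (fun h' => not_le.2 h (openedNew_castSucc.1 h').2)
        (fun h' => hc.1 (by rw [h', hU])) (fun h' => not_le.2 h (h2 h')) h1 (by linarith)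
  · rw [hL] at hc ⊢
    rcases le_or_gt t t₂ with h | h
    · exact N _ k t (Or.inr ⟨rfl, h⟩) hc
    · refine rest _ k t hc (openedFrom_last _) (fun h' => ?_) (fun h' => not_le.2 h (h2 h'))
        (fun h' => hc.1 (by rw [h', hL])) (by linarith) h1
      rcases h' with ⟨h', -⟩ | ⟨-, h'⟩
      · exact (Fin.castSucc_lt_last _).ne' h'
      · linarith

end Braidoids

namespace Braidoids
open Set OpenBraid

variable {m n : ℕ} {B : OpenBraid m} {f : Fin m → Fin n} {s : SignType}

/-! ### Shortening the strands at the endpoints -/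

/-- `B` without the part of the strand of the leg above the height `p₁` and the part of the strand
of the head below the height `q₁`. -/
def OpenBraid.restrict (B : OpenBraid m) (p₁ q₁ : ℝ) (hp : B.p ≤ p₁) (hq : q₁ ≤ B.q)
    (lt : ∀ i, Function.update B.a B.leg p₁ i < Function.update B.b B.head q₁ i)
    (hl : ∀ k t, t ≤ p₁ → ¬ B.Crosses B.leg k t)
    (hh : ∀ k t, q₁ ≤ t → ¬ B.Crosses B.head k t) : OpenBraid m :=
  have ha : ∀ i, B.a i ≤ Function.update B.a B.leg p₁ i := fun i => by
    by_cases h : i = B.leg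
    · subst h; rw [Function.update_self]; exact hp
    · rw [Function.update_of_ne h]
  have hb : ∀ i, Function.update B.b B.head q₁ i ≤ B.b i := fun i => by
    by_cases h : i = B.head
    · subst h; rw [Function.update_self]; exact hq
    · rw [Function.update_of_ne h]
  have mem : ∀ {i t}, t ∈ Icc (Function.update B.a B.leg p₁ i) (Function.update B.b B.head q₁ i) →
      t ∈ Icc (B.a i) (B.b i) := fun h => ⟨(ha _).trans h.1, h.2.trans (hb _)⟩
  { a := Function.update B.a B.leg p₁
    b := Function.update B.b B.head q₁
    x := B.x
    sign := B.sign
    a_nonneg := fun i => (B.a_nonneg i).trans (ha i)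
    a_lt_b := lt
    b_le_one := fun i => (hb i).trans (B.b_le_one i)
    x_mem := fun i t ht => B.x_mem i t (mem ht)
    pl := fun i => by
      obtain ⟨S, hS⟩ := B.pl i
      exact ⟨S, fun s u h1 h2 h3 => hS s u ((ha i).trans h1) h2 (h3.trans (hb i))⟩
    sign_symm := B.sign_symm
    finite := fun i j h => (B.finite i j h).subset fun t ht => ⟨mem ht.1, mem ht.2.1, ht.2.2⟩
    interior := fun i j t h hi hj hx => by
      have hc : B.Crosses i j t := ⟨h, mem hi, mem hj, hx⟩
      have := B.interior i j t h (mem hi) (mem hj) hx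
      constructor
      · by_cases e : i = B.leg
        · subst e; rw [Function.update_self]
          exact not_le.1 fun h' => hl j t h' hc
        · rw [Function.update_of_ne e]; exact this.1
      · by_cases e : i = B.head
        · subst e; rw [Function.update_self]
          exact not_le.1 fun h' => hh j t h' hc
        · rw [Function.update_of_ne e]; exact this.2
    transversal := fun i j t h hi hj hx => B.transversal i j t h (mem hi) (mem hj) hx
    double := fun i j k t h h' hi hj hk hx hx' =>
      B.double i j k t h h' (mem hi) (mem hj) (mem hk) hx hx'
    leg := B.leg
    head := B.head
    a_eq := fun i h => (Function.update_of_ne h _ _).trans (B.a_eq i h)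
    b_eq := fun i h => (Function.update_of_ne h _ _).trans (B.b_eq i h)
    leg_pos := B.leg_pos.trans_le (ha _)
    head_lt := (hb _).trans_lt B.head_lt
    aligned := B.aligned }

section restrict

variable {p₁ q₁ : ℝ} {hp : B.p ≤ p₁} {hq : q₁ ≤ B.q}
  {lt : ∀ i, Function.update B.a B.leg p₁ i < Function.update B.b B.head q₁ i}
  {hl : ∀ k t, t ≤ p₁ → ¬ B.Crosses B.leg k t}
  {hh : ∀ k t, q₁ ≤ t → ¬ B.Crosses B.head k t}

theorem restrict_p : (B.restrict p₁ q₁ hp hq lt hl hh).p = p₁ := Function.update_self _ _ _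

theorem restrict_q : (B.restrict p₁ q₁ hp hq lt hl hh).q = q₁ := Function.update_self _ _ _

theorem restrict_mem {i : Fin m} {t : ℝ} :
    t ∈ Icc ((B.restrict p₁ q₁ hp hq lt hl hh).a i) ((B.restrict p₁ q₁ hp hq lt hl hh).b i) ↔
      t ∈ Icc (B.a i) (B.b i) ∧ (i = B.leg → p₁ ≤ t) ∧ (i = B.head → t ≤ q₁) := by
  have e1 : Function.update B.a B.leg p₁ i ≤ t ↔ B.a i ≤ t ∧ (i = B.leg → p₁ ≤ t) := by
    by_cases h : i = B.leg
    · subst h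
      rw [Function.update_self]
      exact ⟨fun h => ⟨hp.trans h, fun _ => h⟩, fun h => h.2 rfl⟩
    · rw [Function.update_of_ne h]; simp [h]
  have e2 : t ≤ Function.update B.b B.head q₁ i ↔ t ≤ B.b i ∧ (i = B.head → t ≤ q₁) := by
    by_cases h : i = B.head
    · subst h
      rw [Function.update_self]
      exact ⟨fun h => ⟨h.trans hq, fun _ => h⟩, fun h => h.2 rfl⟩
    · rw [Function.update_of_ne h]; simp [h]
  change t ∈ Icc (Function.update B.a B.leg p₁ i) (Function.update B.b B.head q₁ i) ↔ _
  rw [mem_Icc, mem_Icc, e1, e2]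
  tauto

theorem restrict_crosses {i j : Fin m} {t : ℝ} :
    (B.restrict p₁ q₁ hp hq lt hl hh).Crosses i j t ↔ B.Crosses i j t := by
  refine ⟨fun h => ⟨h.1, (restrict_mem.1 h.2.1).1, (restrict_mem.1 h.2.2.1).1, h.2.2.2⟩,
    fun h => ⟨h.1, restrict_mem.2 ⟨h.2.1, ?_, ?_⟩, restrict_mem.2 ⟨h.2.2.1, ?_, ?_⟩, h.2.2.2⟩⟩ <;>
  rintro rfl <;> by_contra h'
  · exact hl _ _ (not_le.1 h').le h
  · exact hh _ _ (not_le.1 h').le h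
  · exact hl _ _ (not_le.1 h').le h.symm
  · exact hh _ _ (not_le.1 h').le h.symm

theorem restrict_endMove : EndMove B (B.restrict p₁ q₁ hp hq lt hl hh) q₁ p₁ :=
  ⟨rfl, rfl, fun _ h => Function.update_of_ne h _ _, fun _ h => Function.update_of_ne h _ _, hp,
    restrict_p.le, hq, restrict_q.ge, fun _ _ _ _ _ => rfl, fun _ _ _ _ => rfl, hl,
    fun k t ht hc => hl k t ht (restrict_crosses.1 hc), hh,
    fun k t ht hc => hh k t ht (restrict_crosses.1 hc)⟩

theorem restrict_roomy (hB : B.Roomy) : (B.restrict p₁ q₁ hp hq lt hl hh).Roomy :=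
  fun i t ht => hB i t (restrict_mem.1 ht).1

theorem IsGrid.restrict {T : Finset ℝ} (hT : IsGrid B.toStrandDiagram T) (h1 : p₁ ∈ T)
    (h2 : q₁ ∈ T) : IsGrid (B.restrict p₁ q₁ hp hq lt hl hh).toStrandDiagram T where
  zero := hT.zero
  one := hT.one
  a_mem i := by
    change Function.update B.a B.leg p₁ i ∈ T
    rw [Function.update_apply]; split_ifs
    exacts [h1, hT.a_mem i]
  b_mem i := by
    change Function.update B.b B.head q₁ i ∈ T
    rw [Function.update_apply]; split_ifs
    exacts [h2, hT.b_mem i]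
  poly i := by
    have hlt := (B.restrict p₁ q₁ hp hq lt hl hh).a_lt_b i
    have h3 := (restrict_mem (hp := hp) (hq := hq) (lt := lt) (hl := hl) (hh := hh)).1
      (left_mem_Icc.2 hlt.le)
    have h4 := (restrict_mem (hp := hp) (hq := hq) (lt := lt) (hl := hl) (hh := hh)).1
      (right_mem_Icc.2 hlt.le)
    exact (hT.poly i).sub_interval h3.1.1 h4.1.2
  cross i j t hc := hT.cross i j t (restrict_crosses.1 hc)

end restrict

/-- Three positions beside the strands, to the left of them if `P` holds, and else to the right. The
position `e` is the farthest one from the strands. -/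
theorem OpenBraid.Roomy.exists_side (hB : B.Roomy) (P : Prop) : ∃ lo hi e₀ e e' : ℝ, 0 < lo ∧
    hi < 1 ∧ e₀ ∈ Icc lo hi ∧ e ∈ Icc lo hi ∧ e' ∈ Icc lo hi ∧
    ((P ∧ (∀ i, ∀ t ∈ Icc (B.a i) (B.b i), hi < B.x i t) ∧ e < e₀ ∧ e₀ < e') ∨
      (¬ P ∧ (∀ i, ∀ t ∈ Icc (B.a i) (B.b i), B.x i t < lo) ∧ e' < e₀ ∧ e₀ < e)) := by
  obtain ⟨δ, h0, h1, hδ⟩ := hB.exists_margin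
  by_cases hP : P
  · refine ⟨δ / 3, δ, δ / 2, δ / 3, δ, by linarith, by linarith, ⟨by linarith, by linarith⟩,
      ⟨by linarith, by linarith⟩, ⟨by linarith, by linarith⟩, Or.inl ⟨hP, fun i t ht => ?_,
      by linarith, by linarith⟩⟩
    exact (hδ i t ht).1
  · refine ⟨1 - δ, 1 - δ / 3, 1 - δ / 2, 1 - δ / 3, 1 - δ, by linarith, by linarith,
      ⟨by linarith, by linarith⟩, ⟨by linarith, by linarith⟩, ⟨by linarith, by linarith⟩,
      Or.inr ⟨hP, fun i t ht => ?_, by linarith, by linarith⟩⟩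
    exact (hδ i t ht).2

section

variable {p₁ q₁ : ℝ} {hp : B.p ≤ p₁} {hq : q₁ ≤ B.q}
  {lt : ∀ i, Function.update B.a B.leg p₁ i < Function.update B.b B.head q₁ i}
  {hl : ∀ k t, t ≤ p₁ → ¬ B.Crosses B.leg k t}
  {hh : ∀ k t, q₁ ≤ t → ¬ B.Crosses B.head k t}

/-- If the head is moved up on its strand to a height above the leg, the closures remain
equivalent. The added arc of a closure of the shortened diagram is opened near a side of the square;
the result and a closure of `B` differ in the strand of the head below the height `q₁` only. -/
theorem OpenBraid.Roomy.restrict_head (hB : B.Roomy) (hA : Adm s B.toStrandDiagram)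
    (hpq : B.p ≤ B.q) (e : p₁ = B.p) (hqp : q₁ < p₁) :
    Eqv s B (B.restrict p₁ q₁ hp hq lt hl hh) := by
  classical
  subst e
  set B₁ := B.restrict B.p q₁ hp hq lt hl hh with hB₁
  have hr₁ : B₁.Roomy := restrict_roomy hB
  have hA₁ : Adm s B₁.toStrandDiagram := restrict_endMove.adm hA
  have e₁p : B₁.p = B.p := restrict_p
  have e₁q : B₁.q = q₁ := restrict_q
  have hqp₁ : B₁.q < B₁.p := by rw [e₁p, e₁q]; exact hqp
  have hne : B.leg ≠ B.head := leg_ne_head (B := B₁) hqp₁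
  have p1 := B.p_lt_one
  have q1 := B.head_lt
  have q₁0 : 0 < q₁ := e₁q ▸ B₁.q_pos
  obtain ⟨n, f, hf⟩ := B₁.exists_lab
  let g := openLab B₁ f
  have hgi : Function.Injective g := hf.openLab_injective
  have hgs : Function.Surjective g := hf.openLab_surjective hqp₁
  have hg : B.Lab g := ⟨hgs, fun i j => by simp [hgi.eq_iff, not_lt.2 hpq]⟩
  obtain ⟨T₀, hT₀⟩ := exists_isGrid B.toStrandDiagram
  obtain ⟨t₂, h2, h2p, hfree⟩ := Ioo_disjoint_of_finite T₀ q₁ hqp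
  obtain ⟨t₁, h1, h12⟩ := exists_between h2
  let T : Finset ℝ := insert q₁ (insert t₁ (insert t₂ T₀))
  have hT₀T : T₀ ⊆ T := ((Finset.subset_insert _ _).trans (Finset.subset_insert _ _)).trans
    (Finset.subset_insert _ _)
  have hT := hT₀.mono hT₀T
  have q₁T : q₁ ∈ T := by simp [T]
  have t₁T : t₁ ∈ T := by simp [T]
  have t₂T : t₂ ∈ T := by simp [T]
  have pT : B.p ∈ T := hT.a_mem _
  have free : ∀ r ∈ T, r ∉ Ioo t₁ t₂ := by
    intro r hr hr'
    simp only [T, Finset.mem_insert] at hr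
    rcases hr with rfl | rfl | rfl | hr
    · linarith [hr'.1]
    · exact lt_irrefl _ hr'.1
    · exact lt_irrefl _ hr'.2
    · exact hfree r hr ⟨by linarith [hr'.1], hr'.2.le⟩
  -- as seen from the strand of the head, the arcs are on the side of the leg: then the arc to the
  -- leg does not cross this strand, over which it would pass in the wrong way
  obtain ⟨lo, hi, e₀, e₂, e₁, hlo, hhi, he₀, he₂, he₁, side⟩ :=
    hB.exists_side (B.x B.leg B.p < B.x B.head B.p)
  have hm : ∀ i, ∀ t ∈ Icc (B.a i) (B.b i), B.x i t ∉ Icc lo hi := fun i t ht h => by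
    rcases side with ⟨-, h', -⟩ | ⟨-, h', -⟩
    · exact not_lt.2 h.2 (h' i t ht)
    · exact not_lt.2 h.1 (h' i t ht)
  have inner : ∀ {y}, y ∈ Icc lo hi → y ∈ Ioo (0 : ℝ) 1 := fun h =>
    ⟨hlo.trans_le h.1, h.2.trans_lt hhi⟩
  obtain ⟨D, E, hD, hrD, hrE, hR, xE, sE, PE, UE, LE, cU, cL⟩ :=
    exists_opened_closure hf hqp₁ hr₁ (hT.restrict pT q₁T) (e₀ := e₀) (e₁ := e₁) (e₂ := e₂)
      t₁T t₂T (e₁q.trans_lt h1) h12 (h2p.trans_eq e₁p.symm) free hlo hhi he₁ he₂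
      (side.symm.imp (fun h => h.2.2) fun h => h.2.2)
      (fun i t ht => hm i t (restrict_mem.1 ht).1) s
  rw [e₁q] at UE cU
  rw [e₁p] at LE cL
  change ∀ τ ∈ T, q₁ < τ → τ ≤ 1 → E.x (g B.head) τ = _ at UE
  change ∀ τ ∈ T, 0 ≤ τ → τ < B.p → E.x (g B.leg) τ = _ at LE
  change ∀ k t, E.Crosses (g B.head) k t → q₁ < t → (k = g B.leg → t₁ ≤ t) →
    E.sign (g B.head) k t = s at cU
  change ∀ k t, E.Crosses (g B.leg) k t → t < B.p → (k = g B.head → t ≤ t₂) →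
    E.sign (g B.leg) k t = s at cL
  change ∀ i, ∀ t ∈ Icc (B₁.a i) (B₁.b i), E.x (g i) t = B.x i t at xE
  change ∀ i j t, B₁.Crosses i j t → E.sign (g i) (g j) t = B.sign i j t at sE
  let w : ℝ → ℝ := fun τ => if τ ≤ t₁ then e₀ else if τ < B.p then e₂ else e₀
  have hw : ∀ τ, w τ ∈ Icc lo hi := fun τ => by simp only [w]; split_ifs <;> assumption
  have w0 : w 0 = e₀ := if_pos (by linarith)
  have w1 : w 1 = e₀ := (if_neg (by linarith)).trans (if_neg (by linarith))
  have wlt : ∀ τ, τ < B.p → w τ = if τ ≤ t₁ then e₀ else e₂ := fun τ h => by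
    simp only [w, h, if_true]
  obtain ⟨C, hC, PC, WC, room⟩ := Braidoids.exists_clos hg hT s w
    (fun τ _ => Ioo_subset_Icc_self (inner (hw τ)))
    (fun τ _ _ i hi he => hm i τ hi (he ▸ hw τ)) fun _ => by rw [w0, w1]
  have hrC := room hB fun τ _ => inner (hw τ)
  have newleg : ∀ {t}, t < B.p → B.New g (g B.leg) t := fun h =>
    hg.new_of_lt h fun h' => absurd h' (not_lt.2 hpq)
  have newhead : ∀ {t}, B.q < t → B.New g (g B.head) t := fun h =>
    hg.new_of_gt h fun h' => absurd h' (not_lt.2 hpq)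
  have mem₁ : ∀ {i t}, i ≠ B.head → t ∈ Icc (B.a i) (B.b i) → t ∈ Icc (B₁.a i) (B₁.b i) :=
    fun h ht => restrict_mem.2 ⟨ht, fun h' => by rw [h'] at ht; exact ht.1, fun h' => absurd h' h⟩
  have mh : ∀ {t}, 0 ≤ t → t ≤ B.q → t ∈ Icc (B.a B.head) (B.b B.head) := fun h0 h1 =>
    ⟨by rw [B.a_eq _ hne.symm]; exact h0, h1⟩
  have mh₁ : ∀ {t}, 0 ≤ t → t ≤ q₁ → t ∈ Icc (B₁.a B.head) (B₁.b B.head) := fun h0 h1 =>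
    restrict_mem.2 ⟨mh h0 (h1.trans hq), fun h => absurd h.symm hne, fun _ => h1⟩
  have ml : ∀ {t}, B.p ≤ t → t ≤ 1 → t ∈ Icc (B.a B.leg) (B.b B.leg) := fun h0 h1 =>
    ⟨h0, by rw [B.b_eq _ hne]; exact h1⟩
  have old : ∀ {i t}, t ∈ Icc (0 : ℝ) 1 → i ≠ B.head → (i = B.leg → B.p ≤ t) →
      t ∈ Icc (B.a i) (B.b i) := fun {i t} ht h1 h2 => by
    by_cases h : i = B.leg
    · subst h; exact ml (h2 rfl) ht.2
    · rw [B.a_eq i h, B.b_eq i h1]; exact ht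
  have xleg : ∀ t ∈ Icc (0 : ℝ) B.p, C.x (g B.leg) t = E.x (g B.leg) t := fun t ht => by
    refine ((PC _).sub_interval le_rfl p1.le).eq ((PE _).sub_interval le_rfl p1.le) hT.zero pT
      (fun τ h3 h4 => ?_) ht
    rcases eq_or_lt_of_le h4.2 with h5 | h5
    · have := ml h5.ge (h4.2.trans p1.le)
      rw [hC.x_eq _ τ this, xE _ τ (mem₁ hne this)]
    · rw [WC _ τ h3 ⟨h4.1, by linarith⟩ (newleg h5), LE τ h3 h4.1 h5, wlt τ h5]
  have hx : ∀ j, j ≠ g B.head → ∀ t ∈ Icc (0 : ℝ) 1, C.x j t = E.x j t := by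
    intro j hj t ht
    obtain ⟨i, rfl⟩ := hgs j
    have hi : i ≠ B.head := fun h => hj (congrArg g h)
    by_cases h : i = B.leg → B.p ≤ t
    · have := old ht hi h
      rw [hC.x_eq i t this, xE i t (mem₁ hi this)]
    · push Not at h
      rw [h.1]; exact xleg t ⟨ht.1, h.2.le⟩
  have xhead : ∀ t, 0 ≤ t → t ≤ q₁ → C.x (g B.head) t = E.x (g B.head) t := fun t h3 h4 => by
    rw [hC.x_eq _ t (mh h3 (h4.trans hq)), xE _ t (mh₁ h3 h4)]
  have sg : ∀ i i' t, (i = B.head → t < q₁) → (i' = B.head → t < q₁) →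
      E.Crosses (g i) (g i') t → C.sign (g i) (g i') t = E.sign (g i) (g i') t := by
    intro i i' t h3 h4 hc
    have hc' := E.crosses_iff.1 hc
    have ht := hc'.2.1
    have xx : ∀ {i}, (i = B.head → t < q₁) → C.x (g i) t = E.x (g i) t := fun {i} h => by
      by_cases hi : i = B.head
      · have := h hi
        subst hi; exact xhead t ht.1 this.le
      · exact hx _ (fun h => hi (hgi h)) t ht
    have hcC : C.Crosses (g i) (g i') t := C.crosses_iff.2 ⟨hc'.1, ht, by
      rw [xx h3, xx h4, hc'.2.2]⟩
    have leg : ∀ i', t < B.p → (i' = B.head → t < q₁) → E.Crosses (g B.leg) (g i') t →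
        C.Crosses (g B.leg) (g i') t →
        C.sign (g B.leg) (g i') t = E.sign (g B.leg) (g i') t := fun i' h h4 hc hcC => by
      rw [cL _ t hc h fun h' => (h4 (hgi h')).le.trans (by linarith),
        hC.sign_new _ _ t hcC (newleg h)]
    have mem : ∀ {i}, (i = B.head → t < q₁) → (i = B.leg → B.p ≤ t) →
        t ∈ Icc (B.a i) (B.b i) := fun {i} h h' => by
      by_cases hi : i = B.head
      · have := h hi
        subst hi; exact mh ht.1 (this.le.trans hq)
      · exact old ht hi h'
    by_cases h5 : i = B.leg → B.p ≤ t
    · by_cases h6 : i' = B.leg → B.p ≤ t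
      · have hB := hC.crosses_old hcC (mem h3 h5) (mem h4 h6)
        rw [hC.sign_eq _ _ t hB, sE _ _ t (restrict_crosses.2 hB)]
      · push Not at h6
        obtain ⟨rfl, h6⟩ := h6
        rw [C.sign_symm, E.sign_symm, leg i h6 h3 hc.symm hcC.symm]
    · push Not at h5
      obtain ⟨rfl, h5⟩ := h5
      exact leg i' h5 h4 hc hcC
  refine ⟨n + 1, g, C, n, f, D, hC, hrC, hD, hrD, ((hR hA₁).trans ?_).symm⟩
  refine arc_move (c := g B.head) (u := q₁) (v := 1) (s' := s) q₁0.le (by linarith) le_rfl hx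
    (fun t ht ht' => ?_) (fun j k t hj hk hc => ?_) (fun k t ht hc => ?_) (fun k t ht hc => ?_)
    (fun k t ht hc => ?_) (fun h j k t _ _ _ hc h' => absurd h' ?_)
    (fun h => ⟨h, (hR hA₁).adm_iff.1 (hD.adm hA₁) h⟩) hrE hrC
  · rcases le_or_gt t q₁ with h3 | h3
    · exact xhead t ht.1 h3
    · obtain rfl : t = 1 := le_antisymm ht.2 (not_lt.1 fun h => ht' ⟨h3, h⟩)
      rw [WC _ 1 hT.one ht (newhead q1), UE 1 hT.one h3 le_rfl, w1, if_neg (by linarith)]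
  · obtain ⟨i, rfl⟩ := hgs j
    obtain ⟨i', rfl⟩ := hgs k
    exact sg i i' t (fun h => absurd (congrArg g h) hj) (fun h => absurd (congrArg g h) hk) hc
  · obtain ⟨i', rfl⟩ := hgs k
    have htq : t < q₁ := not_le.1 fun h => ht ⟨h, hc.inner.2.le⟩
    exact sg _ i' t (fun _ => htq) (fun _ => htq) hc
  · have hc' := E.crosses_iff.1 hc
    rcases eq_or_lt_of_le ht.1 with rfl | h3
    · exfalso
      obtain ⟨i', rfl⟩ := hgs k
      have hi' : i' ≠ B.head := fun h => hc'.1 (congrArg g h.symm)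
      have hxx := hc'.2.2
      rw [xE _ _ (mh₁ q₁0.le le_rfl)] at hxx
      by_cases h : i' = B.leg
      · subst h
        rw [LE q₁ q₁T q₁0.le hqp, if_pos h1.le] at hxx
        exact hm _ _ (mh q₁0.le hq) (hxx ▸ he₀)
      · have := old hc'.2.1 hi' fun h' => absurd h' h
        rw [xE _ _ (mem₁ hi' this)] at hxx
        exact hh i' q₁ le_rfl ⟨hi'.symm, mh q₁0.le hq, this, hxx⟩
    · refine cU k t hc h3 fun h => not_lt.1 fun h4 => ?_
      subst h
      have a1 : ∀ τ ∈ T, τ ∈ Icc q₁ t₁ → E.x (g B.leg) τ = e₀ := fun τ h5 h6 => by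
        rw [LE τ h5 (by linarith [h6.1]) (by linarith [h6.2]), if_pos h6.2]
      have a2 : ∀ τ ∈ T, τ ∈ Icc q₁ t₁ → (τ = q₁ ∧ E.x (g B.head) τ = B.x B.head τ) ∨
          E.x (g B.head) τ = e₁ := fun τ h5 h6 => by
        rcases eq_or_lt_of_le h6.1 with h7 | h7
        · exact Or.inl ⟨h7.symm, xE _ _ (mh₁ (by linarith) h7.ge)⟩
        · exact Or.inr (by rw [UE τ h5 h7 (by linarith [h6.2]), if_pos h6.2])
      have t1 : t₁ ≤ 1 := by linarith
      rcases side with ⟨-, m, -, m'⟩ | ⟨-, m, m', -⟩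
      · refine (((PE (g B.leg)).sub_interval q₁0.le t1).lt ((PE (g B.head)).sub_interval q₁0.le t1)
          q₁T t₁T (fun τ h5 h6 => ?_) ⟨h3.le, h4.le⟩).ne' hc'.2.2
        rw [a1 τ h5 h6]
        rcases a2 τ h5 h6 with ⟨h7, h8⟩ | h8 <;> rw [h8]
        · exact he₀.2.trans_lt (m _ _ (by rw [h7]; exact mh q₁0.le hq))
        · exact m'
      · refine (((PE (g B.head)).sub_interval q₁0.le t1).lt ((PE (g B.leg)).sub_interval q₁0.le t1)
          q₁T t₁T (fun τ h5 h6 => ?_) ⟨h3.le, h4.le⟩).ne hc'.2.2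
        rw [a1 τ h5 h6]
        rcases a2 τ h5 h6 with ⟨h7, h8⟩ | h8 <;> rw [h8]
        · exact (m _ _ (by rw [h7]; exact mh q₁0.le hq)).trans_le he₀.1
        · exact m'
  · rcases lt_or_ge B.q t with h3 | h3
    · exact hC.sign_new _ _ _ hc (newhead h3)
    exfalso
    have hc' := C.crosses_iff.1 hc
    have m0 := mh hc'.2.1.1 h3
    obtain ⟨i', rfl⟩ := hgs k
    have hi' : i' ≠ B.head := fun h => hc'.1 (congrArg g h.symm)
    by_cases h5 : i' = B.leg → B.p ≤ t
    · exact hh i' t ht.1 (hC.crosses_old hc m0 (old hc'.2.1 hi' h5))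
    · push Not at h5
      obtain ⟨rfl, h5⟩ := h5
      have a1 : ∀ τ ∈ T, τ ∈ Icc q₁ B.p → (τ = B.p ∧ C.x (g B.leg) τ = B.x B.leg B.p) ∨
          C.x (g B.leg) τ ∈ Icc lo hi := fun τ h6 h7 => by
        rcases eq_or_lt_of_le h7.2 with h8 | h8
        · exact Or.inl ⟨h8, by rw [h8, hC.x_eq _ _ (ml le_rfl p1.le)]⟩
        · right
          rw [WC _ τ h6 ⟨by linarith [h7.1], by linarith⟩ (newleg h8)]
          exact hw τ
      have a2 : ∀ τ, τ ∈ Icc q₁ B.p → τ ∈ Icc (B.a B.head) (B.b B.head) := fun τ h6 =>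
        mh (by linarith [h6.1]) (h6.2.trans hpq)
      have a3 : ∀ τ, τ ∈ Icc q₁ B.p → C.x (g B.head) τ = B.x B.head τ := fun τ h6 =>
        hC.x_eq _ τ (a2 τ h6)
      have hxp : B.x B.leg B.p ≠ B.x B.head B.p := fun h =>
        hl B.head B.p le_rfl ⟨hne, ml le_rfl p1.le, mh B.leg_pos.le hpq, h⟩
      rcases side with ⟨m'', m, -⟩ | ⟨m'', m, -⟩
      · refine (((PC (g B.leg)).sub_interval q₁0.le p1.le).lt ((PC (g B.head)).sub_interval q₁0.le
          p1.le) q₁T pT (fun τ h6 h7 => ?_) ⟨ht.1, h5.le⟩).ne' hc'.2.2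
        rw [a3 τ h7]
        rcases a1 τ h6 h7 with ⟨h8, h9⟩ | h9
        · rw [h9, h8]; exact m''
        · exact h9.2.trans_lt (m _ _ (a2 τ h7))
      · refine (((PC (g B.head)).sub_interval q₁0.le p1.le).lt ((PC (g B.leg)).sub_interval q₁0.le
          p1.le) q₁T pT (fun τ h6 h7 => ?_) ⟨ht.1, h5.le⟩).ne hc'.2.2
        rw [a3 τ h7]
        rcases a1 τ h6 h7 with ⟨h8, h9⟩ | h9
        · rw [h9, h8]; exact lt_of_le_of_ne (not_lt.1 m'') hxp.symm
        · exact (m _ _ (a2 τ h7)).trans_le h9.1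
  · exact (hR hA₁).adm_iff.1 (hD.adm hA₁) h j k t hc

end

end Braidoids

namespace Braidoids
open Set OpenBraid

variable {m n : ℕ} {B : OpenBraid m} {s : SignType} {p₁ q₁ : ℝ} {hp : B.p ≤ p₁} {hq : q₁ ≤ B.q}
  {lt : ∀ i, Function.update B.a B.leg p₁ i < Function.update B.b B.head q₁ i}
  {hl : ∀ k t, t ≤ p₁ → ¬ B.Crosses B.leg k t}
  {hh : ∀ k t, q₁ ≤ t → ¬ B.Crosses B.head k t}

/-- If the leg is moved down on its strand to a height below the head, the closures remain
equivalent. The argument is that of `OpenBraid.Roomy.restrict_head`, upside down. -/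
theorem OpenBraid.Roomy.restrict_leg (hB : B.Roomy) (hA : Adm s B.toStrandDiagram)
    (hpq : B.p ≤ B.q) (e : q₁ = B.q) (hqp : q₁ < p₁) :
    Eqv s B (B.restrict p₁ q₁ hp hq lt hl hh) := by
  classical
  subst e
  set B₁ := B.restrict p₁ B.q hp hq lt hl hh with hB₁
  have hr₁ : B₁.Roomy := restrict_roomy hB
  have hA₁ : Adm s B₁.toStrandDiagram := restrict_endMove.adm hA
  have e₁p : B₁.p = p₁ := restrict_p
  have e₁q : B₁.q = B.q := restrict_q
  have hqp₁ : B₁.q < B₁.p := by rw [e₁p, e₁q]; exact hqp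
  have hne : B.leg ≠ B.head := leg_ne_head (B := B₁) hqp₁
  have q1 := B.head_lt
  have q0 := B.q_pos
  have p0 := B.leg_pos
  have p₁1 : p₁ < 1 := e₁p ▸ B₁.p_lt_one
  have p1 := B.p_lt_one
  obtain ⟨n, f, hf⟩ := B₁.exists_lab
  let g := openLab B₁ f
  have hgi : Function.Injective g := hf.openLab_injective
  have hgs : Function.Surjective g := hf.openLab_surjective hqp₁
  have hg : B.Lab g := ⟨hgs, fun i j => by simp [hgi.eq_iff, not_lt.2 hpq]⟩
  obtain ⟨T₀, hT₀⟩ := exists_isGrid B.toStrandDiagram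
  obtain ⟨t₂, h2, h2p, hfree⟩ := Ioo_disjoint_of_finite T₀ B.q hqp
  obtain ⟨t₁, h1, h12⟩ := exists_between h2
  let T : Finset ℝ := insert p₁ (insert t₁ (insert t₂ T₀))
  have hT₀T : T₀ ⊆ T := ((Finset.subset_insert _ _).trans (Finset.subset_insert _ _)).trans
    (Finset.subset_insert _ _)
  have hT := hT₀.mono hT₀T
  have p₁T : p₁ ∈ T := by simp [T]
  have t₁T : t₁ ∈ T := by simp [T]
  have t₂T : t₂ ∈ T := by simp [T]
  have qT : B.q ∈ T := hT.b_mem _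
  have free : ∀ r ∈ T, r ∉ Ioo t₁ t₂ := by
    intro r hr hr'
    simp only [T, Finset.mem_insert] at hr
    rcases hr with rfl | rfl | rfl | hr
    · linarith [hr'.2]
    · exact lt_irrefl _ hr'.1
    · exact lt_irrefl _ hr'.2
    · exact hfree r hr ⟨by linarith [hr'.1], hr'.2.le⟩
  -- as seen from the strand of the leg, the arcs are on the side of the head
  obtain ⟨lo, hi, e₀, e₁, e₂, hlo, hhi, he₀, he₁, he₂, side⟩ :=
    hB.exists_side (B.x B.head B.q < B.x B.leg B.q)
  have hm : ∀ i, ∀ t ∈ Icc (B.a i) (B.b i), B.x i t ∉ Icc lo hi := fun i t ht h => by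
    rcases side with ⟨-, h', -⟩ | ⟨-, h', -⟩
    · exact not_lt.2 h.2 (h' i t ht)
    · exact not_lt.2 h.1 (h' i t ht)
  have inner : ∀ {y}, y ∈ Icc lo hi → y ∈ Ioo (0 : ℝ) 1 := fun h =>
    ⟨hlo.trans_le h.1, h.2.trans_lt hhi⟩
  obtain ⟨D, E, hD, hrD, hrE, hR, xE, sE, PE, UE, LE, cU, cL⟩ :=
    exists_opened_closure hf hqp₁ hr₁ (hT.restrict p₁T qT) (e₀ := e₀) (e₁ := e₁) (e₂ := e₂)
      t₁T t₂T (e₁q.trans_lt h1) h12 (h2p.trans_eq e₁p.symm) free hlo hhi he₁ he₂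
      (side.imp (fun h => h.2.2) fun h => h.2.2)
      (fun i t ht => hm i t (restrict_mem.1 ht).1) s
  rw [e₁q] at UE cU
  rw [e₁p] at LE cL
  change ∀ τ ∈ T, B.q < τ → τ ≤ 1 → E.x (g B.head) τ = _ at UE
  change ∀ τ ∈ T, 0 ≤ τ → τ < p₁ → E.x (g B.leg) τ = _ at LE
  change ∀ k t, E.Crosses (g B.head) k t → B.q < t → (k = g B.leg → t₁ ≤ t) →
    E.sign (g B.head) k t = s at cU
  change ∀ k t, E.Crosses (g B.leg) k t → t < p₁ → (k = g B.head → t ≤ t₂) →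
    E.sign (g B.leg) k t = s at cL
  change ∀ i, ∀ t ∈ Icc (B₁.a i) (B₁.b i), E.x (g i) t = B.x i t at xE
  change ∀ i j t, B₁.Crosses i j t → E.sign (g i) (g j) t = B.sign i j t at sE
  let w : ℝ → ℝ := fun τ => if τ ≤ B.q then e₀ else if τ ≤ t₁ then e₁ else e₀
  have hw : ∀ τ, w τ ∈ Icc lo hi := fun τ => by simp only [w]; split_ifs <;> assumption
  have w0 : w 0 = e₀ := if_pos q0.le
  have w1 : w 1 = e₀ := (if_neg (by linarith)).trans (if_neg (by linarith))
  have wlt : ∀ τ, B.q < τ → w τ = if τ ≤ t₁ then e₁ else e₀ := fun τ h => if_neg (not_le.2 h)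
  obtain ⟨C, hC, PC, WC, room⟩ := Braidoids.exists_clos hg hT s w
    (fun τ _ => Ioo_subset_Icc_self (inner (hw τ)))
    (fun τ _ _ i hi he => hm i τ hi (he ▸ hw τ)) fun _ => by rw [w0, w1]
  have hrC := room hB fun τ _ => inner (hw τ)
  have newleg : ∀ {t}, t < B.p → B.New g (g B.leg) t := fun h =>
    hg.new_of_lt h fun h' => absurd h' (not_lt.2 hpq)
  have newhead : ∀ {t}, B.q < t → B.New g (g B.head) t := fun h =>
    hg.new_of_gt h fun h' => absurd h' (not_lt.2 hpq)
  have mem₁ : ∀ {i t}, i ≠ B.leg → t ∈ Icc (B.a i) (B.b i) → t ∈ Icc (B₁.a i) (B₁.b i) :=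
    fun h ht => restrict_mem.2 ⟨ht, fun h' => absurd h' h, fun h' => by rw [h'] at ht; exact ht.2⟩
  have mh : ∀ {t}, 0 ≤ t → t ≤ B.q → t ∈ Icc (B.a B.head) (B.b B.head) := fun h0 h1 =>
    ⟨by rw [B.a_eq _ hne.symm]; exact h0, h1⟩
  have ml : ∀ {t}, B.p ≤ t → t ≤ 1 → t ∈ Icc (B.a B.leg) (B.b B.leg) := fun h0 h1 =>
    ⟨h0, by rw [B.b_eq _ hne]; exact h1⟩
  have ml₁ : ∀ {t}, p₁ ≤ t → t ≤ 1 → t ∈ Icc (B₁.a B.leg) (B₁.b B.leg) := fun h0 h1 =>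
    restrict_mem.2 ⟨ml (hp.trans h0) h1, fun _ => h0, fun h => absurd h hne⟩
  have old : ∀ {i t}, t ∈ Icc (0 : ℝ) 1 → i ≠ B.leg → (i = B.head → t ≤ B.q) →
      t ∈ Icc (B.a i) (B.b i) := fun {i t} ht h1 h2 => by
    by_cases h : i = B.head
    · subst h; exact mh ht.1 (h2 rfl)
    · rw [B.a_eq i h1, B.b_eq i h]; exact ht
  have xhead : ∀ t ∈ Icc B.q 1, C.x (g B.head) t = E.x (g B.head) t := fun t ht => by
    refine ((PC _).sub_interval q0.le le_rfl).eq ((PE _).sub_interval q0.le le_rfl) qT hT.one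
      (fun τ h3 h4 => ?_) ht
    rcases eq_or_lt_of_le h4.1 with h5 | h5
    · have := mh (q0.le.trans h4.1) h5.ge
      rw [hC.x_eq _ τ this, xE _ τ (mem₁ hne.symm this)]
    · rw [WC _ τ h3 ⟨by linarith, h4.2⟩ (newhead h5), UE τ h3 h5 h4.2, wlt τ h5]
  have hx : ∀ j, j ≠ g B.leg → ∀ t ∈ Icc (0 : ℝ) 1, C.x j t = E.x j t := by
    intro j hj t ht
    obtain ⟨i, rfl⟩ := hgs j
    have hi : i ≠ B.leg := fun h => hj (congrArg g h)
    by_cases h : i = B.head → t ≤ B.q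
    · have := old ht hi h
      rw [hC.x_eq i t this, xE i t (mem₁ hi this)]
    · push Not at h
      rw [h.1]; exact xhead t ⟨h.2.le, ht.2⟩
  have xleg : ∀ t, p₁ ≤ t → t ≤ 1 → C.x (g B.leg) t = E.x (g B.leg) t := fun t h3 h4 => by
    rw [hC.x_eq _ t (ml (hp.trans h3) h4), xE _ t (ml₁ h3 h4)]
  have sg : ∀ i i' t, (i = B.leg → p₁ < t) → (i' = B.leg → p₁ < t) →
      E.Crosses (g i) (g i') t → C.sign (g i) (g i') t = E.sign (g i) (g i') t := by
    intro i i' t h3 h4 hc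
    have hc' := E.crosses_iff.1 hc
    have ht := hc'.2.1
    have xx : ∀ {i}, (i = B.leg → p₁ < t) → C.x (g i) t = E.x (g i) t := fun {i} h => by
      by_cases hi : i = B.leg
      · have := h hi
        subst hi; exact xleg t this.le ht.2
      · exact hx _ (fun h => hi (hgi h)) t ht
    have hcC : C.Crosses (g i) (g i') t := C.crosses_iff.2 ⟨hc'.1, ht, by
      rw [xx h3, xx h4, hc'.2.2]⟩
    have head : ∀ i', B.q < t → (i' = B.leg → p₁ < t) → E.Crosses (g B.head) (g i') t →
        C.Crosses (g B.head) (g i') t →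
        C.sign (g B.head) (g i') t = E.sign (g B.head) (g i') t := fun i' h h4 hc hcC => by
      rw [cU _ t hc h fun h' => le_trans (by linarith) (h4 (hgi h')).le,
        hC.sign_new _ _ t hcC (newhead h)]
    have mem : ∀ {i}, (i = B.leg → p₁ < t) → (i = B.head → t ≤ B.q) →
        t ∈ Icc (B.a i) (B.b i) := fun {i} h h' => by
      by_cases hi : i = B.leg
      · have := h hi
        subst hi; exact ml (hp.trans this.le) ht.2
      · exact old ht hi h'
    by_cases h5 : i = B.head → t ≤ B.q
    · by_cases h6 : i' = B.head → t ≤ B.q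
      · have hB := hC.crosses_old hcC (mem h3 h5) (mem h4 h6)
        rw [hC.sign_eq _ _ t hB, sE _ _ t (restrict_crosses.2 hB)]
      · push Not at h6
        obtain ⟨rfl, h6⟩ := h6
        rw [C.sign_symm, E.sign_symm, head i h6 h3 hc.symm hcC.symm]
    · push Not at h5
      obtain ⟨rfl, h5⟩ := h5
      exact head i' h5 h4 hc hcC
  refine ⟨n + 1, g, C, n, f, D, hC, hrC, hD, hrD, ((hR hA₁).trans ?_).symm⟩
  refine arc_move (c := g B.leg) (u := 0) (v := p₁) (s' := s) le_rfl (by linarith) p₁1.le hx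
    (fun t ht ht' => ?_) (fun j k t hj hk hc => ?_) (fun k t ht hc => ?_) (fun k t ht hc => ?_)
    (fun k t ht hc => ?_) (fun h j k t _ _ _ hc h' => absurd h' ?_)
    (fun h => ⟨h, (hR hA₁).adm_iff.1 (hD.adm hA₁) h⟩) hrE hrC
  · rcases le_or_gt p₁ t with h3 | h3
    · exact xleg t h3 ht.2
    · obtain rfl : t = 0 := le_antisymm (not_lt.1 fun h => ht' ⟨h, h3⟩) ht.1
      rw [WC _ 0 hT.zero ht (newleg p0), LE 0 hT.zero le_rfl h3, w0, if_pos (by linarith)]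
  · obtain ⟨i, rfl⟩ := hgs j
    obtain ⟨i', rfl⟩ := hgs k
    exact sg i i' t (fun h => absurd (congrArg g h) hj) (fun h => absurd (congrArg g h) hk) hc
  · obtain ⟨i', rfl⟩ := hgs k
    have htq : p₁ < t := not_le.1 fun h => ht ⟨hc.inner.1.le, h⟩
    exact sg _ i' t (fun _ => htq) (fun _ => htq) hc
  · have hc' := E.crosses_iff.1 hc
    rcases eq_or_lt_of_le ht.2 with rfl | h3
    · exfalso
      obtain ⟨i', rfl⟩ := hgs k
      have hi' : i' ≠ B.leg := fun h => hc'.1 (congrArg g h.symm)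
      have hxx := hc'.2.2
      rw [xE _ _ (ml₁ le_rfl p₁1.le)] at hxx
      by_cases h : i' = B.head
      · subst h
        rw [UE t p₁T hqp p₁1.le, if_neg (by linarith)] at hxx
        exact hm _ _ (ml hp p₁1.le) (hxx ▸ he₀)
      · have := old hc'.2.1 hi' fun h' => absurd h' h
        rw [xE _ _ (mem₁ hi' this)] at hxx
        exact hl i' t le_rfl ⟨hi'.symm, ml hp p₁1.le, this, hxx⟩
    · refine cL k t hc h3 fun h => not_lt.1 fun h4 => ?_
      subst h
      have a1 : ∀ τ ∈ T, τ ∈ Icc t₂ p₁ → E.x (g B.head) τ = e₀ := fun τ h5 h6 => by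
        rw [UE τ h5 (by linarith [h6.1]) (by linarith [h6.2]), if_neg (by linarith [h6.1])]
      have a2 : ∀ τ ∈ T, τ ∈ Icc t₂ p₁ → (τ = p₁ ∧ E.x (g B.leg) τ = B.x B.leg τ) ∨
          E.x (g B.leg) τ = e₂ := fun τ h5 h6 => by
        rcases eq_or_lt_of_le h6.2 with h7 | h7
        · exact Or.inl ⟨h7, xE _ _ (ml₁ h7.ge (by linarith))⟩
        · exact Or.inr (by rw [LE τ h5 (by linarith [h6.1]) h7, if_neg (by linarith [h6.1])])
      have t20 : 0 ≤ t₂ := by linarith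
      rcases side with ⟨-, m, -, m'⟩ | ⟨-, m, m', -⟩
      · refine (((PE (g B.head)).sub_interval t20 p₁1.le).lt ((PE (g B.leg)).sub_interval t20
          p₁1.le) t₂T p₁T (fun τ h5 h6 => ?_) ⟨h4.le, h3.le⟩).ne' hc'.2.2
        rw [a1 τ h5 h6]
        rcases a2 τ h5 h6 with ⟨h7, h8⟩ | h8 <;> rw [h8]
        · exact he₀.2.trans_lt (m _ _ (by rw [h7]; exact ml hp p₁1.le))
        · exact m'
      · refine (((PE (g B.leg)).sub_interval t20 p₁1.le).lt ((PE (g B.head)).sub_interval t20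
          p₁1.le) t₂T p₁T (fun τ h5 h6 => ?_) ⟨h4.le, h3.le⟩).ne hc'.2.2
        rw [a1 τ h5 h6]
        rcases a2 τ h5 h6 with ⟨h7, h8⟩ | h8 <;> rw [h8]
        · exact (m _ _ (by rw [h7]; exact ml hp p₁1.le)).trans_le he₀.1
        · exact m'
  · rcases lt_or_ge t B.p with h3 | h3
    · exact hC.sign_new _ _ _ hc (newleg h3)
    exfalso
    have hc' := C.crosses_iff.1 hc
    have m0 := ml h3 hc'.2.1.2
    obtain ⟨i', rfl⟩ := hgs k
    have hi' : i' ≠ B.leg := fun h => hc'.1 (congrArg g h.symm)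
    by_cases h5 : i' = B.head → t ≤ B.q
    · exact hl i' t ht.2 (hC.crosses_old hc m0 (old hc'.2.1 hi' h5))
    · push Not at h5
      obtain ⟨rfl, h5⟩ := h5
      have a1 : ∀ τ ∈ T, τ ∈ Icc B.q p₁ → (τ = B.q ∧ C.x (g B.head) τ = B.x B.head B.q) ∨
          C.x (g B.head) τ ∈ Icc lo hi := fun τ h6 h7 => by
        rcases eq_or_lt_of_le h7.1 with h8 | h8
        · exact Or.inl ⟨h8.symm, by rw [← h8, hC.x_eq _ _ (mh q0.le le_rfl)]⟩
        · right
          rw [WC _ τ h6 ⟨by linarith, by linarith [h7.2]⟩ (newhead h8)]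
          exact hw τ
      have a2 : ∀ τ, τ ∈ Icc B.q p₁ → τ ∈ Icc (B.a B.leg) (B.b B.leg) := fun τ h6 =>
        ml (hpq.trans h6.1) (h6.2.trans p₁1.le)
      have a3 : ∀ τ, τ ∈ Icc B.q p₁ → C.x (g B.leg) τ = B.x B.leg τ := fun τ h6 =>
        hC.x_eq _ τ (a2 τ h6)
      have hxp : B.x B.head B.q ≠ B.x B.leg B.q := fun h =>
        hh B.leg B.q le_rfl ⟨hne.symm, mh q0.le le_rfl, ml hpq q1.le, h⟩
      rcases side with ⟨m'', m, -⟩ | ⟨m'', m, -⟩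
      · refine (((PC (g B.head)).sub_interval q0.le p₁1.le).lt ((PC (g B.leg)).sub_interval q0.le
          p₁1.le) qT p₁T (fun τ h6 h7 => ?_) ⟨h5.le, ht.2⟩).ne' hc'.2.2
        rw [a3 τ h7]
        rcases a1 τ h6 h7 with ⟨h8, h9⟩ | h9
        · rw [h9, h8]; exact m''
        · exact h9.2.trans_lt (m _ _ (a2 τ h7))
      · refine (((PC (g B.leg)).sub_interval q0.le p₁1.le).lt ((PC (g B.head)).sub_interval q0.le
          p₁1.le) qT p₁T (fun τ h6 h7 => ?_) ⟨h5.le, ht.2⟩).ne hc'.2.2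
        rw [a3 τ h7]
        rcases a1 τ h6 h7 with ⟨h8, h9⟩ | h9
        · rw [h9, h8]; exact lt_of_le_of_ne (not_lt.1 m'') hxp.symm
        · exact (m _ _ (a2 τ h7)).trans_le h9.1
  · exact (hR hA₁).adm_iff.1 (hD.adm hA₁) h j k t hc

/-! ### Moves of the head and the leg -/

namespace EndMove

variable {B' : OpenBraid m} {tH tL : ℝ}

/-- A move of the head does not change the closures, up to equivalence. -/
theorem eqv_head (h : EndMove B B' tH B.p) (hp' : B'.p = B.p) (hA : Adm s B.toStrandDiagram)
    (hB : B.Roomy) (hB' : B'.Roomy) (h0 : 0 ≤ tH) (ha : B.a B.head ≤ tH)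
    (hlt : tH < B.q) (hlt' : tH < B'.q) : Eqv s B B' := by
  rcases le_or_gt B.p tH with hpH | hpH
  · exact h.eqv_of_opened hA hB hB' hpH
  -- both heads are moved up to a height above the leg
  obtain ⟨q₁, hq₁, hq₁'⟩ := exists_between (lt_min hpH (lt_min hlt hlt'))
  rw [lt_min_iff, lt_min_iff] at hq₁'
  obtain ⟨h1, h2, h3⟩ := hq₁'
  have cut : ∀ {B B' : OpenBraid m}, EndMove B B' tH B.p → Adm s B.toStrandDiagram → B.Roomy →
      B.a B.head ≤ tH → q₁ < B.p → q₁ < B.q → ∃ B₁ : OpenBraid m, EndMove B B₁ tH B.p ∧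
        B₁.Roomy ∧ B₁.q = q₁ ∧ B₁.p = B.p ∧ Eqv s B B₁ := by
    intro B B' h hA hB ha h1 h2
    have lt : ∀ i, Function.update B.a B.leg B.p i < Function.update B.b B.head q₁ i := fun i => by
      rw [Function.update_eq_self]
      by_cases hi : i = B.head
      · subst hi; rw [Function.update_self]; exact ha.trans_lt hq₁
      · rw [Function.update_of_ne hi]; exact B.a_lt_b i
    have em : EndMove B (B.restrict B.p q₁ le_rfl h2.le lt h.leg_free
      fun k t ht => h.head_free k t (hq₁.le.trans ht)) q₁ B.p := restrict_endMove
    refine ⟨_, em.mono hq₁.le le_rfl h.leg_free h.head_free, restrict_roomy hB, restrict_q,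
      restrict_p, ?_⟩
    rcases lt_or_ge B.q B.p with hqp | hpq
    · exact em.eqv_of_joined hA hB (restrict_roomy hB) hqp
        (by rw [restrict_p, restrict_q]; exact h1) h1 (h0.trans hq₁.le) B.p_lt_one.le
    · exact hB.restrict_head hA hpq rfl h1
  have h' : EndMove B' B tH B'.p := by rw [hp']; exact h.symm
  have ha' : B'.a B'.head ≤ tH := by
    rw [h.head, h.a _ fun e => ?_]
    · exact ha
    · have : B.a B.head = B.p := by rw [e]
      linarith
  obtain ⟨B₁, em, r₁, e1, e2, E₁⟩ := cut h hA hB ha h1 h2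
  obtain ⟨B₁', em', r₁', e1', e2', E₁'⟩ := cut h' (h.adm hA) hB' ha' (by rw [hp']; exact h1) h3
  rw [hp'] at em'
  exact E₁.trans (Eqv.trans (((em.symm.trans h).trans em').eqv_of_joined (em.adm hA) r₁ r₁'
    (by rw [e1, e2]; exact h1) (by rw [e1', e2', hp']; exact h1) hpH h0 B.p_lt_one.le) E₁'.symm
    (em'.adm (h.adm hA)) r₁') (em.adm hA) r₁

/-- A move of the leg does not change the closures, up to equivalence. -/
theorem eqv_leg (h : EndMove B B' B.q tL) (hq' : B'.q = B.q) (hA : Adm s B.toStrandDiagram)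
    (hB : B.Roomy) (hB' : B'.Roomy) (h0 : tL ≤ 1) (hb : tL ≤ B.b B.leg)
    (hlt : B.p < tL) (hlt' : B'.p < tL) : Eqv s B B' := by
  rcases le_or_gt tL B.q with hqL | hqL
  · exact h.eqv_of_opened hA hB hB' hqL
  -- both legs are moved down to a height below the head
  obtain ⟨p₁, hp₁', hp₁⟩ := exists_between (max_lt hqL (max_lt hlt hlt'))
  rw [max_lt_iff, max_lt_iff] at hp₁'
  obtain ⟨h1, h2, h3⟩ := hp₁'
  have cut : ∀ {B B' : OpenBraid m}, EndMove B B' B.q tL → Adm s B.toStrandDiagram → B.Roomy →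
      tL ≤ B.b B.leg → B.q < p₁ → B.p < p₁ → ∃ B₁ : OpenBraid m, EndMove B B₁ B.q tL ∧
        B₁.Roomy ∧ B₁.q = B.q ∧ B₁.p = p₁ ∧ Eqv s B B₁ := by
    intro B B' h hA hB hb h1 h2
    have lt : ∀ i, Function.update B.a B.leg p₁ i < Function.update B.b B.head B.q i := fun i => by
      rw [Function.update_eq_self B.head B.b]
      by_cases hi : i = B.leg
      · subst hi; rw [Function.update_self]; exact hp₁.trans_le hb
      · rw [Function.update_of_ne hi]; exact B.a_lt_b i
    have em : EndMove B (B.restrict p₁ B.q h2.le le_rfl lt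
      (fun k t ht => h.leg_free k t (ht.trans hp₁.le)) h.head_free) B.q p₁ := restrict_endMove
    refine ⟨_, em.mono le_rfl hp₁.le h.leg_free h.head_free, restrict_roomy hB, restrict_q,
      restrict_p, ?_⟩
    rcases lt_or_ge B.q B.p with hqp | hpq
    · exact em.eqv_of_joined hA hB (restrict_roomy hB) hqp
        (by rw [restrict_p, restrict_q]; exact h1) h1 B.q_pos.le (hp₁.le.trans h0)
    · exact hB.restrict_leg hA hpq rfl h1
  have h' : EndMove B' B B'.q tL := by rw [hq']; exact h.symm
  have hb' : tL ≤ B'.b B'.leg := by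
    rw [h.leg, h.b _ fun e => ?_]
    · exact hb
    · have : B.b B.leg = B.q := by rw [e]
      linarith
  obtain ⟨B₁, em, r₁, e1, e2, E₁⟩ := cut h hA hB hb h1 h2
  obtain ⟨B₁', em', r₁', e1', e2', E₁'⟩ := cut h' (h.adm hA) hB' hb' (by rw [hq']; exact h1) h3
  rw [hq'] at em'
  exact E₁.trans (Eqv.trans (((em.symm.trans h).trans em').eqv_of_joined (em.adm hA) r₁ r₁'
    (by rw [e1, e2]; exact h1) (by rw [e1', e2', hq']; exact h1) hqL B.q_pos.le h0) E₁'.symm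
    (em'.adm (h.adm hA)) r₁') (em.adm hA) r₁

end EndMove

end Braidoids

namespace Braidoids
open Set OpenBraid

variable {m n : ℕ}

/-! ### Contraction of the square towards the middle -/

section scale

variable {c : ℝ}

theorem scale_inj (h0 : 0 < c) {x y : ℝ} : c * x + c = c * y + c ↔ x = y :=
  ⟨fun h => mul_left_cancel₀ h0.ne' (by linarith), fun h => by rw [h]⟩

theorem scale_lt (h0 : 0 < c) {x y : ℝ} : c * x + c < c * y + c ↔ x < y := by
  rw [add_lt_add_iff_right, mul_lt_mul_iff_right₀ h0]

theorem scale_mem (h0 : 0 < c) (h1 : c ≤ 1 / 3) {x : ℝ} (hx : x ∈ Icc (0 : ℝ) 1) :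
    c * x + c ∈ Ioo (0 : ℝ) 1 := by
  have := mul_nonneg h0.le hx.1
  have := mul_le_of_le_one_right h0.le hx.2
  exact ⟨by linarith, by linarith⟩

theorem scale_mem_uIcc (h0 : 0 < c) {x y z : ℝ} :
    c * z + c ∈ uIcc (c * x + c) (c * y + c) ↔ z ∈ uIcc x y := by
  have le : ∀ {x y : ℝ}, c * x + c ≤ c * y + c ↔ x ≤ y := by
    intro x y; rw [← not_lt, ← not_lt, scale_lt h0]
  simp only [mem_uIcc, le]

/-- The diagram contracted horizontally by the factor `c` towards the point `c / (1 - c)`. -/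
def StrandDiagram.scale (D : StrandDiagram n) (h0 : 0 < c) (h1 : c ≤ 1 / 3) :
    StrandDiagram n where
  a := D.a
  b := D.b
  x i t := c * D.x i t + c
  sign := D.sign
  a_nonneg := D.a_nonneg
  a_lt_b := D.a_lt_b
  b_le_one := D.b_le_one
  x_mem i t ht := Ioo_subset_Icc_self (scale_mem h0 h1 (D.x_mem i t ht))
  pl i := by
    obtain ⟨S, hS⟩ := D.pl i
    exact ⟨S, fun s u a b d e => (hS s u a b d e).comp_affine c c⟩
  sign_symm := D.sign_symm
  finite i j h := (D.finite i j h).subset fun t ht => ⟨ht.1, ht.2.1, (scale_inj h0).1 ht.2.2⟩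
  interior i j t h hi hj hx := D.interior i j t h hi hj ((scale_inj h0).1 hx)
  transversal i j t h hi hj hx := by
    obtain ⟨ε, hε, H⟩ := D.transversal i j t h hi hj ((scale_inj h0).1 hx)
    refine ⟨ε, hε, fun s hs => ?_⟩
    have := mul_neg_of_pos_of_neg (mul_pos h0 h0) (H s hs)
    nlinarith
  double i j k t h h' hi hj hk hx hx' :=
    D.double i j k t h h' hi hj hk ((scale_inj h0).1 hx) ((scale_inj h0).1 hx')

theorem StrandDiagram.scale_crosses {D : StrandDiagram n} {h0 : 0 < c} {h1 : c ≤ 1 / 3}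
    {i j : Fin n} {t : ℝ} : (D.scale h0 h1).Crosses i j t ↔ D.Crosses i j t :=
  and_congr_right fun _ => and_congr_right fun _ => and_congr_right fun _ => scale_inj h0

theorem Adm.scale {s : SignType} {D : StrandDiagram n} (hD : Adm s D) (h0 : 0 < c)
    (h1 : c ≤ 1 / 3) : Adm s (D.scale h0 h1) := fun hs i j t hc =>
  hD hs i j t (StrandDiagram.scale_crosses.1 hc)

/-- The contraction of a braid diagram. -/
def BraidDiagram.scale (D : BraidDiagram n) (h0 : 0 < c) (h1 : c ≤ 1 / 3) : BraidDiagram n where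
  toStrandDiagram := D.toStrandDiagram.scale h0 h1
  n_pos := D.n_pos
  a_eq := D.a_eq
  b_eq := D.b_eq
  ends i := (D.ends i).imp fun _ h => (scale_inj h0).2 h

theorem BraidDiagram.scale_roomy (D : BraidDiagram n) (h0 : 0 < c) (h1 : c ≤ 1 / 3) :
    (D.scale h0 h1).Roomy := fun i t ht => scale_mem h0 h1 (D.fam.mem i t ht)

theorem BraidDiagram.scale_R {s : SignType} {D : BraidDiagram n} (hD : Adm s D.toStrandDiagram)
    (h0 : 0 < c) (h1 : c ≤ 1 / 3) : R s ⟨n, D⟩ ⟨n, D.scale h0 h1⟩ :=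
  .of_planar ⟨Equiv.refl _, fun _ _ _ _ => (scale_lt h0).symm, fun _ _ _ _ => rfl⟩ hD

theorem BraidDiagram.scale_crosses {D : BraidDiagram n} {h0 : 0 < c} {h1 : c ≤ 1 / 3}
    {i j : Fin n} {t : ℝ} : (D.scale h0 h1).Crosses i j t ↔ D.Crosses i j t :=
  StrandDiagram.scale_crosses (h0 := h0) (h1 := h1)

namespace OpenBraid

/-- The contraction of a braidoid diagram. -/
def scale (B : OpenBraid m) (h0 : 0 < c) (h1 : c ≤ 1 / 3) : OpenBraid m where
  toStrandDiagram := B.toStrandDiagram.scale h0 h1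
  leg := B.leg
  head := B.head
  a_eq := B.a_eq
  b_eq := B.b_eq
  leg_pos := B.leg_pos
  head_lt := B.head_lt
  aligned y := by
    constructor
    · rintro ⟨i, hi, rfl⟩
      obtain ⟨j, hj, e⟩ := (B.aligned _).1 ⟨i, hi, rfl⟩
      exact ⟨j, hj, (scale_inj h0).2 e⟩
    · rintro ⟨i, hi, rfl⟩
      obtain ⟨j, hj, e⟩ := (B.aligned _).2 ⟨i, hi, rfl⟩
      exact ⟨j, hj, (scale_inj h0).2 e⟩

variable {B B' : OpenBraid m} {s s' : SignType} {h0 : 0 < c} {h1 : c ≤ 1 / 3}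

theorem scale_crosses {i j : Fin m} {t : ℝ} :
    (B.scale h0 h1).Crosses i j t ↔ B.Crosses i j t :=
  StrandDiagram.scale_crosses (h0 := h0) (h1 := h1)

theorem scale_roomy : (B.scale h0 h1).Roomy := fun i t ht => scale_mem h0 h1 (B.x_mem i t ht)

end OpenBraid

variable {B B' : OpenBraid m} {s s' : SignType} {h0 : 0 < c} {h1 : c ≤ 1 / 3}

theorem Clos.scale {D : BraidDiagram n} {f : Fin m → Fin n} (h : Clos s B D f) :
    Clos s (B.scale h0 h1) (D.scale h0 h1) f where
  lab := ⟨h.lab.surj, h.lab.ker⟩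
  ends hpq := (scale_inj h0).2 (h.ends hpq)
  x_eq i t ht := (scale_inj h0).2 (h.x_eq i t ht)
  sign_eq i j t hc := h.sign_eq i j t (OpenBraid.scale_crosses.1 hc)
  sign_new k j t hc hn := h.sign_new k j t (BraidDiagram.scale_crosses.1 hc) hn

theorem WindowChange.scale {i : Fin m} {u v : ℝ} (h : WindowChange s' B B' i u v) :
    WindowChange s' (B.scale h0 h1) (B'.scale h0 h1) i u v where
  leg := h.leg
  head := h.head
  a := h.a
  b := h.b
  a_le := h.a_le
  lt := h.lt
  le_b := h.le_b
  x_ne j hj t ht := (scale_inj h0).2 (h.x_ne j hj t ht)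
  x_off t ht ht' := (scale_inj h0).2 (h.x_off t ht ht')
  sign_off j k t hc := h.sign_off j k t (OpenBraid.scale_crosses.1 hc)
  sign_on k t ht hc := h.sign_on k t ht (OpenBraid.scale_crosses.1 hc)
  sign_on' k t ht hc := h.sign_on' k t ht (OpenBraid.scale_crosses.1 hc)
  leg_off h2 h3 h4 := h.leg_off h2 h3 ((scale_mem_uIcc h0).1 h4)
  head_off h2 h3 h4 := h.head_off h2 h3 ((scale_mem_uIcc h0).1 h4)
  virt hs j k t hj hk ht hc hz h4 :=
    h.virt hs j k t hj hk ht (OpenBraid.scale_crosses.1 hc) hz ((scale_mem_uIcc h0).1 h4)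

theorem EndMove.scale {tH tL : ℝ} (h : EndMove B B' tH tL) :
    EndMove (B.scale h0 h1) (B'.scale h0 h1) tH tL where
  leg := h.leg
  head := h.head
  a := h.a
  b := h.b
  p_le := h.p_le
  p_le' := h.p_le'
  le_q := h.le_q
  le_q' := h.le_q'
  x_eq j t ht h2 h3 := (scale_inj h0).2 (h.x_eq j t ht h2 h3)
  sign_eq j k t hc := h.sign_eq j k t (OpenBraid.scale_crosses.1 hc)
  leg_free k t ht hc := h.leg_free k t ht (OpenBraid.scale_crosses.1 hc)
  leg_free' k t ht hc := h.leg_free' k t ht (OpenBraid.scale_crosses.1 hc)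
  head_free k t ht hc := h.head_free k t ht (OpenBraid.scale_crosses.1 hc)
  head_free' k t ht hc := h.head_free' k t ht (OpenBraid.scale_crosses.1 hc)

end scale

/-! ### Braidoid diagrams and their closures -/

namespace BraidoidDiagram

/-- `m - 1` strands with different ends at positions `k / m`, with `0 < k < m`, take all of them. -/
theorem exists_end (l : Fin m) (y : Fin m → ℝ)
    (h : ∀ i, i ≠ l → ∃ k : ℕ, 0 < k ∧ k < m ∧ y i = (k : ℝ) / m)
    (inj : ∀ i j, i ≠ l → j ≠ l → y i = y j → i = j) {k : ℕ} (hk : 0 < k) (hkm : k < m) :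
    ∃ i, i ≠ l ∧ y i = (k : ℝ) / m := by
  classical
  choose! κ h1 h2 h3 using h
  have key : (Finset.univ.erase l).image κ = Finset.Ioo 0 m := by
    refine Finset.eq_of_subset_of_card_le (fun r hr => ?_) ?_
    · obtain ⟨i, hi, rfl⟩ := Finset.mem_image.1 hr
      have := Finset.ne_of_mem_erase hi
      exact Finset.mem_Ioo.2 ⟨h1 i this, h2 i this⟩
    · rw [Finset.card_image_of_injOn, Finset.card_erase_of_mem (Finset.mem_univ _)]
      · simp
      · intro i hi j hj e
        have hi' := Finset.ne_of_mem_erase hi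
        have hj' := Finset.ne_of_mem_erase hj
        exact inj i j hi' hj' (by rw [h3 i hi', h3 j hj', e])
  have : k ∈ (Finset.univ.erase l).image κ := by rw [key]; exact Finset.mem_Ioo.2 ⟨hk, hkm⟩
  obtain ⟨i, hi, rfl⟩ := Finset.mem_image.1 this
  have hi' := Finset.ne_of_mem_erase hi
  exact ⟨i, hi', h3 i hi'⟩

/-- A braidoid diagram, without the condition that its ends lie equidistantly. -/
def toOpen (B : BraidoidDiagram m) : OpenBraid m where
  toStrandDiagram := B.toStrandDiagram
  leg := B.leg
  head := B.head
  a_eq := B.a_eq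
  b_eq := B.b_eq
  leg_pos := B.leg_pos
  head_lt := B.head_lt
  aligned y := by
    constructor
    · rintro ⟨i, hi, rfl⟩
      obtain ⟨k, h1, h2, e⟩ := B.bottom_ends i hi
      obtain ⟨j, hj, e'⟩ := exists_end B.leg (fun j => B.x j 0) B.top_ends (fun i j hi hj e => by
        by_contra hij
        have := B.interior i j 0 hij ⟨(B.a_eq i hi).le, (B.a_nonneg i).trans (B.a_lt_b i).le⟩
          ⟨(B.a_eq j hj).le, (B.a_nonneg j).trans (B.a_lt_b j).le⟩ e
        rw [B.a_eq i hi] at this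
        exact lt_irrefl _ this.1) h1 h2
      exact ⟨j, hj, e'.trans e.symm⟩
    · rintro ⟨i, hi, rfl⟩
      obtain ⟨k, h1, h2, e⟩ := B.top_ends i hi
      obtain ⟨j, hj, e'⟩ := exists_end B.head (fun j => B.x j 1) B.bottom_ends
        (fun i j hi hj e => by
          by_contra hij
          have := B.interior i j 1 hij ⟨(B.a_lt_b i).le.trans (B.b_le_one i), (B.b_eq i hi).ge⟩
            ⟨(B.a_lt_b j).le.trans (B.b_le_one j), (B.b_eq j hj).ge⟩ e
          rw [B.b_eq i hi] at this
          exact lt_irrefl _ this.2) h1 h2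
      exact ⟨j, hj, e'.trans e.symm⟩

end BraidoidDiagram

variable {s : SignType} {B B' : BraidoidDiagram m}

theorem IsClosureVia.clos {D : BraidDiagram n} {f : Fin m → Fin n} (h : IsClosureVia s B D f) :
    Clos s B.toOpen D f where
  lab := ⟨h.surj, fun i j => by
    refine ⟨fun e => ?_, fun e => ?_⟩
    · rcases h.inj i j e with e' | e'
      · exact Or.inl e'
      rcases lt_or_ge B.headHeight B.legHeight with h1 | h1
      · exact Or.inr ⟨h1, e'⟩
      · exact Or.inl ((h.opened h1).1 e)
    · rcases e with rfl | ⟨h1, ⟨rfl, rfl⟩ | ⟨rfl, rfl⟩⟩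
      · rfl
      · exact h.joined h1
      · exact (h.joined h1).symm⟩
  ends h1 := (h.opened h1).2.1
  x_eq := h.x_eq
  sign_eq := h.sign_eq
  sign_new := h.sign_new

theorem BraidoidDiagram.exists_closure (B : BraidoidDiagram m) (s : SignType)
    (hA : Adm s B.toStrandDiagram) : ∃ (n : ℕ) (D : BraidDiagram n) (f : Fin m → Fin n),
      IsClosureVia s B D f ∧ Adm s D.toStrandDiagram := by
  classical
  obtain ⟨n, f, hf⟩ := B.toOpen.exists_lab
  obtain ⟨T, hT⟩ := exists_isGrid B.toStrandDiagram
  obtain ⟨y, hy, hyS⟩ := exists_not_mem_finite (Finset.univ.biUnion fun i => T.image (B.x i))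
  -- the new ends are on the vertical line of the leg
  let x₀ := B.x B.leg B.legHeight
  have hx₀ : x₀ ∈ Icc (0 : ℝ) 1 := B.x_mem _ _ ⟨le_rfl, (B.a_lt_b _).le⟩
  obtain ⟨D, hD, -, W, -⟩ := exists_clos (B := B.toOpen) hf hT s
    (fun τ => if τ = 0 ∨ τ = 1 then x₀ else y)
    (fun τ _ => by split_ifs; exacts [hx₀, ⟨hy.1.le, hy.2.le⟩])
    (fun τ hτ _ i hi he => by
      split_ifs at he with h
      · rcases h with rfl | rfl
        · have hne : i ≠ B.leg := fun h => by
            have := B.leg_pos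
            rw [h] at hi
            exact not_lt.2 hi.1 this
          obtain ⟨k, h1, h2, e⟩ := B.top_ends i hne
          exact B.leg_not_aligned k h1 h2 (he.trans e)
        · have hne : i ≠ B.head := fun h => by
            have := B.head_lt
            rw [h] at hi
            exact not_lt.2 hi.2 this
          obtain ⟨k, h1, h2, e⟩ := B.bottom_ends i hne
          exact B.leg_not_aligned k h1 h2 (he.trans e)
      · exact hyS (Finset.mem_biUnion.2 ⟨i, Finset.mem_univ _, Finset.mem_image.2 ⟨τ, hτ, he.symm⟩⟩))
    (fun _ => by simp)
  refine ⟨n, D, f, ⟨hf.surj, fun i j e => ((hf.ker i j).1 e).imp_right And.right, hf.joined,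
    fun h => ⟨hf.inj h, hD.ends h, ?_⟩, hD.x_eq, hD.sign_eq, hD.sign_new⟩, hD.adm hA⟩
  have e : D.x (f B.leg) 0 = _ := W _ 0 hT.zero ⟨le_rfl, zero_le_one⟩ (new_zero hf h)
  rw [e, if_pos (Or.inl rfl)]
  exact left_mem_uIcc

end Braidoids

namespace Braidoids
open Set OpenBraid

variable {m n n' : ℕ} {s : SignType}

/-! ### Isotopic braidoid diagrams have equivalent closures -/

theorem AffineOn.mem_convex {f : ℝ → ℝ} {u v t : ℝ} {S : Set (ℝ × ℝ)} (h : AffineOn f u v)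
    (hS : Convex ℝ S) (hu : (f u, u) ∈ S) (hv : (f v, v) ∈ S) (ht : t ∈ Icc u v) :
    (f t, t) ∈ S := by
  obtain ⟨p, q, h⟩ := h
  have huv : u ≤ v := ht.1.trans ht.2
  have ht' : t ∈ segment ℝ u v := by rwa [segment_eq_Icc huv]
  obtain ⟨a, b, ha, hb, hab, rfl⟩ := ht'
  convert hS hu hv ha hb hab using 1
  rw [h _ ht, h u ⟨le_rfl, huv⟩, h v ⟨huv, le_rfl⟩]
  ext
  · simp only [Prod.smul_mk, Prod.mk_add_mk, smul_eq_mul]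
    linear_combination (-q) * hab
  · simp

/-- The region between the old and the new arc is contained in the triangle of a `Δ`-move. -/
theorem mem_hull_of_slice {h h' : ℝ → ℝ} {tA tC tB : ℝ}
    (h1 : AffineOn h tA tB) (h2 : AffineOn h' tA tC) (h3 : AffineOn h' tC tB)
    (eA : h' tA = h tA) (eB : h' tB = h tB) {y t : ℝ} (ht : t ∈ Icc tA tB)
    (hy : y ∈ uIcc (h t) (h' t)) :
    (y, t) ∈ convexHull ℝ {(h tA, tA), (h' tC, tC), (h tB, tB)} := by
  set S : Set (ℝ × ℝ) := convexHull ℝ {(h tA, tA), (h' tC, tC), (h tB, tB)}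
  have hS : Convex ℝ S := convex_convexHull ..
  have hA : (h tA, tA) ∈ S := subset_convexHull _ _ (by simp)
  have hB : (h tB, tB) ∈ S := subset_convexHull _ _ (by simp)
  have hC : (h' tC, tC) ∈ S := subset_convexHull _ _ (by simp)
  have e1 : (h t, t) ∈ S := h1.mem_convex hS hA hB ht
  have e2 : (h' t, t) ∈ S := by
    rcases le_total t tC with h | h
    · exact h2.mem_convex hS (by rwa [eA]) hC ⟨ht.1, h⟩
    · exact h3.mem_convex hS hC (by rwa [eB]) ⟨h, ht.2⟩
  rw [← segment_eq_uIcc] at hy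
  obtain ⟨a, b, ha, hb, hab, rfl⟩ := hy
  convert hS e1 e2 ha hb hab using 1
  ext
  · simp
  · simp only [Prod.smul_mk, Prod.mk_add_mk, smul_eq_mul]
    rw [← add_mul, hab, one_mul]

section moves

variable {B B' : BraidoidDiagram m} {c : ℝ} {h0 : 0 < c} {h1 : c ≤ 1 / 3}

namespace BraidoidDiagram

theorem Same.crosses {e : Equiv.Perm (Fin m)}
    (hab : ∀ i, B'.a (e i) = B.a i ∧ B'.b (e i) = B.b i)
    (hx : ∀ i, ∀ t ∈ Icc (B.a i) (B.b i), B'.x (e i) t = B.x i t) {i j : Fin m} {t : ℝ} :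
    B'.Crosses (e i) (e j) t ↔ B.Crosses i j t := by
  unfold StrandDiagram.Crosses
  rw [(hab i).1, (hab i).2, (hab j).1, (hab j).2, e.injective.ne_iff]
  refine and_congr_right fun _ => and_congr_right fun hi => and_congr_right fun hj => ?_
  rw [hx i t hi, hx j t hj]

/-- The same diagram, with another numbering of the strands, has the same closures. -/
theorem Same.clos (h : B.Same B') {D : BraidDiagram n} {f : Fin m → Fin n}
    (hD : Clos s B.toOpen D f) : ∃ f' : Fin m → Fin n, Clos s B'.toOpen D f' := by
  obtain ⟨e, hl, hh, hab, hx, hs⟩ := h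
  have hc : ∀ {i j t}, B'.Crosses (e i) (e j) t ↔ B.Crosses i j t := Same.crosses hab hx
  have hp : B'.toOpen.p = B.toOpen.p := by
    change B'.a B'.leg = B.a B.leg
    rw [← hl, (hab _).1]
  have hq : B'.toOpen.q = B.toOpen.q := by
    change B'.b B'.head = B.b B.head
    rw [← hh, (hab _).2]
  have hl' : e.symm B'.leg = B.leg := by rw [← hl, e.symm_apply_apply]
  have hh' : e.symm B'.head = B.head := by rw [← hh, e.symm_apply_apply]
  have hI : ∀ i t, t ∈ Icc (B'.a i) (B'.b i) ↔ t ∈ Icc (B.a (e.symm i)) (B.b (e.symm i)) := by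
    intro i t
    rw [← (hab _).1, ← (hab _).2, e.apply_symm_apply]
  have hC : ∀ i j t, B'.Crosses i j t → B.Crosses (e.symm i) (e.symm j) t := by
    intro i j t h
    rw [← hc, e.apply_symm_apply, e.apply_symm_apply]
    exact h
  refine ⟨f ∘ e.symm, ⟨hD.lab.surj.comp e.symm.surjective, fun i j => ?_⟩, fun hpq => ?_,
    fun i t ht => ?_, fun i j t h => ?_, fun k j t h hn => ?_⟩
  · have := hD.lab.ker (e.symm i) (e.symm j)
    rw [hp, hq]
    change _ ↔ i = j ∨ _ ∧ (i = B'.leg ∧ j = B'.head ∨ i = B'.head ∧ j = B'.leg)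
    rw [← e.symm.injective.eq_iff (a := i) (b := j), ← e.symm.injective.eq_iff (a := i) (b := B'.leg),
      ← e.symm.injective.eq_iff (a := j) (b := B'.leg),
      ← e.symm.injective.eq_iff (a := i) (b := B'.head),
      ← e.symm.injective.eq_iff (a := j) (b := B'.head), hl', hh']
    exact this
  · rw [hp, hq] at hpq
    change D.x (f (e.symm B'.leg)) 0 = D.x (f (e.symm B'.head)) 1
    rw [hl', hh']
    exact hD.ends hpq
  · have ht' := (hI i t).1 ht
    refine (hD.x_eq _ t ht').trans ?_
    have := hx _ t ht'
    rw [e.apply_symm_apply] at this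
    exact this.symm
  · have := hs _ _ _ (hC i j t h)
    rw [e.apply_symm_apply, e.apply_symm_apply] at this
    exact (hD.sign_eq _ _ t (hC i j t h)).trans this.symm
  · refine hD.sign_new k j t h fun i hi ht => hn (e i) ?_ ?_
    · change f (e.symm (e i)) = k
      rwa [e.symm_apply_apply]
    · change t ∈ Icc (B'.a (e i)) (B'.b (e i))
      rwa [(hab i).1, (hab i).2]

theorem Same.eqv (h : B.Same B') (hA : Adm s B.toStrandDiagram) :
    Eqv s (B.toOpen.scale h0 h1) (B'.toOpen.scale h0 h1) := by
  obtain ⟨n, D, f, hD, -⟩ := B.exists_closure s hA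
  obtain ⟨f', hf'⟩ := h.clos hD.clos
  exact ⟨n, f, D.scale h0 h1, n, f', D.scale h0 h1, hD.clos.scale, D.scale_roomy h0 h1, hf'.scale,
    D.scale_roomy h0 h1, .refl _ _⟩

/-- A `Δ`-move is a change of a strand that sweeps no endpoint. -/
theorem eqv_of_delta (hl : B'.leg = B.leg) (hh : B'.head = B.head)
    (h : StrandDiagram.DeltaMove {B.legPt, B.headPt} B.toStrandDiagram B'.toStrandDiagram)
    (hA : Adm s B.toStrandDiagram) (hA' : Adm s B'.toStrandDiagram) :
    Eqv s (B.toOpen.scale h0 h1) (B'.toOpen.scale h0 h1) := by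
  obtain ⟨i, r, tA, tC, tB, ha, hb, hiA, hAC, hCB, hBi, aff, aff1, aff2, hx, hsig, hon, hon', hE,
    hv⟩ := h
  have hAB := hAC.trans hCB
  have slice : ∀ {y t}, t ∈ Icc tA tB → y ∈ uIcc (B.x i t) (B'.x i t) →
      (y, t) ∈ convexHull ℝ {B.pt i tA, B'.pt i tC, B.pt i tB} := fun ht hy =>
    mem_hull_of_slice aff aff1 aff2
      (hx i tA ⟨hiA, hAB.le.trans hBi⟩ (Or.inr fun h => lt_irrefl _ h.1))
      (hx i tB ⟨hiA.trans hAB.le, hBi⟩ (Or.inr fun h => lt_irrefl _ h.2)) ht hy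
  have W : ∀ r' : SignType, (∀ j, ∀ t ∈ Icc tA tB, B.Crosses i j t → B.sign i j t = r') →
      (∀ j, ∀ t ∈ Icc tA tB, B'.Crosses i j t → B'.sign i j t = r') →
      (r' ≠ 0 → ∀ j k t, j ≠ i → k ≠ i → B.Crosses j k t →
        B.pt j t ∈ convexHull ℝ {B.pt i tA, B'.pt i tC, B.pt i tB} → B.sign j k t ≠ 0) →
      WindowChange r' B.toOpen B'.toOpen i tA tB := fun r' h2 h3 h4 =>
    { leg := hl
      head := hh
      a := ha
      b := hb
      a_le := hiA
      lt := hAB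
      le_b := hBi
      x_ne := fun j hj t ht => hx j t ht (Or.inl hj)
      x_off := fun t ht ht' => hx i t ht (Or.inr ht')
      sign_off := hsig
      sign_on := h2
      sign_on' := h3
      leg_off := fun _ ht hy => hE _ (Or.inl rfl) (slice ht hy)
      head_off := fun _ ht hy => hE _ (Or.inr rfl) (slice ht hy)
      virt := fun hr j k t hj hk ht hc hz hy => h4 hr j k t hj hk hc
        (slice (Ioo_subset_Icc_self ht) hy) hz }
  by_cases hr : s ≠ 0 → r ≠ 0
  · exact (W r hon hon' hv).scale.eqv (hA.scale h0 h1) hr scale_roomy scale_roomy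
  · push Not at hr
    obtain ⟨h2, rfl⟩ := hr
    -- without virtual crossings, a virtual move meets no strand: it is also a move over
    refine (W 1 (fun j t ht hc => ?_) (fun j t ht hc => ?_)
      (fun _ j k t _ _ hc _ => hA h2 j k t hc)).scale.eqv (hA.scale h0 h1) (fun _ => one_ne_zero)
      scale_roomy scale_roomy
    · exact (hA h2 i j t hc (hon j t ht hc)).elim
    · exact (hA' h2 i j t hc (hon' j t ht hc)).elim

theorem HeadMove.eqv (h : B.HeadMove B') (hA : Adm s B.toStrandDiagram) :
    Eqv s (B.toOpen.scale h0 h1) (B'.toOpen.scale h0 h1) := by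
  obtain ⟨tA, hl, hh, ha, hb, hA1, hlt, hlt', aff, aff', hx, hxo, hs, htri⟩ := h
  set S : Set (ℝ × ℝ) := convexHull ℝ {B.pt B.head tA, B.headPt, B'.headPt}
  have hS : Convex ℝ S := convex_convexHull ..
  have mA : (B.x B.head tA, tA) ∈ S := subset_convexHull _ _ (by simp [StrandDiagram.pt])
  have mP : (B.x B.head B.headHeight, B.headHeight) ∈ S := subset_convexHull _ _
    (Or.inr (Or.inl rfl))
  have mP' : (B'.x B.head B'.headHeight, B'.headHeight) ∈ S := subset_convexHull _ _
    (Or.inr (Or.inr (by rw [← hh]; rfl)))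
  have hp : B'.toOpen.p = B.toOpen.p := by
    change B'.a B'.leg = B.a B.leg
    rw [ha, hl]
  have eA : B'.x B.head tA = B.x B.head tA := hx tA ⟨hA1, le_rfl⟩
  have hq' : B'.b B.head = B'.headHeight := by rw [← hh]; rfl
  have E : EndMove B.toOpen B'.toOpen tA B.toOpen.p :=
    { leg := hl
      head := hh
      a := fun j _ => congrFun ha j
      b := hb
      p_le := le_rfl
      p_le' := hp.le
      le_q := hlt.le
      le_q' := hlt'.le
      x_eq := fun j t ht _ h3 => by
        by_cases hj : j = B.head
        · subst hj
          exact hx t ⟨ht.1, h3 rfl⟩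
        · exact hxo j hj t ht
      sign_eq := hs
      leg_free := fun k t ht hc =>
        not_lt.2 ht (B.interior _ _ _ hc.1 hc.2.1 hc.2.2.1 hc.2.2.2).1
      leg_free' := fun k t ht hc => not_lt.2 ht (by
        have := (B'.interior _ _ _ hc.1 hc.2.1 hc.2.2.1 hc.2.2.2).1
        change B'.a B.leg < t at this
        rwa [ha] at this)
      head_free := fun k t ht hc => by
        refine htri k hc.1.symm t hc.2.2.1 ?_
        have := aff.mem_convex hS mA mP ⟨ht, hc.2.1.2⟩
        have h4 : B.x B.head t = B.x k t := hc.2.2.2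
        rwa [h4] at this
      head_free' := fun k t ht hc => by
        have hk : k ≠ B.head := hc.1.symm
        have hI : t ∈ Icc (B.a k) (B.b k) := by
          have := hc.2.2.1
          change t ∈ Icc (B'.a k) (B'.b k) at this
          rwa [ha, hb k hk] at this
        refine htri k hk t hI ?_
        have h5 : t ≤ B'.headHeight := hq' ▸ hc.2.1.2
        have := aff'.mem_convex hS (by rwa [eA]) mP' ⟨ht, h5⟩
        have h4 : B'.x B.head t = B'.x k t := hc.2.2.2
        rwa [h4, hxo k hk t hI] at this }
  exact E.scale.eqv_head hp (hA.scale h0 h1) scale_roomy scale_roomy ((B.a_nonneg _).trans hA1) hA1 hlt hlt'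

theorem LegMove.eqv (h : B.LegMove B') (hA : Adm s B.toStrandDiagram) :
    Eqv s (B.toOpen.scale h0 h1) (B'.toOpen.scale h0 h1) := by
  obtain ⟨tA, hl, hh, hb, ha, hA1, hlt, hlt', aff, aff', hx, hxo, hs, htri⟩ := h
  set S : Set (ℝ × ℝ) := convexHull ℝ {B.pt B.leg tA, B.legPt, B'.legPt}
  have hS : Convex ℝ S := convex_convexHull ..
  have mA : (B.x B.leg tA, tA) ∈ S := subset_convexHull _ _ (by simp [StrandDiagram.pt])
  have mP : (B.x B.leg B.legHeight, B.legHeight) ∈ S := subset_convexHull _ _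
    (Or.inr (Or.inl rfl))
  have mP' : (B'.x B.leg B'.legHeight, B'.legHeight) ∈ S := subset_convexHull _ _
    (Or.inr (Or.inr (by rw [← hl]; rfl)))
  have hq : B'.toOpen.q = B.toOpen.q := by
    change B'.b B'.head = B.b B.head
    rw [hb, hh]
  have eA : B'.x B.leg tA = B.x B.leg tA := hx tA ⟨le_rfl, hA1⟩
  have hp' : B'.a B.leg = B'.legHeight := by rw [← hl]; rfl
  have E : EndMove B.toOpen B'.toOpen B.toOpen.q tA :=
    { leg := hl
      head := hh
      a := ha
      b := fun j _ => congrFun hb j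
      p_le := hlt.le
      p_le' := hlt'.le
      le_q := le_rfl
      le_q' := hq.ge
      x_eq := fun j t ht h3 _ => by
        by_cases hj : j = B.leg
        · subst hj
          exact hx t ⟨h3 rfl, ht.2⟩
        · exact hxo j hj t ht
      sign_eq := hs
      head_free := fun k t ht hc =>
        not_lt.2 ht (B.interior _ _ _ hc.1 hc.2.1 hc.2.2.1 hc.2.2.2).2
      head_free' := fun k t ht hc => not_lt.2 ht (by
        have := (B'.interior _ _ _ hc.1 hc.2.1 hc.2.2.1 hc.2.2.2).2
        change t < B'.b B.head at this
        rwa [hb] at this)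
      leg_free := fun k t ht hc => by
        refine htri k hc.1.symm t hc.2.2.1 ?_
        have := aff.mem_convex hS mP mA ⟨hc.2.1.1, ht⟩
        have h4 : B.x B.leg t = B.x k t := hc.2.2.2
        rwa [h4] at this
      leg_free' := fun k t ht hc => by
        have hk : k ≠ B.leg := hc.1.symm
        have hI : t ∈ Icc (B.a k) (B.b k) := by
          have := hc.2.2.1
          change t ∈ Icc (B'.a k) (B'.b k) at this
          rwa [hb, ha k hk] at this
        refine htri k hk t hI ?_
        have h5 : B'.legHeight ≤ t := hp' ▸ hc.2.1.1
        have := aff'.mem_convex hS mP' (by rwa [eA]) ⟨h5, ht⟩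
        have h4 : B'.x B.leg t = B'.x k t := hc.2.2.2
        rwa [h4, hxo k hk t hI] at this }
  exact E.scale.eqv_leg hq (hA.scale h0 h1) scale_roomy scale_roomy (hA1.trans (B.b_le_one _)) hA1 hlt hlt'

end BraidoidDiagram

/-- The passage to roomy diagrams, by contraction. -/
theorem Eqv.of_scale {m' : ℕ} {B : BraidoidDiagram m} {B' : BraidoidDiagram m'}
    (h : Eqv s (B.toOpen.scale h0 h1) (B'.toOpen.scale h0 h1)) (hA : Adm s B.toStrandDiagram)
    (hA' : Adm s B'.toStrandDiagram) {D : BraidDiagram n} {D' : BraidDiagram n'}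
    {f : Fin m → Fin n} {f' : Fin m' → Fin n'} (hD : IsClosureVia s B D f)
    (hD' : IsClosureVia s B' D' f') : R s ⟨n, D⟩ ⟨n', D'⟩ :=
  ((D.scale_R (hD.clos.adm hA) h0 h1).trans
    (h.all (hA.scale h0 h1) (hA'.scale h0 h1) scale_roomy scale_roomy hD.clos.scale hD'.clos.scale
      (D.scale_roomy h0 h1) (D'.scale_roomy h0 h1))).trans
    (D'.scale_R (hD'.clos.adm hA') h0 h1).symm

end moves

theorem third_pos : (0 : ℝ) < 1 / 3 := by norm_num

/-- All closures of a braidoid diagram are equivalent. -/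
theorem IsClosureVia.unique {B : BraidoidDiagram m} {D : BraidDiagram n} {D' : BraidDiagram n'}
    {f : Fin m → Fin n} {f' : Fin m → Fin n'} (hA : Adm s B.toStrandDiagram)
    (hD : IsClosureVia s B D f) (hD' : IsClosureVia s B D' f') : R s ⟨n, D⟩ ⟨n', D'⟩ :=
  (Eqv.refl s (B := B.toOpen.scale third_pos le_rfl) scale_roomy).of_scale hA hA hD hD'

/-- The closures of two braidoid diagrams that differ by a move are equivalent. -/
theorem BraidoidMove.closure {B B' : Σ m, BraidoidDiagram m} (h : BraidoidMove B B')
    (hA : Adm s B.2.toStrandDiagram) (hA' : Adm s B'.2.toStrandDiagram) {D : BraidDiagram n}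
    {D' : BraidDiagram n'} {f : Fin B.1 → Fin n} {f' : Fin B'.1 → Fin n'}
    (hD : IsClosureVia s B.2 D f) (hD' : IsClosureVia s B'.2 D' f') : R s ⟨n, D⟩ ⟨n', D'⟩ := by
  have key : Eqv s (B.2.toOpen.scale third_pos le_rfl) (B'.2.toOpen.scale third_pos le_rfl) := by
    cases h with
    | same h => exact h.eqv hA
    | delta hl hh h => exact BraidoidDiagram.eqv_of_delta hl hh h hA hA'
    | head h => exact h.eqv hA
    | leg h => exact h.eqv hA
  exact key.of_scale hA hA' hD hD'

end Braidoids

namespace Braidoids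
open Set OpenBraid

variable {m n : ℕ} {s : SignType}

/-! ### Every braid is equivalent to a closure -/

theorem openedFrom_eq {i : Fin n} {c d : Fin (n + 1)} (h : openedFrom i c = openedFrom i d) :
    c = d ∨ (c = Fin.last n ∧ d = i.castSucc) ∨ (c = i.castSucc ∧ d = Fin.last n) := by
  induction c using Fin.lastCases with
  | last =>
    induction d using Fin.lastCases with
    | last => exact Or.inl rfl
    | cast d =>
      rw [openedFrom_last, openedFrom_castSucc] at h
      exact Or.inr (Or.inl ⟨rfl, by rw [h]⟩)
  | cast c =>
    induction d using Fin.lastCases with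
    | last =>
      rw [openedFrom_last, openedFrom_castSucc] at h
      exact Or.inr (Or.inr ⟨by rw [h], rfl⟩)
    | cast d =>
      rw [openedFrom_castSucc, openedFrom_castSucc] at h
      exact Or.inl (by rw [h])

/-- A braid diagram whose ends lie equidistantly is the closure of the braidoid diagram that is
left when a small arc of one strand is removed. -/
theorem BraidDiagram.exists_cut (D : BraidDiagram n) (i : Fin n) {u v : ℝ} (hu : 0 < u)
    (huv : u < v) (hv : v < 1) (free : ∀ j, ∀ t ∈ Icc u v, ¬ D.Crosses i j t)
    (ends : ∀ j, ∃ k : ℕ, 0 < k ∧ k < n + 1 ∧ D.x j 0 = (k : ℝ) / (n + 1 : ℕ))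
    (hxu : ∀ k : ℕ, 0 < k → k < n + 1 → D.x i u ≠ (k : ℝ) / (n + 1 : ℕ))
    (hxv : ∀ k : ℕ, 0 < k → k < n + 1 → D.x i v ≠ (k : ℝ) / (n + 1 : ℕ)) :
    ∃ B : BraidoidDiagram (n + 1), ∀ s, IsClosureVia s B D (openedFrom i) := by
  classical
  let g := openedFrom i
  let a : Fin (n + 1) → ℝ := fun c => if c = Fin.last n then v else 0
  let b : Fin (n + 1) → ℝ := fun c => if c = i.castSucc then u else 1
  have hne : i.castSucc ≠ Fin.last n := (Fin.castSucc_lt_last i).ne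
  have a0 : ∀ c, 0 ≤ a c := fun c => by
    dsimp only [a]; split_ifs <;> linarith
  have b1 : ∀ c, b c ≤ 1 := fun c => by
    dsimp only [b]; split_ifs <;> linarith
  have al : a (Fin.last n) = v := if_pos rfl
  have bl : b i.castSucc = u := if_pos rfl
  have ac : ∀ c, c ≠ Fin.last n → a c = 0 := fun c hc => if_neg hc
  have bc : ∀ c, c ≠ i.castSucc → b c = 1 := fun c hc => if_neg hc
  have ab : ∀ c, a c < b c := fun c => by
    by_cases h : c = Fin.last n
    · rw [h, al, bc _ hne.symm]; exact hv
    · rw [ac c h]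
      by_cases h' : c = i.castSucc
      · rw [h', bl]; exact hu
      · rw [bc c h']; exact zero_lt_one
  have mem : ∀ {c t}, t ∈ Icc (a c) (b c) → t ∈ Icc (0 : ℝ) 1 := fun h =>
    ⟨(a0 _).trans h.1, h.2.trans (b1 _)⟩
  have memD : ∀ {c t}, t ∈ Icc (a c) (b c) → t ∈ Icc (D.a (g c)) (D.b (g c)) := fun h => by
    rw [D.a_eq, D.b_eq]; exact mem h
  have uniq : ∀ {c d t}, t ∈ Icc (a c) (b c) → t ∈ Icc (a d) (b d) → g c = g d → c = d := by
    intro c d t hc hd h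
    rcases openedFrom_eq h with h | ⟨rfl, rfl⟩ | ⟨rfl, rfl⟩
    · exact h
    · rw [al] at hc; rw [bl] at hd; linarith [hc.1, hd.2]
    · rw [bl] at hc; rw [al] at hd; linarith [hc.2, hd.1]
  have inn : ∀ {c d t}, c ≠ d → t ∈ Icc (a c) (b c) → t ∈ Icc (a d) (b d) →
      D.x (g c) t = D.x (g d) t → t ∈ Ioo (a c) (b c) := by
    intro c d t hcd hc hd hx
    have hgc : g c ≠ g d := fun h => hcd (uniq hc hd h)
    have h1 := D.interior (g c) (g d) t hgc (memD hc) (memD hd) hx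
    rw [D.a_eq, D.b_eq] at h1
    have hcr : D.Crosses (g c) (g d) t := ⟨hgc, memD hc, memD hd, hx⟩
    refine ⟨lt_of_le_of_ne hc.1 fun e => ?_, lt_of_le_of_ne hc.2 fun e => ?_⟩
    · by_cases h : c = Fin.last n
      · subst h
        rw [al] at e
        have hg : g (Fin.last n) = i := openedFrom_last i
        rw [hg] at hcr
        exact free _ t ⟨by linarith, e.ge⟩ hcr
      · rw [ac c h] at e
        exact h1.1.ne e
    · by_cases h : c = i.castSucc
      · subst h
        rw [bl] at e
        have hg : g i.castSucc = i := openedFrom_castSucc i i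
        rw [hg] at hcr
        exact free _ t ⟨e.ge, by linarith⟩ hcr
      · rw [bc c h] at e
        exact h1.2.ne e
  let B : BraidoidDiagram (n + 1) :=
    { a := a
      b := b
      x := fun c t => D.x (g c) t
      sign := fun c d t => D.sign (g c) (g d) t
      a_nonneg := a0
      a_lt_b := ab
      b_le_one := b1
      x_mem := fun c t ht => D.x_mem _ _ (memD ht)
      pl := fun c => by
        obtain ⟨S, hS⟩ := D.pl (g c)
        refine ⟨S, fun y z h1 h2 h3 h4 => hS y z ?_ h2 ?_ h4⟩
        · rw [D.a_eq]; exact (a0 c).trans h1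
        · rw [D.b_eq]; exact h3.trans (b1 c)
      sign_symm := fun c d t => D.sign_symm _ _ _
      finite := fun c d hcd => by
        by_cases h : g c = g d
        · exact finite_empty.subset fun t ht => hcd (uniq ht.1 ht.2.1 h)
        · exact (D.finite _ _ h).subset fun t ht => ⟨memD ht.1, memD ht.2.1, ht.2.2⟩
      interior := fun c d t => inn
      transversal := fun c d t hcd hc hd hx =>
        D.transversal _ _ t (fun h => hcd (uniq hc hd h)) (memD hc) (memD hd) hx
      double := fun c d e t hcd hce hc hd he hx hx' => uniq hd he
        (D.double _ _ _ t (fun h => hcd (uniq hc hd h)) (fun h => hce (uniq hc he h)) (memD hc)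
          (memD hd) (memD he) hx hx')
      leg := Fin.last n
      head := i.castSucc
      a_eq := ac
      b_eq := bc
      leg_pos := by rw [al]; linarith
      head_lt := by rw [bl]; linarith
      top_ends := fun c _ => ends (g c)
      bottom_ends := fun c _ => by
        obtain ⟨j, hj⟩ := D.ends (g c)
        rw [hj]
        exact ends j
      leg_not_aligned := by
        have hg : g (Fin.last n) = i := openedFrom_last i
        rw [al, hg]
        exact hxv
      head_not_aligned := by
        have hg : g i.castSucc = i := openedFrom_castSucc i i
        rw [bl, hg]
        exact hxu }
  refine ⟨B, fun s => ⟨fun j => ⟨j.castSucc, openedFrom_castSucc i j⟩, fun c d h => openedFrom_eq h,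
    fun _ => (openedFrom_last i).trans (openedFrom_castSucc i i).symm, fun h => ?_,
    fun _ _ _ => rfl, fun _ _ _ _ => rfl, fun c j t hc hn => ?_⟩⟩
  · have h' : a (Fin.last n) ≤ b i.castSucc := h
    rw [al, bl] at h'
    linarith
  · -- the added arc has no crossing
    have ht := hc.2.1
    rw [D.a_eq, D.b_eq] at ht
    have h1 : t ∉ Icc (a c.castSucc) (b c.castSucc) := hn c.castSucc (openedFrom_castSucc i c)
    rw [ac _ (Fin.castSucc_lt_last c).ne] at h1
    by_cases hci : c = i
    · subst hci
      have h2 : t ∉ Icc (a (Fin.last n)) (b (Fin.last n)) := hn _ (openedFrom_last c)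
      rw [al, bc _ hne.symm] at h2
      rw [bl] at h1
      refine (free j t ⟨?_, ?_⟩ hc).elim
      · by_contra h; exact h1 ⟨ht.1, (not_le.1 h).le⟩
      · by_contra h; exact h2 ⟨(not_le.1 h).le, ht.2⟩
    · rw [bc _ fun h => hci (Fin.castSucc_injective n h)] at h1
      exact (h1 ht).elim

theorem IsClosureVia.adm_of {B : BraidoidDiagram m} {D : BraidDiagram n} {f : Fin m → Fin n}
    (h : IsClosureVia s B D f) (hD : Adm s D.toStrandDiagram) : Adm s B.toStrandDiagram := by
  intro hs i j t hc
  rw [← h.sign_eq i j t hc]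
  have mem : ∀ i, t ∈ Icc (B.a i) (B.b i) → t ∈ Icc (D.a (f i)) (D.b (f i)) := fun i hi => by
    rw [D.a_eq, D.b_eq]
    exact ⟨(B.a_nonneg i).trans hi.1, hi.2.trans (B.b_le_one i)⟩
  refine hD hs _ _ t ⟨fun e => hc.1 (h.clos.lab.old_unique hc.2.1 hc.2.2.1 e), mem i hc.2.1,
    mem j hc.2.2.1, ?_⟩
  rw [h.x_eq i t hc.2.1, h.x_eq j t hc.2.2.1, hc.2.2.2]

/-- Every braid diagram is isotopic to a closure: contract it, move its ends to the positions
`k / (n + 1)` near the top and the bottom line, and remove a small arc of a strand. -/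
theorem BraidDiagram.exists_closure_of (D : BraidDiagram n) (hD : Adm s D.toStrandDiagram) :
    ∃ (B : BraidoidDiagram (n + 1)) (D' : BraidDiagram n) (f : Fin (n + 1) → Fin n),
      IsClosureVia s B D' f ∧ Adm s B.toStrandDiagram ∧ R s ⟨n, D⟩ ⟨n, D'⟩ := by
  classical
  have hN : (0 : ℝ) < (n + 1 : ℕ) := by positivity
  have hN1 : (1 : ℝ) ≤ (n + 1 : ℕ) := by exact_mod_cast Nat.le_add_left 1 n
  -- the contracted diagram lies on the left of all the positions `k / (n + 1)`
  let c : ℝ := 1 / (3 * (n + 1 : ℕ))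
  have hc0 : 0 < c := by positivity
  have hc1 : c ≤ 1 / 3 := one_div_le_one_div_of_le (by norm_num) (by linarith)
  have hc3 : 3 * c = 1 / (n + 1 : ℕ) := by simp only [c]; field_simp
  let D₁ := D.scale hc0 hc1
  let φ : ℝ → ℝ := fun y => ((Finset.univ.filter fun i => D₁.x i 0 ≤ y).card : ℝ) / (n + 1 : ℕ)
  have hk : ∀ i, ∃ k : ℕ, 0 < k ∧ k < n + 1 ∧ φ (D₁.x i 0) = (k : ℝ) / (n + 1 : ℕ) := fun i =>
    ⟨_, Finset.card_pos.2 ⟨i, by simp⟩, by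
      have := Finset.card_filter_le (Finset.univ : Finset (Fin n)) fun j => D₁.x j 0 ≤ D₁.x i 0
      rw [Finset.card_univ, Fintype.card_fin] at this
      omega, rfl⟩
  obtain ⟨ε, D', hε, -, hε2, hord, hsig, hmid, htop, -⟩ := D₁.exists_move_ends φ
    (fun i j hij => by
      refine div_lt_div_of_pos_right (Nat.cast_lt.2 (Finset.card_lt_card ?_)) hN
      refine ⟨fun k hk => ?_, fun h => ?_⟩
      · rw [Finset.mem_filter] at hk ⊢
        exact ⟨hk.1, hk.2.trans hij.le⟩
      · have := h (Finset.mem_filter.2 ⟨Finset.mem_univ j, le_rfl⟩)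
        exact not_le.2 hij (Finset.mem_filter.1 this).2)
    (fun i => by
      obtain ⟨k, _, h2, e⟩ := hk i
      rw [e]
      refine ⟨by positivity, (div_le_one hN).2 (by exact_mod_cast h2.le)⟩)
    (b := 1 / 2) (by norm_num)
  have hR : R s ⟨n, D⟩ ⟨n, D'⟩ := (D.scale_R hD hc0 hc1).trans
    (.of_planar ⟨Equiv.refl _, hord, fun _ _ _ _ => by rw [hsig]; rfl⟩ (hD.scale hc0 hc1))
  obtain ⟨T, hT⟩ := exists_isGrid D'.toStrandDiagram
  obtain ⟨w, h1, h2, h3⟩ := Ioo_disjoint_of_finite T ε (show ε < 1 - ε by linarith)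
  have hal : ∀ i, ∀ t ∈ Icc ε (1 - ε), ∀ k : ℕ, 0 < k → k < n + 1 →
      D'.x i t ≠ (k : ℝ) / (n + 1 : ℕ) := by
    intro i t ht k hk _ e
    have hx := D.fam.mem i t ⟨by linarith [ht.1], by linarith [ht.2]⟩
    have e' : D'.x i t = c * D.x i t + c := hmid i t ht
    have h4 : (1 : ℝ) / (n + 1 : ℕ) ≤ (k : ℝ) / (n + 1 : ℕ) :=
      div_le_div_of_nonneg_right (by exact_mod_cast hk) hN.le
    rw [← e, e', ← hc3] at h4
    have := mul_le_of_le_one_right hc0.le hx.2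
    linarith
  obtain ⟨B, hB⟩ := D'.exists_cut ⟨0, D.n_pos⟩ (u := (2 * ε + w) / 3) (v := (ε + 2 * w) / 3)
    (by linarith) (by linarith) (by linarith)
    (fun j t ht hc => h3 t (hT.cross _ _ _ hc) ⟨by linarith [ht.1], by linarith [ht.2]⟩)
    (fun j => by rw [htop]; exact hk j)
    (hal _ _ ⟨by linarith, by linarith⟩) (hal _ _ ⟨by linarith, by linarith⟩)
  exact ⟨B, D', _, hB s, (hB s).adm_of (hR.adm_iff.1 hD), hR⟩

/-! ### The closure maps -/

theorem R.lclass_eq (hs : s ≠ 0) {X Y : Σ n, BraidDiagram n} (h : R s X Y)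
    (hX : X.2.IsClassical) (hY : Y.2.IsClassical) :
    (Quot.mk _ ⟨X, hX⟩ : LClass) = Quot.mk _ ⟨Y, hY⟩ := by
  induction h with
  | rel X Y h =>
    refine Quot.sound ?_
    rcases h.2.2 with hm | ⟨n, E, E', rfl, rfl, hm⟩
    · exact .isotopy hm
    · exact .lmove s hs hm
  | refl => rfl
  | symm X Y _ ih => exact (ih hY hX).symm
  | trans X Y Z h _ ih ih' =>
    have hM : Y.2.IsClassical := (R.adm_iff h).1 (fun _ => hX) hs
    exact (ih hX hM).trans (ih' hM hY)

theorem R.virtualLClass_eq {X Y : Σ n, BraidDiagram n} (h : R 0 X Y) :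
    (Quot.mk _ X : VirtualLClass) = Quot.mk _ Y := by
  induction h with
  | rel X Y h =>
    refine Quot.sound ?_
    rcases h.2.2 with hm | ⟨n, E, E', rfl, rfl, hm⟩
    · exact .isotopy hm
    · exact .basic hm
  | refl => rfl
  | symm X Y _ ih => exact ih.symm
  | trans X Y Z _ _ ih ih' => exact ih.trans ih'

theorem exists_isUnderpassClosure (B : ClassicalBraidoidDiagram) :
    ∃ D, IsUnderpassClosure B D := by
  obtain ⟨n, D, f, h, hA⟩ := B.1.2.exists_closure (-1) fun _ => B.2
  exact ⟨⟨⟨n, D⟩, hA (by decide)⟩, f, h⟩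

theorem exists_isVirtualClosure (B : VirtualBraidoidDiagram) : ∃ D, IsVirtualClosure B D := by
  obtain ⟨n, D, f, h, -⟩ := B.2.exists_closure 0 fun h => (h rfl).elim
  exact ⟨⟨n, D⟩, f, h⟩

/-- The underpass closure, as a map of isotopy classes. -/
theorem exists_underpassClosureMap : ∃ F : Braidoid → LClass,
    (∀ B D, IsUnderpassClosure B D → F (Quot.mk _ B) = Quot.mk _ D) ∧ Function.Surjective F := by
  have h1 : (-1 : SignType) ≠ 0 := by decide
  choose c hc using exists_isUnderpassClosure
  let F : Braidoid → LClass := Quot.lift (fun B => Quot.mk _ (c B)) fun B B' h => by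
    obtain ⟨f, hf⟩ := hc B
    obtain ⟨f', hf'⟩ := hc B'
    exact (BraidoidMove.closure h (fun _ => B.2) (fun _ => B'.2) hf hf').lclass_eq h1 _ _
  have hF : ∀ B D, IsUnderpassClosure B D → F (Quot.mk _ B) = Quot.mk _ D := fun B D ⟨g, hg⟩ => by
    obtain ⟨f, hf⟩ := hc B
    exact (hf.unique (fun _ => B.2) hg).lclass_eq h1 _ _
  refine ⟨F, hF, fun y => ?_⟩
  induction y using Quot.ind with
  | mk D =>
    obtain ⟨B, D', f, hf, hA, hR⟩ := D.1.2.exists_closure_of (s := -1) fun _ => D.2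
    have hD' := hR.adm_iff.1 (fun _ => D.2) h1
    exact ⟨Quot.mk _ ⟨⟨_, B⟩, hA h1⟩,
      (hF ⟨⟨_, B⟩, hA h1⟩ ⟨⟨_, D'⟩, hD'⟩ ⟨f, hf⟩).trans (hR.lclass_eq h1 D.2 hD').symm⟩

/-- The virtual closure, as a map of isotopy classes. Virtual `L`-moves of the basic kind are enough
for it to be well defined. -/
theorem exists_virtualClosureMap : ∃ F : VirtualBraidoid → VirtualLClass,
    (∀ B D, IsVirtualClosure B D → F (Quot.mk _ B) = Quot.mk _ D) ∧ Function.Surjective F := by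
  have h0 : ∀ {n : ℕ} (D : StrandDiagram n), Adm 0 D := fun _ h => (h rfl).elim
  choose c hc using exists_isVirtualClosure
  let F : VirtualBraidoid → VirtualLClass := Quot.lift (fun B => Quot.mk _ (c B)) fun B B' h => by
    obtain ⟨f, hf⟩ := hc B
    obtain ⟨f', hf'⟩ := hc B'
    exact (BraidoidMove.closure h (h0 _) (h0 _) hf hf').virtualLClass_eq
  have hF : ∀ B D, IsVirtualClosure B D → F (Quot.mk _ B) = Quot.mk _ D := fun B D ⟨g, hg⟩ => by
    obtain ⟨f, hf⟩ := hc B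
    exact (hf.unique (h0 _) hg).virtualLClass_eq
  refine ⟨F, hF, fun y => ?_⟩
  induction y using Quot.ind with
  | mk D =>
    obtain ⟨B, D', f, hf, -, hR⟩ := D.2.exists_closure_of (h0 D.2.toStrandDiagram)
    exact ⟨Quot.mk _ ⟨_, B⟩, (hF ⟨_, B⟩ ⟨_, D'⟩ ⟨f, hf⟩).trans hR.virtualLClass_eq.symm⟩

end Braidoids

theorem proposition2 :
    -- the underpass closure
    ((∀ B : Braidoids.ClassicalBraidoidDiagram, ∃ D, Braidoids.IsUnderpassClosure B D) ∧
      ∃ F : Braidoids.Braidoid → Braidoids.LClass,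
        (∀ B D, Braidoids.IsUnderpassClosure B D → F (Quot.mk _ B) = Quot.mk _ D) ∧
        Function.Surjective F) ∧
    -- the virtual closure
    ((∀ B : Braidoids.VirtualBraidoidDiagram, ∃ D, Braidoids.IsVirtualClosure B D) ∧
      ∃ F : Braidoids.VirtualBraidoid → Braidoids.VirtualLClass,
        (∀ B D, Braidoids.IsVirtualClosure B D → F (Quot.mk _ B) = Quot.mk _ D) ∧
        Function.Surjective F) :=
  ⟨⟨Braidoids.exists_isUnderpassClosure, Braidoids.exists_underpassClosureMap⟩,
    Braidoids.exists_isVirtualClosure, Braidoids.exists_virtualClosureMap⟩
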